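/- Let $n$ be a natural number, $1\le\rho\le\infty$ and $1<p<2n-1$ (so $n\ge 2$). Fix Littlewood--Paley decompositions of unity $\{\psi_k\}_{k\in\mathbb Z}$ on $\mathbb R$ (variable $t$) and $\{\phi_j\}_{j\in\mathbb Z}$ on $\mathbb R^{n-1}$ (variable $x'$): $\widehat{\phi_j}=\widehat\phi(2^{-j}\cdot)$ with $\widehat\phi\ge 0$ smooth, radial, supported in $\{1/2<|\xi|<2\}$, and $\sum_{j}\widehat{\phi_j}(\xi)=1$ for $\xi\neq 0$; likewise for $\psi_k$. For $f$ on $\mathbb R_+\times\mathbb R^{n-1}$, $\mathbb R_+=(0,\infty)$, an extension of $f$ is a tempered distribution $\tilde f$ on $\mathbb R\times\mathbb R^{n-1}$ with $\tilde f|_{\mathbb R_+\times\mathbb R^{n-1}}=f$ and $\tilde f=\sum_j\phi_j *_{x'}\tilde f$ in $\mathcal S'$. For $r,s\in\mathbb R$ and $1\le\sigma\le\infty$ define $$\|f\|_{\widetilde{\dot B^{r}_{\sigma,1}}(\mathbb R_+;\dot B^{s}_{p,1}(\mathbb R^{n-1}))}=\inf_{\tilde f}\sum_{k\in\mathbb Z}2^{rk}\sum_{j\in\mathbb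 Z}2^{sj}\big\|\psi_k *_{t}\phi_j *_{x'}\tilde f\big\|_{L^\sigma(\mathbb R;L^p(\mathbb R^{n-1}))},$$ the infimum being over all extensions $\tilde f$ of $f$, and $$\|f\|_{\widetilde{L^{\sigma}}(\mathbb R_+;\dot B^{s}_{p,1}(\mathbb R^{n-1}))}=\sum_{j\in\mathbb Z}2^{sj}\big\|\phi_j *_{x'}f\big\|_{L^\sigma(\mathbb R_+;L^p(\mathbb R^{n-1}))},$$ where $\phi_j*_{x'}f$ is the restriction to $\mathbb R_+\times\mathbb R^{n-1}$ of $\phi_j*_{x'}\tilde f$ for any extension $\tilde f$ (it does not depend on the choice); both norms are $\infty$ if there is no extension. Write $$\|f\|_{B,\sigma}=\|f\|_{\widetilde{\dot B^{\frac12-\frac1{2p}}_{\sigma,1}}(\mathbb R_+;\dot B^{-1+\frac np}_{p,1}(\mathbb R^{n-1}))},\qquad \|f\|_{L,\sigma}=\|f\|_{\widetilde{L^{\sigma}}(\mathbb R_+;\dot B^{\frac{n-1}p}_{p,1}(\mathbb R^{n-1}))}.$$ Then there is a constant $C\ge 0$, independent of $F$ and $G$, such that for all functions $F,G:\mathbb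 R_+\times\mathbb R^{n-1}\to\mathbb C$ with $\|F\|_{B,\rho}$, $\|F\|_{L,\rho}$, $\|G\|_{B,\infty}$, $\|G\|_{L,\infty}$ all finite, $\|FG\|_{B,\rho}$ is finite and $$\|FG\|_{B,\rho}\le C\,\|F\|_{L,\rho}\,\|G\|_{B,\infty}+C\big(\|F\|_{B,\rho}+\|F\|_{L,\rho}\big)\|G\|_{L,\infty}\le C\big(\|F\|_{B,\rho}+\|F\|_{L,\rho}\big)\big(\|G\|_{B,\infty}+\|G\|_{L,\infty}\big).$$ -/

import Mathlib

open MeasureTheory Set Filter Topology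
open scoped ENNReal NNReal SchwartzMap ContDiff

noncomputable section

/-- A (homogeneous) Littlewood–Paley dyadic decomposition of unity on the frequency space `H`:
`symbol` is the function usually written `φ̂`. -/
structure LittlewoodPaley (H : Type*) [NormedAddCommGroup H] [InnerProductSpace ℝ H] where
  symbol : H → ℝ
  contDiff_symbol : ContDiff ℝ ∞ symbol
  symbol_nonneg : ∀ ξ, 0 ≤ symbol ξ
  symbol_radial : ∀ ξ η, ‖ξ‖ = ‖η‖ → symbol ξ = symbol η
  tsupport_symbol : tsupport symbol ⊆ {ξ | 1 / 2 < ‖ξ‖ ∧ ‖ξ‖ < 2}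
  sum_symbol : ∀ ξ, ξ ≠ 0 → HasSum (fun j : ℤ => symbol ((2 : ℝ) ^ (-j) • ξ)) 1

namespace LittlewoodPaley

/-- The symbol `φ̂(2⁻ʲ ξ)` of the `j`-th dyadic block. Mathlib's Fourier transform uses the
character `exp (-2πi x·ξ)`; the factor `2π` translates to the convention `exp (-i x·ξ)`. -/
def dyadic {H : Type*} [NormedAddCommGroup H] [InnerProductSpace ℝ H]
    (Φ : LittlewoodPaley H) (j : ℤ) (ξ : H) : ℝ :=
  Φ.symbol ((2 : ℝ) ^ (-j) • (2 * Real.pi) • ξ)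

end LittlewoodPaley

namespace CheminLerner

/-- The boundary space `ℝⁿ⁻¹` of the variable `x'`. -/
abbrev Bdry (n : ℕ) : Type := EuclideanSpace ℝ (Fin (n - 1))

/-- Euclidean space-time `ℝ × ℝⁿ⁻¹`, with points `(t, x')`. -/
abbrev SpaceTime (n : ℕ) : Type := WithLp 2 (ℝ × Bdry n)

/-- `φ_j ∗ u`, convolution in `x'` only, for a tempered distribution `u` on space-time. -/
def spaceBlock {n : ℕ} (Φ : LittlewoodPaley (Bdry n)) (j : ℤ) (u : 𝓢'(SpaceTime n, ℂ)) :
    𝓢'(SpaceTime n, ℂ) :=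
  TemperedDistribution.fourierMultiplierCLM ℂ
    (fun z : SpaceTime n => ((Φ.dyadic j z.snd : ℝ) : ℂ)) u

/-- `ψ_k ∗ u`, convolution in `t` only, for a tempered distribution `u` on space-time. -/
def timeBlock {n : ℕ} (Ψ : LittlewoodPaley ℝ) (k : ℤ) (u : 𝓢'(SpaceTime n, ℂ)) :
    𝓢'(SpaceTime n, ℂ) :=
  TemperedDistribution.fourierMultiplierCLM ℂ
    (fun z : SpaceTime n => ((Ψ.dyadic k z.fst : ℝ) : ℂ)) u

/-- For an open set of times `I`: the function `g` is locally integrable on `I × ℝⁿ⁻¹`, and the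
restriction of the distribution `u` to `I × ℝⁿ⁻¹` is `g`. -/
def RestrictsTo {n : ℕ} (I : Set ℝ) (u : 𝓢'(SpaceTime n, ℂ)) (g : ℝ × Bdry n → ℂ) : Prop :=
  LocallyIntegrableOn g (I ×ˢ univ) ∧
    ∀ η : 𝓢(SpaceTime n, ℂ), HasCompactSupport η → tsupport η ⊆ {z | z.fst ∈ I} →
      u η = ∫ z : ℝ × Bdry n, η (WithLp.toLp 2 z) * g z

/-- The norm of `u` in `L^ρ(I; L^p(ℝⁿ⁻¹))`; it is `∞` if `u` is not a function on `I × ℝⁿ⁻¹`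
(a function `g` as below is unique up to a null set). -/
def mixedNorm {n : ℕ} (I : Set ℝ) (ρ p : ℝ≥0∞) (u : 𝓢'(SpaceTime n, ℂ)) : ℝ≥0∞ :=
  ⨅ (g : ℝ × Bdry n → ℂ) (_ : RestrictsTo I u g),
    eLpNorm (fun t => eLpNorm (fun x => g (t, x)) p volume) ρ (volume.restrict I)

/-- `u = ∑_j φ_j ∗ u` (convolution in `x'`), with convergence in the space of tempered
distributions. -/
def IsRealized {n : ℕ} (Φ : LittlewoodPaley (Bdry n)) (u : 𝓢'(SpaceTime n, ℂ)) : Prop :=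
  ∀ η : 𝓢(SpaceTime n, ℂ),
    Tendsto (fun N : ℕ => ∑ j ∈ Finset.Icc (-(N : ℤ)) N, spaceBlock Φ j u η) atTop (𝓝 (u η))

/-- `u` is a tempered distribution on the whole space-time, the sum of its dyadic blocks in `x'`,
whose restriction to `ℝ₊ × ℝⁿ⁻¹` is the function `f`. -/
def IsExtension {n : ℕ} (Φ : LittlewoodPaley (Bdry n)) (u : 𝓢'(SpaceTime n, ℂ))
    (f : ℝ × Bdry n → ℂ) : Prop :=
  IsRealized Φ u ∧ RestrictsTo (Ioi 0) u f

/-- The Chemin–Lerner norm of `L̃^ρ(ℝ₊; Ḃ^s_{p,1}(ℝⁿ⁻¹))`. The blocks of `u` on `ℝ₊ × ℝⁿ⁻¹`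
depend only on the restriction `f` of `u`, so the infimum is over a constant; it is `∞` if `f` has
no extension. -/
def lebesgueBesovNorm {n : ℕ} (Φ : LittlewoodPaley (Bdry n)) (s : ℝ) (ρ p : ℝ≥0∞)
    (f : ℝ × Bdry n → ℂ) : ℝ≥0∞ :=
  ⨅ (u : 𝓢'(SpaceTime n, ℂ)) (_ : IsExtension Φ u f),
    ∑' j : ℤ, (2 : ℝ≥0∞) ^ (s * (j : ℝ)) * mixedNorm (Ioi 0) ρ p (spaceBlock Φ j u)

/-- The Chemin–Lerner norm of `B̃^r_{ρ,1}(ℝ; Ḃ^s_{p,1}(ℝⁿ⁻¹))` (homogeneous in time as well) of a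
tempered distribution on the whole space-time. -/
def besovBesovNormLine {n : ℕ} (Ψ : LittlewoodPaley ℝ) (Φ : LittlewoodPaley (Bdry n)) (r s : ℝ)
    (ρ p : ℝ≥0∞) (u : 𝓢'(SpaceTime n, ℂ)) : ℝ≥0∞ :=
  ∑' k : ℤ, (2 : ℝ≥0∞) ^ (r * (k : ℝ)) *
    ∑' j : ℤ, (2 : ℝ≥0∞) ^ (s * (j : ℝ)) *
      mixedNorm univ ρ p (timeBlock Ψ k (spaceBlock Φ j u))

/-- The Chemin–Lerner norm of `B̃^r_{ρ,1}(ℝ₊; Ḃ^s_{p,1}(ℝⁿ⁻¹))`: the quotient norm on restrictions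
to `ℝ₊ × ℝⁿ⁻¹`, the infimum over all extensions; it is `∞` if there is no extension. -/
def besovBesovNorm {n : ℕ} (Ψ : LittlewoodPaley ℝ) (Φ : LittlewoodPaley (Bdry n)) (r s : ℝ)
    (ρ p : ℝ≥0∞) (f : ℝ × Bdry n → ℂ) : ℝ≥0∞ :=
  ⨅ (u : 𝓢'(SpaceTime n, ℂ)) (_ : IsExtension Φ u f), besovBesovNormLine Ψ Φ r s ρ p u

/-- The critical norm of `B̃^{1/2-1/(2p)}_{σ,1}(ℝ₊; Ḃ^{-1+n/p}_{p,1}(ℝⁿ⁻¹))`. -/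
def normB {n : ℕ} (Ψ : LittlewoodPaley ℝ) (Φ : LittlewoodPaley (Bdry n)) (p : ℝ) (σ : ℝ≥0∞)
    (f : ℝ × Bdry n → ℂ) : ℝ≥0∞ :=
  besovBesovNorm Ψ Φ (1 / 2 - 1 / (2 * p)) (-1 + (n : ℝ) / p) σ (ENNReal.ofReal p) f

/-- The critical norm of `L̃^σ(ℝ₊; Ḃ^{(n-1)/p}_{p,1}(ℝⁿ⁻¹))`. -/
def normL {n : ℕ} (Φ : LittlewoodPaley (Bdry n)) (p : ℝ) (σ : ℝ≥0∞)
    (f : ℝ × Bdry n → ℂ) : ℝ≥0∞ :=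
  lebesgueBesovNorm Φ (((n : ℝ) - 1) / p) σ (ENNReal.ofReal p) f

end CheminLerner

end

/-!
# A product estimate in Chemin–Lerner spaces on the half-line

Write `d = n - 1`, `r = 1/2 - 1/(2p)` and `s = -1 + n/p`. The extension that bounds the norm of a
product is the even reflection in time. It has to be estimated without extensions of the factors at
hand that suit both norms at once, and this is done by describing the norm of
`B̃^r_{ρ,1}(ℝ₊; Ḃ^s_{p,1})` through time differences. Let `F_i` be the `i`-th block in `x'` of the
factor `F` at positive times, `Δ_h F_i (t) = F_i (t + h) - F_i (t)`, and
`N(F) = ∑_k 2^{rk} ∑_i 2^{si} sup_{0 < h ≤ 2^{-k}} ‖Δ_h F_i‖_{L^ρ(ℝ₊; L^p)}` (`besovDiff`). As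
`0 < r < 1`, there are three steps.

* `N(F) ≤ C ‖F‖_B` (`exists_besovDiff_le`). For an extension `u` of `F`, the function `F_i` is the
  restriction of `φ_i u`, whose blocks in time satisfy
  `‖Δ_h ψ_l φ_i u‖ ≤ C min (2, 2^l h) ‖ψ_l φ_i u‖`. What needs an argument is that `Δ_h F_i` is the
  sum of the `Δ_h ψ_l φ_i u`: homogeneous decompositions in time determine a distribution only up to
  polynomials in `t`. A distribution has finite order, so the sum holds for a high power of `Δ_h`,
  and the power is lowered to one since the functions involved grow too slowly to differ by a
  nonzero polynomial (`dt_eq_of_blocks`).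
* `N(FG) ≤ C (N(F) ‖G‖_L + ‖F‖_L N(G))` (`exists_besovDiff_product_le`). By
  `Δ_h (FG) = Δ_h F · G(· + h) + F · Δ_h G` this reduces to an estimate in `x'` at fixed times. The
  `j`-th block of `f_i g_k`, with `f_i`, `g_k` localised at the frequencies `2^i`, `2^k`, is
  `O (2^{δ (j - max i k)})` relative to `2^{si} ‖f_i‖_p 2^{kd/p} ‖g_k‖_p` with the weight `2^{sj}`,
  and vanishes for `j > max i k + 3` (`exists_block_product`). For `s ≤ 0` the interaction of
  comparable frequencies is estimated from `L^{p/2}` to `L^p` by Bernstein's inequality, where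
  `s + d/p > 0`, that is `p < 2n - 1`, is used.
* `‖w‖ ≤ C N(FG)` for the even reflection `w` of `FG` (`exists_besovBesovNormLine_ev_le`). The
  kernels of the blocks in time have mean zero, so that `ψ_k w` is a mean of differences of `w`.
  Differences of `w` across `t = 0` are averages of differences of `FG` at positive times
  (`enorm_sub_le_meanDiff`).

The functions `F_i` do not depend on the extension, because a multiplier in `x'` acts locally in
time, and they sum up to `F` by the finiteness of `‖F‖_L` (`exists_blocks_of_lebesgueBesovNorm`).
That `w` is the sum of its blocks in `x'` amounts to the convergence to zero of its low frequencies
(`isRealized_product`). To pass between distributions and functions, functions are taken measurable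
and integrable against some power of `1 / (1 + ‖z‖)` (`TemperedFun`); Fourier multipliers in `x'` or
in `t` then act by partial convolutions (`RestrictsTo.multiplier`).
-/

namespace CheminLerner

/-! ### Minkowski's integral inequality and iterated Lebesgue norms -/

section MixedNorms

variable {α β γ : Type*} [MeasurableSpace α] [MeasurableSpace β] [MeasurableSpace γ]

theorem measurable_eLpNorm_section {ν : Measure β} [SFinite ν] (p : ℝ≥0∞) {a : α × β → ℝ≥0∞}
    (ha : Measurable a) : Measurable fun t => eLpNorm (fun x => a (t, x)) p ν := by
  rcases eq_or_ne p 0 with rfl | hp0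
  · simp
  rcases eq_or_ne p ⊤ with rfl | hp
  · simp only [eLpNorm_exponent_top, eLpNormEssSup_eq_essSup_enorm, enorm_eq_self]
    refine measurable_of_Ioi fun c => ?_
    have hset : (fun t => essSup (fun x => a (t, x)) ν) ⁻¹' Ioi c
        = (fun t => ν (Prod.mk t ⁻¹' (a ⁻¹' Ioi c))) ⁻¹' {0}ᶜ := by
      ext t
      rw [mem_preimage, mem_Ioi, ← not_le, mem_preimage, mem_compl_iff, not_iff_not,
        mem_singleton_iff]
      constructor
      · intro h
        refine measure_mono_null (fun x hx => ?_)
          (ae_iff.1 (ENNReal.ae_le_essSup (μ := ν) fun x => a (t, x)))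
        exact not_le.2 (h.trans_lt hx)
      · intro h
        refine essSup_le_of_ae_le _ (ae_iff.2 (measure_mono_null (fun x hx => ?_) h))
        exact not_le.1 hx
    rw [hset]
    exact (measurable_measure_prodMk_left (ha measurableSet_Ioi))
      (measurableSet_singleton 0).compl
  · simp only [eLpNorm_eq_lintegral_rpow_enorm_toReal hp0 hp, enorm_eq_self]
    exact ((ha.pow_const _).lintegral_prod_right').pow_const _

/-- **Minkowski's integral inequality**, with an arbitrary measurable majorant of the norms of the
integrands; the majorant makes the endpoint `p = ∞` harmless. -/
theorem eLpNorm_lintegral_le {κ : Measure γ} [SigmaFinite κ] {ν : Measure β} [SFinite ν]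
    {p : ℝ≥0∞} (hp : 1 ≤ p) {a : γ → β → ℝ≥0∞} (ha : Measurable (Function.uncurry a))
    {M : γ → ℝ≥0∞} (hM : Measurable M) (h : ∀ y, eLpNorm (a y) p ν ≤ M y) :
    eLpNorm (fun x => ∫⁻ y, a y x ∂κ) p ν ≤ ∫⁻ y, M y ∂κ := by
  have hswap : Measurable (Function.uncurry fun x y => a y x) := ha.comp measurable_swap
  rcases eq_or_ne p ⊤ with rfl | hpt
  · simp only [eLpNorm_exponent_top, eLpNormEssSup_eq_essSup_enorm, enorm_eq_self] at h ⊢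
    refine essSup_le_of_ae_le _ ?_
    have h1 : ∀ᵐ y ∂κ, ∀ᵐ x ∂ν, a y x ≤ M y := ae_of_all _ fun y =>
      (ENNReal.ae_le_essSup (μ := ν) (a y)).mono fun x hx => hx.trans (h y)
    have h1 := (Measure.ae_ae_comm (p := fun y x => a y x ≤ M y)
      (measurableSet_le ha (hM.comp measurable_fst))).1 h1
    filter_upwards [h1] with x hx
    exact lintegral_mono_ae hx
  have hp0 : p ≠ 0 := (zero_lt_one.trans_le hp).ne'
  set P := p.toReal with hP
  have hP1 : 1 ≤ P := by
    rw [hP, ← ENNReal.toReal_one]; exact ENNReal.toReal_mono hpt hp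
  -- it suffices to treat majorants that are positive, by adding a small positive function
  suffices key : ∀ M : γ → ℝ≥0∞, Measurable M → (∀ y, 0 < M y) →
      (∀ y, eLpNorm (a y) p ν ≤ M y) → eLpNorm (fun x => ∫⁻ y, a y x ∂κ) p ν ≤ ∫⁻ y, M y ∂κ by
    refine ENNReal.le_of_forall_pos_le_add fun ε hε _ => ?_
    obtain ⟨w, hw0, hwm, hw⟩ := exists_pos_lintegral_lt_of_sigmaFinite κ
      (ENNReal.coe_pos.2 hε).ne'
    refine (key (fun y => M y + w y) (hM.add hwm.coe_nnreal_ennreal)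
      (fun y => (ENNReal.coe_pos.2 (hw0 y)).trans_le le_add_self)
      (fun y => (h y).trans le_self_add)).trans ?_
    rw [lintegral_add_left hM]
    gcongr
  intro M hM hM0 h
  rcases eq_or_ne (∫⁻ y, M y ∂κ) ⊤ with hS | hS
  · rw [hS]; exact le_top
  set S := ∫⁻ y, M y ∂κ
  have hMtop : ∀ᵐ y ∂κ, M y ≠ ⊤ := (ae_lt_top hM hS).mono fun y hy => hy.ne
  have hP0 : 0 < P := zero_lt_one.trans_le hP1
  simp only [eLpNorm_eq_lintegral_rpow_enorm_toReal hp0 hpt, enorm_eq_self, ← hP, one_div,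
    ENNReal.rpow_inv_le_iff hP0] at h ⊢
  -- Hölder's inequality with respect to the measure with density `M`
  have hJ : ∀ x, (∫⁻ y, a y x ∂κ) ^ P ≤ S ^ (P - 1) * ∫⁻ y, a y x ^ P * M y ^ (1 - P) ∂κ := by
    intro x
    have hax : Measurable fun y => a y x := ha.comp measurable_prodMk_right
    rcases hP1.eq_or_lt with hP1 | hP1
    · simp [← hP1]
    set q := P.conjExponent
    have hpq : P.HolderConjugate q := Real.HolderConjugate.conjExponent hP1
    have hq : P * q⁻¹ = P - 1 := by
      have := hpq.inv_add_inv_eq_one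
      field_simp [hpq.symm.ne_zero] at this ⊢
      linarith
    have h1 := ENNReal.lintegral_mul_le_Lp_mul_Lq κ hpq
      (f := fun y => a y x * M y ^ (-q⁻¹)) (g := fun y => M y ^ q⁻¹)
      (hax.mul (hM.pow_const _)).aemeasurable (hM.pow_const _).aemeasurable
    have h2 : ∫⁻ y, ((fun y => a y x * M y ^ (-q⁻¹)) * fun y => M y ^ q⁻¹) y ∂κ
        = ∫⁻ y, a y x ∂κ := by
      refine lintegral_congr_ae (hMtop.mono fun y hy => ?_)
      simp only [Pi.mul_apply]
      rw [mul_assoc, ← ENNReal.rpow_add _ _ (hM0 y).ne' hy, neg_add_cancel, ENNReal.rpow_zero,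
        mul_one]
    rw [h2] at h1
    refine (ENNReal.rpow_le_rpow h1 hP0.le).trans_eq ?_
    simp only [one_div]
    rw [ENNReal.mul_rpow_of_nonneg _ _ hP0.le, ENNReal.rpow_inv_rpow hP0.ne', mul_comm,
      ← ENNReal.rpow_mul, mul_comm q⁻¹, hq]
    congr 2
    · congr 1
      funext y
      rw [← ENNReal.rpow_mul, inv_mul_cancel₀ hpq.symm.ne_zero, ENNReal.rpow_one]
    · funext y
      rw [ENNReal.mul_rpow_of_nonneg _ _ hP0.le, ← ENNReal.rpow_mul,
        show -q⁻¹ * P = 1 - P by linarith]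
  have hmeas : Measurable (Function.uncurry fun x y => a y x ^ P * M y ^ (1 - P)) :=
    (hswap.pow_const _).mul ((hM.comp measurable_snd).pow_const _)
  calc ∫⁻ x, (∫⁻ y, a y x ∂κ) ^ P ∂ν
      ≤ ∫⁻ x, S ^ (P - 1) * ∫⁻ y, a y x ^ P * M y ^ (1 - P) ∂κ ∂ν := lintegral_mono hJ
    _ = S ^ (P - 1) * ∫⁻ y, ∫⁻ x, a y x ^ P * M y ^ (1 - P) ∂ν ∂κ := by
      rw [lintegral_const_mul _ hmeas.lintegral_prod_right, lintegral_lintegral_swap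
        hmeas.aemeasurable]
    _ ≤ S ^ (P - 1) * ∫⁻ y, M y ∂κ := by
      refine mul_le_mul_right (lintegral_mono_ae (hMtop.mono fun y hy => ?_)) _
      have hay : Measurable fun x => a y x := ha.comp measurable_prodMk_left
      rw [lintegral_mul_const _ (hay.pow_const _)]
      calc (∫⁻ x, a y x ^ P ∂ν) * M y ^ (1 - P) ≤ M y ^ P * M y ^ (1 - P) := by
            gcongr; exact h y
        _ = M y := by
            rw [← ENNReal.rpow_add _ _ (hM0 y).ne' hy]; simp
    _ = S ^ P := by
      rw [show ∫⁻ y, M y ∂κ = S ^ (1 : ℝ) by simp [S], ← ENNReal.rpow_add_of_nonneg _ _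
        (by linarith) zero_le_one]
      simp

/-- The norm of `L^ρ(α; L^p(β))` of a nonnegative function. -/
noncomputable def mixN (ρ p : ℝ≥0∞) (μ : Measure α) (ν : Measure β) (a : α × β → ℝ≥0∞) : ℝ≥0∞ :=
  eLpNorm (fun t => eLpNorm (fun x => a (t, x)) p ν) ρ μ

variable {ρ p : ℝ≥0∞} {μ : Measure α} {ν : Measure β} [SFinite ν]

theorem mixN_mono_ae {a b : α × β → ℝ≥0∞} (h : ∀ᵐ z ∂μ.prod ν, a z ≤ b z) :
    mixN ρ p μ ν a ≤ mixN ρ p μ ν b := by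
  refine eLpNorm_mono_enorm_ae ((Measure.ae_ae_of_ae_prod h).mono fun t ht => ?_)
  simp only [enorm_eq_self]
  exact eLpNorm_mono_enorm_ae (ht.mono fun x hx => by simpa using hx)

theorem mixN_congr_ae {a b : α × β → ℝ≥0∞} (h : a =ᵐ[μ.prod ν] b) :
    mixN ρ p μ ν a = mixN ρ p μ ν b :=
  le_antisymm (mixN_mono_ae (h.mono fun _ hz => hz.le)) (mixN_mono_ae (h.mono fun _ hz => hz.ge))

theorem mixN_mono {a b : α × β → ℝ≥0∞} (h : ∀ z, a z ≤ b z) :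
    mixN ρ p μ ν a ≤ mixN ρ p μ ν b :=
  mixN_mono_ae (ae_of_all _ h)

theorem mixN_add_le (hρ : 1 ≤ ρ) (hp : 1 ≤ p) {a b : α × β → ℝ≥0∞} (ha : Measurable a)
    (hb : Measurable b) :
    mixN ρ p μ ν (fun z => a z + b z) ≤ mixN ρ p μ ν a + mixN ρ p μ ν b := by
  refine (eLpNorm_mono_enorm (g := fun t => eLpNorm (fun x => a (t, x)) p ν +
    eLpNorm (fun x => b (t, x)) p ν) fun t => ?_).trans
    (eLpNorm_add_le (measurable_eLpNorm_section p ha).aestronglyMeasurable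
      (measurable_eLpNorm_section p hb).aestronglyMeasurable hρ)
  simp only [enorm_eq_self]
  exact eLpNorm_add_le (ha.comp measurable_prodMk_left).aestronglyMeasurable
    (hb.comp measurable_prodMk_left).aestronglyMeasurable hp

omit [SFinite ν] in
theorem mixN_const_mul_le (c : ℝ≥0) (a : α × β → ℝ≥0∞) :
    mixN ρ p μ ν (fun z => c * a z) ≤ c * mixN ρ p μ ν a := by
  refine eLpNorm_le_nnreal_smul_eLpNorm_of_ae_le_mul' (ae_of_all _ fun t => ?_) ρ
  simp only [enorm_eq_self]
  exact eLpNorm_le_nnreal_smul_eLpNorm_of_ae_le_mul' (ae_of_all _ fun x => by simp) p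

/-- Minkowski's integral inequality for mixed norms. -/
theorem mixN_lintegral_le [SFinite μ] {κ : Measure γ} [SigmaFinite κ] (hρ : 1 ≤ ρ) (hp : 1 ≤ p)
    {a : γ → α × β → ℝ≥0∞} (ha : Measurable (Function.uncurry a)) {M : γ → ℝ≥0∞}
    (hM : Measurable M) (h : ∀ y, mixN ρ p μ ν (a y) ≤ M y) :
    mixN ρ p μ ν (fun z => ∫⁻ y, a y z ∂κ) ≤ ∫⁻ y, M y ∂κ := by
  have ha' : Measurable fun w : γ × (α × β) => a w.1 w.2 := ha
  have hb : Measurable fun w : γ × α => eLpNorm (fun x => a w.1 (w.2, x)) p ν := by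
    have h3 : Measurable fun w : (γ × α) × β => a w.1.1 (w.1.2, w.2) :=
      ha'.comp (f := fun w : (γ × α) × β => (w.1.1, (w.1.2, w.2))) (by fun_prop)
    exact measurable_eLpNorm_section (α := γ × α) (β := β) (ν := ν)
      (a := fun w : (γ × α) × β => a w.1.1 (w.1.2, w.2)) p h3
  have h1 : ∀ t, eLpNorm (fun x => ∫⁻ y, a y (t, x) ∂κ) p ν ≤
      ∫⁻ y, eLpNorm (fun x => a y (t, x)) p ν ∂κ := by
    intro t
    have h3 : Measurable fun w : γ × β => a w.1 (t, w.2) :=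
      ha'.comp (f := fun w : γ × β => (w.1, (t, w.2))) (by fun_prop)
    have h4 : Measurable fun y => eLpNorm (fun x => a y (t, x)) p ν :=
      hb.comp (g := fun w : γ × α => eLpNorm (fun x => a w.1 (w.2, x)) p ν)
        (f := fun y => (y, t)) (by fun_prop)
    exact eLpNorm_lintegral_le hp (a := fun y x => a y (t, x)) h3 h4 fun y => le_rfl
  have h2 := eLpNorm_lintegral_le (κ := κ) (ν := μ) hρ
    (a := fun y t => eLpNorm (fun x => a y (t, x)) p ν) hb hM h
  refine le_trans ?_ h2
  unfold mixN
  refine eLpNorm_mono_enorm fun t => ?_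
  rw [enorm_eq_self, enorm_eq_self]
  exact h1 t

theorem mixN_tsum_le [SFinite μ] {ι : Type*} [Countable ι] (hρ : 1 ≤ ρ) (hp : 1 ≤ p)
    {a : ι → α × β → ℝ≥0∞} (ha : ∀ i, Measurable (a i)) :
    mixN ρ p μ ν (fun z => ∑' i, a i z) ≤ ∑' i, mixN ρ p μ ν (a i) := by
  let _ : MeasurableSpace ι := ⊤
  simp only [← lintegral_count]
  exact mixN_lintegral_le hρ hp (measurable_from_prod_countable_right ha)
      (measurable_of_countable _)
    fun _ => le_rfl

theorem eLpNorm_tsum_le {ι : Type*} [Countable ι] (hp : 1 ≤ p)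
    {a : ι → β → ℝ≥0∞} (ha : ∀ i, Measurable (a i)) :
    eLpNorm (fun x => ∑' i, a i x) p ν ≤ ∑' i, eLpNorm (a i) p ν := by
  let _ : MeasurableSpace ι := ⊤
  simp only [← lintegral_count]
  exact eLpNorm_lintegral_le hp (measurable_from_prod_countable_right ha)
    (measurable_of_countable _) fun _ => le_rfl

/-- Mixed norms are invariant under measure preserving maps of each of the two variables. -/
theorem mixN_comp_map {σ : α → α} {τ : β → β} (hσ : MeasurePreserving σ μ μ)
    (hτ : MeasurePreserving τ ν ν) {a : α × β → ℝ≥0∞} (ha : Measurable a) :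
    mixN ρ p μ ν (fun z => a (σ z.1, τ z.2)) = mixN ρ p μ ν a := by
  have h1 : ∀ t, eLpNorm (fun x => a (σ t, τ x)) p ν = eLpNorm (fun x => a (σ t, x)) p ν :=
    fun t => eLpNorm_comp_measurePreserving (g := fun x => a (σ t, x))
      (ha.comp measurable_prodMk_left).aestronglyMeasurable hτ
  simp only [mixN, h1]
  exact eLpNorm_comp_measurePreserving
    (g := fun t => eLpNorm (fun x => a (t, x)) p ν)
    (measurable_eLpNorm_section p ha).aestronglyMeasurable hσ

end MixedNorms

end CheminLerner

/-! ### Symbols and kernels of the dyadic blocks -/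

namespace LittlewoodPaley

variable {H : Type*} [NormedAddCommGroup H] [InnerProductSpace ℝ H]

theorem symbol_eq_zero_of_norm_le (Φ : LittlewoodPaley H) {ξ : H} (h : ‖ξ‖ ≤ 1 / 2) :
    Φ.symbol ξ = 0 := by
  by_contra hne
  exact absurd (Φ.tsupport_symbol (subset_tsupport _ hne)).1 (not_lt.2 h)

theorem symbol_eq_zero_of_le_norm (Φ : LittlewoodPaley H) {ξ : H} (h : 2 ≤ ‖ξ‖) :
    Φ.symbol ξ = 0 := by
  by_contra hne
  exact absurd (Φ.tsupport_symbol (subset_tsupport _ hne)).2 (not_lt.2 h)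

theorem norm_two_zpow_smul (j : ℤ) (ξ : H) : ‖(2 : ℝ) ^ j • ξ‖ = (2 : ℝ) ^ j * ‖ξ‖ := by
  rw [norm_smul, Real.norm_of_nonneg (by positivity)]

/-- The low frequency cut-off `1 - ∑_{j ≥ 1} φ̂(2⁻ʲ ξ)`: the sum of the dyadic symbols of
nonpositive index, extended by `1` to the origin. -/
noncomputable def low (Φ : LittlewoodPaley H) (ξ : H) : ℝ :=
  1 - ∑' j : ℕ, Φ.symbol ((2 : ℝ) ^ (-((j : ℤ) + 1)) • ξ)

theorem low_eq_of_norm_le (Φ : LittlewoodPaley H) (J : ℕ) {ξ : H} (h : ‖ξ‖ ≤ 2 ^ J) :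
    Φ.low ξ = 1 - ∑ j ∈ Finset.range J, Φ.symbol ((2 : ℝ) ^ (-((j : ℤ) + 1)) • ξ) := by
  rw [low, tsum_eq_sum]
  intro j hj
  apply Φ.symbol_eq_zero_of_norm_le
  rw [norm_two_zpow_smul, neg_add, zpow_add₀ two_ne_zero, zpow_neg, zpow_natCast]
  have h2 : (2 : ℝ) ^ J ≤ 2 ^ j := pow_le_pow_right₀ one_le_two (by simpa using hj)
  have h3 : ((2 : ℝ) ^ j)⁻¹ * ‖ξ‖ ≤ 1 := by
    rw [inv_mul_le_iff₀ (by positivity)]; linarith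
  calc ((2 : ℝ) ^ j)⁻¹ * 2 ^ (-1 : ℤ) * ‖ξ‖ = (((2 : ℝ) ^ j)⁻¹ * ‖ξ‖) * (1 / 2) := by
        rw [zpow_neg_one]; ring
    _ ≤ 1 / 2 := by linarith

theorem low_eq_one (Φ : LittlewoodPaley H) {ξ : H} (h : ‖ξ‖ ≤ 1) : Φ.low ξ = 1 := by
  simpa using Φ.low_eq_of_norm_le 0 (by simpa using h)

theorem contDiff_low (Φ : LittlewoodPaley H) : ContDiff ℝ ∞ Φ.low := by
  rw [contDiff_iff_contDiffAt]
  intro ξ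
  obtain ⟨J, hJ⟩ := pow_unbounded_of_one_lt ‖ξ‖ (one_lt_two (α := ℝ))
  have h1 : ContDiff ℝ ∞ fun ξ : H =>
      1 - ∑ j ∈ Finset.range J, Φ.symbol ((2 : ℝ) ^ (-((j : ℤ) + 1)) • ξ) :=
    contDiff_const.sub (ContDiff.sum fun j _ => Φ.contDiff_symbol.comp (contDiff_const_smul _))
  refine h1.contDiffAt.congr_of_eventuallyEq ?_
  filter_upwards [(isOpen_lt continuous_norm continuous_const).mem_nhds hJ] with η hη
  exact Φ.low_eq_of_norm_le J (le_of_lt hη)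

theorem summable_symbol_nat (Φ : LittlewoodPaley H) (ξ : H) :
    Summable fun j : ℕ => Φ.symbol ((2 : ℝ) ^ (-((j : ℤ) + 1)) • ξ) := by
  obtain ⟨J, hJ⟩ := pow_unbounded_of_one_lt ‖ξ‖ (one_lt_two (α := ℝ))
  rcases eq_or_ne ξ 0 with rfl | hξ
  · have : Φ.symbol 0 = 0 := Φ.symbol_eq_zero_of_norm_le (by simp)
    simp [this, summable_zero]
  · have h := (Φ.sum_symbol ξ hξ).summable
    exact h.comp_injective (i := fun j : ℕ => (j : ℤ) + 1) fun a b hab => by simpa using hab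

theorem low_sub_low (Φ : LittlewoodPaley H) (ξ : H) :
    Φ.low ((2 : ℝ)⁻¹ • ξ) - Φ.low ξ = Φ.symbol ((2 : ℝ)⁻¹ • ξ) := by
  have h1 := (Φ.summable_symbol_nat ξ).tsum_eq_zero_add
  have h2 : ∀ j : ℕ, (2 : ℝ) ^ (-((j : ℤ) + 1)) • (2 : ℝ)⁻¹ • ξ
      = (2 : ℝ) ^ (-(((j + 1 : ℕ) : ℤ) + 1)) • ξ := by
    intro j
    rw [smul_smul, ← zpow_neg_one, ← zpow_add₀ two_ne_zero]
    congr 2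
  simp only [low, h2]
  rw [h1]
  simp

theorem low_eq_zero (Φ : LittlewoodPaley H) {ξ : H} (h : 2 ≤ ‖ξ‖) : Φ.low ξ = 0 := by
  have hξ : ξ ≠ 0 := by
    rintro rfl
    rw [norm_zero] at h
    linarith
  have h1 := Φ.sum_symbol ξ hξ
  have hinj : Function.Injective fun j : ℕ => (j : ℤ) + 1 := fun a b hab => by simpa using hab
  have h2 : HasSum (fun j : ℕ => Φ.symbol ((2 : ℝ) ^ (-((j : ℤ) + 1)) • ξ)) 1 := by
    refine (hinj.hasSum_iff (f := fun j : ℤ => Φ.symbol ((2 : ℝ) ^ (-j) • ξ)) ?_).2 h1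
    intro j hj
    have hj0 : j ≤ 0 := by
      by_contra hj'
      exact hj ⟨(j - 1).toNat, by simp only; omega⟩
    apply Φ.symbol_eq_zero_of_le_norm
    rw [norm_two_zpow_smul]
    have : (1 : ℝ) ≤ 2 ^ (-j) := one_le_zpow₀ one_le_two (by omega)
    nlinarith
  rw [low, h2.tsum_eq, sub_self]

/-- The low frequency cut-off in the normalisation of `dyadic`, at frequencies of size `2ʲ`. -/
noncomputable def lowPass (Φ : LittlewoodPaley H) (j : ℤ) (ξ : H) : ℝ :=
  Φ.low ((2 : ℝ) ^ (-j) • (2 * Real.pi) • ξ)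

theorem norm_scaled (j : ℤ) (ξ : H) :
    ‖(2 : ℝ) ^ (-j) • (2 * Real.pi) • ξ‖ = (2 : ℝ) ^ (-j) * (2 * Real.pi * ‖ξ‖) := by
  rw [norm_two_zpow_smul, norm_smul, Real.norm_of_nonneg (by positivity)]

theorem lowPass_sub (Φ : LittlewoodPaley H) (j : ℤ) (ξ : H) :
    Φ.lowPass j ξ - Φ.lowPass (j - 1) ξ = Φ.dyadic j ξ := by
  have h := Φ.low_sub_low ((2 : ℝ) ^ (-(j - 1)) • (2 * Real.pi) • ξ)
  have h2 : (2 : ℝ)⁻¹ • (2 : ℝ) ^ (-(j - 1)) • (2 * Real.pi) • ξ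
      = (2 : ℝ) ^ (-j) • (2 * Real.pi) • ξ := by
    rw [smul_smul, ← zpow_neg_one, ← zpow_add₀ two_ne_zero]
    congr 2
    ring
  rw [h2] at h
  exact h

theorem sum_dyadic (Φ : LittlewoodPaley H) (N : ℕ) (ξ : H) :
    ∑ j ∈ Finset.Icc (-(N : ℤ)) N, Φ.dyadic j ξ = Φ.lowPass N ξ - Φ.lowPass (-(N : ℤ) - 1) ξ := by
  induction N with
  | zero => simp [← lowPass_sub]
  | succ N ih =>
    have h1 : Finset.Icc (-((N + 1 : ℕ) : ℤ)) ((N + 1 : ℕ) : ℤ)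
        = insert (-((N + 1 : ℕ) : ℤ)) (insert ((N + 1 : ℕ) : ℤ) (Finset.Icc (-(N : ℤ)) N)) := by
      ext j; simp only [Finset.mem_Icc, Finset.mem_insert]; omega
    rw [h1, Finset.sum_insert, Finset.sum_insert, ih, ← lowPass_sub, ← lowPass_sub]
    · push_cast
      rw [show -(N : ℤ) - 1 = -((N : ℤ) + 1) by ring, show (N : ℤ) + 1 - 1 = N by ring]
      ring
    · simp
    · simp only [Finset.mem_insert, Finset.mem_Icc, not_or]; omega

theorem dyadic_mul_fat (Φ : LittlewoodPaley H) (j : ℤ) (ξ : H) :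
    Φ.dyadic j ξ * (Φ.dyadic (j - 1) ξ + Φ.dyadic j ξ + Φ.dyadic (j + 1) ξ) = Φ.dyadic j ξ := by
  rcases eq_or_ne (Φ.dyadic j ξ) 0 with h0 | h0
  · simp [h0]
  have h1 : 1 / 2 < ‖(2 : ℝ) ^ (-j) • (2 * Real.pi) • ξ‖ := by
    by_contra h; exact h0 (Φ.symbol_eq_zero_of_norm_le (not_lt.1 h))
  have h2 : ‖(2 : ℝ) ^ (-j) • (2 * Real.pi) • ξ‖ < 2 := by
    by_contra h; exact h0 (Φ.symbol_eq_zero_of_le_norm (not_lt.1 h))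
  rw [norm_scaled] at h1 h2
  have e1 : Φ.lowPass (j + 1) ξ = 1 := by
    apply Φ.low_eq_one
    rw [norm_scaled, neg_add, zpow_add₀ two_ne_zero, zpow_neg_one]
    linarith
  have e2 : Φ.lowPass (j - 1 - 1) ξ = 0 := by
    apply Φ.low_eq_zero
    rw [norm_scaled, show -(j - 1 - 1) = -j + 2 by ring, zpow_add₀ two_ne_zero]
    nlinarith
  rw [← Φ.lowPass_sub (j - 1), ← Φ.lowPass_sub (j + 1), ← Φ.lowPass_sub j,
    show j + 1 - 1 = j by ring, e1, e2]
  ring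

end LittlewoodPaley

namespace CheminLerner

open FourierTransform

section Kernels

variable {H : Type*} [NormedAddCommGroup H] [InnerProductSpace ℝ H]

/-- The symbol `m(2⁻ʲ ξ)`. -/
noncomputable def dilate (m : 𝓢(H, ℂ)) (j : ℤ) : 𝓢(H, ℂ) :=
  SchwartzMap.compCLMOfContinuousLinearEquiv ℂ
    (ContinuousLinearEquiv.smulLeft (Units.mk0 ((2 : ℝ) ^ (-j)) (by positivity))) m

@[simp]
theorem dilate_apply (m : 𝓢(H, ℂ)) (j : ℤ) (ξ : H) : dilate m j ξ = m ((2 : ℝ) ^ (-j) • ξ) := rfl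

variable [FiniteDimensional ℝ H] [MeasurableSpace H] [BorelSpace H]

/-- The convolution kernel of the Fourier multiplier with symbol `m(2⁻ʲ ξ)`. -/
noncomputable def kern (m : 𝓢(H, ℂ)) (j : ℤ) : 𝓢(H, ℂ) := 𝓕⁻ (dilate m j)

theorem fourier_kern (m : 𝓢(H, ℂ)) (j : ℤ) : 𝓕 (kern m j) = dilate m j :=
  FourierTransform.fourier_fourierInv_eq _

theorem kern_apply (m : 𝓢(H, ℂ)) (j : ℤ) (y : H) :
    kern m j y = ((2 : ℝ) ^ j) ^ Module.finrank ℝ H • kern m 0 ((2 : ℝ) ^ j • y) := by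
  simp only [kern, SchwartzMap.fourierInv_coe, Real.fourierInv_eq']
  have h := Measure.integral_comp_smul_of_nonneg (volume : Measure H)
    (fun v => Complex.exp (↑(2 * Real.pi * inner ℝ v ((2 : ℝ) ^ j • y)) * Complex.I) •
      dilate m 0 v) ((2 : ℝ) ^ (-j)) (hR := by positivity)
  rw [zpow_neg, inv_pow, inv_inv, ← zpow_neg] at h
  rw [← h]
  refine integral_congr_ae (ae_of_all _ fun v => ?_)
  simp only [dilate_apply, inner_smul_left, inner_smul_right, neg_zero, zpow_zero, one_smul]
  congr 4
  simp only [conj_trivial, zpow_neg]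
  field_simp

theorem eLpNorm_kern (m : 𝓢(H, ℂ)) (j : ℤ) {q : ℝ≥0∞} :
    eLpNorm (kern m j) q volume =
      (2 : ℝ≥0∞) ^ ((Module.finrank ℝ H : ℝ) * (1 - (1 / q).toReal) * j) *
        eLpNorm (kern m 0) q volume := by
  set d := Module.finrank ℝ H
  have h0 : (0 : ℝ) < 2 ^ j := by positivity
  have h2 : ENNReal.ofReal ((2 : ℝ) ^ j) = (2 : ℝ≥0∞) ^ (j : ℝ) := by
    rw [← Real.rpow_intCast, ← ENNReal.ofReal_rpow_of_pos two_pos, ENNReal.ofReal_ofNat]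
  have h1 : (kern m j : H → ℂ) =
      ((2 : ℝ) ^ j) ^ d • ((kern m 0 : H → ℂ) ∘ fun y => (2 : ℝ) ^ j • y) := by
    funext y
    exact kern_apply m j y
  rw [h1, eLpNorm_const_smul, ← eLpNorm_map_measure (by
    rw [Measure.map_addHaar_smul _ h0.ne']
    exact (kern m 0).continuous.aestronglyMeasurable) (by fun_prop),
    Measure.map_addHaar_smul _ h0.ne', eLpNorm_smul_measure_of_ne_zero (by simp; positivity),
    abs_of_pos (by positivity), Real.enorm_of_nonneg (by positivity), ENNReal.ofReal_pow h0.le,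
    ENNReal.ofReal_inv_of_pos (by positivity), ENNReal.ofReal_pow h0.le, h2, smul_eq_mul,
        ← mul_assoc,
    ← ENNReal.rpow_natCast, ← ENNReal.rpow_mul, ← ENNReal.rpow_neg, ← ENNReal.rpow_mul,
    ← ENNReal.rpow_add _ _ two_ne_zero ENNReal.ofNat_ne_top]
  congr 2
  ring

/-- The Schwartz function on `H` given by a smooth real function supported in `{‖2π ξ‖ ≤ R}`, in the
variable `2π ξ`. -/
noncomputable def bumpSymbol {f : H → ℝ} (hf : ContDiff ℝ ∞ f) {R : ℝ}
    (hR : ∀ ξ, R ≤ ‖ξ‖ → f ξ = 0) : 𝓢(H, ℂ) :=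
  HasCompactSupport.toSchwartzMap (f := fun ξ : H => (f ((2 * Real.pi) • ξ) : ℂ))
    (HasCompactSupport.intro' (isCompact_closedBall (0 : H) (R / (2 * Real.pi)))
      Metric.isClosed_closedBall fun ξ hξ => by
        rw [Metric.mem_closedBall, dist_zero_right, not_le, div_lt_iff₀ (by positivity)] at hξ
        rw [hR, Complex.ofReal_zero]
        rw [norm_smul, Real.norm_of_nonneg (by positivity)]
        linarith)
    (Complex.ofRealCLM.contDiff.comp (hf.comp (contDiff_const_smul _)))

/-- The symbol of the block of index `0`. -/
noncomputable def blockSymbol (Φ : LittlewoodPaley H) : 𝓢(H, ℂ) :=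
  bumpSymbol Φ.contDiff_symbol fun _ => Φ.symbol_eq_zero_of_le_norm

/-- The symbol of the low frequency cut-off of index `0`. -/
noncomputable def lowSymbol (Φ : LittlewoodPaley H) : 𝓢(H, ℂ) :=
  bumpSymbol Φ.contDiff_low fun _ => Φ.low_eq_zero

/-- The sum of the symbols of the blocks of index `-1`, `0` and `1`; it is `1` on the support of the
symbol of index `0`. -/
noncomputable def fatSymbol (Φ : LittlewoodPaley H) : 𝓢(H, ℂ) :=
  dilate (blockSymbol Φ) (-1) + blockSymbol Φ + dilate (blockSymbol Φ) 1

theorem dilate_blockSymbol (Φ : LittlewoodPaley H) (j : ℤ) (ξ : H) :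
    dilate (blockSymbol Φ) j ξ = (Φ.dyadic j ξ : ℂ) := by
  change ((Φ.symbol _ : ℝ) : ℂ) = _
  rw [LittlewoodPaley.dyadic, smul_comm]
  rfl

theorem dilate_lowSymbol (Φ : LittlewoodPaley H) (j : ℤ) (ξ : H) :
    dilate (lowSymbol Φ) j ξ = (Φ.lowPass j ξ : ℂ) := by
  change ((Φ.low _ : ℝ) : ℂ) = _
  rw [LittlewoodPaley.lowPass, smul_comm]
  rfl

theorem dilate_fatSymbol (Φ : LittlewoodPaley H) (j : ℤ) (ξ : H) :
    dilate (fatSymbol Φ) j ξ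
      = ((Φ.dyadic (j - 1) ξ + Φ.dyadic j ξ + Φ.dyadic (j + 1) ξ : ℝ) : ℂ) := by
  have h : ∀ i : ℤ, dilate (dilate (blockSymbol Φ) i) j ξ = dilate (blockSymbol Φ) (j + i) ξ := by
    intro i
    simp only [dilate_apply, smul_smul]
    rw [← zpow_add₀ two_ne_zero, neg_add_rev]
  have h0 : dilate (fatSymbol Φ) j ξ = dilate (dilate (blockSymbol Φ) (-1)) j ξ +
      dilate (blockSymbol Φ) j ξ + dilate (dilate (blockSymbol Φ) 1) j ξ := rfl
  rw [h0, h, h, dilate_blockSymbol, dilate_blockSymbol, dilate_blockSymbol]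
  push_cast
  rfl

theorem dilate_fatSymbol_eq_zero (Φ : LittlewoodPaley H) {j : ℤ} {ξ : H}
    (h : 2 * Real.pi * ‖ξ‖ ≤ 2 ^ (j - 2) ∨ 2 ^ (j + 2) ≤ 2 * Real.pi * ‖ξ‖) :
    dilate (fatSymbol Φ) j ξ = 0 := by
  have h3 : ∀ i : ℤ, j - 1 ≤ i → i ≤ j + 1 → Φ.dyadic i ξ = 0 := by
    intro i h1 h2
    rcases h with h | h
    · apply Φ.symbol_eq_zero_of_norm_le
      rw [LittlewoodPaley.norm_scaled, zpow_neg, inv_mul_le_iff₀ (by positivity)]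
      refine h.trans ?_
      rw [show (2 : ℝ) ^ i * (1 / 2) = 2 ^ (i - 1) by rw [zpow_sub_one₀ two_ne_zero]; ring]
      exact zpow_le_zpow_right₀ one_le_two (by omega)
    · apply Φ.symbol_eq_zero_of_le_norm
      rw [LittlewoodPaley.norm_scaled, zpow_neg, le_inv_mul_iff₀ (by positivity)]
      refine le_trans ?_ h
      rw [show (2 : ℝ) ^ i * 2 = 2 ^ (i + 1) by rw [zpow_add_one₀ two_ne_zero]]
      exact zpow_le_zpow_right₀ one_le_two (by omega)
  rw [dilate_fatSymbol, h3 _ (by omega) (by omega), h3 _ (by omega) (by omega),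
    h3 _ (by omega) (by omega)]
  simp

theorem dilate_blockSymbol_eq_zero (Φ : LittlewoodPaley H) {j : ℤ} {ξ : H}
    (h : 2 * Real.pi * ‖ξ‖ ≤ 2 ^ (j - 1) ∨ 2 ^ (j + 1) ≤ 2 * Real.pi * ‖ξ‖) :
    dilate (blockSymbol Φ) j ξ = 0 := by
  rw [dilate_blockSymbol, LittlewoodPaley.dyadic, Complex.ofReal_eq_zero]
  rcases h with h | h
  · apply Φ.symbol_eq_zero_of_norm_le
    rw [LittlewoodPaley.norm_scaled, zpow_neg, inv_mul_le_iff₀ (by positivity)]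
    rwa [show (2 : ℝ) ^ j * (1 / 2) = 2 ^ (j - 1) by rw [zpow_sub_one₀ two_ne_zero]; ring]
  · apply Φ.symbol_eq_zero_of_le_norm
    rw [LittlewoodPaley.norm_scaled, zpow_neg, le_inv_mul_iff₀ (by positivity)]
    rwa [show (2 : ℝ) ^ j * 2 = 2 ^ (j + 1) by rw [zpow_add_one₀ two_ne_zero]]

theorem dilate_block_mul_fat (Φ : LittlewoodPaley H) (j : ℤ) (ξ : H) :
    dilate (blockSymbol Φ) j ξ * dilate (fatSymbol Φ) j ξ = dilate (blockSymbol Φ) j ξ := by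
  rw [dilate_fatSymbol, dilate_blockSymbol, ← Complex.ofReal_mul, Φ.dyadic_mul_fat]

end Kernels

end CheminLerner

/-! ### Small multipliers on Schwartz functions -/

namespace CheminLerner

section Multipliers

variable {V H : Type*} [NormedAddCommGroup V] [NormedSpace ℝ V] [NormedAddCommGroup H]
  [NormedSpace ℝ H]

/-- The derivatives of `g` at `x` of order at most `n` are controlled at the length scale `ε`. -/
def ScaledBound (ε : ℝ) (n : ℕ) (K : ℝ) (g : V → ℂ) (x : V) : Prop :=
  ∀ a ≤ n, ε ^ a * ‖iteratedFDeriv ℝ a g x‖ ≤ K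

theorem ScaledBound.mul {ε K K' : ℝ} {n : ℕ} {f g : V → ℂ} {x : V} (hε : 0 ≤ ε)
    (hf : ScaledBound ε n K f x) (hg : ScaledBound ε n K' g x) (hf' : ContDiff ℝ ∞ f)
    (hg' : ContDiff ℝ ∞ g) : ScaledBound ε n (2 ^ n * (K * K')) (fun y => f y * g y) x := by
  have hK : 0 ≤ K := by have := hf 0 (Nat.zero_le _); exact le_trans (by positivity) this
  have hK' : 0 ≤ K' := by have := hg 0 (Nat.zero_le _); exact le_trans (by positivity) this
  intro a ha
  calc ε ^ a * ‖iteratedFDeriv ℝ a (fun y => f y * g y) x‖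
      ≤ ε ^ a * ∑ i ∈ Finset.range (a + 1), (a.choose i : ℝ) * ‖iteratedFDeriv ℝ i f x‖ *
          ‖iteratedFDeriv ℝ (a - i) g x‖ := by
        gcongr
        exact norm_iteratedFDeriv_mul_le hf' hg' x (by exact_mod_cast le_top)
    _ = ∑ i ∈ Finset.range (a + 1), (a.choose i : ℝ) * ((ε ^ i * ‖iteratedFDeriv ℝ i f x‖) *
          (ε ^ (a - i) * ‖iteratedFDeriv ℝ (a - i) g x‖)) := by
        rw [Finset.mul_sum]
        refine Finset.sum_congr rfl fun i hi => ?_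
        have : ε ^ a = ε ^ i * ε ^ (a - i) := by
          rw [← pow_add, Nat.add_sub_cancel' (by simpa [Nat.lt_succ_iff] using hi)]
        rw [this]
        ring
    _ ≤ ∑ i ∈ Finset.range (a + 1), (a.choose i : ℝ) * (K * K') := by
        refine Finset.sum_le_sum fun i hi => ?_
        have hi' : i ≤ a := by simpa [Nat.lt_succ_iff] using hi
        gcongr
        · exact hf i (hi'.trans ha)
        · exact hg _ ((Nat.sub_le _ _).trans ha)
    _ = 2 ^ a * (K * K') := by
        rw [← Finset.sum_mul]
        congr 1
        exact_mod_cast Nat.sum_range_choose a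
    _ ≤ 2 ^ n * (K * K') := by
        gcongr
        exact one_le_two

theorem ScaledBound.pow {ε K : ℝ} {n : ℕ} {f : V → ℂ} {x : V} (hε : 0 ≤ ε)
    (hf : ScaledBound ε n K f x) (hf' : ContDiff ℝ ∞ f) (m : ℕ) :
    ScaledBound ε n ((2 ^ n * K) ^ m) (fun y => f y ^ m) x := by
  induction m with
  | zero =>
    intro a _
    rcases Nat.eq_zero_or_pos a with rfl | ha
    · simp
    · simp [iteratedFDeriv_const_of_ne ha.ne' (1 : ℂ)]
  | succ m ih =>
    have := ih.mul hε hf (hf'.pow m) hf'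
    simp only [pow_succ]
    rwa [show (2 ^ n * K) ^ m * (2 ^ n * K) = 2 ^ n * ((2 ^ n * K) ^ m * K) by ring]

theorem norm_iteratedFDeriv_comp_linear_le {f : H → ℂ} (hf : ContDiff ℝ ∞ f) (L : V →L[ℝ] H)
    {c : ℝ} (hL : ‖L‖ ≤ c) (a : ℕ) (x : V) :
    ‖iteratedFDeriv ℝ a (fun y => f (L y)) x‖ ≤ c ^ a * ‖iteratedFDeriv ℝ a f (L x)‖ := by
  have h := L.iteratedFDeriv_comp_right hf x (i := a) (by exact_mod_cast le_top)
  change ‖iteratedFDeriv ℝ a (f ∘ L) x‖ ≤ _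
  rw [h]
  refine (ContinuousMultilinearMap.norm_compContinuousLinearMap_le _ _).trans ?_
  rw [Finset.prod_const, Finset.card_univ, Fintype.card_fin, mul_comm]
  gcongr

theorem norm_smul_linear_le {L : V →L[ℝ] H} (hL : ‖L‖ ≤ 1) {c : ℝ} (hc : 0 ≤ c) :
    ‖c • L‖ ≤ c := by
  rw [norm_smul, Real.norm_of_nonneg hc]
  exact mul_le_of_le_one_right hc hL

theorem iteratedFDeriv_eq_zero_of_eventually {f : H → ℂ} {x : H} (h : f =ᶠ[𝓝 x] 0) (a : ℕ) :
    iteratedFDeriv ℝ a f x = 0 := by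
  rw [(h.iteratedFDeriv ℝ a).eq_of_nhds]
  simp

/-- A function of temperate growth with bounded derivatives and vanishing near the origin becomes
small when it is dilated: this is a multiplier tending to `0` on Schwartz functions. -/
theorem exists_bound_dilated {f : H → ℂ} (hf : ContDiff ℝ ∞ f) {n : ℕ} {B r : ℝ}
    (hB : ∀ a ≤ n, ∀ x, ‖iteratedFDeriv ℝ a f x‖ ≤ B) (hr : 0 < r)
    (h0 : ∀ x, ‖x‖ < r → f x = 0) {L : V →L[ℝ] H} (hL : ‖L‖ ≤ 1) (N : ℕ) :
    ∀ a ≤ n, ∀ z, ‖iteratedFDeriv ℝ a (fun z => f ((2 : ℝ) ^ (-(N : ℤ)) • L z)) z‖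
      ≤ (B / r * 2 ^ (-(N : ℤ))) * (1 + ‖z‖) := by
  intro a ha z
  have hB0 : 0 ≤ B := (norm_nonneg _).trans (hB 0 (Nat.zero_le _) 0)
  have hN : (2 : ℝ) ^ (-(N : ℤ)) ≤ 1 := zpow_le_one_of_nonpos₀ one_le_two (by omega)
  have h1 := norm_iteratedFDeriv_comp_linear_le hf ((2 : ℝ) ^ (-(N : ℤ)) • L)
    (norm_smul_linear_le hL (by positivity)) a z
  simp only [_root_.smul_apply] at h1
  by_cases hz : ‖(2 : ℝ) ^ (-(N : ℤ)) • L z‖ < r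
  · have h2 : f =ᶠ[𝓝 ((2 : ℝ) ^ (-(N : ℤ)) • L z)] 0 := by
      filter_upwards [(isOpen_lt continuous_norm continuous_const).mem_nhds hz] with y hy
      exact h0 y hy
    rw [iteratedFDeriv_eq_zero_of_eventually h2, norm_zero, mul_zero] at h1
    exact h1.trans (by positivity)
  · have h2 : r ≤ 2 ^ (-(N : ℤ)) * ‖z‖ := by
      refine (not_lt.1 hz).trans ?_
      rw [norm_smul, Real.norm_of_nonneg (by positivity)]
      gcongr
      calc ‖L z‖ ≤ ‖L‖ * ‖z‖ := L.le_opNorm z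
        _ ≤ ‖z‖ := mul_le_of_le_one_left (norm_nonneg _) hL
    calc _ ≤ 1 * B := by
          refine h1.trans ?_
          gcongr
          · exact pow_le_one₀ (by positivity) hN
          · exact hB a ha _
      _ ≤ B / r * (2 ^ (-(N : ℤ)) * ‖z‖) := by
          rw [one_mul, div_mul_eq_mul_div, le_div_iff₀ hr]
          gcongr
      _ ≤ _ := by
          rw [mul_assoc]
          gcongr
          linarith

theorem exists_bound_one_sub (s : 𝓢(H, ℂ)) (n : ℕ) :
    ∃ B : ℝ, ∀ a ≤ n, ∀ x, ‖iteratedFDeriv ℝ a (fun x => 1 - s x) x‖ ≤ B := by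
  refine ⟨1 + ∑ a ∈ Finset.range (n + 1), SchwartzMap.seminorm ℝ 0 a s, fun a ha x => ?_⟩
  have h1 : iteratedFDeriv ℝ a (fun x => 1 - s x) x
      = iteratedFDeriv ℝ a (fun _ => (1 : ℂ)) x - iteratedFDeriv ℝ a s x :=
    iteratedFDeriv_sub_apply (f := fun _ => (1 : ℂ)) (g := s) contDiff_const.contDiffAt
      (s.smooth a).contDiffAt
  have h2 : ‖iteratedFDeriv ℝ a (fun _ : H => (1 : ℂ)) x‖ ≤ 1 := by
    rcases Nat.eq_zero_or_pos a with rfl | ha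
    · simp
    · simp [iteratedFDeriv_const_of_ne ha.ne' (1 : ℂ)]
  rw [h1]
  refine (norm_sub_le _ _).trans (add_le_add h2
      ((s.norm_iteratedFDeriv_le_seminorm ℝ a x).trans ?_))
  exact Finset.single_le_sum (f := fun a => SchwartzMap.seminorm ℝ 0 a s)
    (fun i _ => apply_nonneg _ _) (by simpa [Nat.lt_succ_iff] using ha)

/-- If all derivatives of `g` up to order `n` are at most `δ (1 + ‖x‖)`, then multiplication by `g`
is small on Schwartz functions. -/
theorem exists_seminorm_smulLeft_le (k n : ℕ) (ζ : 𝓢(V, ℂ)) :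
    ∃ C : ℝ, 0 ≤ C ∧ ∀ (g : V → ℂ) (δ : ℝ), g.HasTemperateGrowth →
      (∀ a ≤ n, ∀ x, ‖iteratedFDeriv ℝ a g x‖ ≤ δ * (1 + ‖x‖)) →
      SchwartzMap.seminorm ℂ k n (SchwartzMap.smulLeftCLM ℂ g ζ) ≤ C * δ := by
  refine ⟨∑ i ∈ Finset.range (n + 1), (n.choose i : ℝ) * (SchwartzMap.seminorm ℝ k (n - i) ζ +
    SchwartzMap.seminorm ℝ (k + 1) (n - i) ζ), by positivity, fun g δ hg hδ => ?_⟩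
  have hδ0 : 0 ≤ δ := by
    have := (norm_nonneg _).trans (hδ 0 (Nat.zero_le _) 0)
    simpa using this
  refine SchwartzMap.seminorm_le_bound _ _ _ _ (by positivity) fun x => ?_
  have h1 : (SchwartzMap.smulLeftCLM ℂ g ζ : V → ℂ) = fun y => g y * ζ y := by
    funext y
    rw [SchwartzMap.smulLeftCLM_apply_apply hg, smul_eq_mul]
  rw [h1]
  calc ‖x‖ ^ k * ‖iteratedFDeriv ℝ n (fun y => g y * ζ y) x‖
      ≤ ‖x‖ ^ k * ∑ i ∈ Finset.range (n + 1), (n.choose i : ℝ) * ‖iteratedFDeriv ℝ i g x‖ *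
          ‖iteratedFDeriv ℝ (n - i) ζ x‖ := by
        gcongr
        exact norm_iteratedFDeriv_mul_le hg.1 (ζ.smooth ⊤) x (by exact_mod_cast le_top)
    _ = ∑ i ∈ Finset.range (n + 1), (n.choose i : ℝ) * (‖iteratedFDeriv ℝ i g x‖ *
          (‖x‖ ^ k * ‖iteratedFDeriv ℝ (n - i) ζ x‖)) := by
        rw [Finset.mul_sum]
        exact Finset.sum_congr rfl fun i _ => by ring
    _ ≤ ∑ i ∈ Finset.range (n + 1), (n.choose i : ℝ) * (δ * (SchwartzMap.seminorm ℝ k (n - i) ζ +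
          SchwartzMap.seminorm ℝ (k + 1) (n - i) ζ)) := by
        refine Finset.sum_le_sum fun i hi => ?_
        have hi' : i ≤ n := by simpa [Nat.lt_succ_iff] using hi
        refine mul_le_mul_of_nonneg_left ?_ (Nat.cast_nonneg _)
        calc ‖iteratedFDeriv ℝ i g x‖ * (‖x‖ ^ k * ‖iteratedFDeriv ℝ (n - i) ζ x‖)
            ≤ δ * (1 + ‖x‖) * (‖x‖ ^ k * ‖iteratedFDeriv ℝ (n - i) ζ x‖) := by
              gcongr
              exact hδ i hi' x
          _ = δ * (‖x‖ ^ k * ‖iteratedFDeriv ℝ (n - i) ζ x‖ +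
                ‖x‖ ^ (k + 1) * ‖iteratedFDeriv ℝ (n - i) ζ x‖) := by ring
          _ ≤ _ := by
              gcongr
              · exact SchwartzMap.le_seminorm ℝ k (n - i) ζ x
              · exact SchwartzMap.le_seminorm ℝ (k + 1) (n - i) ζ x
    _ = _ := by
        rw [Finset.sum_mul]
        exact Finset.sum_congr rfl fun i _ => by ring

/-- Every tempered distribution has finite order: it is small on `g ζ` as soon as finitely many
derivatives of `g` are small. -/
theorem exists_order_bound (T : 𝓢(V, ℂ) →L[ℂ] ℂ) :
    ∃ n : ℕ, ∀ ζ : 𝓢(V, ℂ), ∃ C : ℝ, 0 ≤ C ∧ ∀ (g : V → ℂ) (δ : ℝ), g.HasTemperateGrowth →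
      (∀ a ≤ n, ∀ x, ‖iteratedFDeriv ℝ a g x‖ ≤ δ * (1 + ‖x‖)) →
      ‖T (SchwartzMap.smulLeftCLM ℂ g ζ)‖ ≤ C * δ := by
  obtain ⟨s, A, -, hA⟩ := Seminorm.bound_of_continuous (schwartz_withSeminorms ℂ V ℂ)
    ((normSeminorm ℂ ℂ).comp T.toLinearMap) (by
      change Continuous fun x => ‖T x‖
      exact T.continuous.norm)
  refine ⟨s.sup Prod.snd, fun ζ => ?_⟩
  choose c hc0 hc using fun kn : ℕ × ℕ => exists_seminorm_smulLeft_le kn.1 kn.2 ζ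
  refine ⟨A * ∑ kn ∈ s, c kn, mul_nonneg A.2 (Finset.sum_nonneg fun i _ => hc0 i),
    fun g δ hg hδ => ?_⟩
  have hδ0 : 0 ≤ δ := by
    have := (norm_nonneg _).trans (hδ 0 (Nat.zero_le _) 0)
    simpa using this
  refine (hA (SchwartzMap.smulLeftCLM ℂ g ζ)).trans ?_
  rw [_root_.smul_apply, NNReal.smul_def, smul_eq_mul, mul_assoc]
  refine mul_le_mul_of_nonneg_left ?_ A.2
  refine Seminorm.finset_sup_apply_le (mul_nonneg (Finset.sum_nonneg fun i _ => hc0 i) hδ0)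
    fun kn hkn => ?_
  refine (hc kn g δ hg fun a ha x => hδ a (ha.trans (Finset.le_sup hkn)) x).trans ?_
  gcongr
  exact Finset.single_le_sum (f := c) (fun i _ => hc0 i) hkn

theorem tendsto_smulLeft_of_bound (T : 𝓢(V, ℂ) →L[ℂ] ℂ) (ζ : 𝓢(V, ℂ)) {g : ℕ → V → ℂ}
    (hg : ∀ N, (g N).HasTemperateGrowth)
    (h : ∀ n, ∃ C : ℝ, ∀ N, ∀ a ≤ n, ∀ x,
      ‖iteratedFDeriv ℝ a (g N) x‖ ≤ (C * 2 ^ (-(N : ℤ))) * (1 + ‖x‖)) :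
    Tendsto (fun N => T (SchwartzMap.smulLeftCLM ℂ (g N) ζ)) atTop (𝓝 0) := by
  obtain ⟨n, hn⟩ := exists_order_bound T
  obtain ⟨A, hA0, hA⟩ := hn ζ
  obtain ⟨C, hC⟩ := h n
  refine squeeze_zero_norm (fun N => hA _ _ (hg N) (hC N)) ?_
  have h1 : Tendsto (fun N : ℕ => ((2 : ℝ)⁻¹) ^ N) atTop (𝓝 0) :=
    tendsto_pow_atTop_nhds_zero_of_lt_one (by norm_num) (by norm_num)
  have h2 : Tendsto (fun N : ℕ => A * (C * ((2 : ℝ)⁻¹) ^ N)) atTop (𝓝 (A * (C * 0))) :=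
    (h1.const_mul C).const_mul A
  simpa [zpow_neg] using h2

end Multipliers

section Density

variable {V : Type*} [NormedAddCommGroup V] [InnerProductSpace ℝ V] [FiniteDimensional ℝ V]

/-- Density of compactly supported Schwartz functions: a tempered distribution that vanishes on
those supported in the support of `ζ` vanishes at `ζ`. -/
theorem eq_zero_of_forall_compactSupport (T : 𝓢(V, ℂ) →L[ℂ] ℂ)
    (ζ : 𝓢(V, ℂ)) (h : ∀ η : 𝓢(V, ℂ), HasCompactSupport η → tsupport η ⊆ tsupport ζ → T η = 0) :
    T ζ = 0 := by
  let b : ContDiffBump (0 : V) := ⟨1, 2, one_pos, one_lt_two⟩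
  let f : V → ℂ := fun x => ((b x : ℝ) : ℂ)
  have hf : ContDiff ℝ ∞ f := Complex.ofRealCLM.contDiff.comp b.contDiff
  have hfc : HasCompactSupport f := b.hasCompactSupport.comp_left Complex.ofReal_zero
  let f' : V → ℂ := fun x => 1 - f x
  have hf' : ContDiff ℝ ∞ f' := contDiff_const.sub hf
  let e : ℕ → V → V := fun N x => (2 : ℝ) ^ (-(N : ℤ)) • x
  have he : ∀ N, (e N).HasTemperateGrowth := fun N => by
    change (fun x : V => (2 : ℝ) ^ (-(N : ℤ)) • x).HasTemperateGrowth
    fun_prop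
  have hft : f.HasTemperateGrowth := hfc.hasTemperateGrowth hf
  have hft' : f'.HasTemperateGrowth := (Function.HasTemperateGrowth.const 1).sub hft
  have hlim := tendsto_smulLeft_of_bound T ζ (g := fun N x => f' (e N x))
    (fun N => hft'.comp (he N)) (fun n => by
      obtain ⟨B, hB⟩ := exists_bound_one_sub (hfc.toSchwartzMap hf) n
      refine ⟨B / 1, fun N => ?_⟩
      exact exists_bound_dilated hf' hB one_pos (fun x hx => by
        simp only [f', f]
        rw [b.one_of_mem_closedBall (by simpa using hx.le)]
        simp) (L := ContinuousLinearMap.id ℝ V) ContinuousLinearMap.norm_id_le N)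
  have hconst : ∀ N, T (SchwartzMap.smulLeftCLM ℂ (fun x => f' (e N x)) ζ) = T ζ := by
    intro N
    have hc : (fun x => f (e N x)).HasTemperateGrowth := hft.comp (he N)
    have hc' : (fun x => f' (e N x)).HasTemperateGrowth := hft'.comp (he N)
    have h1 : SchwartzMap.smulLeftCLM ℂ (fun x => f' (e N x)) ζ
        = ζ - SchwartzMap.smulLeftCLM ℂ (fun x => f (e N x)) ζ := by
      ext x
      rw [SchwartzMap.smulLeftCLM_apply_apply hc', _root_.sub_apply,
        SchwartzMap.smulLeftCLM_apply_apply hc]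
      simp only [f', smul_eq_mul]
      ring
    have h2 : HasCompactSupport fun x => f (e N x) :=
      hfc.comp_homeomorph (Homeomorph.smulOfNeZero ((2 : ℝ) ^ (-(N : ℤ))) (by positivity))
    have h3 : T (SchwartzMap.smulLeftCLM ℂ (fun x => f (e N x)) ζ) = 0 := by
      have h4 : (SchwartzMap.smulLeftCLM ℂ (fun x => f (e N x)) ζ : V → ℂ)
          = fun x => f (e N x) * ζ x := by
        funext x
        rw [SchwartzMap.smulLeftCLM_apply_apply hc, smul_eq_mul]
      apply h
      · rw [h4]
        exact h2.mul_right
      · rw [h4]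
        exact tsupport_mul_subset_right
    rw [h1, map_sub, h3, sub_zero]
  simp only [hconst] at hlim
  exact tendsto_nhds_unique tendsto_const_nhds hlim

end Density

end CheminLerner

/-! ### Convergence of the dyadic decomposition of a tempered distribution -/

namespace CheminLerner

open FourierTransform

section Convergence

variable {V H : Type*} [NormedAddCommGroup V] [NormedSpace ℝ V] [NormedAddCommGroup H]
  [InnerProductSpace ℝ H] [FiniteDimensional ℝ H]

theorem hasTemperateGrowth_schwartz_comp (s : 𝓢(H, ℂ)) (L : V →L[ℝ] H) :
    (fun z => s (L z)).HasTemperateGrowth :=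
  s.hasTemperateGrowth.comp L.hasTemperateGrowth

theorem lowSymbol_eq_one {Φ : LittlewoodPaley H} {ξ : H} (h : ‖ξ‖ < 1 / (2 * Real.pi)) :
    lowSymbol Φ ξ = 1 := by
  change ((Φ.low _ : ℝ) : ℂ) = 1
  rw [Φ.low_eq_one, Complex.ofReal_one]
  rw [norm_smul, Real.norm_of_nonneg (by positivity), mul_comm]
  rw [lt_div_iff₀ (by positivity)] at h
  exact h.le

theorem lowSymbol_eq_zero {Φ : LittlewoodPaley H} {ξ : H} (h : 1 ≤ ‖ξ‖) :
    lowSymbol Φ ξ = 0 := by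
  change ((Φ.low _ : ℝ) : ℂ) = 0
  rw [Φ.low_eq_zero, Complex.ofReal_zero]
  rw [norm_smul, Real.norm_of_nonneg (by positivity)]
  nlinarith [Real.pi_gt_three]

theorem hasTemperateGrowth_dilate_comp (s : 𝓢(H, ℂ)) (L : V →L[ℝ] H) (j : ℤ) :
    (fun z => dilate s j (L z)).HasTemperateGrowth :=
  hasTemperateGrowth_schwartz_comp (dilate s j) L

/-- Low frequency cut-offs converge to the identity at high frequencies. -/
theorem tendsto_lowPass (Φ : LittlewoodPaley H) {L : V →L[ℝ] H} (hL : ‖L‖ ≤ 1)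
    (T : 𝓢(V, ℂ) →L[ℂ] ℂ) (ζ : 𝓢(V, ℂ)) :
    Tendsto (fun N : ℕ => T (SchwartzMap.smulLeftCLM ℂ
      (fun z => dilate (lowSymbol Φ) N (L z)) ζ)) atTop (𝓝 (T ζ)) := by
  have hs := hasTemperateGrowth_dilate_comp (lowSymbol Φ) L
  have h1 : Tendsto (fun N : ℕ => T (SchwartzMap.smulLeftCLM ℂ
      (fun z => 1 - dilate (lowSymbol Φ) N (L z)) ζ)) atTop (𝓝 0) := by
    refine tendsto_smulLeft_of_bound T ζ
      (fun N => (Function.HasTemperateGrowth.const 1).sub (hs N)) fun n => ?_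
    obtain ⟨B, hB⟩ := exists_bound_one_sub (lowSymbol Φ) n
    refine ⟨B / (1 / (2 * Real.pi)), fun N => ?_⟩
    exact exists_bound_dilated (f := fun x => 1 - lowSymbol Φ x)
      (contDiff_const.sub ((lowSymbol Φ).smooth ⊤)) hB
      (by positivity) (fun x hx => by rw [lowSymbol_eq_one hx, sub_self]) hL N
  have h2 : ∀ N : ℕ, T (SchwartzMap.smulLeftCLM ℂ (fun z => dilate (lowSymbol Φ) N (L z)) ζ)
      = T ζ - T (SchwartzMap.smulLeftCLM ℂ (fun z => 1 - dilate (lowSymbol Φ) N (L z)) ζ) := by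
    intro N
    rw [← map_sub]
    congr 1
    ext z
    have hs' : (fun z => 1 - dilate (lowSymbol Φ) N (L z)).HasTemperateGrowth :=
      (Function.HasTemperateGrowth.const 1).sub (hs N)
    rw [_root_.sub_apply, SchwartzMap.smulLeftCLM_apply_apply (hs N),
      SchwartzMap.smulLeftCLM_apply_apply hs']
    simp only [smul_eq_mul]
    ring
  simp only [h2]
  simpa using h1.const_sub (T ζ)

/-- The symbol of the difference operator of step `h`. -/
noncomputable def diffSymbol (h : ℝ) (τ : ℝ) : ℂ :=
  Complex.exp (2 * Real.pi * h * Complex.I * τ) - 1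

theorem contDiff_diffSymbol (h : ℝ) : ContDiff ℝ ∞ (diffSymbol h) := by
  unfold diffSymbol
  have h1 : ContDiff ℝ ∞ fun τ : ℝ => 2 * Real.pi * h * Complex.I * (τ : ℂ) :=
    contDiff_const.mul Complex.ofRealCLM.contDiff
  exact (h1.cexp).sub contDiff_const

theorem norm_iteratedFDeriv_cexp_le (c : ℝ) (a : ℕ) (τ : ℝ) :
    ‖iteratedFDeriv ℝ a (fun τ : ℝ => Complex.exp (c * Complex.I * τ)) τ‖ ≤ |c| ^ a := by
  have key : ∀ a : ℕ, iteratedDeriv a (fun τ : ℝ => Complex.exp (c * Complex.I * τ))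
      = fun τ : ℝ => (c * Complex.I) ^ a * Complex.exp (c * Complex.I * τ) := by
    intro a
    induction a with
    | zero => simp
    | succ a ih =>
      rw [iteratedDeriv_succ, ih]
      funext τ
      have h1 : HasDerivAt (fun τ : ℝ => c * Complex.I * (τ : ℂ)) (c * Complex.I) τ := by
        simpa using (Complex.ofRealCLM.hasDerivAt (x := τ)).const_mul (c * Complex.I)
      have h2 := (h1.cexp.const_mul ((c * Complex.I) ^ a)).deriv
      rw [h2]
      ring
  rw [norm_iteratedFDeriv_eq_norm_iteratedDeriv, key]
  have h3 : (c : ℂ) * Complex.I * τ = ((c * τ : ℝ) : ℂ) * Complex.I := by push_cast; ring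
  rw [norm_mul, norm_pow, norm_mul, h3, Complex.norm_exp_ofReal_mul_I]
  simp

theorem diffSymbol_eq (h : ℝ) :
    diffSymbol h = fun τ : ℝ => Complex.exp (((2 * Real.pi * h : ℝ) : ℂ) * Complex.I * τ) - 1 := by
  funext τ
  simp [diffSymbol]

theorem norm_iteratedFDeriv_diffSymbol_le (h : ℝ) {a : ℕ} (ha : a ≠ 0) (τ : ℝ) :
    ‖iteratedFDeriv ℝ a (diffSymbol h) τ‖ ≤ |2 * Real.pi * h| ^ a := by
  rw [diffSymbol_eq]
  have h1 : ContDiff ℝ ∞ fun τ : ℝ => Complex.exp (((2 * Real.pi * h : ℝ) : ℂ) * Complex.I * τ) :=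
    (contDiff_const.mul Complex.ofRealCLM.contDiff).cexp
  have h2 := fun_iteratedFDeriv_sub_apply (𝕜 := ℝ) (i := a) (x := τ) (f := fun τ : ℝ =>
      Complex.exp (((2 * Real.pi * h : ℝ) : ℂ) * Complex.I * τ)) (g := fun _ => (1 : ℂ))
    (h1.of_le (by exact_mod_cast le_top)).contDiffAt contDiff_const.contDiffAt
  rw [h2, iteratedFDeriv_const_of_ne ha]
  simpa using norm_iteratedFDeriv_cexp_le (2 * Real.pi * h) a τ

theorem norm_diffSymbol_le (h τ : ℝ) : ‖diffSymbol h τ‖ ≤ |2 * Real.pi * h| * |τ| := by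
  have h3 : (2 : ℂ) * Real.pi * h * Complex.I * τ =
      Complex.I * ((2 * Real.pi * h * τ : ℝ) : ℂ) := by
    push_cast; ring
  rw [diffSymbol, h3]
  refine (Real.norm_exp_I_mul_ofReal_sub_one_le (x := _)).trans ?_
  rw [Real.norm_eq_abs, abs_mul]

theorem hasTemperateGrowth_diffSymbol (h : ℝ) : (diffSymbol h).HasTemperateGrowth := by
  refine ⟨contDiff_diffSymbol h, fun n => ?_⟩
  rcases Nat.eq_zero_or_pos n with rfl | hn
  · refine ⟨1, |2 * Real.pi * h|, fun τ => ?_⟩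
    rw [norm_iteratedFDeriv_zero, pow_one]
    refine (norm_diffSymbol_le h τ).trans ?_
    gcongr
    rw [Real.norm_eq_abs]
    linarith
  · refine ⟨0, |2 * Real.pi * h| ^ n, fun τ => ?_⟩
    simpa using norm_iteratedFDeriv_diffSymbol_le h hn.ne' τ

/-- Since `diffSymbol h` vanishes at the origin, its `m`-th power times a cut-off to frequencies
`|τ| ≲ 2⁻ᴺ` is small together with its derivatives of order less than `m`. -/
theorem exists_bound_diffSymbol_pow_mul_low (Ψ : LittlewoodPaley ℝ) (h : ℝ) (n : ℕ) :
    ∃ C : ℝ, ∀ N : ℕ, ∀ a ≤ n, ∀ τ : ℝ,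
      ‖iteratedFDeriv ℝ a (fun τ => diffSymbol h τ ^ (n + 1) *
        dilate (lowSymbol Ψ) (-(N : ℤ)) τ) τ‖ ≤ C * 2 ^ (-(N : ℤ)) := by
  set A : ℝ := (1 + |2 * Real.pi * h|) ^ (n + 1)
  obtain ⟨B, hB⟩ := exists_bound_one_sub (lowSymbol Ψ) n
  set B' : ℝ := ∑ a ∈ Finset.range (n + 1), SchwartzMap.seminorm ℝ 0 a (lowSymbol Ψ)
  have hA1 : 1 ≤ 1 + |2 * Real.pi * h| := by linarith [abs_nonneg (2 * Real.pi * h)]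
  have hB' : 0 ≤ B' := Finset.sum_nonneg fun i _ => apply_nonneg _ _
  refine ⟨2 ^ n * ((2 ^ n * A) ^ (n + 1) * B'), fun N a ha τ => ?_⟩
  set ε : ℝ := 2 ^ (-(N : ℤ)) with hε
  have hε0 : 0 < ε := by positivity
  have hε1 : ε ≤ 1 := zpow_le_one_of_nonpos₀ one_le_two (by omega)
  have hinv : (2 : ℝ) ^ (- -(N : ℤ)) = ε⁻¹ := by rw [hε, zpow_neg, zpow_neg, inv_inv]
  by_cases hτ : ε < |τ|
  · have h1 : (fun τ => diffSymbol h τ ^ (n + 1) * dilate (lowSymbol Ψ) (-(N : ℤ)) τ)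
        =ᶠ[𝓝 τ] 0 := by
      filter_upwards [(isOpen_lt continuous_const continuous_abs).mem_nhds hτ] with y hy
      have : dilate (lowSymbol Ψ) (-(N : ℤ)) y = 0 := by
        rw [dilate_apply, hinv]
        apply lowSymbol_eq_zero
        rw [norm_smul, Real.norm_of_nonneg (by positivity), Real.norm_eq_abs,
          le_inv_mul_iff₀ hε0, mul_one]
        exact le_of_lt hy
      simp [this]
    rw [iteratedFDeriv_eq_zero_of_eventually h1, norm_zero]
    positivity
  · have hM : ScaledBound ε n (A * ε) (diffSymbol h) τ := by
      intro b hb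
      rcases Nat.eq_zero_or_pos b with rfl | hb0
      · rw [pow_zero, one_mul, norm_iteratedFDeriv_zero]
        refine (norm_diffSymbol_le h τ).trans ?_
        gcongr
        · exact (le_add_of_nonneg_left zero_le_one).trans (le_self_pow₀ hA1 (by omega))
        · exact not_lt.1 hτ
      · calc ε ^ b * ‖iteratedFDeriv ℝ b (diffSymbol h) τ‖
            ≤ ε * (1 + |2 * Real.pi * h|) ^ (n + 1) := by
              gcongr
              · exact pow_le_of_le_one hε0.le hε1 hb0.ne'
              · refine (norm_iteratedFDeriv_diffSymbol_le h hb0.ne' τ).trans ?_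
                refine (pow_le_pow_left₀ (abs_nonneg _)
                  (le_add_of_nonneg_left zero_le_one) b).trans ?_
                exact pow_le_pow_right₀ hA1 (by omega)
          _ = A * ε := mul_comm _ _
    have hlow : ScaledBound ε n B' (dilate (lowSymbol Ψ) (-(N : ℤ))) τ := by
      intro b hb
      have h1 := norm_iteratedFDeriv_comp_linear_le ((lowSymbol Ψ).smooth ⊤)
        ((2 : ℝ) ^ (- -(N : ℤ)) • ContinuousLinearMap.id ℝ ℝ)
        (norm_smul_linear_le ContinuousLinearMap.norm_id_le (by positivity)) b τ
      rw [hinv] at h1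
      have h2 : (dilate (lowSymbol Ψ) (-(N : ℤ)) : ℝ → ℂ)
          = fun y => lowSymbol Ψ ((ε⁻¹ • ContinuousLinearMap.id ℝ ℝ) y) := by
        funext y
        rw [dilate_apply, hinv]
        rfl
      rw [h2]
      calc _ ≤ ε ^ b * (ε⁻¹ ^ b * ‖iteratedFDeriv ℝ b (lowSymbol Ψ)
              ((ε⁻¹ • ContinuousLinearMap.id ℝ ℝ) τ)‖) := by gcongr
        _ = ‖iteratedFDeriv ℝ b (lowSymbol Ψ) ((ε⁻¹ • ContinuousLinearMap.id ℝ ℝ) τ)‖ := by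
            rw [← mul_assoc, ← mul_pow, mul_inv_cancel₀ hε0.ne', one_pow, one_mul]
        _ ≤ _ := (lowSymbol Ψ).norm_iteratedFDeriv_le_seminorm ℝ b _
        _ ≤ B' := Finset.single_le_sum (f := fun a => SchwartzMap.seminorm ℝ 0 a (lowSymbol Ψ))
            (fun i _ => apply_nonneg _ _) (by simpa [Nat.lt_succ_iff] using hb)
    have h1 := (hM.pow hε0.le (contDiff_diffSymbol h) (n + 1)).mul hε0.le hlow
      ((contDiff_diffSymbol h).pow _) ((dilate (lowSymbol Ψ) (-(N : ℤ))).smooth ⊤) a ha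
    have h2 : ε ^ n ≤ ε ^ a := pow_le_pow_of_le_one hε0.le hε1 ha
    set X := ‖iteratedFDeriv ℝ a (fun τ => diffSymbol h τ ^ (n + 1) *
        dilate (lowSymbol Ψ) (-(N : ℤ)) τ) τ‖
    have h3 : ε ^ n * X ≤ ε ^ n * (2 ^ n * ((2 ^ n * A) ^ (n + 1) * B') * ε) := by
      calc ε ^ n * X ≤ ε ^ a * X := by gcongr
        _ ≤ 2 ^ n * ((2 ^ n * (A * ε)) ^ (n + 1) * B') := h1
        _ = _ := by
          rw [show 2 ^ n * (A * ε) = (2 ^ n * A) * ε by ring, mul_pow _ ε, pow_succ ε]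
          ring
    exact le_of_mul_le_mul_left h3 (by positivity)

/-- For a tempered distribution of order `n` in Fourier variables, the low frequencies of its
differences of order `n + 1` tend to `0`. -/
theorem exists_tendsto_low_diff (Ψ : LittlewoodPaley ℝ) {L : V →L[ℝ] ℝ} (hL : ‖L‖ ≤ 1)
    (T : 𝓢(V, ℂ) →L[ℂ] ℂ) :
    ∃ m : ℕ, m ≠ 0 ∧ ∀ (h : ℝ) (ζ : 𝓢(V, ℂ)), Tendsto (fun N : ℕ => T (SchwartzMap.smulLeftCLM ℂ
      (fun z => diffSymbol h (L z) ^ m * dilate (lowSymbol Ψ) (-(N : ℤ)) (L z)) ζ)) atTop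
      (𝓝 0) := by
  obtain ⟨n, hn⟩ := exists_order_bound T
  refine ⟨n + 1, n.succ_ne_zero, fun h ζ => ?_⟩
  obtain ⟨A, hA0, hA⟩ := hn ζ
  obtain ⟨C, hC⟩ := exists_bound_diffSymbol_pow_mul_low Ψ h n
  refine squeeze_zero_norm (fun N => hA _ (C * 2 ^ (-(N : ℤ))) ?_ fun a ha x => ?_) ?_
  · exact (((hasTemperateGrowth_diffSymbol h).pow (n + 1)).mul
      (dilate (lowSymbol Ψ) (-(N : ℤ))).hasTemperateGrowth).comp L.hasTemperateGrowth
  · have h1 := norm_iteratedFDeriv_comp_linear_le (((contDiff_diffSymbol h).pow (n + 1)).mul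
      ((dilate (lowSymbol Ψ) (-(N : ℤ))).smooth ⊤)) L hL a x
    rw [one_pow, one_mul] at h1
    refine h1.trans ((hC N a ha (L x)).trans ?_)
    have h2 : 0 ≤ C * 2 ^ (-(N : ℤ)) := (norm_nonneg _).trans (hC N a ha (L x))
    nlinarith [norm_nonneg x]
  · have h1 : Tendsto (fun N : ℕ => ((2 : ℝ)⁻¹) ^ N) atTop (𝓝 0) :=
      tendsto_pow_atTop_nhds_zero_of_lt_one (by norm_num) (by norm_num)
    have h2 : Tendsto (fun N : ℕ => A * (C * ((2 : ℝ)⁻¹) ^ N)) atTop (𝓝 (A * (C * 0))) :=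
      (h1.const_mul C).const_mul A
    simpa [zpow_neg] using h2

end Convergence

section SpaceTime

variable {n : ℕ}

/-- The projection of space-time on the time axis. -/
noncomputable abbrev fstST (n : ℕ) : SpaceTime n →L[ℝ] ℝ := WithLp.fstL 2 ℝ ℝ (Bdry n)

/-- The projection of space-time on the boundary space. -/
noncomputable abbrev sndST (n : ℕ) : SpaceTime n →L[ℝ] Bdry n := WithLp.sndL 2 ℝ ℝ (Bdry n)

theorem norm_fstST_le : ‖fstST n‖ ≤ 1 :=
  ContinuousLinearMap.opNorm_le_bound _ zero_le_one fun z => by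
    rw [one_mul]; exact WithLp.norm_fst_le ℝ z

theorem norm_sndST_le : ‖sndST n‖ ≤ 1 :=
  ContinuousLinearMap.opNorm_le_bound _ zero_le_one fun z => by
    rw [one_mul]; exact WithLp.norm_snd_le ℝ z

theorem spaceBlock_apply (Φ : LittlewoodPaley (Bdry n)) (j : ℤ) (u : 𝓢'(SpaceTime n, ℂ))
    (η : 𝓢(SpaceTime n, ℂ)) : spaceBlock Φ j u η =
      u (𝓕 (SchwartzMap.smulLeftCLM ℂ (fun z => dilate (blockSymbol Φ) j (sndST n z)) (𝓕⁻ η))) := by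
  have h : (fun z : SpaceTime n => ((Φ.dyadic j z.snd : ℝ) : ℂ))
      = fun z => dilate (blockSymbol Φ) j (sndST n z) := by
    funext z
    rw [dilate_blockSymbol]
    rfl
  rw [spaceBlock, h]
  rfl

theorem timeBlock_apply (Ψ : LittlewoodPaley ℝ) (k : ℤ) (u : 𝓢'(SpaceTime n, ℂ))
    (η : 𝓢(SpaceTime n, ℂ)) : timeBlock Ψ k u η =
      u (𝓕 (SchwartzMap.smulLeftCLM ℂ (fun z => dilate (blockSymbol Ψ) k (fstST n z)) (𝓕⁻ η))) := by
  have h : (fun z : SpaceTime n => ((Ψ.dyadic k z.fst : ℝ) : ℂ))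
      = fun z => dilate (blockSymbol Ψ) k (fstST n z) := by
    funext z
    rw [dilate_blockSymbol]
    rfl
  rw [timeBlock, h]
  rfl

/-- A tempered distribution, precomposed with the Fourier transform. -/
noncomputable def fourierDual (u : 𝓢'(SpaceTime n, ℂ)) : 𝓢(SpaceTime n, ℂ) →L[ℂ] ℂ :=
  (u : 𝓢(SpaceTime n, ℂ) →L[ℂ] ℂ) ∘L fourierCLM ℂ 𝓢(SpaceTime n, ℂ)

theorem fourierDual_apply (u : 𝓢'(SpaceTime n, ℂ)) (ζ : 𝓢(SpaceTime n, ℂ)) :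
    fourierDual u ζ = u (𝓕 ζ) := rfl

theorem fourierDual_fourierInv (u : 𝓢'(SpaceTime n, ℂ)) (ζ : 𝓢(SpaceTime n, ℂ)) :
    fourierDual u (𝓕⁻ ζ) = u ζ := by
  rw [fourierDual_apply, FourierTransform.fourier_fourierInv_eq]

/-- Sums of consecutive dyadic blocks are differences of low frequency cut-offs. -/
theorem sum_smulLeft_dilate {H : Type*} [NormedAddCommGroup H] [InnerProductSpace ℝ H]
    [FiniteDimensional ℝ H] [MeasurableSpace H] [BorelSpace H]
    (Φ : LittlewoodPaley H) (L : SpaceTime n →L[ℝ] H) (T : 𝓢(SpaceTime n, ℂ) →L[ℂ] ℂ)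
    (ζ : 𝓢(SpaceTime n, ℂ)) (N : ℕ) :
    ∑ j ∈ Finset.Icc (-(N : ℤ)) N,
        T (SchwartzMap.smulLeftCLM ℂ (fun z => dilate (blockSymbol Φ) j (L z)) ζ)
      = T (SchwartzMap.smulLeftCLM ℂ (fun z => dilate (lowSymbol Φ) N (L z)) ζ) -
        T (SchwartzMap.smulLeftCLM ℂ
          (fun z => dilate (lowSymbol Φ) (-((N + 1 : ℕ) : ℤ)) (L z)) ζ) := by
  rw [← map_sum, ← map_sub]
  congr 1
  ext z
  rw [_root_.sub_apply, _root_.sum_apply,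
    SchwartzMap.smulLeftCLM_apply_apply (hasTemperateGrowth_dilate_comp _ L _),
    SchwartzMap.smulLeftCLM_apply_apply (hasTemperateGrowth_dilate_comp _ L _)]
  simp only [SchwartzMap.smulLeftCLM_apply_apply (hasTemperateGrowth_dilate_comp _ L _)]
  rw [← Finset.sum_smul, ← sub_smul, dilate_lowSymbol, dilate_lowSymbol]
  simp only [dilate_blockSymbol]
  rw [← Complex.ofReal_sum, Φ.sum_dyadic, Complex.ofReal_sub]
  push_cast
  rw [show -((N : ℤ) + 1) = -(N : ℤ) - 1 by ring]

/-- A tempered distribution is the sum of its blocks as soon as its low frequencies tend to `0`. -/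
theorem isRealized_of_tendsto_low (Φ : LittlewoodPaley (Bdry n)) (u : 𝓢'(SpaceTime n, ℂ))
    (h : ∀ η : 𝓢(SpaceTime n, ℂ), Tendsto (fun N : ℕ => u (𝓕 (SchwartzMap.smulLeftCLM ℂ
      (fun z => dilate (lowSymbol Φ) (-(N : ℤ)) (sndST n z)) (𝓕⁻ η)))) atTop (𝓝 0)) :
    IsRealized Φ u := by
  intro η
  have h1 := tendsto_lowPass Φ norm_sndST_le (fourierDual u) (𝓕⁻ η)
  have h2 := h1.sub ((tendsto_add_atTop_iff_nat 1).2 (h η))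
  rw [fourierDual_fourierInv, sub_zero] at h2
  refine h2.congr fun N => ?_
  simp only [spaceBlock_apply]
  exact (sum_smulLeft_dilate Φ (sndST n) (fourierDual u) (𝓕⁻ η) N).symm

/-- The difference operator of time step `-h` on Schwartz functions. -/
noncomputable def diffS (n : ℕ) (h : ℝ) : 𝓢(SpaceTime n, ℂ) →L[ℂ] 𝓢(SpaceTime n, ℂ) :=
  SchwartzMap.compSubConstCLM ℂ (WithLp.toLp 2 (h, 0)) - ContinuousLinearMap.id ℂ _

theorem diffS_apply (h : ℝ) (ζ : 𝓢(SpaceTime n, ℂ)) (z : SpaceTime n) :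
    diffS n h ζ z = ζ (z - WithLp.toLp 2 (h, 0)) - ζ z := rfl

theorem fourierInv_diffS (h : ℝ) (ζ : 𝓢(SpaceTime n, ℂ)) :
    𝓕⁻ (diffS n h ζ) = SchwartzMap.smulLeftCLM ℂ (fun z => diffSymbol h (fstST n z)) (𝓕⁻ ζ) := by
  ext w
  have hM : (fun z => diffSymbol h (fstST n z)).HasTemperateGrowth :=
    (hasTemperateGrowth_diffSymbol h).comp (fstST n).hasTemperateGrowth
  rw [SchwartzMap.smulLeftCLM_apply_apply hM]
  set a : SpaceTime n := WithLp.toLp 2 (h, 0)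
  have h1 : ∀ ξ : 𝓢(SpaceTime n, ℂ), 𝓕⁻ ξ w = ∫ v, Real.fourierChar (inner ℝ v w) • ξ v := by
    intro ξ
    rw [SchwartzMap.fourierInv_coe, Real.fourierInv_eq]
  have hint : ∀ ξ : 𝓢(SpaceTime n, ℂ),
      Integrable fun v => Real.fourierChar (inner ℝ v w) • ξ v := by
    intro ξ
    refine ξ.integrable.norm.mono' ?_ (ae_of_all _ fun v => by rw [Circle.norm_smul])
    exact Continuous.aestronglyMeasurable (by fun_prop)
  have h2 : ∫ v, Real.fourierChar (inner ℝ v w) • ζ (v - a)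
      = ∫ v, Real.fourierChar (inner ℝ (v + a) w) • ζ v := by
    rw [← integral_add_right_eq_self (fun v => Real.fourierChar (inner ℝ v w) • ζ (v - a)) a]
    simp
  have h3 : 𝓕⁻ (diffS n h ζ) w = (∫ v, Real.fourierChar (inner ℝ v w) • ζ (v - a)) -
      ∫ v, Real.fourierChar (inner ℝ v w) • ζ v := by
    rw [h1]
    refine Eq.trans ?_ (integral_sub (hint (SchwartzMap.compSubConstCLM ℂ a ζ)) (hint ζ))
    simp only [diffS_apply, ← smul_sub]
    rfl
  have h4 : ∀ v, Real.fourierChar (inner ℝ (v + a) w) • ζ v =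
      (diffSymbol h (fstST n w) + 1) • (Real.fourierChar (inner ℝ v w) • ζ v) := by
    intro v
    have h5 : inner ℝ a w = h * w.fst := by
      rw [WithLp.prod_inner_apply]
      simp [a, mul_comm]
    have h6 : ((Real.fourierChar (h * w.fst) : Circle) : ℂ) = diffSymbol h (fstST n w) + 1 := by
      rw [Real.fourierChar_apply, diffSymbol, sub_add_cancel]
      congr 1
      change _ = 2 * Real.pi * h * Complex.I * (w.fst : ℂ)
      push_cast
      ring
    rw [inner_add_left, AddChar.map_add_eq_mul, h5, mul_comm, mul_smul, ← h6]
    rfl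
  rw [h3, h2, h1 ζ]
  simp only [h4]
  rw [integral_smul, add_smul, one_smul, add_sub_cancel_right]

theorem fourierInv_diffS_iterate (h : ℝ) (m : ℕ) (ζ : 𝓢(SpaceTime n, ℂ)) :
    𝓕⁻ ((diffS n h)^[m] ζ) =
      SchwartzMap.smulLeftCLM ℂ (fun z => diffSymbol h (fstST n z) ^ m) (𝓕⁻ ζ) := by
  have hM : (fun z => diffSymbol h (fstST n z)).HasTemperateGrowth :=
    (hasTemperateGrowth_diffSymbol h).comp (fstST n).hasTemperateGrowth
  induction m with
  | zero => simp
  | succ m ih =>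
    have hMm : (fun z => diffSymbol h (fstST n z) ^ m).HasTemperateGrowth := hM.pow m
    rw [Function.iterate_succ_apply', fourierInv_diffS, ih,
      SchwartzMap.smulLeftCLM_smulLeftCLM_apply hM hMm]
    congr 2
    funext z
    simp [pow_succ']

/-- High order differences of a tempered distribution are the sums of those of its blocks in time,
whatever its low frequency part. -/
theorem exists_tendsto_sum_timeBlock (Ψ : LittlewoodPaley ℝ) (u : 𝓢'(SpaceTime n, ℂ)) :
    ∃ m : ℕ, m ≠ 0 ∧ ∀ (h : ℝ) (ζ : 𝓢(SpaceTime n, ℂ)),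
      Tendsto (fun N : ℕ => ∑ k ∈ Finset.Icc (-(N : ℤ)) N, timeBlock Ψ k u ((diffS n h)^[m] ζ))
        atTop (𝓝 (u ((diffS n h)^[m] ζ))) := by
  obtain ⟨m, hm0, hm⟩ := exists_tendsto_low_diff Ψ (norm_fstST_le (n := n)) (fourierDual u)
  refine ⟨m, hm0, fun h ζ => ?_⟩
  have h1 := tendsto_lowPass Ψ norm_fstST_le (fourierDual u) (𝓕⁻ ((diffS n h)^[m] ζ))
  have h2 := h1.sub ((tendsto_add_atTop_iff_nat 1).2 (hm h (𝓕⁻ ζ)))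
  rw [fourierDual_fourierInv, sub_zero] at h2
  refine h2.congr fun N => ?_
  simp only [timeBlock_apply]
  refine Eq.trans ?_
    (sum_smulLeft_dilate Ψ (fstST n) (fourierDual u) (𝓕⁻ ((diffS n h)^[m] ζ)) N).symm
  have hM : (fun z => diffSymbol h (fstST n z) ^ m).HasTemperateGrowth :=
    ((hasTemperateGrowth_diffSymbol h).comp (fstST n).hasTemperateGrowth).pow m
  congr 1
  congr 1
  rw [fourierInv_diffS_iterate, SchwartzMap.smulLeftCLM_smulLeftCLM_apply
    (hasTemperateGrowth_dilate_comp _ _ _) hM]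
  congr 2
  funext z
  simp [mul_comm]

end SpaceTime

end CheminLerner

/-! ### Functions of temperate growth in the mean as tempered distributions -/

namespace CheminLerner

open FourierTransform

section TemperedFunctions

variable {n : ℕ}

/-- The weight `(1 + ‖z‖)⁻ᴺ`. -/
noncomputable def wt {V : Type*} [NormedAddCommGroup V] (N : ℕ) (z : V) : ℝ≥0∞ :=
  ENNReal.ofReal ((1 + ‖z‖) ^ N)⁻¹

theorem measurable_wt {V : Type*} [NormedAddCommGroup V] [MeasurableSpace V] [BorelSpace V]
    (N : ℕ) : Measurable (wt (V := V) N) := by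
  unfold wt
  fun_prop

theorem wt_le_one {V : Type*} [NormedAddCommGroup V] (N : ℕ) (z : V) : wt N z ≤ 1 := by
  rw [wt, ENNReal.ofReal_le_one]
  exact inv_le_one_of_one_le₀ (one_le_pow₀ (by linarith [norm_nonneg z]))

theorem wt_add_le {V : Type*} [NormedAddCommGroup V] (N : ℕ) (z y : V) :
    wt N (z + y) ≤ ENNReal.ofReal ((1 + ‖y‖) ^ N) * wt N z := by
  rw [wt, wt, ← ENNReal.ofReal_mul (by positivity)]
  apply ENNReal.ofReal_le_ofReal
  rw [← div_eq_mul_inv, le_div_iff₀ (by positivity), inv_mul_le_iff₀ (by positivity), ← mul_pow]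
  apply pow_le_pow_left₀ (by positivity)
  have h1 : ‖z‖ ≤ ‖z + y‖ + ‖y‖ := by
    simpa using norm_sub_le (z + y) y
  nlinarith [norm_nonneg z, norm_nonneg y, norm_nonneg (z + y)]

/-- A measurable function that is integrable against some negative power of `1 + ‖z‖`. -/
structure TemperedFun (f : ℝ × Bdry n → ℂ) : Prop where
  measurable : Measurable f
  exists_lt_top : ∃ N : ℕ, ∫⁻ z, ‖f z‖ₑ * wt N z < ⊤

theorem schwartz_le_wt (η : 𝓢(SpaceTime n, ℂ)) (N : ℕ) (z : ℝ × Bdry n) :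
    ‖η (WithLp.toLp 2 z)‖ₑ ≤ ENNReal.ofReal
      (2 ^ N * ((Finset.Iic (N, 0)).sup fun m => SchwartzMap.seminorm ℂ m.1 m.2) η) * wt N z := by
  have h1 := SchwartzMap.one_add_le_sup_seminorm_apply (𝕜 := ℂ) (m := (N, 0)) (k := N) (n := 0)
    le_rfl le_rfl η (WithLp.toLp 2 z)
  set A : ℝ := 2 ^ N * ((Finset.Iic (N, 0)).sup fun m => SchwartzMap.seminorm ℂ m.1 m.2) η
  rw [norm_iteratedFDeriv_zero] at h1
  have h2 : ‖z‖ ≤ ‖(WithLp.toLp 2 z : SpaceTime n)‖ := by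
    rw [Prod.norm_def]
    exact max_le (WithLp.norm_fst_le ℝ (WithLp.toLp 2 z : SpaceTime n))
      (WithLp.norm_snd_le ℝ (WithLp.toLp 2 z : SpaceTime n))
  have h3 : ‖η (WithLp.toLp 2 z)‖ ≤ A * ((1 + ‖z‖) ^ N)⁻¹ := by
    rw [← div_eq_mul_inv, le_div_iff₀ (by positivity), mul_comm]
    exact le_trans (by gcongr) h1
  have hA : 0 ≤ A := le_trans (by positivity) h1
  rw [← ofReal_norm, wt, ← ENNReal.ofReal_mul hA]
  exact ENNReal.ofReal_le_ofReal h3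

theorem exists_schwartz_le_wt (η : 𝓢(SpaceTime n, ℂ)) (N : ℕ) :
    ∃ C : ℝ≥0, ∀ z : ℝ × Bdry n, ‖η (WithLp.toLp 2 z)‖ₑ ≤ C * wt N z :=
  ⟨_, schwartz_le_wt η N⟩

theorem continuous_schwartz_toLp (η : 𝓢(SpaceTime n, ℂ)) :
    Continuous fun z : ℝ × Bdry n => η (WithLp.toLp 2 z) :=
  η.continuous.comp (WithLp.prod_continuous_toLp 2 ℝ (Bdry n))

theorem TemperedFun.lintegral_const_mul {f : ℝ × Bdry n → ℂ} (hf : TemperedFun f) (c : ℝ≥0∞)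
    (N : ℕ) : ∫⁻ z, c * (‖f z‖ₑ * wt N z) = c * ∫⁻ z, ‖f z‖ₑ * wt N z :=
  MeasureTheory.lintegral_const_mul c (hf.measurable.enorm.mul (measurable_wt N))

instance isAddHaarMeasure_volume_prod : (volume : Measure (ℝ × Bdry n)).IsAddHaarMeasure :=
  inferInstanceAs ((volume : Measure ℝ).prod (volume : Measure (Bdry n))).IsAddHaarMeasure

theorem TemperedFun.integrable_mul {f : ℝ × Bdry n → ℂ} (hf : TemperedFun f)
    (η : 𝓢(SpaceTime n, ℂ)) : Integrable fun z => η (WithLp.toLp 2 z) * f z := by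
  obtain ⟨N, hN⟩ := hf.exists_lt_top
  obtain ⟨C, hC⟩ := exists_schwartz_le_wt η N
  refine ⟨((continuous_schwartz_toLp η).measurable.mul hf.measurable).aestronglyMeasurable, ?_⟩
  rw [hasFiniteIntegral_iff_enorm]
  calc ∫⁻ z, ‖η (WithLp.toLp 2 z) * f z‖ₑ ≤ ∫⁻ z, C * (‖f z‖ₑ * wt N z) := by
        refine lintegral_mono fun z => ?_
        rw [enorm_mul, mul_comm ‖f z‖ₑ, ← mul_assoc]
        gcongr
        exact hC z
    _ = C * ∫⁻ z, ‖f z‖ₑ * wt N z :=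
        hf.lintegral_const_mul _ N
    _ < ⊤ := ENNReal.mul_lt_top ENNReal.coe_lt_top hN

theorem TemperedFun.locallyIntegrable {f : ℝ × Bdry n → ℂ} (hf : TemperedFun f) :
    LocallyIntegrable f := by
  obtain ⟨N, hN⟩ := hf.exists_lt_top
  rw [locallyIntegrable_iff]
  intro k hk
  obtain ⟨R, hR⟩ := hk.isBounded.exists_norm_le
  refine ⟨hf.measurable.aestronglyMeasurable, ?_⟩
  rw [hasFiniteIntegral_iff_enorm]
  calc ∫⁻ z in k, ‖f z‖ₑ
      ≤ ∫⁻ z in k, ENNReal.ofReal ((1 + |R|) ^ N) * (‖f z‖ₑ * wt N z) := by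
        refine setLIntegral_mono' hk.measurableSet fun z hz => ?_
        have h1 : 1 ≤ ENNReal.ofReal ((1 + |R|) ^ N) * wt N z := by
          rw [wt, ← ENNReal.ofReal_mul (by positivity), ← ENNReal.ofReal_one]
          apply ENNReal.ofReal_le_ofReal
          rw [← div_eq_mul_inv, one_le_div (by positivity)]
          gcongr
          exact (hR z hz).trans (le_abs_self R)
        calc ‖f z‖ₑ = ‖f z‖ₑ * 1 := (mul_one _).symm
          _ ≤ ‖f z‖ₑ * (ENNReal.ofReal ((1 + |R|) ^ N) * wt N z) := by gcongr
          _ = _ := by ring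
    _ ≤ ∫⁻ z, ENNReal.ofReal ((1 + |R|) ^ N) * (‖f z‖ₑ * wt N z) := setLIntegral_le_lintegral _ _
    _ = ENNReal.ofReal ((1 + |R|) ^ N) * ∫⁻ z, ‖f z‖ₑ * wt N z :=
        hf.lintegral_const_mul _ N
    _ < ⊤ := ENNReal.mul_lt_top ENNReal.ofReal_lt_top hN

/-- The tempered distribution `η ↦ ∫ η f`. -/
noncomputable def TemperedFun.toDistribution {f : ℝ × Bdry n → ℂ} (hf : TemperedFun f) :
    𝓢'(SpaceTime n, ℂ) :=
  ContinuousLinearMap.toPointwiseConvergenceCLM _ _ _ _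
    (SchwartzMap.mkCLMtoNormedSpace (𝕜 := ℂ) (σ := RingHom.id ℂ)
      (fun η : 𝓢(SpaceTime n, ℂ) => ∫ z, η (WithLp.toLp 2 z) * f z)
      (fun η η' => by
        simp only [_root_.add_apply, add_mul]
        exact integral_add (hf.integrable_mul η) (hf.integrable_mul η'))
      (fun c η => by
        simp only [_root_.smul_apply, smul_mul_assoc, integral_smul, RingHom.id_apply])
      (by
        obtain ⟨N, hN⟩ := hf.exists_lt_top
        refine ⟨Finset.Iic (N, 0), 2 ^ N * (∫⁻ z, ‖f z‖ₑ * wt N z).toReal, by positivity,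
          fun η => ?_⟩
        set A : ℝ := ((Finset.Iic (N, 0)).sup fun m => SchwartzMap.seminorm ℂ m.1 m.2) η
        have hA : 0 ≤ A := apply_nonneg _ _
        refine (norm_integral_le_lintegral_norm _).trans ?_
        have h1 : ∫⁻ z, ENNReal.ofReal ‖η (WithLp.toLp 2 z) * f z‖
            ≤ ENNReal.ofReal (2 ^ N * A) * ∫⁻ z, ‖f z‖ₑ * wt N z := by
          rw [← hf.lintegral_const_mul]
          refine lintegral_mono fun z => ?_
          rw [ofReal_norm, enorm_mul, mul_comm ‖f z‖ₑ, ← mul_assoc]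
          gcongr
          exact schwartz_le_wt η N z
        refine (ENNReal.toReal_mono (ENNReal.mul_ne_top ENNReal.ofReal_ne_top hN.ne) h1).trans ?_
        rw [ENNReal.toReal_mul, ENNReal.toReal_ofReal (by positivity)]
        exact le_of_eq (by
          change _ = 2 ^ N * _ * A
          ring)))

theorem TemperedFun.toDistribution_apply {f : ℝ × Bdry n → ℂ} (hf : TemperedFun f)
    (η : 𝓢(SpaceTime n, ℂ)) : hf.toDistribution η = ∫ z, η (WithLp.toLp 2 z) * f z := rfl

theorem TemperedFun.restrictsTo {f : ℝ × Bdry n → ℂ} (hf : TemperedFun f) (I : Set ℝ) :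
    RestrictsTo I hf.toDistribution f :=
  ⟨hf.locallyIntegrable.locallyIntegrableOn _, fun η _ _ => hf.toDistribution_apply η⟩

theorem RestrictsTo.congr {I : Set ℝ} (hI : MeasurableSet I) {v : 𝓢'(SpaceTime n, ℂ)}
    {f g : ℝ × Bdry n → ℂ}
    (hf : RestrictsTo I v f) (h : f =ᵐ[volume.restrict (I ×ˢ univ)] g) : RestrictsTo I v g := by
  refine ⟨?_, fun η hc hs => ?_⟩
  · exact hf.1.congr h
  · rw [hf.2 η hc hs]
    refine integral_congr_ae ?_
    filter_upwards [(ae_restrict_iff' (hI.prod MeasurableSet.univ)).1 h] with z hz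
    by_cases hzI : z.1 ∈ I
    · rw [hz ⟨hzI, mem_univ _⟩]
    · have : η (WithLp.toLp 2 z) = 0 := by
        apply image_eq_zero_of_notMem_tsupport
        exact fun h => hzI (hs h)
      simp [this]

/-- A distribution restricts to at most one function, up to null sets. -/
theorem RestrictsTo.ae_eq {I : Set ℝ} (hI : IsOpen I) {v : 𝓢'(SpaceTime n, ℂ)}
    {f g : ℝ × Bdry n → ℂ} (hf : RestrictsTo I v f) (hg : RestrictsTo I v g) :
    f =ᵐ[volume.restrict (I ×ˢ univ)] g := by
  have hU : IsOpen (I ×ˢ (univ : Set (Bdry n))) := hI.prod isOpen_univ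
  let e := WithLp.prodContinuousLinearEquiv 2 ℝ ℝ (Bdry n)
  have h := hU.ae_eq_zero_of_integral_contDiff_smul_eq_zero (μ := volume) (hf.1.sub hg.1) (by
    intro b hb hc hs
    have hc' : HasCompactSupport fun z : SpaceTime n => ((b (e z) : ℝ) : ℂ) :=
      (hc.comp_homeomorph e.toHomeomorph).comp_left Complex.ofReal_zero
    have hb' : ContDiff ℝ ∞ fun z : SpaceTime n => ((b (e z) : ℝ) : ℂ) :=
      Complex.ofRealCLM.contDiff.comp (hb.comp e.contDiff)
    have hs' : tsupport (fun z : SpaceTime n => ((b (e z) : ℝ) : ℂ)) ⊆ {z | z.fst ∈ I} := by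
      have h1 : tsupport (fun z : SpaceTime n => ((b (e z) : ℝ) : ℂ)) ⊆ e ⁻¹' tsupport b := by
        refine closure_minimal (fun z hz => subset_tsupport b ?_)
          ((isClosed_tsupport b).preimage e.continuous)
        intro h0
        exact hz (by simp [h0])
      exact fun z hz => (hs (h1 hz)).1
    let η : 𝓢(SpaceTime n, ℂ) := hc'.toSchwartzMap hb'
    have h2 : ∀ {k : ℝ × Bdry n → ℂ}, RestrictsTo I v k → Integrable (fun z => b z • k z) := by
      intro k hk
      have h3 : IntegrableOn (fun z => b z • k z) (tsupport b) :=
        (hk.1.integrableOn_compact_subset hs hc).continuousOn_smul hb.continuous.continuousOn hc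
      refine (integrableOn_iff_integrable_of_support_subset ?_).1 h3
      intro z hz
      exact subset_tsupport b (fun h0 => hz (by simp [h0]))
    have h4 := (hf.2 η hc' hs').symm.trans (hg.2 η hc' hs')
    simp only [Pi.sub_apply, smul_sub]
    rw [integral_sub (h2 hf) (h2 hg), sub_eq_zero]
    simp only [Complex.real_smul]
    exact h4)
  rw [Filter.EventuallyEq, ae_restrict_iff' hU.measurableSet]
  filter_upwards [h] with z hz hzU
  exact sub_eq_zero.1 (hz hzU)

/-- If a distribution restricts to a tempered function, it is given by this function on all
Schwartz functions supported in the corresponding region, compactly or not. -/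
theorem RestrictsTo.apply_eq {I : Set ℝ} {v : 𝓢'(SpaceTime n, ℂ)}
    {f : ℝ × Bdry n → ℂ} (hv : RestrictsTo I v f) (hf : TemperedFun f) (η : 𝓢(SpaceTime n, ℂ))
    (hη : tsupport η ⊆ {z | z.fst ∈ I}) : v η = ∫ z, η (WithLp.toLp 2 z) * f z := by
  let A : 𝓢(SpaceTime n, ℂ) →L[ℂ] ℂ := v
  let B : 𝓢(SpaceTime n, ℂ) →L[ℂ] ℂ := hf.toDistribution
  have h := eq_zero_of_forall_compactSupport (A - B) η (fun ζ hc hs =>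
    sub_eq_zero.2 (hv.2 ζ hc (hs.trans hη)))
  exact sub_eq_zero.1 h

end TemperedFunctions

section Convolution

variable {n : ℕ} {H : Type*} [NormedAddCommGroup H] [InnerProductSpace ℝ H]
  [FiniteDimensional ℝ H] [MeasurableSpace H] [BorelSpace H]

/-- Partial convolution with the kernel `κ`, along the linear map `ι`. -/
noncomputable def cv (ι : H →L[ℝ] ℝ × Bdry n) (κ : 𝓢(H, ℂ)) (f : ℝ × Bdry n → ℂ)
    (z : ℝ × Bdry n) : ℂ :=
  ∫ y, κ y * f (z - ι y)

variable {ι : H →L[ℝ] ℝ × Bdry n} {κ : 𝓢(H, ℂ)} {f : ℝ × Bdry n → ℂ}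

omit [FiniteDimensional ℝ H] in
theorem measurable_cv_integrand (hf : Measurable f) :
    Measurable fun q : (ℝ × Bdry n) × H => κ q.2 * f (q.1 - ι q.2) := by
  have h1 : Measurable fun q : (ℝ × Bdry n) × H => q.1 - ι q.2 :=
    measurable_fst.sub (ι.continuous.measurable.comp measurable_snd)
  exact (κ.continuous.measurable.comp measurable_snd).mul (hf.comp h1)

theorem measurable_cv (hf : Measurable f) : Measurable (cv ι κ f) :=
  ((measurable_cv_integrand hf).stronglyMeasurable.integral_prod_right (ν := volume)).measurable

theorem lintegral_schwartz_pow_lt_top (κ : 𝓢(H, ℂ)) (L : H →L[ℝ] ℝ × Bdry n) (N : ℕ) :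
    ∫⁻ y, ‖κ y‖ₑ * ENNReal.ofReal ((1 + ‖L y‖) ^ N) < ⊤ := by
  have h1 : Integrable fun y => ((1 + ‖L‖) ^ N * 2 ^ (N - 1)) *
      (‖y‖ ^ 0 * ‖κ y‖ + ‖y‖ ^ N * ‖κ y‖) :=
    ((κ.integrable_pow_mul volume 0).add (κ.integrable_pow_mul volume N)).const_mul _
  refine lt_of_le_of_lt (lintegral_mono fun y => ?_) h1.hasFiniteIntegral
  rw [← ofReal_norm, ← ENNReal.ofReal_mul (norm_nonneg _), ← ofReal_norm]
  apply ENNReal.ofReal_le_ofReal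
  rw [Real.norm_of_nonneg (by positivity)]
  beta_reduce
  rw [pow_zero, one_mul]
  have h2 : 1 + ‖L y‖ ≤ (1 + ‖L‖) * (1 + ‖y‖) := by
    nlinarith [L.le_opNorm y, norm_nonneg L, norm_nonneg y]
  have h3 : (1 + ‖y‖) ^ N ≤ 2 ^ (N - 1) * (1 ^ N + ‖y‖ ^ N) :=
    add_pow_le zero_le_one (norm_nonneg y) N
  calc ‖κ y‖ * (1 + ‖L y‖) ^ N ≤ ‖κ y‖ * ((1 + ‖L‖) * (1 + ‖y‖)) ^ N := by gcongr
    _ = ‖κ y‖ * ((1 + ‖L‖) ^ N * (1 + ‖y‖) ^ N) := by rw [mul_pow]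
    _ ≤ ‖κ y‖ * ((1 + ‖L‖) ^ N * (2 ^ (N - 1) * (1 ^ N + ‖y‖ ^ N))) := by gcongr
    _ = _ := by rw [one_pow]; ring

/-- The integral that justifies all applications of Fubini's theorem to partial convolutions. -/
theorem TemperedFun.exists_lintegral_cv_lt_top (hf : TemperedFun f) (ι : H →L[ℝ] ℝ × Bdry n)
    (κ : 𝓢(H, ℂ)) :
    ∃ N : ℕ, ∫⁻ z, ∫⁻ y, ‖κ y * f (z - ι y)‖ₑ * wt N z < ⊤ := by
  obtain ⟨N, hN⟩ := hf.exists_lt_top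
  refine ⟨N, ?_⟩
  rw [lintegral_lintegral_swap (by
    exact ((measurable_cv_integrand hf.measurable).enorm.mul
      ((measurable_wt N).comp measurable_fst)).aemeasurable)]
  calc ∫⁻ y, ∫⁻ z, ‖κ y * f (z - ι y)‖ₑ * wt N z
      = ∫⁻ y, ∫⁻ z, ‖κ y * f z‖ₑ * wt N (z + ι y) := by
        refine lintegral_congr fun y => ?_
        rw [← lintegral_add_right_eq_self _ (ι y)]
        simp
    _ ≤ ∫⁻ y, ∫⁻ z, (‖κ y‖ₑ * ENNReal.ofReal ((1 + ‖ι y‖) ^ N)) * (‖f z‖ₑ * wt N z) := by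
        refine lintegral_mono fun y => lintegral_mono fun z => ?_
        rw [enorm_mul]
        calc ‖κ y‖ₑ * ‖f z‖ₑ * wt N (z + ι y)
            ≤ ‖κ y‖ₑ * ‖f z‖ₑ * (ENNReal.ofReal ((1 + ‖ι y‖) ^ N) * wt N z) := by
              gcongr
              exact wt_add_le N z (ι y)
          _ = _ := by ring
    _ = (∫⁻ y, ‖κ y‖ₑ * ENNReal.ofReal ((1 + ‖ι y‖) ^ N)) * ∫⁻ z, ‖f z‖ₑ * wt N z := by
        simp only [hf.lintegral_const_mul]
        refine lintegral_mul_const _ ?_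
        have := κ.continuous.measurable
        have := ι.continuous.measurable
        fun_prop
    _ < ⊤ := ENNReal.mul_lt_top (lintegral_schwartz_pow_lt_top κ ι N) hN

theorem TemperedFun.cv (hf : TemperedFun f) : TemperedFun (cv ι κ f) := by
  refine ⟨measurable_cv hf.measurable, ?_⟩
  obtain ⟨N, hN⟩ := hf.exists_lintegral_cv_lt_top ι κ
  refine ⟨N, lt_of_le_of_lt (lintegral_mono fun z => ?_) hN⟩
  rw [lintegral_mul_const _ (by
    exact ((measurable_cv_integrand hf.measurable).comp measurable_prodMk_left).enorm)]
  gcongr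
  exact enorm_integral_le_lintegral_enorm _

/-- A Fourier multiplier with symbol `𝓕 κ ∘ L` acts on Schwartz functions by convolution along
the adjoint of `L`. -/
theorem fourier_smulLeft_fourierInv {L : SpaceTime n →L[ℝ] H}
    (hL : ∀ y z, inner ℝ (WithLp.toLp 2 (ι y)) z = inner ℝ y (L z)) (η : 𝓢(SpaceTime n, ℂ))
    (z : ℝ × Bdry n) :
    𝓕 (SchwartzMap.smulLeftCLM ℂ (fun z => 𝓕 κ (L z)) (𝓕⁻ η)) (WithLp.toLp 2 z) =
      ∫ y, κ y * η (WithLp.toLp 2 (z + ι y)) := by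
  have hM : (fun z => 𝓕 κ (L z)).HasTemperateGrowth := hasTemperateGrowth_schwartz_comp (𝓕 κ) L
  have h1 : ∀ w, SchwartzMap.smulLeftCLM ℂ (fun z => 𝓕 κ (L z)) (𝓕⁻ η) w = 𝓕 κ (L w) * 𝓕⁻ η w :=
    fun w => by rw [SchwartzMap.smulLeftCLM_apply_apply hM, smul_eq_mul]
  rw [SchwartzMap.fourier_coe, Real.fourier_eq]
  simp only [h1]
  have h2 : ∀ w : SpaceTime n, Real.fourierChar (-inner ℝ w (WithLp.toLp 2 z)) •
      (𝓕 κ (L w) * 𝓕⁻ η w) =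
      ∫ y, κ y * (Real.fourierChar (-inner ℝ w (WithLp.toLp 2 (z + ι y))) • 𝓕⁻ η w) := by
    intro w
    rw [SchwartzMap.fourier_coe, Real.fourier_eq, ← integral_mul_const, Circle.smul_def,
      ← integral_smul]
    refine integral_congr_ae (ae_of_all _ fun y => ?_)
    have h3 : inner ℝ w (WithLp.toLp 2 (z + ι y)) =
        inner ℝ w (WithLp.toLp 2 z) + inner ℝ y (L w) := by
      rw [← hL, WithLp.toLp_add, inner_add_right, real_inner_comm w (WithLp.toLp 2 (ι y))]
    simp only [h3, neg_add, AddChar.map_add_eq_mul, Circle.smul_def, smul_eq_mul, Circle.coe_mul]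
    ring
  simp only [h2]
  rw [integral_integral_swap]
  · refine integral_congr_ae (ae_of_all _ fun y => ?_)
    change ∫ w, κ y * _ = _
    rw [integral_const_mul, ← Real.fourier_eq, ← SchwartzMap.fourier_coe,
      FourierTransform.fourier_fourierInv_eq]
  · have h4 : Integrable (fun q : SpaceTime n × H => (𝓕⁻ η q.1) * κ q.2) (volume.prod volume) :=
      (𝓕⁻ η).integrable.mul_prod κ.integrable
    refine h4.norm.mono' ?_ (ae_of_all _ fun q => ?_)
    · have h5 := ι.continuous
      have h6 : Continuous fun q : SpaceTime n × H => (WithLp.toLp 2 (z + ι q.2) : SpaceTime n) :=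
        (WithLp.prod_continuous_toLp 2 ℝ (Bdry n)).comp (by fun_prop)
      exact Continuous.aestronglyMeasurable (by fun_prop)
    · simp only [Function.uncurry, norm_mul, Circle.norm_smul]
      exact le_of_eq (mul_comm _ _)

/-- Partial convolution of distributions given by tempered functions on a region. -/
theorem RestrictsTo.multiplier {I : Set ℝ} {L : SpaceTime n →L[ℝ] H}
    (hL : ∀ y z, inner ℝ (WithLp.toLp 2 (ι y)) z = inner ℝ y (L z))
    (hI : I = univ ∨ ∀ y, (ι y).1 = 0)
    {v w : 𝓢'(SpaceTime n, ℂ)} (hv : RestrictsTo I v f) (hf : TemperedFun f)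
    (hw : ∀ η, w η = v (𝓕 (SchwartzMap.smulLeftCLM ℂ (fun z => 𝓕 κ (L z)) (𝓕⁻ η)))) :
    RestrictsTo I w (CheminLerner.cv ι κ f) := by
  refine ⟨hf.cv.locallyIntegrable.locallyIntegrableOn _, fun η hc hs => ?_⟩
  set η' := 𝓕 (SchwartzMap.smulLeftCLM ℂ (fun z => 𝓕 κ (L z)) (𝓕⁻ η)) with hη'
  have hη : ∀ z, η' (WithLp.toLp 2 z) = ∫ y, κ y * η (WithLp.toLp 2 (z + ι y)) :=
    fourier_smulLeft_fourierInv hL η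
  have hs' : tsupport η' ⊆ {z | z.fst ∈ I} := by
    rcases hI with rfl | hI
    · exact fun z _ => mem_univ _
    · have h1 : IsClosed {z : SpaceTime n | z.fst ∈ WithLp.fst '' tsupport η} :=
        (hc.image (WithLp.fstL 2 ℝ ℝ (Bdry n)).continuous).isClosed.preimage
          (WithLp.fstL 2 ℝ ℝ (Bdry n)).continuous
      have h2 : tsupport η' ⊆ {z : SpaceTime n | z.fst ∈ WithLp.fst '' tsupport η} := by
        refine closure_minimal (fun z hz => ?_) h1
        by_contra h3
        refine hz ?_
        rw [show z = WithLp.toLp 2 (z.fst, z.snd) from rfl, hη]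
        refine integral_eq_zero_of_ae (ae_of_all _ fun y => ?_)
        have h4 : η (WithLp.toLp 2 ((z.fst, z.snd) + ι y)) = 0 := by
          apply image_eq_zero_of_notMem_tsupport
          intro h5
          exact h3 ⟨_, h5, by simp [hI]⟩
        beta_reduce
        rw [h4, mul_zero]
        rfl
      intro z hz
      obtain ⟨z', hz', h3⟩ := h2 hz
      change z.fst ∈ I
      rw [← h3]
      exact hs hz'
  rw [hw, hv.apply_eq hf η' hs']
  obtain ⟨N, hN⟩ := hf.exists_lintegral_cv_lt_top ι κ
  obtain ⟨C, hC⟩ := exists_schwartz_le_wt η N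
  have hm : Measurable fun q : (ℝ × Bdry n) × H =>
      η (WithLp.toLp 2 q.1) * (κ q.2 * f (q.1 - ι q.2)) :=
    ((continuous_schwartz_toLp η).measurable.comp measurable_fst).mul
      (measurable_cv_integrand hf.measurable)
  have hfin : ∫⁻ q : (ℝ × Bdry n) × H,
      ‖η (WithLp.toLp 2 q.1) * (κ q.2 * f (q.1 - ι q.2))‖ₑ < ⊤ := by
    rw [Measure.volume_eq_prod, lintegral_prod _ hm.enorm.aemeasurable]
    calc ∫⁻ z, ∫⁻ y, ‖η (WithLp.toLp 2 z) * (κ y * f (z - ι y))‖ₑ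
        ≤ ∫⁻ z, ∫⁻ y, C * (‖κ y * f (z - ι y)‖ₑ * wt N z) := by
          refine lintegral_mono fun z => lintegral_mono fun y => ?_
          rw [enorm_mul, mul_comm ‖κ y * _‖ₑ, ← mul_assoc]
          gcongr
          exact hC z
      _ = C * ∫⁻ z, ∫⁻ y, ‖κ y * f (z - ι y)‖ₑ * wt N z := by
          have h1 := (measurable_cv_integrand (ι := ι) (κ := κ) hf.measurable).enorm.mul
            ((measurable_wt N).comp measurable_fst)
          rw [← lintegral_const_mul' _ _ ENNReal.coe_ne_top]
          refine lintegral_congr fun z => ?_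
          rw [lintegral_const_mul' _ _ ENNReal.coe_ne_top]
      _ < ⊤ := ENNReal.mul_lt_top ENNReal.coe_lt_top hN
  have hint : Integrable (fun q : (ℝ × Bdry n) × H =>
      η (WithLp.toLp 2 q.1) * (κ q.2 * f (q.1 - ι q.2))) := ⟨hm.aestronglyMeasurable, hfin⟩
  have hm' : Measurable fun q : (ℝ × Bdry n) × H =>
      (κ q.2 * η (WithLp.toLp 2 (q.1 + ι q.2))) * f q.1 := by
    have h1 : Measurable fun q : (ℝ × Bdry n) × H => q.1 + ι q.2 :=
      measurable_fst.add (ι.continuous.measurable.comp measurable_snd)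
    exact ((κ.continuous.measurable.comp measurable_snd).mul
      ((continuous_schwartz_toLp η).measurable.comp h1)).mul (hf.measurable.comp measurable_fst)
  have hint' : Integrable (fun q : (ℝ × Bdry n) × H =>
      (κ q.2 * η (WithLp.toLp 2 (q.1 + ι q.2))) * f q.1) := by
    refine ⟨hm'.aestronglyMeasurable, ?_⟩
    rw [hasFiniteIntegral_iff_enorm, Measure.volume_eq_prod, lintegral_prod_symm _
      hm'.enorm.aemeasurable]
    rw [Measure.volume_eq_prod, lintegral_prod_symm _ hm.enorm.aemeasurable] at hfin
    refine lt_of_eq_of_lt (lintegral_congr fun y => ?_) hfin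
    rw [← lintegral_add_right_eq_self (fun z => ‖η (WithLp.toLp 2 z) * (κ y * f (z - ι y))‖ₑ) (ι y)]
    refine lintegral_congr fun z => ?_
    rw [add_sub_cancel_right]
    congr 1
    ring
  calc ∫ z, η' (WithLp.toLp 2 z) * f z
      = ∫ z, ∫ y, (κ y * η (WithLp.toLp 2 (z + ι y))) * f z := by
        refine integral_congr_ae (ae_of_all _ fun z => ?_)
        change _ * _ = _
        rw [hη, ← integral_mul_const]
    _ = ∫ y, ∫ z, (κ y * η (WithLp.toLp 2 (z + ι y))) * f z := integral_integral_swap hint'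
    _ = ∫ y, ∫ z, η (WithLp.toLp 2 z) * (κ y * f (z - ι y)) := by
        refine integral_congr_ae (ae_of_all _ fun y => ?_)
        beta_reduce
        rw [← integral_add_right_eq_self
          (fun z => η (WithLp.toLp 2 z) * (κ y * f (z - ι y))) (ι y)]
        refine integral_congr_ae (ae_of_all _ fun z => ?_)
        simp only [add_sub_cancel_right]
        ring
    _ = ∫ z, ∫ y, η (WithLp.toLp 2 z) * (κ y * f (z - ι y)) := (integral_integral_swap hint).symm
    _ = ∫ z, η (WithLp.toLp 2 z) * CheminLerner.cv ι κ f z := by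
        refine integral_congr_ae (ae_of_all _ fun z => ?_)
        beta_reduce
        rw [integral_const_mul, CheminLerner.cv]

end Convolution

end CheminLerner

/-! ### Littlewood–Paley blocks of functions with finite mixed norm -/

namespace CheminLerner

open FourierTransform

section Weights

variable {V : Type*} [NormedAddCommGroup V] [NormedSpace ℝ V] [FiniteDimensional ℝ V]
  [MeasurableSpace V] [BorelSpace V]

theorem exists_lintegral_mul_wt_le (μ : Measure V) [μ.IsAddHaarMeasure] {q : ℝ≥0∞} (hq : 1 ≤ q) :
    ∃ (M : ℕ) (C : ℝ≥0), ∀ a : V → ℝ≥0∞, Measurable a →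
      ∫⁻ x, a x * wt M x ∂μ ≤ C * eLpNorm a q μ := by
  set M : ℕ := Module.finrank ℝ V + 1 with hM
  have h1 : ∫⁻ x : V, wt M x ∂μ < ⊤ := by
    have h2 := finite_integral_one_add_norm (μ := μ) (E := V) (r := M)
        (by rw [hM]; push_cast; linarith)
    refine lt_of_eq_of_lt (lintegral_congr fun x => ?_) h2
    rw [wt, Real.rpow_neg (by positivity), Real.rpow_natCast]
  set κ := μ.withDensity (wt M) with hκ
  have hfin : IsFiniteMeasure κ := isFiniteMeasure_withDensity h1.ne
  have hle : κ ≤ μ := by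
    calc κ ≤ μ.withDensity 1 := withDensity_mono (ae_of_all _ fun x => wt_le_one M x)
      _ = μ := withDensity_one
  have hc : (κ univ) ^ (1 / (1 : ℝ≥0∞).toReal - 1 / q.toReal) ≠ ⊤ := by
    apply ENNReal.rpow_ne_top_of_nonneg ?_ (measure_ne_top κ univ)
    rw [ENNReal.toReal_one, div_one, sub_nonneg]
    rcases eq_or_ne q ⊤ with rfl | hq'
    · simp
    · have : 1 ≤ q.toReal := by
        rw [← ENNReal.toReal_one]
        exact ENNReal.toReal_mono hq' hq
      exact (div_le_one (by linarith)).2 this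
  refine ⟨M, ((κ univ) ^ (1 / (1 : ℝ≥0∞).toReal - 1 / q.toReal)).toNNReal, fun a ha => ?_⟩
  rw [ENNReal.coe_toNNReal hc]
  calc ∫⁻ x, a x * wt M x ∂μ = eLpNorm a 1 κ := by
        rw [eLpNorm_one_eq_lintegral_enorm, hκ,
          lintegral_withDensity_eq_lintegral_mul _ (measurable_wt M) ha.enorm]
        refine lintegral_congr fun x => ?_
        simp [mul_comm]
    _ ≤ eLpNorm a q κ * (κ univ) ^ (1 / (1 : ℝ≥0∞).toReal - 1 / q.toReal) :=
        eLpNorm_le_eLpNorm_mul_rpow_measure_univ hq ha.aestronglyMeasurable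
    _ ≤ eLpNorm a q μ * (κ univ) ^ (1 / (1 : ℝ≥0∞).toReal - 1 / q.toReal) := by
        gcongr
    _ = _ := mul_comm _ _

end Weights

section Norms

variable {n : ℕ} {ρ p : ℝ≥0∞}

/-- The norm of `L^ρ(ℝ; L^p)`. Functions on `ℝ₊ × ℝⁿ⁻¹` are extended by zero. -/
noncomputable def nrm (ρ p : ℝ≥0∞) (f : ℝ × Bdry n → ℂ) : ℝ≥0∞ :=
  mixN ρ p volume volume fun z => ‖f z‖ₑ

theorem exists_lintegral_wt_le_mixN (n : ℕ) (hρ : 1 ≤ ρ) (hp : 1 ≤ p) :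
    ∃ (N : ℕ) (C : ℝ≥0), ∀ a : ℝ × Bdry n → ℝ≥0∞, Measurable a →
      ∫⁻ z, a z * wt N z ≤ C * mixN ρ p volume volume a := by
  obtain ⟨M, C, hC⟩ := exists_lintegral_mul_wt_le (volume : Measure ℝ) hρ
  obtain ⟨M', C', hC'⟩ := exists_lintegral_mul_wt_le (volume : Measure (Bdry n)) hp
  refine ⟨M + M', C' * C, fun a ha => ?_⟩
  have hw : ∀ z : ℝ × Bdry n, wt (M + M') z ≤ wt M z.1 * wt M' z.2 := by
    intro z
    rw [wt, wt, wt, ← ENNReal.ofReal_mul (by positivity), pow_add, mul_inv]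
    apply ENNReal.ofReal_le_ofReal
    have h1 : ‖z.1‖ ≤ ‖z‖ := norm_fst_le z
    have h2 : ‖z.2‖ ≤ ‖z‖ := norm_snd_le z
    gcongr
  calc ∫⁻ z, a z * wt (M + M') z
      ≤ ∫⁻ z : ℝ × Bdry n, a z * (wt M z.1 * wt M' z.2) := by
        refine lintegral_mono fun z => ?_
        gcongr
        exact hw z
    _ = ∫⁻ t, ∫⁻ x : Bdry n, a (t, x) * (wt M t * wt M' x) := by
        rw [Measure.volume_eq_prod]
        refine lintegral_prod _ ?_
        exact (ha.mul (((measurable_wt M).comp measurable_fst).mul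
          ((measurable_wt M').comp measurable_snd))).aemeasurable
    _ = ∫⁻ t, (∫⁻ x : Bdry n, a (t, x) * wt M' x) * wt M t := by
        refine lintegral_congr fun t => ?_
        rw [← lintegral_mul_const' _ _ (ne_top_of_le_ne_top ENNReal.one_ne_top (wt_le_one M t))]
        refine lintegral_congr fun x => ?_
        ring
    _ ≤ ∫⁻ t, (C' * eLpNorm (fun x => a (t, x)) p volume) * wt M t := by
        refine lintegral_mono fun t => ?_
        gcongr
        exact hC' _ (ha.comp measurable_prodMk_left)
    _ = C' * ∫⁻ t, eLpNorm (fun x => a (t, x)) p volume * wt M t := by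
        simp only [mul_assoc]
        rw [lintegral_const_mul' _ _ ENNReal.coe_ne_top]
    _ ≤ C' * (C * mixN ρ p volume volume a) := by
        gcongr
        exact hC (fun t => eLpNorm (fun x => a (t, x)) p volume) (measurable_eLpNorm_section p ha)
    _ = _ := by rw [ENNReal.coe_mul, mul_assoc]

theorem ae_lt_top_of_mixN (hρ : 1 ≤ ρ) (hp : 1 ≤ p) {a : ℝ × Bdry n → ℝ≥0∞} (ha : Measurable a)
    (h : mixN ρ p volume volume a < ⊤) : ∀ᵐ z, a z < ⊤ := by
  obtain ⟨N, C, hC⟩ := exists_lintegral_wt_le_mixN n hρ hp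
  filter_upwards [ae_lt_top (ha.mul (measurable_wt N))
    ((hC a ha).trans_lt (ENNReal.mul_lt_top ENNReal.coe_lt_top h)).ne] with z hz
  by_contra h3
  rw [not_lt, top_le_iff] at h3
  rw [Pi.mul_apply, h3, ENNReal.top_mul] at hz
  · exact lt_irrefl _ hz
  · rw [wt, Ne, ENNReal.ofReal_eq_zero, not_le]
    positivity

theorem exists_lintegral_wt_le_nrm (n : ℕ) (hρ : 1 ≤ ρ) (hp : 1 ≤ p) :
    ∃ (N : ℕ) (C : ℝ≥0), ∀ f : ℝ × Bdry n → ℂ, Measurable f →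
      ∫⁻ z, ‖f z‖ₑ * wt N z ≤ C * nrm ρ p f := by
  obtain ⟨N, C, hC⟩ := exists_lintegral_wt_le_mixN n hρ hp
  exact ⟨N, C, fun f hf => hC (fun z => ‖f z‖ₑ) hf.enorm⟩

theorem tempered_of_nrm (hρ : 1 ≤ ρ) (hp : 1 ≤ p) {f : ℝ × Bdry n → ℂ} (hf : Measurable f)
    (h : nrm ρ p f < ⊤) : TemperedFun f := by
  obtain ⟨N, C, hC⟩ := exists_lintegral_wt_le_nrm n hρ hp
  exact ⟨hf, N, (hC f hf).trans_lt (ENNReal.mul_lt_top ENNReal.coe_lt_top h)⟩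

theorem exists_lintegral_mul_le_nrm (hρ : 1 ≤ ρ) (hp : 1 ≤ p) (η : 𝓢(SpaceTime n, ℂ)) :
    ∃ C : ℝ≥0, ∀ f : ℝ × Bdry n → ℂ, Measurable f →
      ∫⁻ z, ‖η (WithLp.toLp 2 z) * f z‖ₑ ≤ C * nrm ρ p f := by
  obtain ⟨N, C, hC⟩ := exists_lintegral_wt_le_nrm n hρ hp
  obtain ⟨C', hC'⟩ := exists_schwartz_le_wt η N
  refine ⟨C' * C, fun f hf => ?_⟩
  calc ∫⁻ z, ‖η (WithLp.toLp 2 z) * f z‖ₑ ≤ ∫⁻ z, C' * (‖f z‖ₑ * wt N z) := by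
        refine lintegral_mono fun z => ?_
        rw [enorm_mul, mul_comm ‖f z‖ₑ, ← mul_assoc]
        gcongr
        exact hC' z
    _ = C' * ∫⁻ z, ‖f z‖ₑ * wt N z := lintegral_const_mul' _ _ ENNReal.coe_ne_top
    _ ≤ C' * (C * nrm ρ p f) := by
        gcongr
        exact hC f hf
    _ = _ := by rw [ENNReal.coe_mul, mul_assoc]

theorem nrm_congr {f g : ℝ × Bdry n → ℂ} (h : f =ᵐ[volume] g) : nrm ρ p f = nrm ρ p g := by
  refine mixN_congr_ae ?_
  rw [← Measure.volume_eq_prod]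
  filter_upwards [h] with z hz
  rw [hz]

theorem nrm_indicator (I : Set ℝ) (hI : MeasurableSet I) (f : ℝ × Bdry n → ℂ) :
    nrm ρ p ((I ×ˢ univ).indicator f) =
      eLpNorm (fun t => eLpNorm (fun x => f (t, x)) p volume) ρ (volume.restrict I) := by
  rw [← eLpNorm_indicator_eq_eLpNorm_restrict hI, nrm, mixN]
  congr 1
  funext t
  by_cases ht : t ∈ I
  · have h1 : (fun x : Bdry n => ‖(I ×ˢ univ).indicator f (t, x)‖ₑ) = fun x => ‖f (t, x)‖ₑ := by
      funext x
      rw [indicator_of_mem (show (t, x) ∈ I ×ˢ univ from ⟨ht, mem_univ _⟩)]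
    rw [indicator_of_mem ht, h1]
    exact eLpNorm_enorm _
  · rw [indicator_of_notMem ht]
    have : (fun x : Bdry n => ‖(I ×ˢ univ).indicator f (t, x)‖ₑ) = fun _ => 0 := by
      funext x
      rw [indicator_of_notMem (fun h => ht h.1), enorm_zero]
    rw [this]
    exact eLpNorm_zero'

theorem mixedNorm_le {I : Set ℝ} (hI : MeasurableSet I) {u : 𝓢'(SpaceTime n, ℂ)}
    {g : ℝ × Bdry n → ℂ} (h : RestrictsTo I u g) : mixedNorm I ρ p u ≤ nrm ρ p g := by
  refine (iInf₂_le g h).trans ?_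
  rw [← nrm_indicator I hI]
  refine mixN_mono fun z => ?_
  exact enorm_indicator_le_enorm_self _ _

theorem nrm_le_mixedNorm {I : Set ℝ} (hI : IsOpen I) {u : 𝓢'(SpaceTime n, ℂ)}
    {g : ℝ × Bdry n → ℂ} (hg : RestrictsTo I u g) (h0 : ∀ z, z.1 ∉ I → g z = 0) :
    nrm ρ p g ≤ mixedNorm I ρ p u := by
  have hU : MeasurableSet (I ×ˢ (univ : Set (Bdry n))) := hI.measurableSet.prod MeasurableSet.univ
  refine le_iInf₂ fun g' hg' => ?_
  rw [← nrm_indicator I hI.measurableSet]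
  have h3 := hg.ae_eq hI hg'
  refine le_of_eq (nrm_congr ?_)
  rw [Filter.EventuallyEq, ae_restrict_iff' hU] at h3
  filter_upwards [h3] with z hz
  by_cases hzI : z ∈ I ×ˢ (univ : Set (Bdry n))
  · rw [hz hzI, indicator_of_mem hzI]
  · rw [indicator_of_notMem hzI]
    exact h0 z fun h => hzI ⟨h, mem_univ _⟩

/-- A distribution with finite mixed norm is given by a measurable function vanishing outside the
region considered. -/
theorem exists_restrictsTo_of_mixedNorm_lt_top (hρ : 1 ≤ ρ) (hp : 1 ≤ p) {I : Set ℝ}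
    (hI : IsOpen I) {u : 𝓢'(SpaceTime n, ℂ)} (h : mixedNorm I ρ p u < ⊤) :
    ∃ g : ℝ × Bdry n → ℂ, TemperedFun g ∧ RestrictsTo I u g ∧ (∀ z, z.1 ∉ I → g z = 0) ∧
      nrm ρ p g ≤ mixedNorm I ρ p u := by
  have hU : MeasurableSet (I ×ˢ (univ : Set (Bdry n))) := hI.measurableSet.prod MeasurableSet.univ
  have h1 : ∃ g₀, RestrictsTo I u g₀ := by
    by_contra h2
    push Not at h2
    exact h.ne (iInf₂_eq_top.2 fun g hg => absurd hg (h2 g))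
  obtain ⟨g₀, hg₀⟩ := h1
  have hm := hg₀.1.aestronglyMeasurable
  let g := (I ×ˢ (univ : Set (Bdry n))).indicator (hm.mk g₀)
  have hgm : Measurable g := hm.stronglyMeasurable_mk.measurable.indicator hU
  have hae : g₀ =ᵐ[volume.restrict (I ×ˢ univ)] g :=
    hm.ae_eq_mk.trans (indicator_ae_eq_restrict hU).symm
  have hg : RestrictsTo I u g := hg₀.congr hI.measurableSet hae
  have h0 : ∀ z, z.1 ∉ I → g z = 0 := fun z hz => indicator_of_notMem (fun h => hz h.1) _
  have hle : nrm ρ p g ≤ mixedNorm I ρ p u := nrm_le_mixedNorm hI hg h0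
  exact ⟨g, tempered_of_nrm hρ hp hgm (hle.trans_lt h), hg, h0, hle⟩

end Norms

section Blocks

variable {n : ℕ} {ρ p : ℝ≥0∞}

/-- Partial convolution in the space variable. -/
noncomputable abbrev cvx (κ : 𝓢(Bdry n, ℂ)) (f : ℝ × Bdry n → ℂ) : ℝ × Bdry n → ℂ :=
  cv (ContinuousLinearMap.inr ℝ ℝ (Bdry n)) κ f

/-- Partial convolution in the time variable. -/
noncomputable abbrev cvt (κ : 𝓢(ℝ, ℂ)) (f : ℝ × Bdry n → ℂ) : ℝ × Bdry n → ℂ :=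
  cv (ContinuousLinearMap.inl ℝ ℝ (Bdry n)) κ f

theorem inner_inr (y : Bdry n) (z : SpaceTime n) :
    inner ℝ (WithLp.toLp 2 (ContinuousLinearMap.inr ℝ ℝ (Bdry n) y)) z = inner ℝ y (sndST n z) := by
  rw [WithLp.prod_inner_apply]
  simp

theorem inner_inl (y : ℝ) (z : SpaceTime n) :
    inner ℝ (WithLp.toLp 2 (ContinuousLinearMap.inl ℝ ℝ (Bdry n) y)) z = inner ℝ y (fstST n z) := by
  rw [WithLp.prod_inner_apply]
  simp

theorem RestrictsTo.multiplier_space {I : Set ℝ} {m : 𝓢(Bdry n, ℂ)} {j : ℤ}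
    {v w : 𝓢'(SpaceTime n, ℂ)} {f : ℝ × Bdry n → ℂ} (hv : RestrictsTo I v f) (hf : TemperedFun f)
    (hw : ∀ η, w η = v (𝓕 (SchwartzMap.smulLeftCLM ℂ (fun z => dilate m j (sndST n z)) (𝓕⁻ η)))) :
    RestrictsTo I w (cvx (kern m j) f) := by
  refine hv.multiplier inner_inr (Or.inr fun y => rfl) hf ?_
  rwa [fourier_kern]

theorem RestrictsTo.multiplier_time {m : 𝓢(ℝ, ℂ)} {k : ℤ}
    {v w : 𝓢'(SpaceTime n, ℂ)} {f : ℝ × Bdry n → ℂ} (hv : RestrictsTo univ v f) (hf : TemperedFun f)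
    (hw : ∀ η, w η = v (𝓕 (SchwartzMap.smulLeftCLM ℂ (fun z => dilate m k (fstST n z)) (𝓕⁻ η)))) :
    RestrictsTo univ w (cvt (kern m k) f) := by
  refine hv.multiplier inner_inl (Or.inl rfl) hf ?_
  rwa [fourier_kern]

theorem RestrictsTo.spaceBlock {I : Set ℝ} (Φ : LittlewoodPaley (Bdry n)) (j : ℤ)
    {v : 𝓢'(SpaceTime n, ℂ)} {f : ℝ × Bdry n → ℂ} (hv : RestrictsTo I v f) (hf : TemperedFun f) :
    RestrictsTo I (spaceBlock Φ j v) (cvx (kern (blockSymbol Φ) j) f) :=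
  hv.multiplier_space hf (spaceBlock_apply Φ j v)

theorem RestrictsTo.timeBlock (Ψ : LittlewoodPaley ℝ) (k : ℤ)
    {v : 𝓢'(SpaceTime n, ℂ)} {f : ℝ × Bdry n → ℂ} (hv : RestrictsTo univ v f) (hf : TemperedFun f) :
    RestrictsTo univ (timeBlock Ψ k v) (cvt (kern (blockSymbol Ψ) k) f) :=
  hv.multiplier_time hf (timeBlock_apply Ψ k v)

theorem spaceBlock_fat (Φ : LittlewoodPaley (Bdry n)) (j : ℤ) (u : 𝓢'(SpaceTime n, ℂ))
    (η : 𝓢(SpaceTime n, ℂ)) : spaceBlock Φ j u η = spaceBlock Φ j u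
      (𝓕 (SchwartzMap.smulLeftCLM ℂ (fun z => dilate (fatSymbol Φ) j (sndST n z)) (𝓕⁻ η))) := by
  rw [spaceBlock_apply, spaceBlock_apply, FourierTransform.fourierInv_fourier_eq,
    SchwartzMap.smulLeftCLM_smulLeftCLM_apply (hasTemperateGrowth_dilate_comp _ _ _)
      (hasTemperateGrowth_dilate_comp _ _ _)]
  congr 4
  funext z
  exact (dilate_block_mul_fat Φ j _).symm

theorem timeBlock_fat (Ψ : LittlewoodPaley ℝ) (k : ℤ) (u : 𝓢'(SpaceTime n, ℂ))
    (η : 𝓢(SpaceTime n, ℂ)) : timeBlock Ψ k u η = timeBlock Ψ k u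
      (𝓕 (SchwartzMap.smulLeftCLM ℂ (fun z => dilate (fatSymbol Ψ) k (fstST n z)) (𝓕⁻ η))) := by
  rw [timeBlock_apply, timeBlock_apply, FourierTransform.fourierInv_fourier_eq,
    SchwartzMap.smulLeftCLM_smulLeftCLM_apply (hasTemperateGrowth_dilate_comp _ _ _)
      (hasTemperateGrowth_dilate_comp _ _ _)]
  congr 4
  funext z
  exact (dilate_block_mul_fat Ψ k _).symm

/-- A function with the Fourier support of a dyadic block in space is reproduced by the fattened
kernel. -/
theorem RestrictsTo.eq_cvx_fat {I : Set ℝ} (hI : IsOpen I) {Φ : LittlewoodPaley (Bdry n)} {j : ℤ}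
    {u : 𝓢'(SpaceTime n, ℂ)} {f : ℝ × Bdry n → ℂ} (hf : TemperedFun f)
    (h : RestrictsTo I (CheminLerner.spaceBlock Φ j u) f) :
    f =ᵐ[volume.restrict (I ×ˢ univ)] cvx (kern (fatSymbol Φ) j) f :=
  h.ae_eq hI (h.multiplier_space hf (spaceBlock_fat Φ j u))

theorem RestrictsTo.eq_cvt_fat {Ψ : LittlewoodPaley ℝ} {k : ℤ}
    {u : 𝓢'(SpaceTime n, ℂ)} {f : ℝ × Bdry n → ℂ} (hf : TemperedFun f)
    (h : RestrictsTo univ (CheminLerner.timeBlock Ψ k u) f) :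
    f =ᵐ[volume] cvt (kern (fatSymbol Ψ) k) f := by
  have := h.ae_eq isOpen_univ (h.multiplier_time hf (timeBlock_fat Ψ k u))
  rwa [univ_prod_univ, Measure.restrict_univ] at this

/-- Young's inequality for partial convolutions. -/
theorem nrm_cv_le (hρ : 1 ≤ ρ) (hp : 1 ≤ p) {H : Type*} [NormedAddCommGroup H]
    [InnerProductSpace ℝ H] [FiniteDimensional ℝ H] [MeasurableSpace H] [BorelSpace H]
    (ι : H →L[ℝ] ℝ × Bdry n) (κ : 𝓢(H, ℂ)) {f : ℝ × Bdry n → ℂ} (hf : Measurable f) :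
    nrm ρ p (cv ι κ f) ≤ eLpNorm κ 1 volume * nrm ρ p f := by
  have h1 : ∀ y, mixN ρ p volume volume (fun z : ℝ × Bdry n => ‖κ y * f (z - ι y)‖ₑ)
      ≤ ‖κ y‖ₑ * nrm ρ p f := by
    intro y
    have h2 := mixN_comp_map (ρ := ρ) (p := p)
      (measurePreserving_sub_right (volume : Measure ℝ) (ι y).1)
      (measurePreserving_sub_right (volume : Measure (Bdry n)) (ι y).2) hf.enorm
    rw [nrm, ← h2]
    simp only [enorm_mul]
    exact mixN_const_mul_le ‖κ y‖₊ _
  calc nrm ρ p (cv ι κ f)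
      ≤ mixN ρ p volume volume (fun z : ℝ × Bdry n => ∫⁻ y, ‖κ y * f (z - ι y)‖ₑ) :=
        mixN_mono fun z => enorm_integral_le_lintegral_enorm _
    _ ≤ ∫⁻ y, ‖κ y‖ₑ * nrm ρ p f := by
        have h3 : Measurable fun q : (ℝ × Bdry n) × H => ‖κ q.2 * f (q.1 - ι q.2)‖ₑ :=
          (measurable_cv_integrand hf).enorm
        have h4 : Measurable fun y => ‖κ y‖ₑ * nrm ρ p f :=
          κ.continuous.measurable.enorm.mul_const _
        exact mixN_lintegral_le (a := fun y z => ‖κ y * f (z - ι y)‖ₑ) hρ hp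
          (h3.comp (g := fun q : (ℝ × Bdry n) × H => ‖κ q.2 * f (q.1 - ι q.2)‖ₑ)
            (f := Prod.swap) measurable_swap) h4 h1
    _ = eLpNorm κ 1 volume * nrm ρ p f := by
        rw [lintegral_mul_const _ κ.continuous.measurable.enorm, eLpNorm_one_eq_lintegral_enorm]

end Blocks

end CheminLerner

/-! ### Differences in time of functions with a decomposition in time -/

namespace CheminLerner

open FourierTransform

section Sequences

/-- A sequence annihilated by a power of the difference operator and whose partial sums are
`o(N)` vanishes. -/
theorem eq_zero_of_fwdDiff_iterate_eq_zero (m : ℕ) {c : ℕ → ℂ}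
    (hc : ∀ k, (fwdDiff (1 : ℕ))^[m] c k = 0)
    (h : Tendsto (fun N : ℕ => (N : ℂ)⁻¹ * ∑ k ∈ Finset.range N, c k) atTop (𝓝 0)) (k : ℕ) :
    c k = 0 := by
  -- the Cesàro means of all the differences tend to zero as well
  have h1 : ∀ m : ℕ, Tendsto (fun N : ℕ => (N : ℂ)⁻¹ *
      ∑ k ∈ Finset.range N, (fwdDiff (1 : ℕ))^[m] c k) atTop (𝓝 0) := by
    intro m
    have hN : Tendsto (fun N : ℕ => (N : ℂ)⁻¹) atTop (𝓝 0) := tendsto_inv_atTop_nhds_zero_nat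
    induction m with
    | zero => simpa using h
    | succ m ih =>
      have h2 : ∀ N : ℕ, (N : ℂ)⁻¹ * ∑ k ∈ Finset.range N, (fwdDiff (1 : ℕ))^[m + 1] c k
          = (N : ℂ)⁻¹ * (fwdDiff (1 : ℕ))^[m] c N - (N : ℂ)⁻¹ * (fwdDiff (1 : ℕ))^[m] c 0 := by
        intro N
        rw [← mul_sub]
        congr 1
        rw [← Finset.sum_range_sub]
        refine Finset.sum_congr rfl fun k _ => ?_
        rw [Function.iterate_succ_apply', fwdDiff]
      simp only [h2]
      -- a convergent Cesàro mean forces its general term to be `o(N)`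
      have h3 : Tendsto (fun N : ℕ => (N : ℂ)⁻¹ * (fwdDiff (1 : ℕ))^[m] c N) atTop (𝓝 0) := by
        have h4 := ((tendsto_add_atTop_iff_nat 1).2 ih)
        have h5 : Tendsto (fun N : ℕ => (1 + (N : ℂ)⁻¹)) atTop (𝓝 1) := by
          simpa using hN.const_add 1
        have h6 := (h4.mul h5).sub ih
        rw [zero_mul, sub_zero] at h6
        refine h6.congr' ?_
        filter_upwards [eventually_gt_atTop 0] with N hN0
        have hN1 : (N : ℂ) ≠ 0 := by exact_mod_cast hN0.ne'
        have hN2 : (N : ℂ) + 1 ≠ 0 := by exact_mod_cast N.succ_ne_zero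
        rw [Finset.sum_range_succ]
        push_cast
        field_simp
        ring
      simpa using h3.sub (hN.mul_const ((fwdDiff (1 : ℕ))^[m] c 0))
  induction m generalizing k with
  | zero => exact hc k
  | succ m ih =>
    refine ih (fun k => ?_) k
    have hconst : ∀ k, (fwdDiff (1 : ℕ))^[m] c k = (fwdDiff (1 : ℕ))^[m] c 0 := by
      intro k
      induction k with
      | zero => rfl
      | succ k ihk =>
        have := hc k
        rw [Function.iterate_succ_apply', fwdDiff, sub_eq_zero] at this
        rw [this, ihk]
    have h2 := h1 m
    simp only [hconst, Finset.sum_const, Finset.card_range, nsmul_eq_mul] at h2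
    have h3 : Tendsto (fun N : ℕ => (N : ℂ)⁻¹ * ((N : ℂ) * (fwdDiff (1 : ℕ))^[m] c 0)) atTop
        (𝓝 ((fwdDiff (1 : ℕ))^[m] c 0)) := by
      refine tendsto_const_nhds.congr' ?_
      filter_upwards [eventually_gt_atTop 0] with N hN0
      have hN1 : (N : ℂ) ≠ 0 := by exact_mod_cast hN0.ne'
      rw [← mul_assoc, inv_mul_cancel₀ hN1, one_mul]
    rw [hconst k]
    exact tendsto_nhds_unique h3 h2

theorem tsum_int_pow_natAbs_lt_top {q : ℝ≥0∞} (hq : q < 1) : ∑' m : ℤ, q ^ m.natAbs < ⊤ := by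
  have h1 : ∑' n : ℕ, q ^ n < ⊤ := by
    rw [ENNReal.tsum_geometric, ENNReal.inv_lt_top]
    exact tsub_pos_of_lt hq
  rw [tsum_of_nat_of_neg_add_one (f := fun m : ℤ => q ^ m.natAbs) ENNReal.summable
    ENNReal.summable]
  refine ENNReal.add_lt_top.2 ⟨by simpa using h1, lt_of_le_of_lt ?_ h1⟩
  refine ENNReal.tsum_le_tsum fun n => ?_
  have h2 : (-((n : ℤ) + 1)).natAbs = n + 1 := by omega
  rw [h2, pow_succ]
  exact mul_le_of_le_one_right' hq.le

theorem two_rpow_lt_top (x : ℝ) : (2 : ℝ≥0∞) ^ x < ⊤ :=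
  (ENNReal.rpow_ne_top_of_ne_zero two_ne_zero ENNReal.ofNat_ne_top).lt_top

/-- `∑_m min(A 2^{am}, B 2^{-bm})` is finite for positive `a`, `b`. -/
theorem tsum_int_min_lt_top {a b : ℝ} (ha : 0 < a) (hb : 0 < b) {A B : ℝ≥0∞} (hA : A < ⊤)
    (hB : B < ⊤) :
    ∑' m : ℤ, min (A * 2 ^ (a * (m : ℝ))) (B * 2 ^ (-(b * (m : ℝ)))) < ⊤ := by
  set c := min a b
  have hc : 0 < c := lt_min ha hb
  have hq : (2 : ℝ≥0∞) ^ (-c) < 1 :=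
    ENNReal.rpow_lt_one_of_one_lt_of_neg (by norm_num) (by linarith)
  have h1 : ∀ m : ℤ, min (A * (2 : ℝ≥0∞) ^ (a * (m : ℝ))) (B * 2 ^ (-(b * (m : ℝ))))
      ≤ (A + B) * ((2 : ℝ≥0∞) ^ (-c)) ^ m.natAbs := by
    intro m
    have h2 : ((2 : ℝ≥0∞) ^ (-c)) ^ m.natAbs = 2 ^ (-(c * |(m : ℝ)|)) := by
      rw [← ENNReal.rpow_natCast, ← ENNReal.rpow_mul]
      congr 1
      rw [Nat.cast_natAbs, Int.cast_abs]
      ring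
    rw [h2]
    rcases le_total 0 (m : ℝ) with hm | hm
    · refine (min_le_right _ _).trans ?_
      rw [abs_of_nonneg hm]
      gcongr
      · exact le_add_self
      · norm_num
      · exact min_le_right a b
    · refine (min_le_left _ _).trans ?_
      rw [abs_of_nonpos hm]
      gcongr
      · exact le_self_add
      · norm_num
      · nlinarith [min_le_left a b]
  refine lt_of_le_of_lt (ENNReal.tsum_le_tsum h1) ?_
  rw [ENNReal.tsum_mul_left]
  exact ENNReal.mul_lt_top (ENNReal.add_lt_top.2 ⟨hA, hB⟩) (tsum_int_pow_natAbs_lt_top hq)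

end Sequences

section Sums

variable {α : Type*} [MeasurableSpace α]

/-- A measurable function that is the sum of a series of measurable functions wherever it
converges absolutely. -/
theorem exists_measurable_hasSum {ι : Type*} [Countable ι] {f : ι → α → ℂ}
    (hf : ∀ i, Measurable (f i)) :
    ∃ D : α → ℂ, Measurable D ∧ (∀ z, ‖D z‖ₑ ≤ ∑' i, ‖f i z‖ₑ) ∧
      ∀ z, ∑' i, ‖f i z‖ₑ < ⊤ → HasSum (fun i => f i z) (D z) := by
  classical
  set G : Set α := {z | ∑' i, ‖f i z‖ₑ < ⊤}
  have hG : MeasurableSet G :=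
    measurableSet_lt (Measurable.tsum fun i => (hf i).enorm) measurable_const
  have hs : ∀ z, Summable fun i => G.indicator (f i) z := by
    intro z
    by_cases hz : z ∈ G
    · simp only [indicator_of_mem hz]
      refine Summable.of_norm ?_
      have h1 : Summable fun i => (‖f i z‖ₑ).toReal := ENNReal.summable_toReal (ne_of_lt hz)
      simpa using h1
    · simp only [indicator_of_notMem hz]
      exact summable_zero
  refine ⟨fun z => ∑' i, G.indicator (f i) z, ?_, fun z => ?_, fun z hz => ?_⟩
  · have h1 : Tendsto (fun (s : Finset ι) z => ∑ i ∈ s, G.indicator (f i) z) atTop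
        (𝓝 fun z => ∑' i, G.indicator (f i) z) :=
      tendsto_pi_nhds.2 fun z => (hs z).hasSum
    exact measurable_of_tendsto_metrizable' atTop
      (fun s => Finset.measurable_fun_sum s fun i _ => (hf i).indicator hG) h1
  · by_cases hz : z ∈ G
    · simp only [indicator_of_mem hz]
      exact enorm_tsum_le_tsum_enorm
    · simp only [indicator_of_notMem hz]
      simp
  · have h2 := (hs z).hasSum
    simpa only [indicator_of_mem (show z ∈ G from hz)] using h2

end Sums

section KernelDifferences

/-- The `L¹` modulus of continuity of a Schwartz function. -/
theorem exists_lintegral_translate_sub_le (K : 𝓢(ℝ, ℂ)) :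
    ∃ C : ℝ≥0, ∀ a : ℝ, ∫⁻ y, ‖K (y + a) - K y‖ₑ ≤ min 2 ‖a‖ₑ * C := by
  set A := ∫⁻ y, ‖K y‖ₑ
  set B := ∫⁻ y, ‖deriv K y‖ₑ
  have hA : A < ⊤ := K.integrable.hasFiniteIntegral
  have hB : B < ⊤ := (SchwartzMap.derivCLM ℝ ℂ K).integrable.hasFiniteIntegral
  have hKm := K.continuous.measurable
  have hdc : Continuous (deriv K) := (SchwartzMap.derivCLM ℝ ℂ K).continuous
  have h1 : ∀ a : ℝ, ∫⁻ y, ‖K (y + a) - K y‖ₑ ≤ 2 * A := by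
    intro a
    calc ∫⁻ y, ‖K (y + a) - K y‖ₑ ≤ ∫⁻ y, (‖K (y + a)‖ₑ + ‖K y‖ₑ) :=
          lintegral_mono fun y => enorm_sub_le
      _ = (∫⁻ y, ‖K (y + a)‖ₑ) + A := lintegral_add_right _ hKm.enorm
      _ = 2 * A := by
          rw [lintegral_add_right_eq_self (fun y => ‖K y‖ₑ) a, two_mul]
  have h2 : ∀ a : ℝ, ∫⁻ y, ‖K (y + a) - K y‖ₑ ≤ ‖a‖ₑ * B := by
    intro a
    have h3 : ∀ y, ‖K (y + a) - K y‖ₑ ≤ ∫⁻ s in Icc (0 : ℝ) 1, ‖a‖ₑ * ‖deriv K (y + s * a)‖ₑ := by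
      intro y
      have h4 : ∀ s : ℝ, HasDerivAt (fun s : ℝ => K (y + s * a)) (a • deriv K (y + s * a)) s := by
        intro s
        have h5 : HasDerivAt (fun s : ℝ => y + s * a) a s := by
          simpa using (hasDerivAt_mul_const a).const_add y
        exact (K.differentiableAt.hasDerivAt).scomp s h5
      have h6 := intervalIntegral.integral_eq_sub_of_hasDerivAt (a := 0) (b := 1)
        (fun s _ => h4 s) (Continuous.intervalIntegrable (by fun_prop) _ _)
      rw [one_mul, zero_mul, add_zero, intervalIntegral.integral_of_le zero_le_one] at h6
      rw [← h6]
      refine (enorm_integral_le_lintegral_enorm _).trans ?_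
      simp only [enorm_smul]
      exact lintegral_mono_set Ioc_subset_Icc_self
    calc ∫⁻ y, ‖K (y + a) - K y‖ₑ
        ≤ ∫⁻ y, ∫⁻ s in Icc (0 : ℝ) 1, ‖a‖ₑ * ‖deriv K (y + s * a)‖ₑ := lintegral_mono h3
      _ = ∫⁻ s in Icc (0 : ℝ) 1, ∫⁻ y, ‖a‖ₑ * ‖deriv K (y + s * a)‖ₑ := by
          refine lintegral_lintegral_swap ?_
          refine Measurable.aemeasurable ?_
          refine Measurable.const_mul ?_ _
          have : Continuous fun q : ℝ × ℝ => deriv K (q.1 + q.2 * a) := by fun_prop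
          exact this.measurable.enorm
      _ = ∫⁻ s in Icc (0 : ℝ) 1, ‖a‖ₑ * B := by
          refine lintegral_congr fun s => ?_
          rw [lintegral_const_mul _ (by
            have : Continuous fun y : ℝ => deriv K (y + s * a) := by fun_prop
            exact this.measurable.enorm),
            lintegral_add_right_eq_self (fun y => ‖deriv K y‖ₑ)]
      _ = ‖a‖ₑ * B := by simp
  refine ⟨A.toNNReal + B.toNNReal, fun a => ?_⟩
  rw [ENNReal.coe_add, ENNReal.coe_toNNReal hA.ne, ENNReal.coe_toNNReal hB.ne]
  rcases le_total 2 ‖a‖ₑ with h | h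
  · rw [min_eq_left h]
    refine (h1 a).trans ?_
    gcongr
    exact le_self_add
  · rw [min_eq_right h]
    refine (h2 a).trans ?_
    gcongr
    exact le_add_self

theorem ofReal_two_zpow (l : ℤ) : ENNReal.ofReal ((2 : ℝ) ^ l) = (2 : ℝ≥0∞) ^ (l : ℝ) := by
  rw [← Real.rpow_intCast, ← ENNReal.ofReal_rpow_of_pos two_pos, ENNReal.ofReal_ofNat]

theorem lintegral_comp_pos_mul {c : ℝ} (hc : 0 < c) {f : ℝ → ℝ≥0∞} (hf : Measurable f) :
    ENNReal.ofReal c * ∫⁻ y, f (c * y) = ∫⁻ y, f y := by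
  rw [← lintegral_map hf (measurable_const_mul c)]
  conv_rhs => rw [← Real.smul_map_volume_mul_left hc.ne']
  rw [abs_of_pos hc, lintegral_smul_measure, smul_eq_mul]

/-- The modulus of continuity of the dilated kernels. -/
theorem exists_lintegral_kern_sub_le (m : 𝓢(ℝ, ℂ)) :
    ∃ C : ℝ≥0, ∀ (l : ℤ) (a : ℝ),
      ∫⁻ y, ‖kern m l (y + a) - kern m l y‖ₑ ≤ min 2 (2 ^ (l : ℝ) * ‖a‖ₑ) * C := by
  obtain ⟨C, hC⟩ := exists_lintegral_translate_sub_le (kern m 0)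
  refine ⟨C, fun l a => ?_⟩
  have h2 : (0 : ℝ) < 2 ^ l := by positivity
  have h0 : ‖(2 : ℝ) ^ l * a‖ₑ = 2 ^ (l : ℝ) * ‖a‖ₑ := by
    rw [enorm_mul, ← ofReal_norm, Real.norm_of_nonneg h2.le, ofReal_two_zpow]
  rw [← h0]
  refine le_trans (le_of_eq ?_) (hC _)
  have h1 : ∀ y : ℝ, ‖kern m l (y + a) - kern m l y‖ₑ =
      ENNReal.ofReal (2 ^ l) * ‖kern m 0 (2 ^ l * y + 2 ^ l * a) - kern m 0 (2 ^ l * y)‖ₑ := by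
    intro y
    rw [kern_apply, kern_apply m l y, ← smul_sub, enorm_smul, ← ofReal_norm,
      Real.norm_of_nonneg (by positivity), smul_eq_mul, smul_eq_mul, mul_add]
    simp
  simp only [h1]
  rw [lintegral_const_mul' _ _ ENNReal.ofReal_ne_top]
  refine lintegral_comp_pos_mul h2 (f := fun y => ‖kern m 0 (y + 2 ^ l * a) - kern m 0 y‖ₑ) ?_
  exact Continuous.measurable (by fun_prop)

end KernelDifferences

section TimeDifferences

variable {n : ℕ} {ρ p : ℝ≥0∞}

/-- Translation in time. -/
def tr (h : ℝ) (f : ℝ × Bdry n → ℂ) : ℝ × Bdry n → ℂ := fun z => f (z.1 + h, z.2)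

theorem measurable_shift (h : ℝ) : Measurable fun z : ℝ × Bdry n => (z.1 + h, z.2) := by fun_prop

theorem measurable_tr {h : ℝ} {f : ℝ × Bdry n → ℂ} (hf : Measurable f) : Measurable (tr h f) :=
  hf.comp (measurable_shift h)

theorem measurePreserving_shift (h : ℝ) :
    MeasurePreserving (fun z : ℝ × Bdry n => (z.1 + h, z.2)) volume volume := by
  rw [Measure.volume_eq_prod]
  exact (measurePreserving_add_right volume h).prod (MeasurePreserving.id volume)

theorem nrm_tr (h : ℝ) {f : ℝ × Bdry n → ℂ} (hf : Measurable f) :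
    nrm ρ p (tr h f) = nrm ρ p f := by
  have h1 := mixN_comp_map (ρ := ρ) (p := p) (measurePreserving_add_right (volume : Measure ℝ) h)
    (MeasurePreserving.id (volume : Measure (Bdry n))) hf.enorm
  exact h1

theorem nrm_sub_le (hρ : 1 ≤ ρ) (hp : 1 ≤ p) {f g : ℝ × Bdry n → ℂ} (hf : Measurable f)
    (hg : Measurable g) : nrm ρ p (fun z => f z - g z) ≤ nrm ρ p f + nrm ρ p g :=
  (mixN_mono fun _ => enorm_sub_le).trans (mixN_add_le hρ hp hf.enorm hg.enorm)

/-- The difference `f(· + h) - f` in time. -/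
def dt (h : ℝ) (f : ℝ × Bdry n → ℂ) : ℝ × Bdry n → ℂ := fun z => f (z.1 + h, z.2) - f z

theorem measurable_dt {h : ℝ} {f : ℝ × Bdry n → ℂ} (hf : Measurable f) : Measurable (dt h f) :=
  (measurable_tr hf).sub hf

theorem nrm_dt_le (hρ : 1 ≤ ρ) (hp : 1 ≤ p) (h : ℝ) {f : ℝ × Bdry n → ℂ} (hf : Measurable f) :
    nrm ρ p (dt h f) ≤ 2 * nrm ρ p f := by
  refine (nrm_sub_le hρ hp (measurable_tr hf) hf).trans ?_
  rw [nrm_tr h hf, two_mul]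

theorem TemperedFun.ae_integrable_cv {H : Type*} [NormedAddCommGroup H]
    [InnerProductSpace ℝ H] [FiniteDimensional ℝ H] [MeasurableSpace H] [BorelSpace H]
    {f : ℝ × Bdry n → ℂ} (hf : TemperedFun f) (ι : H →L[ℝ] ℝ × Bdry n) (κ : 𝓢(H, ℂ)) :
    ∀ᵐ z, Integrable fun y => κ y * f (z - ι y) := by
  obtain ⟨N, hN⟩ := hf.exists_lintegral_cv_lt_top ι κ
  have h1 : Measurable fun q : (ℝ × Bdry n) × H => ‖κ q.2 * f (q.1 - ι q.2)‖ₑ * wt N q.1 :=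
    (measurable_cv_integrand hf.measurable).enorm.mul ((measurable_wt N).comp measurable_fst)
  filter_upwards [ae_lt_top (h1.lintegral_prod_right' (ν := volume)) hN.ne] with z hz
  have h2 : Measurable fun y => κ y * f (z - ι y) :=
    (measurable_cv_integrand (κ := κ) (ι := ι) hf.measurable).comp measurable_prodMk_left
  refine ⟨h2.aestronglyMeasurable, ?_⟩
  rw [hasFiniteIntegral_iff_enorm]
  rw [lintegral_mul_const _ h2.enorm] at hz
  by_contra h3
  rw [not_lt, top_le_iff] at h3
  rw [h3, ENNReal.top_mul] at hz
  · exact lt_irrefl _ hz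
  · rw [wt, Ne, ENNReal.ofReal_eq_zero, not_le]
    positivity

/-- Bernstein's inequality for differences in time. -/
theorem nrm_dt_cvt_le (hρ : 1 ≤ ρ) (hp : 1 ≤ p) (κ : 𝓢(ℝ, ℂ)) (h : ℝ) {g : ℝ × Bdry n → ℂ}
    (hg : TemperedFun g) (hg' : g =ᵐ[volume] cvt κ g) :
    nrm ρ p (dt h g) ≤ (∫⁻ y, ‖κ (y + h) - κ y‖ₑ) * nrm ρ p g := by
  let κ' : 𝓢(ℝ, ℂ) := SchwartzMap.compSubConstCLM ℂ (-h) κ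
  have hκ' : ∀ y, κ' y = κ (y + h) := fun y => by
    change κ (y - -h) = _
    rw [sub_neg_eq_add]
  have h1 : dt h g =ᵐ[volume] cvt (κ' - κ) g := by
    filter_upwards [hg', (measurePreserving_shift h).quasiMeasurePreserving.ae hg',
      hg.ae_integrable_cv (ContinuousLinearMap.inl ℝ ℝ (Bdry n)) κ,
      hg.ae_integrable_cv (ContinuousLinearMap.inl ℝ ℝ (Bdry n)) κ'] with z h2 h3 h4 h5
    have h6 : cvt κ g (z.1 + h, z.2) = cvt κ' g z := by
      change ∫ y, _ = ∫ y, _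
      rw [← integral_add_right_eq_self (fun y => κ y * g ((z.1 + h, z.2) -
        (ContinuousLinearMap.inl ℝ ℝ (Bdry n)) y)) h]
      refine integral_congr_ae (ae_of_all _ fun y => ?_)
      beta_reduce
      rw [hκ']
      congr 2
      ext <;> simp
    rw [dt, h3, h6, h2]
    change (∫ y, _) - (∫ y, _) = ∫ y, _
    rw [← integral_sub h5 h4]
    refine integral_congr_ae (ae_of_all _ fun y => ?_)
    beta_reduce
    rw [_root_.sub_apply, sub_mul]
  rw [nrm_congr h1]
  refine (nrm_cv_le hρ hp _ _ hg.measurable).trans (le_of_eq ?_)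
  rw [eLpNorm_one_eq_lintegral_enorm]
  simp only [_root_.sub_apply, hκ']

/-- Discrete integration by parts. -/
theorem integral_diffS (h : ℝ) (η : 𝓢(SpaceTime n, ℂ)) {f : ℝ × Bdry n → ℂ} (hf : TemperedFun f)
    (hf' : TemperedFun (tr h f)) :
    ∫ z, diffS n h η (WithLp.toLp 2 z) * f z = ∫ z, η (WithLp.toLp 2 z) * dt h f z := by
  let η' : 𝓢(SpaceTime n, ℂ) := SchwartzMap.compSubConstCLM ℂ (WithLp.toLp 2 (h, 0)) η
  have h1 : ∫ z, η' (WithLp.toLp 2 z) * f z = ∫ z, η (WithLp.toLp 2 z) * tr h f z := by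
    rw [← integral_add_right_eq_self _ ((h, 0) : ℝ × Bdry n)]
    refine integral_congr_ae (ae_of_all _ fun z => ?_)
    beta_reduce
    have h2 : η' (WithLp.toLp 2 (z + (h, 0))) = η (WithLp.toLp 2 z) := by
      change η (WithLp.toLp 2 (z + (h, 0)) - WithLp.toLp 2 (h, 0)) = _
      rw [← WithLp.toLp_sub, add_sub_cancel_right]
    rw [h2, tr]
    congr 2
    ext <;> simp
  calc ∫ z, diffS n h η (WithLp.toLp 2 z) * f z
      = ∫ z, (η' (WithLp.toLp 2 z) * f z - η (WithLp.toLp 2 z) * f z) := by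
        refine integral_congr_ae (ae_of_all _ fun z => ?_)
        beta_reduce
        rw [← sub_mul]
        rfl
    _ = _ := by
        rw [integral_sub (hf.integrable_mul η') (hf.integrable_mul η), h1,
          ← integral_sub (hf'.integrable_mul η) (hf.integrable_mul η)]
        refine integral_congr_ae (ae_of_all _ fun z => ?_)
        beta_reduce
        rw [← mul_sub]
        rfl

/-- The norm in `L^ρ(ℝ₊; L^p)` of the difference of step `h` in time. -/
noncomputable def dN (ρ p : ℝ≥0∞) (h : ℝ) (f : ℝ × Bdry n → ℂ) : ℝ≥0∞ :=
  mixN ρ p (volume.restrict (Ioi 0)) volume fun z => ‖dt h f z‖ₑ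

theorem mixN_restrict_le (I : Set ℝ) (a : ℝ × Bdry n → ℝ≥0∞) :
    mixN ρ p (volume.restrict I) volume a ≤ mixN ρ p volume volume a :=
  eLpNorm_mono_measure _ Measure.restrict_le_self

theorem restrict_prod_univ (I : Set ℝ) :
    (volume : Measure (ℝ × Bdry n)).restrict (I ×ˢ univ) = (volume.restrict I).prod volume := by
  rw [Measure.volume_eq_prod, ← Measure.prod_restrict, Measure.restrict_univ]

/-- The difference operator adjoint to the forward difference of step `h ≥ 0` keeps test functions
supported at positive times. -/
theorem support_diffS {h : ℝ} (hh : 0 ≤ h) {η : 𝓢(SpaceTime n, ℂ)} (hc : HasCompactSupport η)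
    (hs : tsupport η ⊆ {z | z.fst ∈ Ioi 0}) :
    HasCompactSupport (diffS n h η) ∧ tsupport (diffS n h η) ⊆ {z | z.fst ∈ Ioi 0} := by
  set a : SpaceTime n := WithLp.toLp 2 (h, 0)
  have hc' : HasCompactSupport fun z => η (z - a) :=
    hc.comp_homeomorph (Homeomorph.subRight a)
  have h1 : tsupport (fun z => η (z - a)) ⊆ {z | z.fst ∈ Ioi 0} := by
    have h2 : tsupport (fun z => η (z - a)) ⊆ (fun z => z - a) ⁻¹' tsupport η := by
      refine closure_minimal (fun z hz => subset_tsupport η hz)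
        ((isClosed_tsupport η).preimage (by fun_prop))
    intro z hz
    have h3 : 0 < z.fst - h := hs (h2 hz)
    change 0 < z.fst
    linarith
  have h4 : (diffS n h η : SpaceTime n → ℂ) = (fun z => η (z - a)) - η := rfl
  rw [h4]
  refine ⟨hc'.sub hc, ?_⟩
  exact (tsupport_sub _ _).trans (union_subset h1 hs)

theorem min_two_le_rpow (x : ℝ≥0∞) {r : ℝ} (hr : 0 < r) (hr1 : r ≤ 1) : min 2 x ≤ 2 * x ^ r := by
  rcases le_total x 1 with h | h
  · refine (min_le_right _ _).trans ?_
    calc x = x ^ (1 : ℝ) := (ENNReal.rpow_one x).symm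
      _ ≤ x ^ r := ENNReal.rpow_le_rpow_of_exponent_ge h hr1
      _ ≤ 2 * x ^ r := le_mul_of_one_le_left' (by norm_num)
  · refine (min_le_left _ _).trans ?_
    exact le_mul_of_one_le_right' (ENNReal.one_le_rpow h hr)

end TimeDifferences

section DifferencesOfBlocks

variable {n : ℕ} {ρ p : ℝ≥0∞}

/-- Translation in time of Schwartz functions. -/
noncomputable def trS (n : ℕ) (h : ℝ) : 𝓢(SpaceTime n, ℂ) →L[ℂ] 𝓢(SpaceTime n, ℂ) :=
  SchwartzMap.compSubConstCLM ℂ (WithLp.toLp 2 (h, 0))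

theorem trS_apply (h : ℝ) (ζ : 𝓢(SpaceTime n, ℂ)) (z : SpaceTime n) :
    trS n h ζ z = ζ (z - WithLp.toLp 2 (h, 0)) := rfl

theorem trS_add (h h' : ℝ) (ζ : 𝓢(SpaceTime n, ℂ)) : trS n (h + h') ζ = trS n h (trS n h' ζ) := by
  ext z
  simp only [trS_apply]
  congr 1
  rw [sub_sub, ← WithLp.toLp_add]
  simp

theorem diffS_eq (h : ℝ) (ζ : 𝓢(SpaceTime n, ℂ)) : diffS n h ζ = trS n h ζ - ζ := rfl

theorem support_trS {h : ℝ} (hh : 0 ≤ h) {η : 𝓢(SpaceTime n, ℂ)} (hc : HasCompactSupport η)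
    (hs : tsupport η ⊆ {z | z.fst ∈ Ioi 0}) :
    HasCompactSupport (trS n h η) ∧ tsupport (trS n h η) ⊆ {z | z.fst ∈ Ioi 0} := by
  have h1 : (trS n h η : SpaceTime n → ℂ) = diffS n h η + η := by
    funext z
    rw [Pi.add_apply, diffS_apply, trS_apply, sub_add_cancel]
  obtain ⟨h2, h3⟩ := support_diffS hh hc hs
  rw [h1]
  exact ⟨h2.add hc, (tsupport_add _ _).trans (union_subset h3 hs)⟩

/-- Differences of a distribution that restricts to a function, tested on Schwartz functions. -/
theorem RestrictsTo.apply_diffS (hρ : 1 ≤ ρ) (hp : 1 ≤ p) {I : Set ℝ} (hI : Ioi 0 ⊆ I)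
    {v : 𝓢'(SpaceTime n, ℂ)} {f : ℝ × Bdry n → ℂ} (hv : RestrictsTo I v f) (hf : Measurable f)
    (hfN : nrm ρ p f < ⊤) {h : ℝ} (hh : 0 ≤ h) {η : 𝓢(SpaceTime n, ℂ)} (hc : HasCompactSupport η)
    (hs : tsupport η ⊆ {z | z.fst ∈ Ioi 0}) :
    v (diffS n h η) = ∫ z, η (WithLp.toLp 2 z) * dt h f z := by
  obtain ⟨h1, h2⟩ := support_diffS hh hc hs
  rw [hv.2 _ h1 (h2.trans fun z hz => hI hz)]
  exact integral_diffS h η (tempered_of_nrm hρ hp hf hfN)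
    (tempered_of_nrm hρ hp (measurable_tr hf) (by rwa [nrm_tr h hf]))

theorem tendsto_Icc_neg : Tendsto (fun N : ℕ => Finset.Icc (-(N : ℤ)) N) atTop atTop := by
  refine tendsto_atTop_finset_of_monotone
    (fun a b hab => Finset.Icc_subset_Icc (by simpa) (by simpa)) fun l => ⟨l.natAbs, ?_⟩
  rw [Finset.mem_Icc]
  omega

set_option maxHeartbeats 1000000 in
/-- Control of the differences of a function on `ℝ₊ × ℝⁿ⁻¹` by the dyadic blocks in time of an
extension. The blocks determine the extension only up to a polynomial in time; a difference of high
order is the sum of those of the blocks, so some iterated difference of the defect `c` vanishes.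
The sums of `c` telescope and `S (N h) = o(N)`, so the means of `c` tend to zero and
`eq_zero_of_fwdDiff_iterate_eq_zero` applies. -/
theorem dt_eq_of_blocks (hρ : 1 ≤ ρ) (hp : 1 ≤ p) {Ψ : LittlewoodPaley ℝ}
    {v : 𝓢'(SpaceTime n, ℂ)} {f : ℝ × Bdry n → ℂ} (hf : Measurable f) (hfN : nrm ρ p f < ⊤)
    (hv : RestrictsTo (Ioi 0) v f) {g : ℤ → ℝ × Bdry n → ℂ} (hg : ∀ l, Measurable (g l))
    (hgN : ∀ l, nrm ρ p (g l) < ⊤) (hgv : ∀ l, RestrictsTo univ (timeBlock Ψ l v) (g l))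
    {h : ℝ} (hh : 0 < h) {S : ℝ → ℝ≥0∞}
    (hS : ∀ h, ∑' l, nrm ρ p (dt h (g l)) ≤ S h) (hSfin : ∀ h, S h < ⊤)
    (hSlim : Tendsto (fun N : ℕ => (N : ℝ)⁻¹ * (S (N * h)).toReal) atTop (𝓝 0))
    {ζ : 𝓢(SpaceTime n, ℂ)} (hc : HasCompactSupport ζ) (hs : tsupport ζ ⊆ {z | z.fst ∈ Ioi 0}) :
    HasSum (fun l => ∫ z, ζ (WithLp.toLp 2 z) * dt h (g l) z)
      (∫ z, ζ (WithLp.toLp 2 z) * dt h f z) := by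
  set w : ℤ → 𝓢'(SpaceTime n, ℂ) := fun l => timeBlock Ψ l v with hw
  -- a priori bounds for the pairings with the blocks
  have hsum : ∀ (η : 𝓢(SpaceTime n, ℂ)), HasCompactSupport η → tsupport η ⊆ {z | z.fst ∈ Ioi 0} →
      ∃ C : ℝ≥0, ∀ h : ℝ, 0 ≤ h → ∑' l, ‖w l (diffS n h η)‖ₑ ≤ C * S h := by
    intro η hc hs
    obtain ⟨C, hC⟩ := exists_lintegral_mul_le_nrm (n := n) hρ hp η
    refine ⟨C, fun h hh => ?_⟩
    calc ∑' l, ‖w l (diffS n h η)‖ₑ ≤ ∑' l, C * nrm ρ p (dt h (g l)) := by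
          refine ENNReal.tsum_le_tsum fun l => ?_
          rw [hw, (hgv l).apply_diffS hρ hp (subset_univ _) (hg l) (hgN l) hh hc hs]
          exact (enorm_integral_le_lintegral_enorm _).trans (hC _ (measurable_dt (hg l)))
      _ ≤ C * S h := by
          rw [ENNReal.tsum_mul_left]
          gcongr
          exact hS h
  have hsum' : ∀ (η : 𝓢(SpaceTime n, ℂ)), HasCompactSupport η →
      tsupport η ⊆ {z | z.fst ∈ Ioi 0} → ∀ h : ℝ, 0 ≤ h →
      Summable fun l => w l (diffS n h η) := by
    intro η hc hs h hh
    obtain ⟨C, hC⟩ := hsum η hc hs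
    have h1 := ENNReal.summable_toReal
      ((hC h hh).trans_lt (ENNReal.mul_lt_top ENNReal.coe_lt_top (hSfin h))).ne
    refine Summable.of_norm ?_
    simpa using h1
  have hsupp : ∀ k : ℕ, HasCompactSupport (trS n (k * h) ζ) ∧
      tsupport (trS n (k * h) ζ) ⊆ {z | z.fst ∈ Ioi 0} := fun k =>
    support_trS (by positivity) hc hs
  -- the defect `v - ∑ l, w l`, tested on the differences of translates of `ζ`
  let c : ℕ → ℂ := fun k =>
    v (diffS n h (trS n (k * h) ζ)) - ∑' l, w l (diffS n h (trS n (k * h) ζ))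
  let Λ : ℕ → 𝓢(SpaceTime n, ℂ) → ℂ := fun N η =>
    v (diffS n h η) - ∑ l ∈ Finset.Icc (-(N : ℤ)) N, w l (diffS n h η)
  have hΛsub : ∀ N η η', Λ N (η - η') = Λ N η - Λ N η' := by
    intro N η η'
    simp only [Λ, map_sub, Finset.sum_sub_distrib]
    ring
  have hcΛ : ∀ k : ℕ, Tendsto (fun N => Λ N (trS n (k * h) ζ)) atTop (𝓝 (c k)) := fun k =>
    ((hsum' _ (hsupp k).1 (hsupp k).2 h hh.le).hasSum.comp tendsto_Icc_neg).const_sub _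
  have hiter : ∀ (m k N : ℕ), (fwdDiff (1 : ℕ))^[m] (fun k => Λ N (trS n ((k : ℕ) * h) ζ)) k
      = Λ N ((diffS n h)^[m] (trS n (k * h) ζ)) := by
    intro m
    induction m with
    | zero => intro k N; rfl
    | succ m ih =>
      intro k N
      rw [Function.iterate_succ_apply', fwdDiff, ih, ih, ← hΛsub, Function.iterate_succ_apply]
      congr 1
      have h1 : trS n ((k + 1 : ℕ) * h) ζ = trS n h (trS n (k * h) ζ) := by
        rw [← trS_add]
        congr 2
        push_cast
        ring
      rw [h1, diffS_eq]
      exact (iterate_map_sub (diffS n h) m _ _).symm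
  have hlim : ∀ m k : ℕ, Tendsto (fun N =>
      (fwdDiff (1 : ℕ))^[m] (fun k => Λ N (trS n ((k : ℕ) * h) ζ)) k)
      atTop (𝓝 ((fwdDiff (1 : ℕ))^[m] c k)) := by
    intro m
    induction m with
    | zero => exact hcΛ
    | succ m ih =>
      intro k
      simp only [Function.iterate_succ_apply', fwdDiff]
      exact (ih _).sub (ih _)
  obtain ⟨m, hm0, hm⟩ := exists_tendsto_sum_timeBlock Ψ v
  obtain ⟨m, rfl⟩ := Nat.exists_eq_succ_of_ne_zero hm0
  have hc0 : ∀ k, (fwdDiff (1 : ℕ))^[m] c k = 0 := by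
    intro k
    refine tendsto_nhds_unique (hlim m k) ?_
    simp only [hiter]
    have h1 := (hm h (trS n (k * h) ζ)).const_sub (v ((diffS n h)^[m + 1] (trS n (k * h) ζ)))
    rw [sub_self] at h1
    simpa only [Λ, ← Function.iterate_succ_apply' (diffS n h)] using h1
  have hces : Tendsto (fun N : ℕ => (N : ℂ)⁻¹ * ∑ k ∈ Finset.range N, c k) atTop (𝓝 0) := by
    obtain ⟨C, hC⟩ := hsum ζ hc hs
    obtain ⟨C', hC'⟩ := exists_lintegral_mul_le_nrm (n := n) hρ hp ζ
    have h1 : ∀ N : ℕ, ∑ k ∈ Finset.range N, c k =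
        v (diffS n (N * h) ζ) - ∑' l, w l (diffS n (N * h) ζ) := by
      intro N
      have h2 : ∑ k ∈ Finset.range N, diffS n h (trS n (k * h) ζ) = diffS n (N * h) ζ := by
        have h3 : ∀ k : ℕ, diffS n h (trS n (k * h) ζ)
            = trS n ((k + 1 : ℕ) * h) ζ - trS n (k * h) ζ := by
          intro k
          rw [diffS_eq, ← trS_add]
          congr 3
          push_cast
          ring
        simp only [h3]
        rw [Finset.sum_range_sub (fun k : ℕ => trS n (k * h) ζ), diffS_eq]
        congr 1
        ext z
        rw [trS_apply, Nat.cast_zero, zero_mul]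
        congr 1
        change z - 0 = z
        exact sub_zero z
      rw [← h2]
      simp only [map_sum]
      rw [Summable.tsum_finsetSum fun k _ => hsum' _ (hsupp k).1 (hsupp k).2 h hh.le,
        ← Finset.sum_sub_distrib]
    have h2 : ∀ N : ℕ, ‖∑ k ∈ Finset.range N, c k‖ ≤
        (C' * (2 * nrm ρ p f)).toReal + C * (S (N * h)).toReal := by
      intro N
      have hNh : 0 ≤ N * h := by positivity
      rw [h1]
      refine (norm_sub_le _ _).trans (add_le_add ?_ ?_)
      · rw [hv.apply_diffS hρ hp subset_rfl hf hfN hNh hc hs, ← toReal_enorm]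
        refine ENNReal.toReal_mono ?_ ?_
        · exact ENNReal.mul_ne_top ENNReal.coe_ne_top
            (ENNReal.mul_ne_top ENNReal.ofNat_ne_top hfN.ne)
        · refine (enorm_integral_le_lintegral_enorm _).trans ((hC' _ (measurable_dt hf)).trans ?_)
          gcongr
          exact nrm_dt_le hρ hp _ hf
      · rw [← toReal_enorm, ← ENNReal.coe_toReal C, ← ENNReal.toReal_mul]
        refine ENNReal.toReal_mono ?_ ?_
        · exact ENNReal.mul_ne_top ENNReal.coe_ne_top (hSfin _).ne
        · exact enorm_tsum_le_tsum_enorm.trans (hC _ hNh)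
    have h3 : Tendsto (fun N : ℕ => (N : ℝ)⁻¹ * (C' * (2 * nrm ρ p f)).toReal +
        C * ((N : ℝ)⁻¹ * (S (N * h)).toReal)) atTop (𝓝 0) := by
      have h4 : Tendsto (fun N : ℕ => (N : ℝ)⁻¹) atTop (𝓝 0) := tendsto_inv_atTop_nhds_zero_nat
      simpa using (h4.mul_const (C' * (2 * nrm ρ p f)).toReal).add (hSlim.const_mul (C : ℝ))
    refine squeeze_zero_norm (fun N => ?_) h3
    rw [norm_mul, norm_inv, Complex.norm_natCast]
    refine (mul_le_mul_of_nonneg_left (h2 N) (by positivity)).trans (le_of_eq ?_)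
    ring
  have h0 := eq_zero_of_fwdDiff_iterate_eq_zero m hc0 hces 0
  have htr : trS n ((0 : ℕ) * h) ζ = ζ := by
    ext z
    rw [trS_apply, Nat.cast_zero, zero_mul]
    congr 1
    change z - 0 = z
    exact sub_zero z
  simp only [c, htr, sub_eq_zero] at h0
  have h1 := (hsum' ζ hc hs h hh.le).hasSum
  rw [← h0, hv.apply_diffS hρ hp subset_rfl hf hfN hh.le hc hs] at h1
  have h2 : (fun l => w l (diffS n h ζ)) = fun l => ∫ z, ζ (WithLp.toLp 2 z) * dt h (g l) z :=
    funext fun l => (hgv l).apply_diffS hρ hp (subset_univ _) (hg l) (hgN l) hh.le hc hs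
  rwa [h2] at h1

theorem dN_le_tsum (hρ : 1 ≤ ρ) (hp : 1 ≤ p) {Ψ : LittlewoodPaley ℝ}
    {v : 𝓢'(SpaceTime n, ℂ)} {f : ℝ × Bdry n → ℂ} (hf : Measurable f) (hfN : nrm ρ p f < ⊤)
    (hv : RestrictsTo (Ioi 0) v f) {g : ℤ → ℝ × Bdry n → ℂ} (hg : ∀ l, Measurable (g l))
    (hgN : ∀ l, nrm ρ p (g l) < ⊤) (hgv : ∀ l, RestrictsTo univ (timeBlock Ψ l v) (g l))
    {h : ℝ} (hh : 0 < h) {S : ℝ → ℝ≥0∞}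
    (hS : ∀ h, ∑' l, nrm ρ p (dt h (g l)) ≤ S h) (hSfin : ∀ h, S h < ⊤)
    (hSlim : Tendsto (fun N : ℕ => (N : ℝ)⁻¹ * (S (N * h)).toReal) atTop (𝓝 0)) :
    dN ρ p h f ≤ S h := by
  obtain ⟨D, hDm, hDle, hD⟩ := exists_measurable_hasSum fun l => measurable_dt (h := h) (hg l)
  have hMm : Measurable fun z => ∑' l, ‖dt h (g l) z‖ₑ :=
    Measurable.tsum fun l => (measurable_dt (hg l)).enorm
  have hM : mixN ρ p volume volume (fun z => ∑' l, ‖dt h (g l) z‖ₑ) ≤ S h :=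
    (mixN_tsum_le hρ hp fun l => (measurable_dt (hg l)).enorm).trans (hS h)
  have hDN : nrm ρ p D ≤ S h := (mixN_mono hDle).trans hM
  have hDt := tempered_of_nrm hρ hp hDm (hDN.trans_lt (hSfin h))
  have hfin := ae_lt_top_of_mixN hρ hp hMm (hM.trans_lt (hSfin h))
  have hdtf : TemperedFun (dt h f) := tempered_of_nrm hρ hp (measurable_dt hf)
    ((nrm_dt_le hρ hp h hf).trans_lt (ENNReal.mul_lt_top (by norm_num) hfN))
  have hrest : RestrictsTo (Ioi 0) hDt.toDistribution (dt h f) := by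
    refine ⟨hdtf.locallyIntegrable.locallyIntegrableOn _, fun ζ hc hs => ?_⟩
    have h1 := dt_eq_of_blocks hρ hp hf hfN hv hg hgN hgv hh hS hSfin hSlim hc hs
    obtain ⟨C, hC⟩ := exists_lintegral_mul_le_nrm (n := n) hρ hp ζ
    have h2 : ∀ l, Integrable fun z => ζ (WithLp.toLp 2 z) * dt h (g l) z := fun l =>
      (tempered_of_nrm hρ hp (measurable_dt (hg l))
        ((nrm_dt_le hρ hp h (hg l)).trans_lt
          (ENNReal.mul_lt_top (by norm_num) (hgN l)))).integrable_mul ζ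
    have h3 : ∑' l, ∫⁻ z, ‖ζ (WithLp.toLp 2 z) * dt h (g l) z‖ₑ < ⊤ := by
      refine lt_of_le_of_lt (ENNReal.tsum_le_tsum fun l => hC _ (measurable_dt (hg l))) ?_
      rw [ENNReal.tsum_mul_left]
      exact ENNReal.mul_lt_top ENNReal.coe_lt_top ((hS h).trans_lt (hSfin h))
    have h4 : Summable fun l => ∫ z, ‖ζ (WithLp.toLp 2 z) * dt h (g l) z‖ := by
      refine (ENNReal.summable_toReal h3.ne).congr fun l => ?_
      rw [integral_norm_eq_lintegral_enorm (h2 l).aestronglyMeasurable]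
    have h5 := hasSum_integral_of_summable_integral_norm h2 h4
    rw [hDt.toDistribution_apply, h1.unique h5]
    refine integral_congr_ae ?_
    filter_upwards [hfin] with z hz
    exact ((hD z hz).mul_left (ζ (WithLp.toLp 2 z))).tsum_eq.symm
  have hae := hrest.ae_eq isOpen_Ioi (hDt.restrictsTo (Ioi 0))
  rw [restrict_prod_univ] at hae
  calc dN ρ p h f = mixN ρ p (volume.restrict (Ioi 0)) volume fun z => ‖D z‖ₑ := by
        refine mixN_congr_ae ?_
        filter_upwards [hae] with z hz
        rw [hz]
    _ ≤ nrm ρ p D := mixN_restrict_le _ _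
    _ ≤ S h := hDN

/-- The modulus of continuity in time of a function on `ℝ₊ × ℝⁿ⁻¹`, in terms of the dyadic blocks
in time of an extension. -/
theorem exists_dN_le (Ψ : LittlewoodPaley ℝ) : ∃ C : ℝ≥0, ∀ (n : ℕ) (ρ p : ℝ≥0∞), 1 ≤ ρ → 1 ≤ p →
    ∀ (v : 𝓢'(SpaceTime n, ℂ)) (f : ℝ × Bdry n → ℂ), Measurable f → nrm ρ p f < ⊤ →
    RestrictsTo (Ioi 0) v f → ∀ (r : ℝ), 0 < r → r < 1 →
    ∑' l : ℤ, (2 : ℝ≥0∞) ^ (r * (l : ℝ)) * mixedNorm univ ρ p (timeBlock Ψ l v) < ⊤ →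
    ∀ h : ℝ, 0 < h → dN ρ p h f ≤
      ∑' l : ℤ, min 2 (2 ^ (l : ℝ) * ‖h‖ₑ) * C * mixedNorm univ ρ p (timeBlock Ψ l v) := by
  obtain ⟨C, hC⟩ := exists_lintegral_kern_sub_le (fatSymbol Ψ)
  refine ⟨C, fun n ρ p hρ hp v f hf hfN hv r hr hr1 hA h hh => ?_⟩
  set a : ℤ → ℝ≥0∞ := fun l => mixedNorm univ ρ p (timeBlock Ψ l v) with ha
  set A : ℝ≥0∞ := ∑' l : ℤ, (2 : ℝ≥0∞) ^ (r * (l : ℝ)) * a l with hAdef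
  have hafin : ∀ l, a l < ⊤ := by
    intro l
    have h1 := (ENNReal.le_tsum l).trans_lt hA
    by_contra h2
    rw [not_lt, top_le_iff] at h2
    rw [h2, ENNReal.mul_top
      (ENNReal.rpow_pos two_pos (by norm_num)).ne'] at h1
    exact lt_irrefl _ h1
  choose g hg hgv _ hgN using fun l =>
    exists_restrictsTo_of_mixedNorm_lt_top hρ hp isOpen_univ (hafin l)
  let S : ℝ → ℝ≥0∞ := fun h => ∑' l : ℤ, min 2 (2 ^ (l : ℝ) * ‖h‖ₑ) * C * a l
  have hS : ∀ h, ∑' l, nrm ρ p (dt h (g l)) ≤ S h := fun h =>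
    ENNReal.tsum_le_tsum fun l =>
      (nrm_dt_cvt_le hρ hp _ h (hg l) ((hgv l).eq_cvt_fat (hg l))).trans
        (mul_le_mul' (hC l h) (hgN l))
  have hSle : ∀ h : ℝ, S h ≤ ‖h‖ₑ ^ r * (2 * C * A) := by
    intro h
    calc S h ≤ ∑' l : ℤ, ‖h‖ₑ ^ r * (2 * C * ((2 : ℝ≥0∞) ^ (r * (l : ℝ)) * a l)) := by
          refine ENNReal.tsum_le_tsum fun l => ?_
          calc _ ≤ 2 * (2 ^ (l : ℝ) * ‖h‖ₑ) ^ r * C * a l := by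
                gcongr
                exact min_two_le_rpow _ hr hr1.le
            _ = _ := by
                rw [ENNReal.mul_rpow_of_nonneg _ _ hr.le, ← ENNReal.rpow_mul, mul_comm (l : ℝ) r]
                ring
      _ = _ := by rw [ENNReal.tsum_mul_left, ENNReal.tsum_mul_left]
  have hK : 2 * C * A < ⊤ := ENNReal.mul_lt_top (ENNReal.mul_lt_top (by norm_num)
    ENNReal.coe_lt_top) hA
  have hSfin : ∀ h, S h < ⊤ := fun h => (hSle h).trans_lt
    (ENNReal.mul_lt_top (ENNReal.rpow_lt_top_of_nonneg hr.le enorm_lt_top.ne) hK)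
  refine dN_le_tsum hρ hp hf hfN hv (fun l => (hg l).measurable)
    (fun l => (hgN l).trans_lt (hafin l)) hgv hh hS hSfin ?_
  have h1 : ∀ N : ℕ, (N : ℝ)⁻¹ * (S (N * h)).toReal ≤
      (N : ℝ)⁻¹ * ((N : ℝ) ^ r * (h ^ r * (2 * C * A).toReal)) := by
    intro N
    gcongr
    refine (ENNReal.toReal_mono (ENNReal.mul_lt_top
      (ENNReal.rpow_lt_top_of_nonneg hr.le enorm_lt_top.ne) hK).ne (hSle (N * h))).trans
      (le_of_eq ?_)
    rw [ENNReal.toReal_mul, ← ENNReal.toReal_rpow, toReal_enorm,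
      Real.norm_of_nonneg (by positivity), Real.mul_rpow (by positivity) hh.le, mul_assoc]
  have h2 : Tendsto (fun N : ℕ => (N : ℝ)⁻¹ * ((N : ℝ) ^ r * (h ^ r * (2 * C * A).toReal))) atTop
      (𝓝 0) := by
    have h3 : Tendsto (fun N : ℕ => (N : ℝ) ^ (-(1 - r))) atTop (𝓝 0) :=
      (tendsto_rpow_neg_atTop (by linarith)).comp tendsto_natCast_atTop_atTop
    have h4 := h3.mul_const (h ^ r * (2 * C * A).toReal)
    rw [zero_mul] at h4
    refine h4.congr' ?_
    filter_upwards [eventually_gt_atTop 0] with N hN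
    have hN' : (0 : ℝ) < N := by exact_mod_cast hN
    rw [show -(1 - r) = -1 + r by ring, Real.rpow_add hN', Real.rpow_neg_one, mul_assoc]
  exact squeeze_zero (fun N => by positivity) h1 h2

/-- The moduli of continuity in time of a sequence of functions, with weights `2^{si}`. -/
noncomputable def om (ρ p : ℝ≥0∞) (s : ℝ) (F : ℤ → ℝ × Bdry n → ℂ) (a : ℝ) : ℝ≥0∞ :=
  ∑' i : ℤ, (2 : ℝ≥0∞) ^ (s * (i : ℝ)) * ⨆ (h : ℝ) (_ : 0 < h ∧ h ≤ a), dN ρ p h (F i)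

theorem om_mono (ρ p : ℝ≥0∞) (s : ℝ) (F : ℤ → ℝ × Bdry n → ℂ) : Monotone (om ρ p s F) := by
  intro a b hab
  refine ENNReal.tsum_le_tsum fun i => ?_
  refine mul_le_mul' le_rfl ?_
  exact iSup_mono fun h => iSup_mono' fun hh => ⟨⟨hh.1, hh.2.trans hab⟩, le_rfl⟩

/-- The Besov norm defined by means of the moduli of continuity in time of the blocks in space. -/
noncomputable def besovDiff (ρ p : ℝ≥0∞) (r s : ℝ) (F : ℤ → ℝ × Bdry n → ℂ) : ℝ≥0∞ :=
  ∑' k : ℤ, (2 : ℝ≥0∞) ^ (r * (k : ℝ)) * om ρ p s F (2 ^ (-(k : ℝ)))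

/-- The norm defined by differences is controlled by the norm of any extension. -/
theorem exists_besovDiff_le (Ψ : LittlewoodPaley ℝ) {r : ℝ} (hr : 0 < r) (hr1 : r < 1) :
    ∃ C : ℝ≥0, ∀ (n : ℕ) (Φ : LittlewoodPaley (Bdry n)) (ρ p : ℝ≥0∞), 1 ≤ ρ → 1 ≤ p → ∀ (s : ℝ)
      (u : 𝓢'(SpaceTime n, ℂ)) (F : ℤ → ℝ × Bdry n → ℂ), (∀ i, Measurable (F i)) →
      (∀ i, nrm ρ p (F i) < ⊤) → (∀ i, RestrictsTo (Ioi 0) (spaceBlock Φ i u) (F i)) →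
      besovDiff ρ p r s F ≤ C * besovBesovNormLine Ψ Φ r s ρ p u := by
  obtain ⟨C, hC⟩ := exists_dN_le Ψ
  set B : ℝ≥0∞ := ∑' m : ℤ, min (2 * 2 ^ (r * (m : ℝ))) (1 * 2 ^ (-((1 - r) * (m : ℝ)))) with hB
  have hBfin : B < ⊤ := tsum_int_min_lt_top hr (by linarith) (by norm_num) (by norm_num)
  refine ⟨C * B.toNNReal + 1, fun n Φ ρ p hρ hp s u F hF hFN hFu => ?_⟩
  rcases eq_or_ne (besovBesovNormLine Ψ Φ r s ρ p u) ⊤ with htop | htop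
  · rw [htop, ENNReal.mul_top (by simp)]
    exact le_top
  set a : ℤ → ℤ → ℝ≥0∞ := fun l i => mixedNorm univ ρ p (timeBlock Ψ l (spaceBlock Φ i u)) with ha
  have hline : besovBesovNormLine Ψ Φ r s ρ p u = ∑' l : ℤ, (2 : ℝ≥0∞) ^ (r * (l : ℝ)) *
    ∑' i : ℤ, (2 : ℝ≥0∞) ^ (s * (i : ℝ)) * a l i := rfl
  have hA : ∀ i, ∑' l : ℤ, (2 : ℝ≥0∞) ^ (r * (l : ℝ)) * a l i < ⊤ := by
    intro i
    have h1 : (2 : ℝ≥0∞) ^ (s * (i : ℝ)) * ∑' l : ℤ, (2 : ℝ≥0∞) ^ (r * (l : ℝ)) * a l i < ⊤ := by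
      refine lt_of_le_of_lt ?_ htop.lt_top
      rw [← ENNReal.tsum_mul_left, hline]
      refine ENNReal.tsum_le_tsum fun l => ?_
      rw [mul_left_comm]
      gcongr
      exact ENNReal.le_tsum (f := fun i : ℤ => (2 : ℝ≥0∞) ^ (s * (i : ℝ)) * a l i) i
    by_contra h2
    rw [not_lt, top_le_iff] at h2
    rw [h2, ENNReal.mul_top (ENNReal.rpow_pos two_pos (by norm_num)).ne'] at h1
    exact lt_irrefl _ h1
  have hom : ∀ k : ℤ, om ρ p s F (2 ^ (-(k : ℝ))) ≤ ∑' i : ℤ, (2 : ℝ≥0∞) ^ (s * (i : ℝ)) *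
      ∑' l : ℤ, min 2 (2 ^ ((l - k : ℤ) : ℝ)) * C * a l i := by
    intro k
    refine ENNReal.tsum_le_tsum fun i => ?_
    gcongr
    refine iSup₂_le fun h hh => ?_
    refine (hC n ρ p hρ hp _ _ (hF i) (hFN i) (hFu i) r hr hr1 (hA i) h hh.1).trans ?_
    refine ENNReal.tsum_le_tsum fun l => ?_
    gcongr
    have h1 : ‖h‖ₑ ≤ 2 ^ (-(k : ℝ)) := by
      rw [← ofReal_norm, Real.norm_of_nonneg hh.1.le]
      refine (ENNReal.ofReal_le_ofReal hh.2).trans (le_of_eq ?_)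
      rw [← ENNReal.ofReal_rpow_of_pos two_pos, ENNReal.ofReal_ofNat]
    calc (2 : ℝ≥0∞) ^ (l : ℝ) * ‖h‖ₑ ≤ 2 ^ (l : ℝ) * 2 ^ (-(k : ℝ)) := by gcongr
      _ = 2 ^ ((l - k : ℤ) : ℝ) := by
          rw [← ENNReal.rpow_add _ _ two_ne_zero ENNReal.ofNat_ne_top]
          congr 1
          push_cast
          ring
  have hsum : ∀ l : ℤ, ∑' k : ℤ, (2 : ℝ≥0∞) ^ (r * (k : ℝ)) * min 2 (2 ^ ((l - k : ℤ) : ℝ))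
      = 2 ^ (r * (l : ℝ)) * B := by
    intro l
    rw [hB, ← ENNReal.tsum_mul_left, ← (Equiv.addRight l).tsum_eq]
    refine tsum_congr fun m => ?_
    have h0 : (2 : ℝ≥0∞) ^ (r * ((m : ℝ) + l)) = 2 ^ (r * (l : ℝ)) * 2 ^ (r * (m : ℝ)) := by
      rw [← ENNReal.rpow_add _ _ two_ne_zero ENNReal.ofNat_ne_top]
      congr 1
      ring
    rw [Equiv.coe_addRight]
    push_cast
    rw [h0, mul_assoc]
    congr 1
    rw [mul_min, one_mul, mul_comm _ (2 : ℝ≥0∞),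
      ← ENNReal.rpow_add _ _ two_ne_zero ENNReal.ofNat_ne_top]
    congr 2
    ring
  calc besovDiff ρ p r s F
      ≤ ∑' k : ℤ, (2 : ℝ≥0∞) ^ (r * (k : ℝ)) * ∑' i : ℤ, (2 : ℝ≥0∞) ^ (s * (i : ℝ)) *
        ∑' l : ℤ, min 2 (2 ^ ((l - k : ℤ) : ℝ)) * C * a l i := by
        refine ENNReal.tsum_le_tsum fun k => ?_
        gcongr
        exact hom k
    _ = ∑' k : ℤ, ∑' i : ℤ, ∑' l : ℤ, (2 : ℝ≥0∞) ^ (s * (i : ℝ)) * (C * a l i) *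
          (2 ^ (r * (k : ℝ)) * min 2 (2 ^ ((l - k : ℤ) : ℝ))) := by
        simp only [← ENNReal.tsum_mul_left]
        refine tsum_congr fun k => tsum_congr fun i => tsum_congr fun l => ?_
        ring
    _ = ∑' l : ℤ, ∑' i : ℤ, ∑' k : ℤ, (2 : ℝ≥0∞) ^ (s * (i : ℝ)) * (C * a l i) *
          (2 ^ (r * (k : ℝ)) * min 2 (2 ^ ((l - k : ℤ) : ℝ))) := by
        rw [ENNReal.tsum_comm]
        rw [ENNReal.tsum_comm (f := fun l i : ℤ => ∑' k : ℤ, (2 : ℝ≥0∞) ^ (s * (i : ℝ)) *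
          (C * a l i) * (2 ^ (r * (k : ℝ)) * min 2 (2 ^ ((l - k : ℤ) : ℝ))))]
        exact tsum_congr fun i => ENNReal.tsum_comm
    _ = ∑' l : ℤ, ∑' i : ℤ, (C * B) *
          (2 ^ (r * (l : ℝ)) * ((2 : ℝ≥0∞) ^ (s * (i : ℝ)) * a l i)) := by
        refine tsum_congr fun l => tsum_congr fun i => ?_
        rw [ENNReal.tsum_mul_left, hsum]
        ring
    _ = (C * B) * besovBesovNormLine Ψ Φ r s ρ p u := by
        rw [hline]
        simp only [ENNReal.tsum_mul_left]
    _ ≤ _ := by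
        gcongr
        rw [ENNReal.coe_add, ENNReal.coe_mul, ENNReal.coe_toNNReal hBfin.ne]
        exact le_self_add

end DifferencesOfBlocks

end CheminLerner

/-! ### Products of functions with localised frequencies -/

namespace CheminLerner

open FourierTransform

section SpaceConvolution

variable {H : Type*} [NormedAddCommGroup H] [InnerProductSpace ℝ H] [FiniteDimensional ℝ H]
  [MeasurableSpace H] [BorelSpace H]

/-- Convolution with a Schwartz function. -/
noncomputable def cs (κ : 𝓢(H, ℂ)) (f : H → ℂ) (x : H) : ℂ := ∫ y, κ y * f (x - y)

theorem measurable_cs_integrand (κ : 𝓢(H, ℂ)) {f : H → ℂ} (hf : Measurable f) :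
    Measurable fun q : H × H => κ q.2 * f (q.1 - q.2) :=
  (κ.continuous.measurable.comp measurable_snd).mul
    (hf.comp (measurable_fst.sub measurable_snd))

theorem measurable_cs (κ : 𝓢(H, ℂ)) {f : H → ℂ} (hf : Measurable f) : Measurable (cs κ f) :=
  ((measurable_cs_integrand κ hf).stronglyMeasurable.integral_prod_right (ν := volume)).measurable

theorem enorm_cs_le (κ : 𝓢(H, ℂ)) (f : H → ℂ) (x : H) :
    ‖cs κ f x‖ₑ ≤ ∫⁻ y, ‖κ y‖ₑ * ‖f (x - y)‖ₑ := by
  refine (enorm_integral_le_lintegral_enorm _).trans (le_of_eq ?_)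
  simp only [enorm_mul]

theorem eLpNorm_comp_sub_left {p : ℝ≥0∞} (x : H) {f : H → ℂ} (hf : Measurable f) :
    eLpNorm (fun y => f (x - y)) p volume = eLpNorm f p volume :=
  eLpNorm_comp_measurePreserving hf.aestronglyMeasurable
      (Measure.measurePreserving_sub_left volume x)

/-- Young's inequality. -/
theorem eLpNorm_cs_le {p : ℝ≥0∞} (hp : 1 ≤ p) (κ : 𝓢(H, ℂ)) {f : H → ℂ} (hf : Measurable f) :
    eLpNorm (cs κ f) p volume ≤ eLpNorm κ 1 volume * eLpNorm f p volume := by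
  have h3 : Measurable fun q : H × H => ‖κ q.1‖ₑ * ‖f (q.2 - q.1)‖ₑ :=
    (κ.continuous.measurable.comp measurable_fst).enorm.mul
      (hf.comp (measurable_snd.sub measurable_fst)).enorm
  have h2 : ∀ y, eLpNorm (fun x => ‖κ y‖ₑ * ‖f (x - y)‖ₑ) p volume
      ≤ ‖κ y‖ₑ * eLpNorm f p volume := by
    intro y
    have h4 : eLpNorm (fun x => f (x - y)) p volume = eLpNorm f p volume :=
      eLpNorm_comp_measurePreserving hf.aestronglyMeasurable (measurePreserving_sub_right volume y)
    rw [← h4]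
    have h5 : eLpNorm (fun x => ‖κ y‖ₑ * ‖f (x - y)‖ₑ) p volume
        = eLpNorm (κ y • fun x => f (x - y)) p volume := by
      refine eLpNorm_congr_enorm_ae (ae_of_all _ fun x => ?_)
      simp
    rw [h5]
    exact eLpNorm_const_smul_le
  calc eLpNorm (cs κ f) p volume
      ≤ eLpNorm (fun x => ∫⁻ y, ‖κ y‖ₑ * ‖f (x - y)‖ₑ) p volume :=
        eLpNorm_mono_enorm fun x => by simpa using enorm_cs_le κ f x
    _ ≤ ∫⁻ y, ‖κ y‖ₑ * eLpNorm f p volume :=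
        eLpNorm_lintegral_le (a := fun y x => ‖κ y‖ₑ * ‖f (x - y)‖ₑ) hp h3
          (κ.continuous.measurable.enorm.mul_const _) h2
    _ = _ := by
        rw [lintegral_mul_const _ κ.continuous.measurable.enorm, eLpNorm_one_eq_lintegral_enorm]

/-- Hölder's inequality. -/
theorem lintegral_mul_le_eLpNorm {p q : ℝ≥0∞} [ENNReal.HolderTriple q p 1] {f g : H → ℂ}
    (hf : Measurable f) (hg : Measurable g) :
    ∫⁻ y, ‖f y‖ₑ * ‖g y‖ₑ ≤ eLpNorm f q volume * eLpNorm g p volume := by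
  have h := eLpNorm_smul_le_mul_eLpNorm (p := q) (q := p) (r := 1) (μ := volume)
    hg.aestronglyMeasurable hf.aestronglyMeasurable
  rw [eLpNorm_one_eq_lintegral_enorm] at h
  simpa [enorm_mul] using h

theorem enorm_cs_le_mul {p q : ℝ≥0∞} [ENNReal.HolderTriple q p 1] (κ : 𝓢(H, ℂ)) {f : H → ℂ}
    (hf : Measurable f) (x : H) :
    ∫⁻ y, ‖κ y‖ₑ * ‖f (x - y)‖ₑ ≤ eLpNorm κ q volume * eLpNorm f p volume := by
  rw [← eLpNorm_comp_sub_left x hf]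
  exact lintegral_mul_le_eLpNorm κ.continuous.measurable
    (hf.comp (measurable_const.sub measurable_id))

/-- `‖u‖_p ≤ ‖u‖_{p/2}^{1/2} sup |u|^{1/2}`. -/
theorem eLpNorm_le_of_half {p : ℝ} (hp : 0 < p) {u : H → ℂ} {A B : ℝ≥0∞} (hA : A < ⊤)
    (hu : ∀ x, ‖u x‖ₑ ≤ A) (hB : eLpNorm u (ENNReal.ofReal (p / 2)) volume ≤ B) :
    eLpNorm u (ENNReal.ofReal p) volume ≤ (A * B) ^ (1 / 2 : ℝ) := by
  have h0 : ENNReal.ofReal p ≠ 0 := by simpa using hp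
  have h0' : ENNReal.ofReal (p / 2) ≠ 0 := by simpa using hp
  rw [eLpNorm_eq_lintegral_rpow_enorm_toReal h0 ENNReal.ofReal_ne_top, ENNReal.toReal_ofReal hp.le]
  rw [eLpNorm_eq_lintegral_rpow_enorm_toReal h0' ENNReal.ofReal_ne_top,
    ENNReal.toReal_ofReal (by linarith)] at hB
  have hp2 : 0 < p / 2 := by linarith
  calc (∫⁻ x, ‖u x‖ₑ ^ p) ^ (1 / p)
      ≤ (A ^ (p / 2) * ∫⁻ x, ‖u x‖ₑ ^ (p / 2)) ^ (1 / p) := by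
        gcongr
        rw [← lintegral_const_mul' _ _ (ENNReal.rpow_lt_top_of_nonneg hp2.le hA.ne).ne]
        refine lintegral_mono fun x => ?_
        calc ‖u x‖ₑ ^ p = ‖u x‖ₑ ^ (p / 2) * ‖u x‖ₑ ^ (p / 2) := by
              rw [← ENNReal.rpow_add_of_nonneg _ _ hp2.le hp2.le, add_halves]
          _ ≤ _ := by
              gcongr
              exact hu x
    _ = (A * (∫⁻ x, ‖u x‖ₑ ^ (p / 2)) ^ (1 / (p / 2))) ^ (1 / 2 : ℝ) := by
        rw [ENNReal.mul_rpow_of_nonneg _ _ (by positivity),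
          ENNReal.mul_rpow_of_nonneg _ _ (by positivity), ← ENNReal.rpow_mul, ← ENNReal.rpow_mul]
        congr 2 <;> field_simp
    _ ≤ _ := by gcongr

end SpaceConvolution

section FourierSupports

variable {H : Type*} [NormedAddCommGroup H] [InnerProductSpace ℝ H] [FiniteDimensional ℝ H]
  [MeasurableSpace H] [BorelSpace H]

/-- Convolution in terms of the Fourier transform. -/
theorem integral_mul_comp_sub {A : H → ℂ} (hA : Integrable A) (B : 𝓢(H, ℂ)) (a : H) :
    ∫ y, A y * B (a - y) = ∫ ξ, 𝓕 B ξ * (Real.fourierChar (inner ℝ ξ a) * 𝓕 A ξ) := by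
  have h1 : ∀ y, A y * B (a - y) =
      ∫ ξ, 𝓕 B ξ * (Real.fourierChar (inner ℝ ξ a) * (Real.fourierChar (-inner ℝ y ξ) • A y)) := by
    intro y
    have h2 : B (a - y) = ∫ ξ, Real.fourierChar (inner ℝ ξ (a - y)) • 𝓕 B ξ := by
      rw [← Real.fourierInv_eq, ← SchwartzMap.fourierInv_coe,
          FourierTransform.fourierInv_fourier_eq]
    rw [h2, ← integral_const_mul]
    refine integral_congr_ae (ae_of_all _ fun ξ => ?_)
    have h3 : inner ℝ ξ (a - y) = inner ℝ ξ a + -inner ℝ y ξ := by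
      rw [inner_sub_right, real_inner_comm y ξ]; ring
    simp only [h3, AddChar.map_add_eq_mul, Circle.smul_def, smul_eq_mul, Circle.coe_mul]
    ring
  simp only [h1]
  rw [integral_integral_swap]
  · refine integral_congr_ae (ae_of_all _ fun ξ => ?_)
    beta_reduce
    rw [integral_const_mul, integral_const_mul, ← Real.fourier_eq]
  · have h4 : Integrable (fun q : H × H => A q.1 * 𝓕 B q.2) (volume.prod volume) :=
      hA.mul_prod (𝓕 B).integrable
    refine h4.norm.mono' ?_ (ae_of_all _ fun q => ?_)
    · have h5 : Continuous fun q : H × H => 𝓕 B q.2 * (Real.fourierChar (inner ℝ q.2 a) : ℂ) := by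
        fun_prop
      have h6 : Continuous fun q : H × H => (Real.fourierChar (-inner ℝ q.1 q.2) : ℂ) := by fun_prop
      have h7 := (h5.mul h6).aestronglyMeasurable (μ := volume.prod volume) |>.mul
        (hA.aestronglyMeasurable.comp_fst (ν := volume))
      refine h7.congr (ae_of_all _ fun q => ?_)
      simp only [Function.uncurry, Circle.smul_def, smul_eq_mul, Pi.mul_apply]
      ring
    · simp only [Function.uncurry, norm_mul, Circle.norm_smul, Circle.norm_coe]
      exact le_of_eq (by ring)

/-- The integral of a product of three functions whose frequencies do not add up vanishes. -/
theorem integral_mul_mul_eq_zero (A B C : 𝓢(H, ℂ)) (h : ∀ ξ η, 𝓕 A (ξ + η) * 𝓕 B ξ * 𝓕 C η = 0)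
    (a b : H) : ∫ y, (A y * C (b - y)) * B (a - y) = 0 := by
  obtain ⟨M, hM⟩ : ∃ M, ∀ x, ‖C x‖ ≤ M := ⟨_, fun x => SchwartzMap.norm_le_seminorm ℝ C x⟩
  have hAC : Integrable fun y => A y * C (b - y) := by
    have := (A.integrable (μ := volume)).bdd_mul (c := M) (f := fun y => C (b - y))
      (Continuous.aestronglyMeasurable (by fun_prop)) (ae_of_all _ fun y => hM _)
    simpa [mul_comm] using this
  rw [integral_mul_comp_sub hAC]
  refine integral_eq_zero_of_ae (ae_of_all _ fun ξ => ?_)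
  have h1 : 𝓕 (fun y => A y * C (b - y)) ξ =
      ∫ η, 𝓕 C η * (Real.fourierChar (inner ℝ η b) * 𝓕 A (ξ + η)) := by
    have hA' : Integrable fun y => Real.fourierChar (-inner ℝ y ξ) • A y := by
      refine A.integrable.norm.mono' (Continuous.aestronglyMeasurable (by fun_prop))
        (ae_of_all _ fun y => ?_)
      rw [Circle.norm_smul]
    have h2 := integral_mul_comp_sub hA' C b
    rw [Real.fourier_eq]
    simp only [Circle.smul_def, smul_eq_mul, mul_assoc] at h2 ⊢
    rw [h2]
    refine integral_congr_ae (ae_of_all _ fun η => ?_)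
    beta_reduce
    congr 2
    rw [SchwartzMap.fourier_coe, Real.fourier_eq, Real.fourier_eq]
    refine integral_congr_ae (ae_of_all _ fun y => ?_)
    simp only [Circle.smul_def, smul_eq_mul, inner_add_right, neg_add, AddChar.map_add_eq_mul,
      Circle.coe_mul]
    ring
  beta_reduce
  rw [h1, ← integral_const_mul, ← integral_const_mul]
  refine integral_eq_zero_of_ae (ae_of_all _ fun η => ?_)
  beta_reduce
  calc _ = (𝓕 A (ξ + η) * 𝓕 B ξ * 𝓕 C η) *
        (Real.fourierChar (inner ℝ ξ a) * Real.fourierChar (inner ℝ η b)) := by ring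
    _ = 0 := by rw [h, zero_mul]

/-- A product of functions with localised frequencies has no component in frequencies that are
not sums of theirs. -/
theorem cs_mul_eq_zero {p q : ℝ≥0∞} [ENNReal.HolderTriple q p 1] {A B C : 𝓢(H, ℂ)}
    (h : ∀ ξ η, 𝓕 A (ξ + η) * 𝓕 B ξ * 𝓕 C η = 0)
    {f g : H → ℂ} (hf : Measurable f) (hg : Measurable g) (hfp : eLpNorm f p volume < ⊤)
    (hgp : eLpNorm g p volume < ⊤) (hfB : f =ᵐ[volume] cs B f) (hgC : g =ᵐ[volume] cs C g) (x : H) :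
    cs A (fun y => f y * g y) x = 0 := by
  have hsub : ∀ (B : 𝓢(H, ℂ)) (f : H → ℂ) (x : H), cs B f x = ∫ z, B (x - z) * f z := by
    intro B f x
    rw [← integral_sub_left_eq_self _ volume x]
    simp [cs]
  have hq : ∀ (B : 𝓢(H, ℂ)) (f : H → ℂ), Measurable f → eLpNorm f p volume < ⊤ →
      ∃ M : ℝ≥0, ∀ x, ∫⁻ z, ‖B (x - z) * f z‖ₑ ≤ M := by
    intro B f hf hfp
    have hfin : eLpNorm B q volume * eLpNorm f p volume < ⊤ :=
      ENNReal.mul_lt_top (B.memLp q volume).eLpNorm_lt_top hfp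
    refine ⟨(eLpNorm B q volume * eLpNorm f p volume).toNNReal, fun x => ?_⟩
    rw [ENNReal.coe_toNNReal hfin.ne, ← lintegral_sub_left_eq_self _ x]
    simp only [sub_sub_cancel, enorm_mul]
    exact enorm_cs_le_mul B hf x
  -- replace first one function, then the other, by its convolution
  have key : ∀ (A' : H → ℂ) (B : 𝓢(H, ℂ)) (f : H → ℂ), Measurable f → eLpNorm f p volume < ⊤ →
      f =ᵐ[volume] cs B f → Integrable A' →
      ∫ y, A' y * f (x - y) = ∫ z, (∫ y, A' y * B (x - z - y)) * f z := by
    intro A' B f hf hfp hfB hA'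
    obtain ⟨M, hM⟩ := hq B f hf hfp
    have h1 : ∀ᵐ y, f (x - y) = cs B f (x - y) :=
      (Measure.measurePreserving_sub_left volume x).quasiMeasurePreserving.ae hfB
    calc ∫ y, A' y * f (x - y) = ∫ y, ∫ z, A' y * B (x - z - y) * f z := by
          refine integral_congr_ae ?_
          filter_upwards [h1] with y hy
          rw [hy, hsub, ← integral_const_mul]
          refine integral_congr_ae (ae_of_all _ fun z => ?_)
          beta_reduce
          rw [sub_right_comm, mul_assoc]
      _ = ∫ z, ∫ y, A' y * B (x - z - y) * f z := by
          refine integral_integral_swap ?_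
          have hm : AEStronglyMeasurable (fun q : H × H => A' q.1 * B (x - q.2 - q.1) * f q.2)
              (volume.prod volume) := by
            refine (hA'.aestronglyMeasurable.comp_fst.mul
              (Continuous.aestronglyMeasurable (by fun_prop))).mul
              hf.aestronglyMeasurable.comp_snd
          refine ⟨hm, ?_⟩
          rw [hasFiniteIntegral_iff_enorm]
          change ∫⁻ q : H × H, ‖A' q.1 * B (x - q.2 - q.1) * f q.2‖ₑ ∂(volume.prod volume) < ⊤
          rw [lintegral_prod _ hm.enorm]
          calc ∫⁻ y, ∫⁻ z, ‖A' y * B (x - z - y) * f z‖ₑ ≤ ∫⁻ y, ‖A' y‖ₑ * M := by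
                refine lintegral_mono fun y => ?_
                simp only [mul_assoc]
                simp only [enorm_mul (A' y)]
                rw [lintegral_const_mul' _ _ enorm_ne_top]
                gcongr
                simp only [sub_right_comm x _ y]
                exact hM _
            _ < ⊤ := by
                rw [lintegral_mul_const' _ _ ENNReal.coe_ne_top]
                exact ENNReal.mul_lt_top hA'.hasFiniteIntegral ENNReal.coe_lt_top
      _ = _ := by
          refine integral_congr_ae (ae_of_all _ fun z => ?_)
          beta_reduce
          rw [← integral_mul_const]
  have hAf : Integrable fun y => A y * f (x - y) := by
    refine ⟨(A.continuous.measurable.mul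
      (hf.comp (measurable_const.sub measurable_id))).aestronglyMeasurable,
      ?_⟩
    rw [hasFiniteIntegral_iff_enorm]
    simp only [enorm_mul]
    exact (enorm_cs_le_mul (p := p) (q := q) A hf x).trans_lt
      (ENNReal.mul_lt_top (A.memLp q volume).eLpNorm_lt_top hfp)
  have hAC : ∀ b, Integrable fun y => A y * C (b - y) := by
    intro b
    have := (A.integrable (μ := volume)).bdd_mul (c := SchwartzMap.seminorm ℝ 0 0 C)
      (f := fun y => C (b - y)) (Continuous.aestronglyMeasurable (by fun_prop))
      (ae_of_all _ fun y => SchwartzMap.norm_le_seminorm ℝ C _)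
    simpa [mul_comm] using this
  calc cs A (fun y => f y * g y) x = ∫ y, A y * f (x - y) * g (x - y) := by
        simp only [cs, mul_assoc]
    _ = ∫ z, (∫ y, A y * f (x - y) * C (x - z - y)) * g z := key _ C g hg hgp hgC hAf
    _ = ∫ z : H, 0 := by
        refine integral_congr_ae (ae_of_all _ fun z => ?_)
        beta_reduce
        have h1 := key _ B f hf hfp hfB (hAC (x - z))
        simp only [integral_mul_mul_eq_zero A B C h, zero_mul, integral_zero] at h1
        simp only [mul_right_comm] at h1
        rw [h1, zero_mul]
    _ = 0 := by simp

end FourierSupports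

section Bernstein

variable {H : Type*} [NormedAddCommGroup H] [InnerProductSpace ℝ H] [FiniteDimensional ℝ H]
  [MeasurableSpace H] [BorelSpace H] {p : ℝ}

theorem exists_holderTriple (hp : 1 ≤ p) : ∃ q : ℝ≥0∞,
    ENNReal.HolderTriple q (ENNReal.ofReal p) 1 ∧ 1 - (1 / q).toReal = 1 / p := by
  have hp' : 1 ≤ ENNReal.ofReal p := by simpa using hp
  have h1 : (ENNReal.ofReal p)⁻¹ ≤ 1 := ENNReal.inv_le_one.2 hp'
  refine ⟨(1 - (ENNReal.ofReal p)⁻¹)⁻¹, ⟨?_⟩, ?_⟩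
  · rw [inv_inv, tsub_add_cancel_of_le h1, inv_one]
  · rw [one_div, inv_inv, ENNReal.toReal_sub_of_le h1 ENNReal.one_ne_top, ENNReal.toReal_one,
      ENNReal.toReal_inv, ENNReal.toReal_ofReal (by linarith)]
    ring

/-- Bernstein's inequality from `L^p` to bounded functions. -/
theorem exists_enorm_cs_kern_le (hp : 1 ≤ p) (m : 𝓢(H, ℂ)) :
    ∃ C : ℝ≥0, ∀ (j : ℤ) (f : H → ℂ), Measurable f → ∀ x, ‖cs (kern m j) f x‖ₑ ≤
      C * (2 ^ ((Module.finrank ℝ H / p : ℝ) * (j : ℝ)) * eLpNorm f (ENNReal.ofReal p) volume) := by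
  obtain ⟨q, hq, hq'⟩ := exists_holderTriple hp
  have hC : eLpNorm (kern m 0) q volume < ⊤ := ((kern m 0).memLp q volume).eLpNorm_lt_top
  refine ⟨(eLpNorm (kern m 0) q volume).toNNReal, fun j f hf x => ?_⟩
  refine (enorm_cs_le _ _ _).trans
    ((enorm_cs_le_mul (p := ENNReal.ofReal p) (q := q) _ hf x).trans ?_)
  rw [ENNReal.coe_toNNReal hC.ne, eLpNorm_kern, hq', mul_one_div]
  exact le_of_eq (by ring)

theorem eLpNorm_kern_one (m : 𝓢(H, ℂ)) (j : ℤ) :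
    eLpNorm (kern m j) 1 volume = eLpNorm (kern m 0) 1 volume := by
  rw [eLpNorm_kern]
  simp

/-- Bernstein's inequality from `L^{p/2}` to `L^p`. -/
theorem exists_eLpNorm_cs_kern_half_le (hp : 2 ≤ p) (m : 𝓢(H, ℂ)) :
    ∃ C : ℝ≥0, ∀ (j : ℤ) (f : H → ℂ), Measurable f → eLpNorm f (ENNReal.ofReal (p / 2)) volume < ⊤ →
      eLpNorm (cs (kern m j) f) (ENNReal.ofReal p) volume ≤
      C * (2 ^ ((Module.finrank ℝ H / p : ℝ) * (j : ℝ)) *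
        eLpNorm f (ENNReal.ofReal (p / 2)) volume) := by
  have hp2 : 1 ≤ p / 2 := by linarith
  have hp2' : 1 ≤ ENNReal.ofReal (p / 2) := by simpa using hp2
  obtain ⟨C, hC⟩ := exists_enorm_cs_kern_le hp2 m
  have hK : eLpNorm (kern m 0) 1 volume < ⊤ := ((kern m 0).memLp 1 volume).eLpNorm_lt_top
  refine ⟨((C : ℝ≥0∞) * eLpNorm (kern m 0) 1 volume).toNNReal ^ (1 / 2 : ℝ), fun j f hf hfN => ?_⟩
  set X := eLpNorm f (ENNReal.ofReal (p / 2)) volume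
  have h1 : C * ((2 : ℝ≥0∞) ^ ((Module.finrank ℝ H / (p / 2) : ℝ) * (j : ℝ)) * X) < ⊤ :=
    ENNReal.mul_lt_top ENNReal.coe_lt_top (ENNReal.mul_lt_top (two_rpow_lt_top _) hfN)
  refine (eLpNorm_le_of_half (by linarith) h1 (hC j f hf) (eLpNorm_cs_le hp2' _ hf)).trans
    (le_of_eq ?_)
  rw [eLpNorm_kern_one, ENNReal.coe_rpow_of_nonneg _ (by norm_num),
    ENNReal.coe_toNNReal (ENNReal.mul_lt_top ENNReal.coe_lt_top hK).ne]
  have h2 : C * ((2 : ℝ≥0∞) ^ ((Module.finrank ℝ H / (p / 2) : ℝ) * (j : ℝ)) * X) *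
      (eLpNorm (kern m 0) 1 volume * X) = (C * eLpNorm (kern m 0) 1 volume) *
      (2 ^ ((Module.finrank ℝ H / p : ℝ) * (j : ℝ)) * X) ^ (2 : ℝ) := by
    have h3 : (2 : ℝ≥0∞) ^ ((Module.finrank ℝ H / (p / 2) : ℝ) * (j : ℝ)) =
        2 ^ ((Module.finrank ℝ H / p : ℝ) * (j : ℝ)) *
          2 ^ ((Module.finrank ℝ H / p : ℝ) * (j : ℝ)) := by
      rw [← ENNReal.rpow_add _ _ two_ne_zero ENNReal.ofNat_ne_top]
      congr 1
      field_simp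
      ring
    rw [h3, ENNReal.rpow_two]
    ring
  rw [h2, ENNReal.mul_rpow_of_nonneg _ _ (by norm_num), ← ENNReal.rpow_mul]
  norm_num

end Bernstein

section FrequencyArithmetic

variable {H : Type*} [NormedAddCommGroup H] [InnerProductSpace ℝ H] [FiniteDimensional ℝ H]
  [MeasurableSpace H] [BorelSpace H]

theorem block_mul_fat_mul_fat_eq_zero_of_le (Φ : LittlewoodPaley H) {i j k : ℤ}
    (h : max i k + 4 ≤ j) (ξ η : H) : dilate (blockSymbol Φ) j (ξ + η) *
      dilate (fatSymbol Φ) i ξ * dilate (fatSymbol Φ) k η = 0 := by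
  by_contra h0
  have h1 : ¬ ((2 : ℝ) ^ (i + 2) ≤ 2 * Real.pi * ‖ξ‖) := fun h1 => h0 (by
    rw [dilate_fatSymbol_eq_zero Φ (j := i) (Or.inr h1)]; ring)
  have h2 : ¬ ((2 : ℝ) ^ (k + 2) ≤ 2 * Real.pi * ‖η‖) := fun h1 => h0 (by
    rw [dilate_fatSymbol_eq_zero Φ (j := k) (Or.inr h1)]; ring)
  have h3 : ¬ (2 * Real.pi * ‖ξ + η‖ ≤ (2 : ℝ) ^ (j - 1)) := fun h1 => h0 (by
    rw [dilate_blockSymbol_eq_zero Φ (j := j) (Or.inl h1)]; ring)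
  push Not at h1 h2 h3
  have h4 : (2 : ℝ) ^ (i + 2) ≤ 2 ^ (j - 2) := zpow_le_zpow_right₀ one_le_two (by omega)
  have h5 : (2 : ℝ) ^ (k + 2) ≤ 2 ^ (j - 2) := zpow_le_zpow_right₀ one_le_two (by omega)
  have h6 : (2 : ℝ) ^ (j - 1) = 2 * 2 ^ (j - 2) := by
    rw [show j - 1 = (j - 2) + 1 by ring, zpow_add_one₀ two_ne_zero]; ring
  nlinarith [norm_add_le ξ η, Real.pi_pos]

theorem block_mul_fat_mul_fat_eq_zero_of_gap (Φ : LittlewoodPaley H) {i j k : ℤ}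
    (hik : k + 5 ≤ i) (h : j + 4 ≤ i) (ξ η : H) : dilate (blockSymbol Φ) j (ξ + η) *
      dilate (fatSymbol Φ) i ξ * dilate (fatSymbol Φ) k η = 0 := by
  by_contra h0
  have h1 : ¬ (2 * Real.pi * ‖ξ‖ ≤ (2 : ℝ) ^ (i - 2)) := fun h1 => h0 (by
    rw [dilate_fatSymbol_eq_zero Φ (j := i) (Or.inl h1)]; ring)
  have h2 : ¬ ((2 : ℝ) ^ (k + 2) ≤ 2 * Real.pi * ‖η‖) := fun h1 => h0 (by
    rw [dilate_fatSymbol_eq_zero Φ (j := k) (Or.inr h1)]; ring)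
  have h3 : ¬ ((2 : ℝ) ^ (j + 1) ≤ 2 * Real.pi * ‖ξ + η‖) := fun h1 => h0 (by
    rw [dilate_blockSymbol_eq_zero Φ (j := j) (Or.inr h1)]; ring)
  push Not at h1 h2 h3
  have h4 : (2 : ℝ) ^ (k + 2) ≤ 2 ^ (i - 3) := zpow_le_zpow_right₀ one_le_two (by omega)
  have h5 : (2 : ℝ) ^ (j + 1) ≤ 2 ^ (i - 3) := zpow_le_zpow_right₀ one_le_two (by omega)
  have h6 : (2 : ℝ) ^ (i - 2) = 2 * 2 ^ (i - 3) := by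
    rw [show i - 2 = (i - 3) + 1 by ring, zpow_add_one₀ two_ne_zero]; ring
  have h7 : ‖ξ‖ ≤ ‖ξ + η‖ + ‖η‖ := by simpa using norm_sub_le (ξ + η) η
  nlinarith [Real.pi_pos]

end FrequencyArithmetic

section BlockProduct

variable {H : Type*} [NormedAddCommGroup H] [InnerProductSpace ℝ H] [FiniteDimensional ℝ H]
  [MeasurableSpace H] [BorelSpace H]

/-- The decay of the `j`-th block of a product of blocks of indices `i`, `k`, in terms of
`m = j - max i k`. -/
noncomputable def gam (δ : ℝ) (m : ℤ) : ℝ≥0∞ := if m ≤ 3 then 2 ^ (δ * (m : ℝ)) else 0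

theorem tsum_gam_lt_top {δ : ℝ} (hδ : 0 < δ) : ∑' m : ℤ, gam δ m < ⊤ := by
  refine lt_of_le_of_lt (ENNReal.tsum_le_tsum fun m => ?_)
    (tsum_int_min_lt_top hδ hδ (A := 1) (B := 2 ^ (6 * δ)) (by norm_num) (two_rpow_lt_top _))
  rw [gam]
  split_ifs with h
  · rw [one_mul, ← ENNReal.rpow_add _ _ two_ne_zero ENNReal.ofNat_ne_top]
    refine le_min le_rfl (ENNReal.rpow_le_rpow_of_exponent_le (by norm_num) ?_)
    have : (m : ℝ) ≤ 3 := by exact_mod_cast h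
    nlinarith
  · exact zero_le

theorem two_rpow_mul (x y : ℝ) : (2 : ℝ≥0∞) ^ x * 2 ^ y = 2 ^ (x + y) :=
  (ENNReal.rpow_add _ _ two_ne_zero ENNReal.ofNat_ne_top).symm

theorem two_rpow_le {x y : ℝ} (h : x ≤ y) : (2 : ℝ≥0∞) ^ x ≤ 2 ^ y :=
  ENNReal.rpow_le_rpow_of_exponent_le (by norm_num) h

theorem eLpNorm_mul_le_of_bound {p : ℝ≥0∞} {f g : H → ℂ} {A : ℝ≥0∞} (hA : A < ⊤)
    (hf : ∀ᵐ x, ‖f x‖ₑ ≤ A) : eLpNorm (fun x => f x * g x) p volume ≤ A * eLpNorm g p volume := by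
  have h1 : eLpNorm (fun x => f x * g x) p volume ≤ eLpNorm ((A.toNNReal : ℝ) • g) p volume := by
    refine eLpNorm_mono_enorm_ae ?_
    filter_upwards [hf] with x hx
    rw [Pi.smul_apply, enorm_mul, enorm_smul]
    gcongr
    refine hx.trans (le_of_eq ?_)
    rw [Real.enorm_of_nonneg (by positivity), ENNReal.ofReal_coe_nnreal, ENNReal.coe_toNNReal hA.ne]
  refine h1.trans (eLpNorm_const_smul_le.trans (le_of_eq ?_))
  rw [Real.enorm_of_nonneg (by positivity), ENNReal.ofReal_coe_nnreal, ENNReal.coe_toNNReal hA.ne]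

theorem eLpNorm_mul_half_le {p : ℝ} (hp : 0 < p) {f g : H → ℂ} (hf : Measurable f)
    (hg : Measurable g) : eLpNorm (fun x => f x * g x) (ENNReal.ofReal (p / 2)) volume ≤
      eLpNorm f (ENNReal.ofReal p) volume * eLpNorm g (ENNReal.ofReal p) volume := by
  have hH : ENNReal.HolderTriple (ENNReal.ofReal p) (ENNReal.ofReal p)
      (ENNReal.ofReal (p / 2)) := by
    refine ⟨?_⟩
    rw [← ENNReal.ofReal_inv_of_pos hp, ← ENNReal.ofReal_inv_of_pos (by linarith),
      ← ENNReal.ofReal_add (by positivity) (by positivity)]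
    congr 1
    field_simp
    norm_num
  have h := eLpNorm_smul_le_mul_eLpNorm (p := ENNReal.ofReal p) (q := ENNReal.ofReal p)
    (r := ENNReal.ofReal (p / 2)) (μ := (volume : Measure H)) (f := g) (φ := f)
    hg.aestronglyMeasurable hf.aestronglyMeasurable
  exact h

set_option maxHeartbeats 1000000 in
/-- The dyadic blocks of a product of two functions with frequencies of sizes `2ⁱ` and `2ᵏ`. They
vanish for `j` well above `max i k`. Otherwise the low frequency factor is bounded by Bernstein's
inequality, with `δ = s` when `0 < s`; when `s ≤ 0` and the frequencies are comparable, the block is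
estimated in `L^{p/2}` and then in `L^p` by Bernstein's inequality, with `δ = s + d / p`. -/
theorem exists_block_product (Φ : LittlewoodPaley H) {p s : ℝ} (hp : 1 ≤ p)
    (hsa : s ≤ Module.finrank ℝ H / p)
    (hs : 0 < s ∨ 2 ≤ p ∧ 0 < s + Module.finrank ℝ H / p) :
    ∃ (C : ℝ≥0) (δ : ℝ), 0 < δ ∧ ∀ (i j k : ℤ) (f g : H → ℂ), Measurable f → Measurable g →
      eLpNorm f (ENNReal.ofReal p) volume < ⊤ → eLpNorm g (ENNReal.ofReal p) volume < ⊤ →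
      f =ᵐ[volume] cs (kern (fatSymbol Φ) i) f → g =ᵐ[volume] cs (kern (fatSymbol Φ) k) g →
      2 ^ (s * (j : ℝ)) * eLpNorm (cs (kern (blockSymbol Φ) j) fun x => f x * g x)
        (ENNReal.ofReal p) volume ≤ C * gam δ (j - max i k) *
          ((2 ^ (s * (i : ℝ)) * eLpNorm f (ENNReal.ofReal p) volume) *
          (2 ^ (Module.finrank ℝ H / p * (k : ℝ)) * eLpNorm g (ENNReal.ofReal p) volume)) := by
  set a : ℝ := Module.finrank ℝ H / p with ha
  have ha0 : 0 ≤ a := by positivity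
  have hp1 : 1 ≤ ENNReal.ofReal p := by simpa using hp
  obtain ⟨q, hq, -⟩ := exists_holderTriple hp
  obtain ⟨CB, hCB⟩ := exists_enorm_cs_kern_le hp (fatSymbol Φ)
  set K := eLpNorm (kern (blockSymbol Φ) 0) 1 volume with hK
  have hKfin : K < ⊤ := ((kern (blockSymbol Φ) 0).memLp 1 volume).eLpNorm_lt_top
  -- the bounds obtained from Hölder's and Young's inequalities
  have hinf : ∀ (i : ℤ) (f : H → ℂ), Measurable f → f =ᵐ[volume] cs (kern (fatSymbol Φ) i) f →
      ∀ᵐ x, ‖f x‖ₑ ≤ CB * (2 ^ (a * (i : ℝ)) * eLpNorm f (ENNReal.ofReal p) volume) := by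
    intro i f hf hfi
    filter_upwards [hfi] with x hx
    rw [hx]
    exact hCB i f hf x
  have hlow : ∀ (i j : ℤ) (f g : H → ℂ), Measurable f → Measurable g →
      eLpNorm f (ENNReal.ofReal p) volume < ⊤ → f =ᵐ[volume] cs (kern (fatSymbol Φ) i) f →
      eLpNorm (cs (kern (blockSymbol Φ) j) fun x => f x * g x) (ENNReal.ofReal p) volume ≤
        (K * CB) * (2 ^ (a * (i : ℝ)) * (eLpNorm f (ENNReal.ofReal p) volume *
          eLpNorm g (ENNReal.ofReal p) volume)) := by
    intro i j f g hf hg hfp hfi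
    have hA : CB * ((2 : ℝ≥0∞) ^ (a * (i : ℝ)) * eLpNorm f (ENNReal.ofReal p) volume) < ⊤ :=
      ENNReal.mul_lt_top ENNReal.coe_lt_top (ENNReal.mul_lt_top (two_rpow_lt_top _) hfp)
    refine (eLpNorm_cs_le hp1 _ (hf.mul hg)).trans ?_
    rw [eLpNorm_kern_one, ← hK]
    calc K * eLpNorm (fun x => f x * g x) (ENNReal.ofReal p) volume
        ≤ K * ((CB * ((2 : ℝ≥0∞) ^ (a * (i : ℝ)) * eLpNorm f (ENNReal.ofReal p) volume)) *
          eLpNorm g (ENNReal.ofReal p) volume) := by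
          gcongr
          exact eLpNorm_mul_le_of_bound hA (hinf i f hf hfi)
      _ = _ := by ring
  -- the bound for frequencies of comparable sizes
  obtain ⟨CM, δ, hδ, hM⟩ : ∃ (CM : ℝ≥0) (δ : ℝ), 0 < δ ∧ ∀ (i j k : ℤ) (f g : H → ℂ),
      Measurable f → Measurable g →
      eLpNorm f (ENNReal.ofReal p) volume < ⊤ → eLpNorm g (ENNReal.ofReal p) volume < ⊤ →
      f =ᵐ[volume] cs (kern (fatSymbol Φ) i) f → g =ᵐ[volume] cs (kern (fatSymbol Φ) k) g →
      i ≤ k + 4 → k ≤ i + 4 →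
      2 ^ (s * (j : ℝ)) * eLpNorm (cs (kern (blockSymbol Φ) j) fun x => f x * g x)
        (ENNReal.ofReal p) volume ≤ CM * (2 ^ (δ * ((j - max i k : ℤ) : ℝ)) *
          ((2 ^ (s * (i : ℝ)) * eLpNorm f (ENNReal.ofReal p) volume) *
          (2 ^ (a * (k : ℝ)) * eLpNorm g (ENNReal.ofReal p) volume))) := by
    rcases hs with hs | ⟨hp2, hs⟩
    · have hc : K * CB * 2 ^ (4 * s) < ⊤ := ENNReal.mul_lt_top
        (ENNReal.mul_lt_top hKfin ENNReal.coe_lt_top) (two_rpow_lt_top _)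
      refine ⟨(K * CB * 2 ^ (4 * s)).toNNReal, s, hs, ?_⟩
      rw [ENNReal.coe_toNNReal hc.ne]
      intro i j k f g hf hg hfp hgp hfi hgk hik hki
      have h1 := hlow k j g f hg hf hgp hgk
      simp only [mul_comm (g _)] at h1
      set X := eLpNorm f (ENNReal.ofReal p) volume
      set Y := eLpNorm g (ENNReal.ofReal p) volume
      have hmax : ((max i k : ℤ) : ℝ) ≤ i + 4 := by
        exact_mod_cast (max_le (by omega) hki : max i k ≤ i + 4)
      have h2 : (2 : ℝ≥0∞) ^ (s * (j : ℝ)) ≤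
          2 ^ (4 * s) * (2 ^ (s * ((j - max i k : ℤ) : ℝ)) * 2 ^ (s * (i : ℝ))) := by
        rw [two_rpow_mul, two_rpow_mul]
        apply two_rpow_le
        rw [Int.cast_sub]
        nlinarith
      calc _ ≤ (2 ^ (4 * s) * (2 ^ (s * ((j - max i k : ℤ) : ℝ)) * 2 ^ (s * (i : ℝ)))) *
            ((K * CB) * (2 ^ (a * (k : ℝ)) * (Y * X))) := by gcongr
        _ = _ := by ring
    · obtain ⟨C3, hC3⟩ := exists_eLpNorm_cs_kern_half_le hp2 (blockSymbol Φ)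
      have hc : (C3 : ℝ≥0∞) * 2 ^ (4 * |s| + 4 * a) < ⊤ := ENNReal.mul_lt_top
        ENNReal.coe_lt_top (two_rpow_lt_top _)
      refine ⟨((C3 : ℝ≥0∞) * 2 ^ (4 * |s| + 4 * a)).toNNReal, s + a, hs, ?_⟩
      rw [ENNReal.coe_toNNReal hc.ne]
      intro i j k f g hf hg hfp hgp hfi hgk hik hki
      have h0 := eLpNorm_mul_half_le (p := p) (by linarith) hf hg
      have h1 := hC3 j _ (hf.mul hg) (h0.trans_lt (ENNReal.mul_lt_top hfp hgp))
      set X := eLpNorm f (ENNReal.ofReal p) volume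
      set Y := eLpNorm g (ENNReal.ofReal p) volume
      have hmax1 : ((max i k : ℤ) : ℝ) ≤ i + 4 := by
        exact_mod_cast (max_le (by omega) hki : max i k ≤ i + 4)
      have hmax2 : ((max i k : ℤ) : ℝ) ≤ k + 4 := by
        exact_mod_cast (max_le hik (by omega) : max i k ≤ k + 4)
      have hmax3 : (i : ℝ) ≤ ((max i k : ℤ) : ℝ) := by exact_mod_cast le_max_left i k
      have h2 : (2 : ℝ≥0∞) ^ (s * (j : ℝ)) * 2 ^ (a * (j : ℝ)) ≤
          2 ^ (4 * |s| + 4 * a) * (2 ^ ((s + a) * ((j - max i k : ℤ) : ℝ)) *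
            (2 ^ (s * (i : ℝ)) * 2 ^ (a * (k : ℝ)))) := by
        rw [two_rpow_mul, two_rpow_mul, two_rpow_mul, two_rpow_mul]
        apply two_rpow_le
        rw [Int.cast_sub]
        have h3 : s * (((max i k : ℤ) : ℝ) - i) ≤ |s| * 4 := by
          refine mul_le_mul (le_abs_self s) (by linarith) (by linarith) (abs_nonneg s)
        nlinarith
      calc _ ≤ 2 ^ (s * (j : ℝ)) * (C3 * (2 ^ (a * (j : ℝ)) * (X * Y))) := by
            gcongr
            exact h1.trans (by gcongr; exact h0)
        _ = C3 * (X * Y) * (2 ^ (s * (j : ℝ)) * 2 ^ (a * (j : ℝ))) := by ring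
        _ ≤ C3 * (X * Y) * (2 ^ (4 * |s| + 4 * a) * (2 ^ ((s + a) * ((j - max i k : ℤ) : ℝ)) *
            (2 ^ (s * (i : ℝ)) * 2 ^ (a * (k : ℝ))))) := by gcongr
        _ = _ := by ring
  have hc : K * CB * 2 ^ (3 * |s - δ|) < ⊤ := ENNReal.mul_lt_top
    (ENNReal.mul_lt_top hKfin ENNReal.coe_lt_top) (two_rpow_lt_top _)
  refine ⟨CM + (K * CB * 2 ^ (3 * |s - δ|)).toNNReal, δ, hδ, ?_⟩
  rw [ENNReal.coe_add, ENNReal.coe_toNNReal hc.ne]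
  intro i j k f g hf hg hfp hgp hfi hgk
  -- blocks at frequencies that are not sums of those of the factors vanish
  have hzero : (∀ ξ η, dilate (blockSymbol Φ) j (ξ + η) * dilate (fatSymbol Φ) i ξ *
      dilate (fatSymbol Φ) k η = 0) → 2 ^ (s * (j : ℝ)) *
      eLpNorm (cs (kern (blockSymbol Φ) j) fun x => f x * g x) (ENNReal.ofReal p) volume = 0 := by
    intro h
    have h1 : cs (kern (blockSymbol Φ) j) (fun x => f x * g x) = 0 := by
      funext x
      refine cs_mul_eq_zero (p := ENNReal.ofReal p) (q := q) ?_ hf hg hfp hgp hfi hgk x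
      simpa only [fourier_kern] using h
    rw [h1, eLpNorm_zero, mul_zero]
  by_cases hj : max i k + 4 ≤ j
  · rw [hzero (block_mul_fat_mul_fat_eq_zero_of_le Φ hj)]
    exact zero_le
  rw [gam, if_pos (by omega)]
  have hshift : ∀ m : ℤ, j - m ≤ 3 → -3 ≤ j - m → (2 : ℝ≥0∞) ^ (s * (j : ℝ)) ≤
      2 ^ (3 * |s - δ|) * 2 ^ (δ * ((j - m : ℤ) : ℝ)) * 2 ^ (s * (m : ℝ)) := by
    intro m h1 h2
    rw [two_rpow_mul, two_rpow_mul]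
    apply two_rpow_le
    have h3 : |((j - m : ℤ) : ℝ)| ≤ 3 := by
      rw [abs_le]
      exact ⟨by exact_mod_cast h2, by exact_mod_cast h1⟩
    have h4 : (s - δ) * ((j - m : ℤ) : ℝ) ≤ |s - δ| * 3 := by
      refine (le_abs_self _).trans ?_
      rw [abs_mul]
      gcongr
    rw [Int.cast_sub] at h4 ⊢
    nlinarith
  set X := eLpNorm f (ENNReal.ofReal p) volume with hX
  set Y := eLpNorm g (ENNReal.ofReal p) volume with hY
  rcases le_or_gt (k + 5) i with hik | hik
  · have hmax : max i k = i := max_eq_left (by omega)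
    by_cases hj' : j + 4 ≤ i
    · rw [hzero (block_mul_fat_mul_fat_eq_zero_of_gap Φ hik hj')]
      exact zero_le
    have h1 := hlow k j g f hg hf hgp hgk
    simp only [mul_comm (g _)] at h1
    rw [hmax] at hj ⊢
    calc _ ≤ (2 ^ (3 * |s - δ|) * 2 ^ (δ * ((j - i : ℤ) : ℝ)) * 2 ^ (s * (i : ℝ))) *
          ((K * CB) * (2 ^ (a * (k : ℝ)) * (Y * X))) := by
          gcongr
          exact hshift i (by omega) (by omega)
      _ = (K * CB * 2 ^ (3 * |s - δ|)) * 2 ^ (δ * ((j - i : ℤ) : ℝ)) *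
          (2 ^ (s * (i : ℝ)) * X * (2 ^ (a * (k : ℝ)) * Y)) := by ring
      _ ≤ _ := by
          gcongr
          exact le_add_self
  rcases le_or_gt (i + 5) k with hki | hki
  · have hmax : max i k = k := max_eq_right (by omega)
    by_cases hj' : j + 4 ≤ k
    · rw [hzero (fun ξ η => ?_)]
      · exact zero_le
      · have := block_mul_fat_mul_fat_eq_zero_of_gap Φ hki hj' η ξ
        rw [add_comm ξ η]
        linear_combination this
    have h1 := hlow i j f g hf hg hfp hfi
    rw [hmax] at hj ⊢
    have h2 : (2 : ℝ≥0∞) ^ (s * (k : ℝ)) * 2 ^ (a * (i : ℝ)) ≤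
        2 ^ (s * (i : ℝ)) * 2 ^ (a * (k : ℝ)) := by
      rw [two_rpow_mul, two_rpow_mul]
      apply two_rpow_le
      have h3 : (i : ℝ) ≤ k := by exact_mod_cast (by omega : i ≤ k)
      nlinarith
    calc _ ≤ (2 ^ (3 * |s - δ|) * 2 ^ (δ * ((j - k : ℤ) : ℝ)) * 2 ^ (s * (k : ℝ))) *
          ((K * CB) * (2 ^ (a * (i : ℝ)) * (X * Y))) := by
          gcongr
          exact hshift k (by omega) (by omega)
      _ = (K * CB * 2 ^ (3 * |s - δ|)) * 2 ^ (δ * ((j - k : ℤ) : ℝ)) *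
          ((2 ^ (s * (k : ℝ)) * 2 ^ (a * (i : ℝ))) * (X * Y)) := by ring
      _ ≤ (K * CB * 2 ^ (3 * |s - δ|)) * 2 ^ (δ * ((j - k : ℤ) : ℝ)) *
          ((2 ^ (s * (i : ℝ)) * 2 ^ (a * (k : ℝ))) * (X * Y)) := by gcongr
      _ = (K * CB * 2 ^ (3 * |s - δ|)) * 2 ^ (δ * ((j - k : ℤ) : ℝ)) *
          (2 ^ (s * (i : ℝ)) * X * (2 ^ (a * (k : ℝ)) * Y)) := by ring
      _ ≤ _ := by
          gcongr
          exact le_add_self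
  · refine (hM i j k f g hf hg hfp hgp hfi hgk (by omega) (by omega)).trans ?_
    rw [← mul_assoc]
    gcongr
    exact le_self_add

end BlockProduct

end CheminLerner

/-! ### Products of series of blocks in the space variable -/

namespace CheminLerner

open FourierTransform

section BlockSums

variable {H : Type*} [NormedAddCommGroup H] [InnerProductSpace ℝ H] [FiniteDimensional ℝ H]
  [MeasurableSpace H] [BorelSpace H]

theorem tsum_prod_mul {α β : Type*} (u : α → ℝ≥0∞) (v : β → ℝ≥0∞) :
    ∑' q : α × β, u q.1 * v q.2 = (∑' i, u i) * ∑' k, v k := by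
  rw [ENNReal.tsum_prod (f := fun i k => u i * v k)]
  simp only [ENNReal.tsum_mul_left, ENNReal.tsum_mul_right]

theorem integrable_cs {p : ℝ} (hp : 1 ≤ p) (κ : 𝓢(H, ℂ)) {f : H → ℂ} (hf : Measurable f)
    (hfp : eLpNorm f (ENNReal.ofReal p) volume < ⊤) (x : H) :
    Integrable fun y => κ y * f (x - y) := by
  obtain ⟨q, hq, -⟩ := exists_holderTriple hp
  refine ⟨(κ.continuous.measurable.mul (hf.comp (measurable_const.sub
    measurable_id))).aestronglyMeasurable, ?_⟩
  have h := enorm_cs_le_mul (p := ENNReal.ofReal p) (q := q) κ hf x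
  simp only [HasFiniteIntegral, enorm_mul]
  exact h.trans_lt (ENNReal.mul_lt_top (κ.memLp q volume).eLpNorm_lt_top hfp)

theorem integrable_cs_of_bound (κ : 𝓢(H, ℂ)) {f : H → ℂ} (hf : Measurable f) {A : ℝ≥0∞}
    (hA : A < ⊤) (h : ∀ᵐ x, ‖f x‖ₑ ≤ A) (x : H) : Integrable fun y => κ y * f (x - y) := by
  refine ⟨(κ.continuous.measurable.mul (hf.comp (measurable_const.sub
    measurable_id))).aestronglyMeasurable, ?_⟩
  simp only [HasFiniteIntegral, enorm_mul]
  have h1 : ∀ᵐ y, ‖f (x - y)‖ₑ ≤ A :=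
    (Measure.measurePreserving_sub_left volume x).quasiMeasurePreserving.ae h
  calc ∫⁻ y, ‖κ y‖ₑ * ‖f (x - y)‖ₑ ≤ ∫⁻ y, ‖κ y‖ₑ * A :=
        lintegral_mono_ae (h1.mono fun y hy => by gcongr)
    _ = (∫⁻ y, ‖κ y‖ₑ) * A := lintegral_mul_const _ κ.continuous.measurable.enorm
    _ < ⊤ := ENNReal.mul_lt_top κ.integrable.2 hA

/-- Convolution with a Schwartz function commutes with series of functions whose uniform norms are
summable. -/
theorem eLpNorm_cs_le_tsum {ι : Type*} [Countable ι] {p : ℝ≥0∞} (hp : 1 ≤ p) (κ : 𝓢(H, ℂ))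
    {u : ι → H → ℂ} {U : H → ℂ} (hu : ∀ i, Measurable (u i))
    (hU : ∀ᵐ x, HasSum (fun i => u i x) (U x)) {A : ι → ℝ≥0∞} (hA : ∑' i, A i < ⊤)
    (hb : ∀ i, ∀ᵐ x, ‖u i x‖ₑ ≤ A i) :
    eLpNorm (cs κ U) p volume ≤ ∑' i, eLpNorm (cs κ (u i)) p volume := by
  have h1 : ∀ x, ‖cs κ U x‖ₑ ≤ ∑' i, ‖cs κ (u i) x‖ₑ := by
    intro x
    have hmp := (Measure.measurePreserving_sub_left (volume : Measure H) x).quasiMeasurePreserving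
    have hAi : ∀ i, A i < ⊤ := fun i => (ENNReal.le_tsum i).trans_lt hA
    have hint : ∀ i, Integrable fun y => κ y * u i (x - y) := fun i =>
      integrable_cs_of_bound κ (hu i) (hAi i) (hb i) x
    have hsum : ∑' i, ∫⁻ y, ‖κ y * u i (x - y)‖ₑ ≤ (∫⁻ y, ‖κ y‖ₑ) * ∑' i, A i := by
      rw [← ENNReal.tsum_mul_left]
      refine ENNReal.tsum_le_tsum fun i => ?_
      rw [← lintegral_mul_const _ κ.continuous.measurable.enorm]
      refine lintegral_mono_ae ((hmp.ae (hb i)).mono fun y hy => ?_)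
      rw [enorm_mul]
      gcongr
    have hfin : ∑' i, ∫⁻ y, ‖κ y * u i (x - y)‖ₑ < ⊤ :=
      hsum.trans_lt (ENNReal.mul_lt_top κ.integrable.2 hA)
    have hs : Summable fun i => ∫ y, ‖κ y * u i (x - y)‖ := by
      have h2 : ∀ i, ∫ y, ‖κ y * u i (x - y)‖ = (∫⁻ y, ‖κ y * u i (x - y)‖ₑ).toReal := fun i =>
        integral_norm_eq_lintegral_enorm (hint i).1
      simp only [h2]
      exact ENNReal.summable_toReal hfin.ne
    have h3 := hasSum_integral_of_summable_integral_norm hint hs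
    have h4 : ∫ y, ∑' i, κ y * u i (x - y) = cs κ U x := by
      refine integral_congr_ae ((hmp.ae hU).mono fun y hy => ?_)
      exact (HasSum.mul_left _ hy).tsum_eq
    rw [h4] at h3
    rw [← h3.tsum_eq]
    exact enorm_tsum_le_tsum_enorm
  calc eLpNorm (cs κ U) p volume ≤ eLpNorm (fun x => ∑' i, ‖cs κ (u i) x‖ₑ) p volume :=
        eLpNorm_mono_enorm fun x => by simpa using h1 x
    _ ≤ ∑' i, eLpNorm (fun x => ‖cs κ (u i) x‖ₑ) p volume :=
        eLpNorm_tsum_le hp fun i => (measurable_cs κ (hu i)).enorm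
    _ = _ := by simp only [eLpNorm_enorm]

theorem cs_sub {p : ℝ} (hp : 1 ≤ p) (κ : 𝓢(H, ℂ)) {f g : H → ℂ} (hf : Measurable f)
    (hg : Measurable g) (hfp : eLpNorm f (ENNReal.ofReal p) volume < ⊤)
    (hgp : eLpNorm g (ENNReal.ofReal p) volume < ⊤) :
    cs κ (fun x => f x - g x) = fun x => cs κ f x - cs κ g x := by
  funext x
  rw [cs, cs, cs, ← integral_sub (integrable_cs hp κ hf hfp x) (integrable_cs hp κ hg hgp x)]
  simp only [mul_sub]

theorem cs_sub_of_bound (κ : 𝓢(H, ℂ)) {f g : H → ℂ} (hf : Measurable f)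
    (hg : Measurable g) {A B : ℝ≥0∞} (hA : A < ⊤) (hB : B < ⊤) (hfA : ∀ᵐ x, ‖f x‖ₑ ≤ A)
    (hgB : ∀ᵐ x, ‖g x‖ₑ ≤ B) :
    cs κ (fun x => f x - g x) = fun x => cs κ f x - cs κ g x := by
  funext x
  rw [cs, cs, cs, ← integral_sub (integrable_cs_of_bound κ hf hA hfA x)
    (integrable_cs_of_bound κ hg hB hgB x)]
  simp only [mul_sub]

/-- The critical Besov norm `∑ 2^{id/p} ‖f i‖_p` of a family of blocks. -/
noncomputable def bN (p : ℝ) (f : ℤ → H → ℂ) : ℝ≥0∞ :=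
  ∑' i : ℤ, 2 ^ (Module.finrank ℝ H / p * (i : ℝ)) * eLpNorm (f i) (ENNReal.ofReal p) volume

/-- `D` is the sum of the functions `f i`, whose frequencies are localised as those of the dyadic
blocks of index `i`, and whose critical Besov norm is finite. -/
structure IsBlockSum (Φ : LittlewoodPaley H) (p : ℝ) (f : ℤ → H → ℂ) (D : H → ℂ) : Prop where
  measurable : ∀ i, Measurable (f i)
  measurable_sum : Measurable D
  eq_fat : ∀ i, f i =ᵐ[volume] cs (kern (fatSymbol Φ) i) (f i)
  bN_lt_top : bN p f < ⊤
  hasSum : ∀ᵐ x, HasSum (fun i => f i x) (D x)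

variable {Φ : LittlewoodPaley H} {p : ℝ} {f g : ℤ → H → ℂ} {D E : H → ℂ}

theorem eLpNorm_lt_top_of_bN (h : bN p f < ⊤) (i : ℤ) :
    eLpNorm (f i) (ENNReal.ofReal p) volume < ⊤ := by
  have h1 := (ENNReal.le_tsum i).trans_lt h
  refine lt_top_iff_ne_top.2 fun h2 => ?_
  rw [h2, ENNReal.mul_top (ENNReal.rpow_pos (by norm_num) (by norm_num)).ne'] at h1
  exact lt_irrefl _ h1

theorem exists_bernstein (Φ : LittlewoodPaley H) (hp : 1 ≤ p) : ∃ C : ℝ≥0,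
    ∀ (i : ℤ) (f : H → ℂ), Measurable f → f =ᵐ[volume] cs (kern (fatSymbol Φ) i) f →
      ∀ᵐ x, ‖f x‖ₑ ≤ C * (2 ^ (Module.finrank ℝ H / p * (i : ℝ)) *
        eLpNorm f (ENNReal.ofReal p) volume) := by
  obtain ⟨C, hC⟩ := exists_enorm_cs_kern_le hp (fatSymbol Φ)
  refine ⟨C, fun i f hf h => ?_⟩
  filter_upwards [h] with x hx
  rw [hx]
  exact hC i f hf x

theorem exists_enorm_le_bN (Φ : LittlewoodPaley H) (hp : 1 ≤ p) : ∃ C : ℝ≥0,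
    ∀ (f : ℤ → H → ℂ) (D : H → ℂ), IsBlockSum Φ p f D → ∀ᵐ x, ‖D x‖ₑ ≤ C * bN p f := by
  obtain ⟨C, hC⟩ := exists_bernstein Φ hp
  refine ⟨C, fun f D h => ?_⟩
  have h1 := ae_all_iff.2 fun i => hC i (f i) (h.measurable i) (h.eq_fat i)
  filter_upwards [h1, h.hasSum] with x hx hx'
  rw [← hx'.tsum_eq, bN, ← ENNReal.tsum_mul_left]
  exact enorm_tsum_le_tsum_enorm.trans (ENNReal.tsum_le_tsum hx)

theorem IsBlockSum.sub (hp : 1 ≤ p) (hf : IsBlockSum Φ p f D) (hg : IsBlockSum Φ p g E) :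
    IsBlockSum Φ p (fun i x => f i x - g i x) (fun x => D x - E x) where
  measurable i := (hf.measurable i).sub (hg.measurable i)
  measurable_sum := hf.measurable_sum.sub hg.measurable_sum
  eq_fat i := by
    rw [cs_sub hp _ (hf.measurable i) (hg.measurable i) (eLpNorm_lt_top_of_bN hf.bN_lt_top i)
      (eLpNorm_lt_top_of_bN hg.bN_lt_top i)]
    filter_upwards [hf.eq_fat i, hg.eq_fat i] with x h1 h2
    rw [← h1, ← h2]
  bN_lt_top := by
    refine lt_of_le_of_lt ?_ (ENNReal.add_lt_top.2 ⟨hf.bN_lt_top, hg.bN_lt_top⟩)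
    rw [bN, bN, bN, ← ENNReal.tsum_add]
    refine ENNReal.tsum_le_tsum fun i => ?_
    rw [← mul_add]
    gcongr
    exact eLpNorm_sub_le (hf.measurable i).aestronglyMeasurable
      (hg.measurable i).aestronglyMeasurable (by simpa using hp)
  hasSum := by
    filter_upwards [hf.hasSum, hg.hasSum] with x h1 h2
    exact h1.sub h2

/-- The `j`-th block of a product of two sums of blocks. -/
theorem exists_cs_product_le (Φ : LittlewoodPaley H) {p s : ℝ} (hp : 1 ≤ p)
    (hsa : s ≤ Module.finrank ℝ H / p)
    (hs : 0 < s ∨ 2 ≤ p ∧ 0 < s + Module.finrank ℝ H / p) :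
    ∃ (C : ℝ≥0) (δ : ℝ), 0 < δ ∧ ∀ (j : ℤ) (f g : ℤ → H → ℂ) (D E : H → ℂ),
      IsBlockSum Φ p f D → IsBlockSum Φ p g E →
      2 ^ (s * (j : ℝ)) * eLpNorm (cs (kern (blockSymbol Φ) j) fun x => D x * E x)
        (ENNReal.ofReal p) volume ≤ ∑' q : ℤ × ℤ, C * gam δ (j - max q.1 q.2) *
          ((2 ^ (s * (q.1 : ℝ)) * eLpNorm (f q.1) (ENNReal.ofReal p) volume) *
          (2 ^ (Module.finrank ℝ H / p * (q.2 : ℝ)) *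
            eLpNorm (g q.2) (ENNReal.ofReal p) volume)) := by
  obtain ⟨C, δ, hδ, hC⟩ := exists_block_product Φ hp hsa hs
  obtain ⟨B, hB⟩ := exists_bernstein Φ hp
  refine ⟨C, δ, hδ, fun j f g D E hf hg => ?_⟩
  have hsum : ∀ᵐ x, HasSum (fun q : ℤ × ℤ => f q.1 x * g q.2 x) (D x * E x) := by
    filter_upwards [hf.hasSum, hg.hasSum] with x h1 h2
    exact HasSum.mul (f := fun i => f i x) (g := fun k => g k x) h1 h2
      (summable_mul_of_summable_norm (f := fun i => f i x) (g := fun k => g k x)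
        h1.summable.norm h2.summable.norm)
  obtain ⟨u, hu⟩ : ∃ u : ℤ → ℝ≥0∞, u = fun i : ℤ => B * (2 ^ (Module.finrank ℝ H / p * (i : ℝ)) *
      eLpNorm (f i) (ENNReal.ofReal p) volume) := ⟨_, rfl⟩
  obtain ⟨v, hv⟩ : ∃ v : ℤ → ℝ≥0∞, v = fun k : ℤ => B * (2 ^ (Module.finrank ℝ H / p * (k : ℝ)) *
      eLpNorm (g k) (ENNReal.ofReal p) volume) := ⟨_, rfl⟩
  have hA : ∑' q : ℤ × ℤ, u q.1 * v q.2 < ⊤ := by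
    rw [tsum_prod_mul, hu, hv, ENNReal.tsum_mul_left, ENNReal.tsum_mul_left]
    exact ENNReal.mul_lt_top (ENNReal.mul_lt_top ENNReal.coe_lt_top hf.bN_lt_top)
      (ENNReal.mul_lt_top ENNReal.coe_lt_top hg.bN_lt_top)
  have h1 := eLpNorm_cs_le_tsum (p := ENNReal.ofReal p) (by simpa using hp)
    (kern (blockSymbol Φ) j) (u := fun (q : ℤ × ℤ) x => f q.1 x * g q.2 x)
    (fun q => (hf.measurable q.1).mul (hg.measurable q.2)) hsum hA (by
      intro q
      filter_upwards [hB q.1 _ (hf.measurable q.1) (hf.eq_fat q.1),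
        hB q.2 _ (hg.measurable q.2) (hg.eq_fat q.2)] with x h1 h2
      rw [enorm_mul, hu, hv]
      exact mul_le_mul' h1 h2)
  refine (mul_le_mul' le_rfl h1).trans ?_
  rw [← ENNReal.tsum_mul_left]
  exact ENNReal.tsum_le_tsum fun q => hC q.1 j q.2 _ _ (hf.measurable _) (hg.measurable _)
    (eLpNorm_lt_top_of_bN hf.bN_lt_top _) (eLpNorm_lt_top_of_bN hg.bN_lt_top _)
    (hf.eq_fat _) (hg.eq_fat _)

end BlockSums

end CheminLerner

/-! ### Functions on space-time as sums of blocks in the space variable -/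

namespace CheminLerner

open FourierTransform

section Families

variable {n : ℕ} {ρ : ℝ≥0∞} {p : ℝ}

/-- The norm of `L̃^ρ(ℝ; Ḃ^{(n-1)/p}_{p,1})` of a family of blocks. -/
noncomputable def lN (ρ : ℝ≥0∞) (p : ℝ) (F : ℤ → ℝ × Bdry n → ℂ) : ℝ≥0∞ :=
  ∑' i : ℤ, 2 ^ (Module.finrank ℝ (Bdry n) / p * (i : ℝ)) * nrm ρ (ENNReal.ofReal p) (F i)

/-- `D` is the sum of the functions `F i`, which at each time are frequency-localised blocks. -/
structure IsBlockFamily (Φ : LittlewoodPaley (Bdry n)) (ρ : ℝ≥0∞) (p : ℝ)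
    (F : ℤ → ℝ × Bdry n → ℂ) (D : ℝ × Bdry n → ℂ) : Prop where
  measurable : ∀ i, Measurable (F i)
  measurable_sum : Measurable D
  fibre : ∀ t, IsBlockSum Φ p (fun i x => F i (t, x)) fun x => D (t, x)
  lN_lt_top : lN ρ p F < ⊤
  hasSum : ∀ᵐ z, HasSum (fun i => F i z) (D z)

theorem cvx_apply (κ : 𝓢(Bdry n, ℂ)) (f : ℝ × Bdry n → ℂ) (t : ℝ) (x : Bdry n) :
    cvx κ f (t, x) = cs κ (fun x => f (t, x)) x := by
  simp [cv, cs]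

theorem measurable_eLpNorm_fibre {P : ℝ≥0∞} {f : ℝ × Bdry n → ℂ} (hf : Measurable f) :
    Measurable fun t => eLpNorm (fun x => f (t, x)) P volume := by
  have h := measurable_eLpNorm_section (ν := (volume : Measure (Bdry n))) P
    (a := fun z => ‖f z‖ₑ) hf.enorm
  simpa only [eLpNorm_enorm] using h

theorem measurable_bN {F : ℤ → ℝ × Bdry n → ℂ} (hF : ∀ i, Measurable (F i)) :
    Measurable fun t => bN p fun i x => F i (t, x) := by
  exact Measurable.tsum fun i => (measurable_eLpNorm_fibre (hF i)).const_mul _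

theorem eLpNorm_bN_le (hρ : 1 ≤ ρ) {F : ℤ → ℝ × Bdry n → ℂ} (hF : ∀ i, Measurable (F i)) :
    eLpNorm (fun t => bN p fun i x => F i (t, x)) ρ volume ≤ lN ρ p F := by
  have hm : ∀ i, Measurable fun t => eLpNorm (fun x => F i (t, x)) (ENNReal.ofReal p) volume :=
    fun i => measurable_eLpNorm_fibre (hF i)
  refine (eLpNorm_tsum_le (ν := (volume : Measure ℝ)) hρ (a := fun (i : ℤ) t =>
    2 ^ (Module.finrank ℝ (Bdry n) / p * (i : ℝ)) *
      eLpNorm (fun x => F i (t, x)) (ENNReal.ofReal p) volume)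
    fun i => (hm i).const_mul _).trans (ENNReal.tsum_le_tsum fun i => ?_)
  have h2 : (2 : ℝ≥0∞) ^ (Module.finrank ℝ (Bdry n) / p * (i : ℝ)) =
      ((2 ^ (Module.finrank ℝ (Bdry n) / p * (i : ℝ)) : ℝ≥0∞).toNNReal : ℝ≥0∞) :=
    (ENNReal.coe_toNNReal (two_rpow_lt_top _).ne).symm
  rw [h2, nrm, mixN]
  simp only [eLpNorm_enorm]
  refine eLpNorm_le_nnreal_smul_eLpNorm_of_ae_le_mul' (ae_of_all _ fun t => ?_) ρ
  simp

theorem ae_lt_top_of_eLpNorm (hρ : 1 ≤ ρ) {b : ℝ → ℝ≥0∞} (hb : Measurable b)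
    (h : eLpNorm b ρ volume < ⊤) : ∀ᵐ t, b t < ⊤ := by
  obtain ⟨N, C, hC⟩ := exists_lintegral_mul_wt_le (volume : Measure ℝ) hρ
  filter_upwards [ae_lt_top (hb.mul (measurable_wt N))
    ((hC b hb).trans_lt (ENNReal.mul_lt_top ENNReal.coe_lt_top h)).ne] with z hz
  by_contra h3
  rw [not_lt, top_le_iff] at h3
  rw [Pi.mul_apply, h3, ENNReal.top_mul] at hz
  · exact lt_irrefl _ hz
  · rw [wt, Ne, ENNReal.ofReal_eq_zero, not_le]
    positivity

theorem nrm_lt_top_of_lN {F : ℤ → ℝ × Bdry n → ℂ} (h : lN ρ p F < ⊤) (i : ℤ) :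
    nrm ρ (ENNReal.ofReal p) (F i) < ⊤ := by
  have h1 := (ENNReal.le_tsum i).trans_lt h
  refine lt_top_iff_ne_top.2 fun h2 => ?_
  rw [h2, ENNReal.mul_top (ENNReal.rpow_pos (by norm_num) (by norm_num)).ne'] at h1
  exact lt_irrefl _ h1

/-- Bernstein's inequality for blocks on space-time. -/
theorem exists_nrm_top_le (Φ : LittlewoodPaley (Bdry n)) (hp : 1 ≤ p) : ∃ C : ℝ≥0,
    ∀ (ρ : ℝ≥0∞) (i : ℤ) (f : ℝ × Bdry n → ℂ), Measurable f →
      (∀ t, (fun x => f (t, x)) =ᵐ[volume] cs (kern (fatSymbol Φ) i) fun x => f (t, x)) →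
      nrm ρ ⊤ f ≤ C * (2 ^ (Module.finrank ℝ (Bdry n) / p * (i : ℝ)) *
        nrm ρ (ENNReal.ofReal p) f) := by
  obtain ⟨C, hC⟩ := exists_bernstein Φ hp
  refine ⟨C, fun ρ i f hf h => ?_⟩
  have h2 : (C : ℝ≥0∞) * 2 ^ (Module.finrank ℝ (Bdry n) / p * (i : ℝ)) =
      (((C : ℝ≥0∞) * 2 ^ (Module.finrank ℝ (Bdry n) / p * (i : ℝ))).toNNReal : ℝ≥0∞) :=
    (ENNReal.coe_toNNReal (ENNReal.mul_lt_top ENNReal.coe_lt_top (two_rpow_lt_top _)).ne).symm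
  rw [← mul_assoc, h2, nrm, nrm, mixN, mixN]
  simp only [eLpNorm_enorm]
  refine eLpNorm_le_nnreal_smul_eLpNorm_of_ae_le_mul' (ae_of_all _ fun t => ?_) ρ
  rw [← h2, enorm_eq_self, enorm_eq_self, mul_assoc, eLpNorm_exponent_top]
  exact essSup_le_of_ae_le _ (hC i _ (hf.comp measurable_prodMk_left) (h t))

theorem IsBlockFamily.tempered {Φ : LittlewoodPaley (Bdry n)} (hρ : 1 ≤ ρ) (hp : 1 ≤ p)
    {F : ℤ → ℝ × Bdry n → ℂ} {D : ℝ × Bdry n → ℂ} (h : IsBlockFamily Φ ρ p F D) (i : ℤ) :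
    TemperedFun (F i) :=
  tempered_of_nrm hρ (by simpa using hp) (h.measurable i) (nrm_lt_top_of_lN h.lN_lt_top i)

theorem IsBlockFamily.tsum_nrm_top_lt_top {Φ : LittlewoodPaley (Bdry n)} (hp : 1 ≤ p)
    {F : ℤ → ℝ × Bdry n → ℂ} {D : ℝ × Bdry n → ℂ} (h : IsBlockFamily Φ ρ p F D) :
    ∑' i, nrm ρ ⊤ (F i) < ⊤ := by
  obtain ⟨C, hC⟩ := exists_nrm_top_le Φ hp
  refine lt_of_le_of_lt (ENNReal.tsum_le_tsum fun i =>
    hC ρ i (F i) (h.measurable i) fun t => (h.fibre t).eq_fat i) ?_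
  rw [ENNReal.tsum_mul_left]
  exact ENNReal.mul_lt_top ENNReal.coe_lt_top h.lN_lt_top

theorem exists_nrm_sum_le (Φ : LittlewoodPaley (Bdry n)) (hp : 1 ≤ p) : ∃ C : ℝ≥0,
    ∀ (ρ : ℝ≥0∞), 1 ≤ ρ → ∀ (F : ℤ → ℝ × Bdry n → ℂ) (D : ℝ × Bdry n → ℂ),
      IsBlockFamily Φ ρ p F D → nrm ρ ⊤ D ≤ C * lN ρ p F := by
  obtain ⟨C, hC⟩ := exists_enorm_le_bN Φ hp
  refine ⟨C, fun ρ hρ F D h => ?_⟩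
  refine le_trans ?_ (mul_le_mul' le_rfl (eLpNorm_bN_le hρ h.measurable))
  rw [nrm, mixN]
  refine eLpNorm_le_nnreal_smul_eLpNorm_of_ae_le_mul' (ae_of_all _ fun t => ?_) ρ
  rw [enorm_eq_self, enorm_eq_self, eLpNorm_enorm, eLpNorm_exponent_top]
  exact essSup_le_of_ae_le _ (hC _ _ (h.fibre t))

theorem IsBlockFamily.tempered_sum {Φ : LittlewoodPaley (Bdry n)} (hρ : 1 ≤ ρ) (hp : 1 ≤ p)
    {F : ℤ → ℝ × Bdry n → ℂ} {D : ℝ × Bdry n → ℂ} (h : IsBlockFamily Φ ρ p F D) :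
    TemperedFun D := by
  obtain ⟨C, hC⟩ := exists_nrm_sum_le Φ hp
  exact tempered_of_nrm hρ le_top h.measurable_sum
    ((hC ρ hρ F D h).trans_lt (ENNReal.mul_lt_top ENNReal.coe_lt_top h.lN_lt_top))

/-- After a modification on a null set of times, frequency-localised functions with summable norms
form a family of blocks. -/
theorem exists_isBlockFamily {Φ : LittlewoodPaley (Bdry n)} (hρ : 1 ≤ ρ) (hp : 1 ≤ p)
    {G : ℤ → ℝ × Bdry n → ℂ} (hG : ∀ i, Measurable (G i))
    (hfat : ∀ i, G i =ᵐ[volume] cvx (kern (fatSymbol Φ) i) (G i)) (hl : lN ρ p G < ⊤) :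
    ∃ F D, IsBlockFamily Φ ρ p F D ∧ (∀ i, F i =ᵐ[volume] G i) ∧
      (∀ i z, G i z = 0 → F i z = 0) := by
  have hp' : 1 ≤ ENNReal.ofReal p := by simpa using hp
  have h1 : ∀ᵐ t, (∀ i, (fun x => G i (t, x)) =ᵐ[volume]
      cs (kern (fatSymbol Φ) i) fun x => G i (t, x)) ∧ bN p (fun i x => G i (t, x)) < ⊤ := by
    refine Filter.Eventually.and (ae_all_iff.2 fun i => ?_)
      (ae_lt_top_of_eLpNorm hρ (measurable_bN hG) ((eLpNorm_bN_le hρ hG).trans_lt hl))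
    have h2 := hfat i
    rw [Measure.volume_eq_prod] at h2
    filter_upwards [Measure.ae_ae_of_ae_prod h2] with t ht
    filter_upwards [ht] with x hx
    rw [← cvx_apply]
    exact hx
  obtain ⟨T, hT, hTm, hT'⟩ := exists_measurable_superset_of_null h1
  have hgood : ∀ t ∉ T, (∀ i, (fun x => G i (t, x)) =ᵐ[volume]
      cs (kern (fatSymbol Φ) i) fun x => G i (t, x)) ∧ bN p (fun i x => G i (t, x)) < ⊤ := by
    intro t ht
    by_contra h
    exact ht (hT h)
  set F : ℤ → ℝ × Bdry n → ℂ := fun i => (Tᶜ ×ˢ univ).indicator (G i) with hFdef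
  have hFm : ∀ i, Measurable (F i) := fun i =>
    (hG i).indicator (hTm.compl.prod MeasurableSet.univ)
  have hF0 : ∀ t ∈ T, ∀ i, (fun x => F i (t, x)) = 0 := fun t ht i => by
    funext x
    exact indicator_of_notMem (fun h => h.1 ht) _
  have hF1 : ∀ t ∉ T, ∀ i, (fun x => F i (t, x)) = fun x => G i (t, x) := fun t ht i => by
    funext x
    exact indicator_of_mem (show (t, x) ∈ Tᶜ ×ˢ univ from ⟨ht, mem_univ _⟩) _
  have hFG : ∀ i, F i =ᵐ[volume] G i := by
    intro i
    have h3 : ∀ᵐ z : ℝ × Bdry n, z.1 ∉ T := by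
      rw [Measure.volume_eq_prod]
      exact Measure.quasiMeasurePreserving_fst.ae
        (by simpa [ae_iff] using hT' : ∀ᵐ t, t ∉ T)
    filter_upwards [h3] with z hz
    exact indicator_of_mem (show z ∈ Tᶜ ×ˢ univ from ⟨hz, mem_univ _⟩) _
  have hfatF : ∀ t i, (fun x => F i (t, x)) =ᵐ[volume]
      cs (kern (fatSymbol Φ) i) fun x => F i (t, x) := by
    intro t i
    by_cases ht : t ∈ T
    · rw [hF0 t ht]
      refine ae_of_all _ fun x => ?_
      simp [cs]
    · rw [hF1 t ht]
      exact (hgood t ht).1 i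
  have hbN : ∀ t, bN p (fun i x => F i (t, x)) < ⊤ := by
    intro t
    by_cases ht : t ∈ T
    · simp only [bN, hF0 t ht]
      simp
    · have h3 : (fun i x => F i (t, x)) = fun i x => G i (t, x) := funext (hF1 t ht)
      rw [h3]
      exact (hgood t ht).2
  have hlF : lN ρ p F < ⊤ := by
    refine lt_of_eq_of_lt ?_ hl
    simp only [lN]
    exact tsum_congr fun i => by rw [nrm_congr (hFG i)]
  obtain ⟨D, hD, -, hD'⟩ := exists_measurable_hasSum hFm
  obtain ⟨C, hC⟩ := exists_bernstein Φ hp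
  obtain ⟨C', hC'⟩ := exists_nrm_top_le Φ hp
  refine ⟨F, D, ⟨hFm, hD, fun t => ⟨fun i => (hFm i).comp measurable_prodMk_left,
    hD.comp measurable_prodMk_left, hfatF t, hbN t, ?_⟩, hlF, ?_⟩, hFG, fun i z hz => ?_⟩
  · filter_upwards [ae_all_iff.2 fun i => hC i _ ((hFm i).comp measurable_prodMk_left) (hfatF t i)]
      with x hx
    refine hD' _ ((ENNReal.tsum_le_tsum hx).trans_lt ?_)
    rw [ENNReal.tsum_mul_left]
    exact ENNReal.mul_lt_top ENNReal.coe_lt_top (hbN t)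
  · have h4 : mixN ρ ⊤ volume volume (fun z => ∑' i, ‖F i z‖ₑ) < ⊤ := by
      refine (mixN_tsum_le hρ le_top (a := fun i z => ‖F i z‖ₑ) fun i => (hFm i).enorm).trans_lt ?_
      refine lt_of_le_of_lt (ENNReal.tsum_le_tsum fun i => hC' ρ i (F i) (hFm i)
        fun t => hfatF t i) ?_
      rw [ENNReal.tsum_mul_left]
      exact ENNReal.mul_lt_top ENNReal.coe_lt_top hlF
    filter_upwards [ae_lt_top_of_mixN hρ le_top (Measurable.tsum fun i => (hFm i).enorm) h4]
      with z hz
    exact hD' z hz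
  · rw [hFdef]
    by_cases h : z ∈ Tᶜ ×ˢ (univ : Set (Bdry n))
    · simp only [indicator_of_mem h, hz]
    · exact indicator_of_notMem h _

/-- A realised distribution whose blocks are given by a family of blocks is the sum of the
family. -/
theorem IsRealized.restrictsTo_sum {Φ : LittlewoodPaley (Bdry n)} (hρ : 1 ≤ ρ) (hp : 1 ≤ p)
    {u : 𝓢'(SpaceTime n, ℂ)} (hu : IsRealized Φ u) {F : ℤ → ℝ × Bdry n → ℂ}
    {D : ℝ × Bdry n → ℂ} (h : IsBlockFamily Φ ρ p F D) {I : Set ℝ}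
    (hF : ∀ i, RestrictsTo I (spaceBlock Φ i u) (F i)) : RestrictsTo I u D := by
  have hD := h.tempered_sum hρ hp
  refine ⟨hD.locallyIntegrable.locallyIntegrableOn _, fun η hc hs => ?_⟩
  obtain ⟨C, hC⟩ := exists_lintegral_mul_le_nrm (n := n) hρ le_top η
  have hint := fun i => (h.tempered hρ hp i).integrable_mul η
  have hsum : Summable fun i => ∫ z, ‖η (WithLp.toLp 2 z) * F i z‖ := by
    have h2 : ∀ i, ∫ z, ‖η (WithLp.toLp 2 z) * F i z‖ =
        (∫⁻ z, ‖η (WithLp.toLp 2 z) * F i z‖ₑ).toReal := fun i =>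
      integral_norm_eq_lintegral_enorm (hint i).1
    simp only [h2]
    refine ENNReal.summable_toReal (ne_top_of_le_ne_top ?_
      (ENNReal.tsum_le_tsum fun i => hC (F i) (h.measurable i)))
    rw [ENNReal.tsum_mul_left]
    exact (ENNReal.mul_lt_top ENNReal.coe_lt_top (h.tsum_nrm_top_lt_top hp)).ne
  have h3 := hasSum_integral_of_summable_integral_norm hint hsum
  have h4 : ∫ z, ∑' i, η (WithLp.toLp 2 z) * F i z = ∫ z, η (WithLp.toLp 2 z) * D z :=
    integral_congr_ae (h.hasSum.mono fun z hz => (HasSum.mul_left _ hz).tsum_eq)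
  rw [h4] at h3
  refine tendsto_nhds_unique (hu η) ?_
  refine (h3.comp tendsto_Icc_neg).congr fun N => ?_
  exact Finset.sum_congr rfl fun i _ => ((hF i).2 η hc hs).symm

/-- A function with finite norm in `L̃^ρ(ℝ₊; Ḃ^{(n-1)/p}_{p,1})` is the sum on the half-space of a
family of blocks, which are the restrictions of the blocks of every extension. -/
theorem exists_blocks_of_lebesgueBesovNorm {Φ : LittlewoodPaley (Bdry n)} (hρ : 1 ≤ ρ)
    (hp : 1 ≤ p) {f : ℝ × Bdry n → ℂ} (hf : lebesgueBesovNorm Φ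
      (Module.finrank ℝ (Bdry n) / p) ρ (ENNReal.ofReal p) f < ⊤) :
    ∃ (F : ℤ → ℝ × Bdry n → ℂ) (D : ℝ × Bdry n → ℂ), IsBlockFamily Φ ρ p F D ∧
      (∀ i z, z.1 ∉ Ioi (0 : ℝ) → F i z = 0) ∧
      f =ᵐ[volume.restrict (Ioi 0 ×ˢ univ)] D ∧
      (∀ u, IsExtension Φ u f → ∀ i, RestrictsTo (Ioi 0) (spaceBlock Φ i u) (F i)) ∧
      lN ρ p F ≤ lebesgueBesovNorm Φ (Module.finrank ℝ (Bdry n) / p) ρ (ENNReal.ofReal p) f := by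
  have hp' : 1 ≤ ENNReal.ofReal p := by simpa using hp
  have hI : IsOpen (Ioi (0 : ℝ)) := isOpen_Ioi
  have hU : MeasurableSet (Ioi (0 : ℝ) ×ˢ (univ : Set (Bdry n))) :=
    hI.measurableSet.prod MeasurableSet.univ
  obtain ⟨u, hu⟩ := iInf_lt_iff.1 hf
  obtain ⟨hext, hsum⟩ := iInf_lt_iff.1 hu
  have hmix : ∀ i, mixedNorm (Ioi 0) ρ (ENNReal.ofReal p) (spaceBlock Φ i u) < ⊤ := by
    intro i
    have h1 := (ENNReal.le_tsum i).trans_lt hsum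
    refine lt_top_iff_ne_top.2 fun h2 => ?_
    rw [h2, ENNReal.mul_top (ENNReal.rpow_pos (by norm_num) (by norm_num)).ne'] at h1
    exact lt_irrefl _ h1
  choose G hGt hGr hG0 hGn using fun i =>
    exists_restrictsTo_of_mixedNorm_lt_top hρ hp' hI (hmix i)
  have hfat : ∀ i, G i =ᵐ[volume] cvx (kern (fatSymbol Φ) i) (G i) := by
    intro i
    have h1 := (hGr i).eq_cvx_fat hI (hGt i)
    rw [Filter.EventuallyEq, ae_restrict_iff' hU] at h1
    filter_upwards [h1] with z hz
    by_cases hzI : z.1 ∈ Ioi (0 : ℝ)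
    · exact hz ⟨hzI, mem_univ _⟩
    · have h2 : cvx (kern (fatSymbol Φ) i) (G i) (z.1, z.2) = 0 := by
        rw [cvx_apply, cs]
        refine integral_eq_zero_of_ae (ae_of_all _ fun y => ?_)
        beta_reduce
        rw [hG0 i (z.1, z.2 - y) hzI, mul_zero]
        rfl
      rw [hG0 i z hzI]
      exact h2.symm
  have hl : lN ρ p G < ⊤ := by
    refine lt_of_le_of_lt (ENNReal.tsum_le_tsum fun i => ?_) hsum
    gcongr
    exact hGn i
  obtain ⟨F, D, hFD, hFG, hF0⟩ := exists_isBlockFamily hρ hp (fun i => (hGt i).measurable) hfat hl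
  have hFu : ∀ i, RestrictsTo (Ioi 0) (spaceBlock Φ i u) (F i) := fun i =>
    (hGr i).congr hI.measurableSet (ae_restrict_of_ae (hFG i).symm)
  have huD := hext.1.restrictsTo_sum hρ hp hFD hFu
  have hfD := hext.2.ae_eq hI huD
  have hDt := hFD.tempered_sum hρ hp
  have hall : ∀ u, IsExtension Φ u f → ∀ i, RestrictsTo (Ioi 0) (spaceBlock Φ i u) (F i) := by
    intro v hv i
    have h1 := (hv.2.congr hI.measurableSet hfD).spaceBlock Φ i hDt
    exact h1.congr hI.measurableSet ((huD.spaceBlock Φ i hDt).ae_eq hI (hFu i))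
  have h0 : ∀ i z, z.1 ∉ Ioi (0 : ℝ) → F i z = 0 := fun i z hz => hF0 i z (hG0 i z hz)
  refine ⟨F, D, hFD, h0, hfD, hall, le_iInf₂ fun v hv => ENNReal.tsum_le_tsum fun i => ?_⟩
  gcongr
  exact nrm_le_mixedNorm hI (hall v hv i) (h0 i)

end Families

end CheminLerner

/-! ### Time differences of the blocks of a product -/

namespace CheminLerner

open FourierTransform

section ProductDifferences

variable {n : ℕ} {ρ : ℝ≥0∞} {p : ℝ}

theorem eLpNorm_const_mul_le {α : Type*} [MeasurableSpace α] {μ : Measure α} {c : ℝ≥0∞}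
    (hc : c < ⊤) (b : α → ℝ≥0∞) : eLpNorm (fun t => c * b t) ρ μ ≤ c * eLpNorm b ρ μ := by
  lift c to ℝ≥0 using hc.ne
  refine eLpNorm_le_nnreal_smul_eLpNorm_of_ae_le_mul' (ae_of_all _ fun t => ?_) ρ
  simp

theorem const_mul_eLpNorm_le {α : Type*} [MeasurableSpace α] {μ : Measure α} {c : ℝ≥0∞}
    (hc0 : c ≠ 0) (hc : c < ⊤) (b : α → ℝ≥0∞) :
    c * eLpNorm b ρ μ ≤ eLpNorm (fun t => c * b t) ρ μ := by
  have h1 : eLpNorm b ρ μ ≤ c⁻¹ * eLpNorm (fun t => c * b t) ρ μ := by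
    refine le_trans (le_of_eq ?_) (eLpNorm_const_mul_le (ENNReal.inv_lt_top.2
      (pos_iff_ne_zero.2 hc0)) _)
    congr 1
    funext t
    rw [← mul_assoc, ENNReal.inv_mul_cancel hc0 hc.ne, one_mul]
  calc c * eLpNorm b ρ μ ≤ c * (c⁻¹ * eLpNorm (fun t => c * b t) ρ μ) := by gcongr
    _ = _ := by rw [← mul_assoc, ENNReal.mul_inv_cancel hc0 hc.ne, one_mul]

theorem ae_eLpNorm_le_nrm_top {P : ℝ≥0∞} (f : ℝ × Bdry n → ℂ) :
    ∀ᵐ t, eLpNorm (fun x => f (t, x)) P volume ≤ nrm ⊤ P f := by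
  have h := ae_le_eLpNormEssSup (f := fun t => eLpNorm (fun x => ‖f (t, x)‖ₑ) P volume)
    (μ := (volume : Measure ℝ))
  filter_upwards [h] with t ht
  rw [nrm, mixN, eLpNorm_exponent_top]
  simpa only [enorm_eq_self, eLpNorm_enorm] using ht

theorem ae_eLpNorm_le_dN_top {P : ℝ≥0∞} (h : ℝ) (f : ℝ × Bdry n → ℂ) :
    ∀ᵐ t ∂volume.restrict (Ioi (0 : ℝ)),
      eLpNorm (fun x => dt h f (t, x)) P volume ≤ dN ⊤ P h f := by
  have h := ae_le_eLpNormEssSup (f := fun t => eLpNorm (fun x => ‖dt h f (t, x)‖ₑ) P volume)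
    (μ := (volume : Measure ℝ).restrict (Ioi 0))
  filter_upwards [h] with t ht
  rw [dN, mixN, eLpNorm_exponent_top]
  simpa only [enorm_eq_self, eLpNorm_enorm] using ht

/-- A bilinear series of functions of time, one factor in `L^ρ`, the other bounded. -/
theorem eLpNorm_tsum_mul_le {μ : Measure ℝ} [SFinite μ] (hρ : 1 ≤ ρ) {c : ℤ × ℤ → ℝ≥0∞}
    (hc : ∀ q, c q < ⊤)
    {A B : ℤ → ℝ → ℝ≥0∞} (hA : ∀ i, Measurable (A i)) (hB : ∀ i, Measurable (B i))
    {M N : ℤ → ℝ≥0∞} (hM : ∀ i, eLpNorm (A i) ρ μ ≤ M i) (hN : ∀ k, ∀ᵐ t ∂μ, B k t ≤ N k)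
    (hNfin : ∀ k, N k < ⊤) :
    eLpNorm (fun t => ∑' q : ℤ × ℤ, c q * (A q.1 t * B q.2 t)) ρ μ ≤
      ∑' q : ℤ × ℤ, c q * (M q.1 * N q.2) := by
  refine (eLpNorm_tsum_le hρ (a := fun (q : ℤ × ℤ) t => c q * (A q.1 t * B q.2 t)) fun q =>
    ((hA q.1).mul (hB q.2)).const_mul _).trans (ENNReal.tsum_le_tsum fun q => ?_)
  calc eLpNorm (fun t => c q * (A q.1 t * B q.2 t)) ρ μ
      ≤ eLpNorm (fun t => (c q * N q.2) * A q.1 t) ρ μ := by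
        refine eLpNorm_mono_enorm_ae ?_
        filter_upwards [hN q.2] with t ht
        rw [enorm_eq_self, enorm_eq_self, mul_assoc, mul_comm (N q.2)]
        gcongr
    _ ≤ (c q * N q.2) * eLpNorm (A q.1) ρ μ :=
        eLpNorm_const_mul_le (ENNReal.mul_lt_top (hc q) (hNfin q.2)) _
    _ ≤ (c q * N q.2) * M q.1 := by gcongr; exact hM q.1
    _ = _ := by ring

theorem eLpNorm_tsum_mul_le' {μ : Measure ℝ} [SFinite μ] (hρ : 1 ≤ ρ) {c : ℤ × ℤ → ℝ≥0∞}
    (hc : ∀ q, c q < ⊤) {A B : ℤ → ℝ → ℝ≥0∞} (hA : ∀ i, Measurable (A i))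
    (hB : ∀ i, Measurable (B i)) {M N : ℤ → ℝ≥0∞} (hM : ∀ i, ∀ᵐ t ∂μ, A i t ≤ M i)
    (hMfin : ∀ i, M i < ⊤) (hN : ∀ k, eLpNorm (B k) ρ μ ≤ N k) :
    eLpNorm (fun t => ∑' q : ℤ × ℤ, c q * (A q.1 t * B q.2 t)) ρ μ ≤
      ∑' q : ℤ × ℤ, c q * (M q.1 * N q.2) := by
  have h := eLpNorm_tsum_mul_le hρ (c := fun q => c q.swap) (fun q => hc _) hB hA hN hM hMfin
  have h3 : ∀ f : ℤ × ℤ → ℝ≥0∞, ∑' q : ℤ × ℤ, f q.swap = ∑' q, f q := fun f =>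
    (Equiv.prodComm ℤ ℤ).tsum_eq f
  rw [← h3 fun q => c q * (M q.1 * N q.2)]
  simp only [← h3 fun q => c q * (A q.1 _ * B q.2 _)]
  refine le_trans (le_of_eq ?_) (h.trans (le_of_eq (tsum_congr fun q => ?_)))
  · congr 1
    funext t
    refine tsum_congr fun q => ?_
    rw [mul_comm (B q.1 t)]
    rfl
  · rw [mul_comm (N q.1)]
    rfl

theorem eLpNorm_le_add_of_le {α : Type*} [MeasurableSpace α] {μ : Measure α} (hρ : 1 ≤ ρ)
    {f a b : α → ℝ≥0∞} (ha : Measurable a) (hb : Measurable b) (h : ∀ t, f t ≤ a t + b t)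
    {A B : ℝ≥0∞} (hA : eLpNorm a ρ μ ≤ A) (hB : eLpNorm b ρ μ ≤ B) : eLpNorm f ρ μ ≤ A + B :=
  (eLpNorm_mono_enorm (g := a + b) fun t => by
    simpa only [enorm_eq_self, Pi.add_apply] using h t).trans
    ((eLpNorm_add_le ha.aestronglyMeasurable hb.aestronglyMeasurable hρ).trans
      (add_le_add hA hB))

theorem gam_lt_top (δ : ℝ) (m : ℤ) : gam δ m < ⊤ := by
  rw [gam]
  split_ifs
  · exact two_rpow_lt_top _
  · exact ENNReal.zero_lt_top

/-- Leibniz' rule for differences, at a fixed time. -/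
theorem exists_fibre_product_le (Φ : LittlewoodPaley (Bdry n)) {s : ℝ} (hp : 1 ≤ p)
    (hsa : s ≤ Module.finrank ℝ (Bdry n) / p)
    (hs : 0 < s ∨ 2 ≤ p ∧ 0 < s + Module.finrank ℝ (Bdry n) / p) :
    ∃ (C : ℝ≥0) (δ : ℝ), 0 < δ ∧ ∀ (ρ ρ' : ℝ≥0∞) (F G : ℤ → ℝ × Bdry n → ℂ)
      (D E : ℝ × Bdry n → ℂ), IsBlockFamily Φ ρ p F D → IsBlockFamily Φ ρ' p G E →
      ∀ (h : ℝ) (j : ℤ) (t : ℝ), 2 ^ (s * (j : ℝ)) * eLpNorm (fun x => dt h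
        (cvx (kern (blockSymbol Φ) j) fun z => D z * E z) (t, x)) (ENNReal.ofReal p) volume ≤
      (∑' q : ℤ × ℤ, C * gam δ (j - max q.1 q.2) *
        ((2 ^ (s * (q.1 : ℝ)) * eLpNorm (fun x => dt h (F q.1) (t, x)) (ENNReal.ofReal p) volume) *
        (2 ^ (Module.finrank ℝ (Bdry n) / p * (q.2 : ℝ)) *
          eLpNorm (fun x => G q.2 (t + h, x)) (ENNReal.ofReal p) volume))) +
      ∑' q : ℤ × ℤ, C * gam δ (j - max q.1 q.2) *
        ((2 ^ (s * (q.1 : ℝ)) * eLpNorm (fun x => dt h (G q.1) (t, x)) (ENNReal.ofReal p) volume) *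
        (2 ^ (Module.finrank ℝ (Bdry n) / p * (q.2 : ℝ)) *
          eLpNorm (fun x => F q.2 (t, x)) (ENNReal.ofReal p) volume)) := by
  obtain ⟨C, δ, hδ, hC⟩ := exists_cs_product_le Φ hp hsa hs
  obtain ⟨B, hB⟩ := exists_enorm_le_bN Φ hp
  have hp' : 1 ≤ ENNReal.ofReal p := by simpa using hp
  refine ⟨C, δ, hδ, fun ρ ρ' F G D E hF hG h j t => ?_⟩
  set κ := kern (blockSymbol Φ) j with hκ
  have hprod : ∀ t t' : ℝ, ∀ᵐ x, ‖D (t, x) * E (t', x)‖ₑ ≤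
      (B * bN p fun i x => F i (t, x)) * (B * bN p fun i x => G i (t', x)) := by
    intro t t'
    filter_upwards [hB _ _ (hF.fibre t), hB _ _ (hG.fibre t')] with x h1 h2
    rw [enorm_mul]
    exact mul_le_mul' h1 h2
  have hfin : ∀ t t' : ℝ,
      (B * bN p fun i x => F i (t, x)) * (B * bN p fun i x => G i (t', x)) < ⊤ := fun t t' =>
    ENNReal.mul_lt_top (ENNReal.mul_lt_top ENNReal.coe_lt_top (hF.fibre t).bN_lt_top)
      (ENNReal.mul_lt_top ENNReal.coe_lt_top (hG.fibre t').bN_lt_top)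
  have hm : ∀ t t' : ℝ, Measurable fun x => D (t, x) * E (t', x) := fun t t' =>
    (hF.fibre t).measurable_sum.mul (hG.fibre t').measurable_sum
  have e1 := cs_sub_of_bound κ (hm (t + h) (t + h)) (hm t (t + h)) (hfin _ _) (hfin _ _)
    (hprod _ _) (hprod _ _)
  have e2 := cs_sub_of_bound κ (hm t (t + h)) (hm t t) (hfin _ _) (hfin _ _)
    (hprod _ _) (hprod _ _)
  have hsplit : (fun x => dt h (cvx κ fun z => D z * E z) (t, x)) =
      (cs κ fun x => (D (t + h, x) - D (t, x)) * E (t + h, x)) +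
      (cs κ fun x => (E (t + h, x) - E (t, x)) * D (t, x)) := by
    have e3 : (fun x => (D (t + h, x) - D (t, x)) * E (t + h, x)) =
        fun x => D (t + h, x) * E (t + h, x) - D (t, x) * E (t + h, x) := by
      funext x; ring
    have e4 : (fun x => (E (t + h, x) - E (t, x)) * D (t, x)) =
        fun x => D (t, x) * E (t + h, x) - D (t, x) * E (t, x) := by
      funext x; ring
    rw [e3, e4, e1, e2]
    funext x
    rw [Pi.add_apply, dt, cvx_apply, cvx_apply]
    ring
  have hDs := (hF.fibre (t + h)).sub hp (hF.fibre t)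
  have hEs := (hG.fibre (t + h)).sub hp (hG.fibre t)
  rw [hsplit]
  refine (mul_le_mul' le_rfl (eLpNorm_add_le
    (measurable_cs κ (hDs.measurable_sum.mul
      (hG.fibre (t + h)).measurable_sum)).aestronglyMeasurable
    (measurable_cs κ (hEs.measurable_sum.mul
      (hF.fibre t).measurable_sum)).aestronglyMeasurable hp')).trans ?_
  rw [mul_add]
  have c1 := hC j (fun i x => dt h (F i) (t, x)) (fun i x => G i (t + h, x)) _ _ hDs
    (hG.fibre (t + h))
  have c2 := hC j (fun i x => dt h (G i) (t, x)) (fun i x => F i (t, x)) _ _ hEs (hF.fibre t)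
  exact add_le_add c1 c2

/-- Leibniz' rule for differences: the time differences of the blocks of a product in terms of
those of the blocks of the factors. -/
theorem exists_dN_product_le (Φ : LittlewoodPaley (Bdry n)) {s : ℝ} (hp : 1 ≤ p)
    (hsa : s ≤ Module.finrank ℝ (Bdry n) / p)
    (hs : 0 < s ∨ 2 ≤ p ∧ 0 < s + Module.finrank ℝ (Bdry n) / p) :
    ∃ (C : ℝ≥0) (δ : ℝ), 0 < δ ∧ ∀ (ρ : ℝ≥0∞), 1 ≤ ρ → ∀ (F G : ℤ → ℝ × Bdry n → ℂ)
      (D E : ℝ × Bdry n → ℂ), IsBlockFamily Φ ρ p F D → IsBlockFamily Φ ⊤ p G E → ∀ (h : ℝ) (j : ℤ),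
      2 ^ (s * (j : ℝ)) * dN ρ (ENNReal.ofReal p) h
        (cvx (kern (blockSymbol Φ) j) fun z => D z * E z) ≤
      (∑' q : ℤ × ℤ, C * gam δ (j - max q.1 q.2) *
        ((2 ^ (s * (q.1 : ℝ)) * dN ρ (ENNReal.ofReal p) h (F q.1)) *
        (2 ^ (Module.finrank ℝ (Bdry n) / p * (q.2 : ℝ)) * nrm ⊤ (ENNReal.ofReal p) (G q.2)))) +
      ∑' q : ℤ × ℤ, C * gam δ (j - max q.1 q.2) *
        ((2 ^ (s * (q.1 : ℝ)) * dN ⊤ (ENNReal.ofReal p) h (G q.1)) *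
        (2 ^ (Module.finrank ℝ (Bdry n) / p * (q.2 : ℝ)) * nrm ρ (ENNReal.ofReal p) (F q.2))) := by
  obtain ⟨C, δ, hδ, hC⟩ := exists_fibre_product_le Φ hp hsa hs
  have hp' : 1 ≤ ENNReal.ofReal p := by simpa using hp
  refine ⟨C, δ, hδ, fun ρ hρ F G D E hF hG h j => ?_⟩
  have hfix := hC ρ ⊤ F G D E hF hG h j
  set P := ENNReal.ofReal p with hP
  set a : ℝ := Module.finrank ℝ (Bdry n) / p with ha
  set κ := kern (blockSymbol Φ) j with hκ
  have hc : ∀ q : ℤ × ℤ, (C : ℝ≥0∞) * gam δ (j - max q.1 q.2) < ⊤ := fun q =>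
    ENNReal.mul_lt_top ENNReal.coe_lt_top (gam_lt_top _ _)
  have hGn := fun i => nrm_lt_top_of_lN hG.lN_lt_top i
  have hmF : ∀ i (c : ℝ≥0∞), Measurable fun t => c * eLpNorm (fun x => F i (t, x)) P volume :=
    fun i c => (measurable_eLpNorm_fibre (hF.measurable i)).const_mul c
  have hmG : ∀ i (c : ℝ≥0∞), Measurable fun t => c * eLpNorm (fun x => G i (t + h, x)) P volume :=
    fun i c => ((measurable_eLpNorm_fibre (hG.measurable i)).comp
      (measurable_id.add_const h)).const_mul c
  have hmdF : ∀ i (c : ℝ≥0∞),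
      Measurable fun t => c * eLpNorm (fun x => dt h (F i) (t, x)) P volume :=
    fun i c => (measurable_eLpNorm_fibre (measurable_dt (hF.measurable i))).const_mul c
  have hmdG : ∀ i (c : ℝ≥0∞),
      Measurable fun t => c * eLpNorm (fun x => dt h (G i) (t, x)) P volume :=
    fun i c => (measurable_eLpNorm_fibre (measurable_dt (hG.measurable i))).const_mul c
  rw [dN, mixN]
  simp only [eLpNorm_enorm]
  refine (const_mul_eLpNorm_le (ENNReal.rpow_pos (by norm_num) (by norm_num)).ne'
    (two_rpow_lt_top _) _).trans ?_
  refine eLpNorm_le_add_of_le hρ ?_ ?_ hfix ?_ ?_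
  · exact Measurable.tsum fun q => ((hmdF q.1 _).mul (hmG q.2 _)).const_mul _
  · exact Measurable.tsum fun q => ((hmdG q.1 _).mul (hmF q.2 _)).const_mul _
  · refine eLpNorm_tsum_mul_le hρ (c := fun q => C * gam δ (j - max q.1 q.2))
      (A := fun i t => 2 ^ (s * (i : ℝ)) * eLpNorm (fun x => dt h (F i) (t, x)) P volume)
      (B := fun k t => 2 ^ (a * (k : ℝ)) * eLpNorm (fun x => G k (t + h, x)) P volume)
      (M := fun i => 2 ^ (s * (i : ℝ)) * dN ρ P h (F i))
      (N := fun k => 2 ^ (a * (k : ℝ)) * nrm ⊤ P (G k)) hc (fun i => hmdF i _)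
      (fun k => hmG k _) (fun i => ?_)
      (fun k => ?_) fun k => ENNReal.mul_lt_top (two_rpow_lt_top _) (hGn k)
    · refine (eLpNorm_const_mul_le (two_rpow_lt_top _) _).trans ?_
      rw [dN, mixN]
      simp only [eLpNorm_enorm]
      exact le_rfl
    · have h1 := (measurePreserving_add_right (volume : Measure ℝ) h).quasiMeasurePreserving.ae
        (ae_eLpNorm_le_nrm_top (P := P) (G k))
      filter_upwards [ae_restrict_of_ae h1] with t ht
      gcongr
  · refine eLpNorm_tsum_mul_le' hρ (c := fun q => C * gam δ (j - max q.1 q.2))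
      (A := fun i t => 2 ^ (s * (i : ℝ)) * eLpNorm (fun x => dt h (G i) (t, x)) P volume)
      (B := fun k t => 2 ^ (a * (k : ℝ)) * eLpNorm (fun x => F k (t, x)) P volume)
      (M := fun i => 2 ^ (s * (i : ℝ)) * dN ⊤ P h (G i))
      (N := fun k => 2 ^ (a * (k : ℝ)) * nrm ρ P (F k)) hc (fun i => hmdG i _)
      (fun k => hmF k _) (fun i => ?_) (fun i => ?_) fun k => ?_
    · filter_upwards [ae_eLpNorm_le_dN_top (P := P) h (G i)] with t ht
      gcongr
    · refine ENNReal.mul_lt_top (two_rpow_lt_top _) ((mixN_restrict_le _ _).trans_lt ?_)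
      exact (nrm_dt_le le_top hp' h (hG.measurable i)).trans_lt
        (ENNReal.mul_lt_top (by norm_num) (hGn i))
    · refine (eLpNorm_const_mul_le (two_rpow_lt_top _) _).trans ?_
      gcongr
      refine (eLpNorm_mono_measure _ Measure.restrict_le_self).trans ?_
      rw [nrm, mixN]
      simp only [eLpNorm_enorm]
      exact le_rfl

theorem tsum_gam_sub (δ : ℝ) (m : ℤ) : ∑' j : ℤ, gam δ (j - m) = ∑' j : ℤ, gam δ j :=
  (Equiv.subRight m).tsum_eq (gam δ)

/-- The modulus of continuity of a product. -/
theorem exists_om_product_le (Φ : LittlewoodPaley (Bdry n)) {s : ℝ} (hp : 1 ≤ p)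
    (hsa : s ≤ Module.finrank ℝ (Bdry n) / p)
    (hs : 0 < s ∨ 2 ≤ p ∧ 0 < s + Module.finrank ℝ (Bdry n) / p) :
    ∃ C : ℝ≥0, ∀ (ρ : ℝ≥0∞), 1 ≤ ρ → ∀ (F G : ℤ → ℝ × Bdry n → ℂ)
      (D E : ℝ × Bdry n → ℂ), IsBlockFamily Φ ρ p F D → IsBlockFamily Φ ⊤ p G E → ∀ b : ℝ,
      om ρ (ENNReal.ofReal p) s (fun j => cvx (kern (blockSymbol Φ) j) fun z => D z * E z) b ≤
        C * (om ρ (ENNReal.ofReal p) s F b * lN ⊤ p G +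
          om ⊤ (ENNReal.ofReal p) s G b * lN ρ p F) := by
  obtain ⟨C, δ, hδ, hC⟩ := exists_dN_product_le Φ hp hsa hs
  have hΓ := tsum_gam_lt_top hδ
  refine ⟨C * (∑' m, gam δ m).toNNReal, fun ρ hρ F G D E hF hG b => ?_⟩
  rw [ENNReal.coe_mul, ENNReal.coe_toNNReal hΓ.ne]
  set P := ENNReal.ofReal p with hP
  set a : ℝ := Module.finrank ℝ (Bdry n) / p with ha
  obtain ⟨X, hX⟩ : ∃ X : ℤ → ℝ≥0∞, X = fun i : ℤ =>
    2 ^ (s * (i : ℝ)) * ⨆ (h : ℝ) (_ : 0 < h ∧ h ≤ b), dN ρ P h (F i) := ⟨_, rfl⟩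
  obtain ⟨Y, hY⟩ : ∃ Y : ℤ → ℝ≥0∞, Y = fun i : ℤ =>
    2 ^ (s * (i : ℝ)) * ⨆ (h : ℝ) (_ : 0 < h ∧ h ≤ b), dN ⊤ P h (G i) := ⟨_, rfl⟩
  obtain ⟨U, hU⟩ : ∃ U : ℤ → ℝ≥0∞, U = fun k : ℤ => 2 ^ (a * (k : ℝ)) * nrm ρ P (F k) := ⟨_, rfl⟩
  obtain ⟨V, hV⟩ : ∃ V : ℤ → ℝ≥0∞, V = fun k : ℤ => 2 ^ (a * (k : ℝ)) * nrm ⊤ P (G k) := ⟨_, rfl⟩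
  have e1 : om ρ P s F b = ∑' i, X i := by rw [hX]; rfl
  have e2 : om ⊤ P s G b = ∑' i, Y i := by rw [hY]; rfl
  have e3 : lN ρ p F = ∑' k, U k := by rw [hU]; rfl
  have e4 : lN ⊤ p G = ∑' k, V k := by rw [hV]; rfl
  have h1 : ∀ j : ℤ, 2 ^ (s * (j : ℝ)) * (⨆ (h : ℝ) (_ : 0 < h ∧ h ≤ b),
      dN ρ P h (cvx (kern (blockSymbol Φ) j) fun z => D z * E z)) ≤
      (∑' q : ℤ × ℤ, C * gam δ (j - max q.1 q.2) * (X q.1 * V q.2)) +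
      ∑' q : ℤ × ℤ, C * gam δ (j - max q.1 q.2) * (Y q.1 * U q.2) := by
    intro j
    simp only [ENNReal.mul_iSup]
    refine iSup₂_le fun h hh => (hC ρ hρ F G D E hF hG h j).trans ?_
    rw [hX, hY, hU, hV]
    refine add_le_add (ENNReal.tsum_le_tsum fun q => ?_) (ENNReal.tsum_le_tsum fun q => ?_)
    · exact mul_le_mul' le_rfl (mul_le_mul' (mul_le_mul' le_rfl
        (le_iSup₂ (f := fun (h : ℝ) (_ : 0 < h ∧ h ≤ b) => dN ρ P h (F q.1)) h hh)) le_rfl)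
    · exact mul_le_mul' le_rfl (mul_le_mul' (mul_le_mul' le_rfl
        (le_iSup₂ (f := fun (h : ℝ) (_ : 0 < h ∧ h ≤ b) => dN ⊤ P h (G q.1)) h hh)) le_rfl)
  have h2 : ∀ x y : ℤ → ℝ≥0∞, ∑' j : ℤ, ∑' q : ℤ × ℤ,
      C * gam δ (j - max q.1 q.2) * (x q.1 * y q.2) =
      C * (∑' m, gam δ m) * ((∑' i, x i) * ∑' k, y k) := by
    intro x y
    rw [ENNReal.tsum_comm, ← tsum_prod_mul, ← ENNReal.tsum_mul_left]
    refine tsum_congr fun q => ?_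
    rw [ENNReal.tsum_mul_right, ENNReal.tsum_mul_left, tsum_gam_sub]
  rw [e1, e2, e3, e4, mul_add, ← h2, ← h2, ← ENNReal.tsum_add]
  exact ENNReal.tsum_le_tsum h1

theorem exists_besovDiff_product_le (Φ : LittlewoodPaley (Bdry n)) {s : ℝ} (hp : 1 ≤ p)
    (hsa : s ≤ Module.finrank ℝ (Bdry n) / p)
    (hs : 0 < s ∨ 2 ≤ p ∧ 0 < s + Module.finrank ℝ (Bdry n) / p) :
    ∃ C : ℝ≥0, ∀ (ρ : ℝ≥0∞), 1 ≤ ρ → ∀ (r : ℝ) (F G : ℤ → ℝ × Bdry n → ℂ)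
      (D E : ℝ × Bdry n → ℂ), IsBlockFamily Φ ρ p F D → IsBlockFamily Φ ⊤ p G E →
      besovDiff ρ (ENNReal.ofReal p) r s
          (fun j => cvx (kern (blockSymbol Φ) j) fun z => D z * E z) ≤
        C * (besovDiff ρ (ENNReal.ofReal p) r s F * lN ⊤ p G +
          besovDiff ⊤ (ENNReal.ofReal p) r s G * lN ρ p F) := by
  obtain ⟨C, hC⟩ := exists_om_product_le Φ hp hsa hs
  refine ⟨C, fun ρ hρ r F G D E hF hG => ?_⟩
  rw [besovDiff, besovDiff, besovDiff, ← ENNReal.tsum_mul_right, ← ENNReal.tsum_mul_right,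
    ← ENNReal.tsum_add, ← ENNReal.tsum_mul_left]
  refine ENNReal.tsum_le_tsum fun k =>
    (mul_le_mul' le_rfl (hC ρ hρ F G D E hF hG _)).trans (le_of_eq ?_)
  ring

end ProductDifferences

end CheminLerner

/-! ### Realisation of products -/

namespace CheminLerner

open FourierTransform

section Realisation

variable {n : ℕ} {ρ : ℝ≥0∞} {p : ℝ}

/-- Low frequency cut-offs of a product of sums of blocks. -/
theorem exists_cs_low_product_le {H : Type*} [NormedAddCommGroup H] [InnerProductSpace ℝ H]
    [FiniteDimensional ℝ H] [MeasurableSpace H] [BorelSpace H] (Φ : LittlewoodPaley H)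
    (hp : 1 ≤ p) (m : 𝓢(H, ℂ)) : ∃ C : ℝ≥0,
    ∀ (j : ℤ) (f g : ℤ → H → ℂ) (D E : H → ℂ), IsBlockSum Φ p f D → IsBlockSum Φ p g E →
      eLpNorm (cs (kern m j) fun x => D x * E x) ⊤ volume ≤ C * (bN p g *
        ∑' i : ℤ, min (2 ^ (Module.finrank ℝ H / p * (j : ℝ)))
          (2 ^ (Module.finrank ℝ H / p * (i : ℝ))) * eLpNorm (f i) (ENNReal.ofReal p) volume) := by
  obtain ⟨B, hB⟩ := exists_enorm_le_bN Φ hp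
  obtain ⟨B', hB'⟩ := exists_bernstein Φ hp
  obtain ⟨K, hK⟩ := exists_enorm_cs_kern_le hp m
  have hK0 : eLpNorm (kern m 0) 1 volume < ⊤ := ((kern m 0).memLp 1 volume).eLpNorm_lt_top
  set K' := (eLpNorm (kern m 0) 1 volume).toNNReal with hK'
  refine ⟨(K + K' * B') * B, fun j f g D E hf hg => ?_⟩
  set a : ℝ := Module.finrank ℝ H / p with ha
  have hBg : B * bN p g < ⊤ := ENNReal.mul_lt_top ENNReal.coe_lt_top hg.bN_lt_top
  have hE := hB g E hg
  have hfb := fun i => hB' i (f i) (hf.measurable i) (hf.eq_fat i)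
  have hsum : ∀ᵐ x, HasSum (fun i => f i x * E x) (D x * E x) := by
    filter_upwards [hf.hasSum] with x hx
    exact hx.mul_right _
  have hb : ∀ i, ∀ᵐ x, ‖f i x * E x‖ₑ ≤
      (B' * (2 ^ (a * (i : ℝ)) * eLpNorm (f i) (ENNReal.ofReal p) volume)) * (B * bN p g) := by
    intro i
    filter_upwards [hfb i, hE] with x h1 h2
    rw [enorm_mul]
    exact mul_le_mul' h1 h2
  have hA : ∑' i : ℤ, (B' * (2 ^ (a * (i : ℝ)) * eLpNorm (f i) (ENNReal.ofReal p) volume)) *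
      (B * bN p g) < ⊤ := by
    rw [ENNReal.tsum_mul_right, ENNReal.tsum_mul_left]
    exact ENNReal.mul_lt_top (ENNReal.mul_lt_top ENNReal.coe_lt_top hf.bN_lt_top) hBg
  have hm : ∀ i, Measurable fun x => f i x * E x := fun i =>
    (hf.measurable i).mul hg.measurable_sum
  refine (eLpNorm_cs_le_tsum (u := fun i x => f i x * E x) le_top (kern m j) hm hsum hA
    hb).trans ?_
  rw [← ENNReal.tsum_mul_left, ← ENNReal.tsum_mul_left]
  refine ENNReal.tsum_le_tsum fun i => ?_
  set X := eLpNorm (f i) (ENNReal.ofReal p) volume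
  -- Bernstein's inequality for the cut-off
  have h1 : eLpNorm (cs (kern m j) fun x => f i x * E x) ⊤ volume ≤
      K * (2 ^ (a * (j : ℝ)) * ((B * bN p g) * X)) := by
    rw [eLpNorm_exponent_top]
    refine essSup_le_of_ae_le _ (ae_of_all _ fun x => (hK j _ (hm i) x).trans ?_)
    have h2 := eLpNorm_mul_le_of_bound (p := ENNReal.ofReal p) (f := E) (g := f i) hBg hE
    simp only [mul_comm (E _)] at h2
    exact mul_le_mul' le_rfl (mul_le_mul' le_rfl h2)
  -- Bernstein's inequality for the block
  have h2 : eLpNorm (cs (kern m j) fun x => f i x * E x) ⊤ volume ≤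
      K' * ((B' * (2 ^ (a * (i : ℝ)) * X)) * (B * bN p g)) := by
    refine (eLpNorm_cs_le le_top _ (hm i)).trans ?_
    rw [eLpNorm_kern_one, hK', ENNReal.coe_toNNReal hK0.ne]
    gcongr
    rw [eLpNorm_exponent_top]
    exact essSup_le_of_ae_le _ (hb i)
  rw [ENNReal.coe_mul, ENNReal.coe_add, ENNReal.coe_mul]
  rcases le_total ((2 : ℝ≥0∞) ^ (a * (j : ℝ))) (2 ^ (a * (i : ℝ))) with h | h
  · rw [min_eq_left h]
    refine h1.trans ?_
    calc (K : ℝ≥0∞) * (2 ^ (a * (j : ℝ)) * ((B * bN p g) * X))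
        = (K * B) * (bN p g * (2 ^ (a * (j : ℝ)) * X)) := by ring
      _ ≤ _ := by gcongr; exact le_self_add
  · rw [min_eq_right h]
    refine h2.trans ?_
    calc (K' : ℝ≥0∞) * ((B' * (2 ^ (a * (i : ℝ)) * X)) * (B * bN p g))
        = ((K' * B') * B) * (bN p g * (2 ^ (a * (i : ℝ)) * X)) := by ring
      _ ≤ _ := by gcongr; exact le_add_self

theorem exists_nrm_low_product_le (Φ : LittlewoodPaley (Bdry n)) (hp : 1 ≤ p)
    (m : 𝓢(Bdry n, ℂ)) : ∃ C : ℝ≥0, ∀ ρ : ℝ≥0∞, 1 ≤ ρ → ∀ (j : ℤ)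
      (F G : ℤ → ℝ × Bdry n → ℂ) (D E : ℝ × Bdry n → ℂ),
      IsBlockFamily Φ ρ p F D → IsBlockFamily Φ ⊤ p G E →
      nrm ρ ⊤ (cvx (kern m j) fun z => D z * E z) ≤ C * (lN ⊤ p G *
        ∑' i : ℤ, min (2 ^ (Module.finrank ℝ (Bdry n) / p * (j : ℝ)))
          (2 ^ (Module.finrank ℝ (Bdry n) / p * (i : ℝ))) * nrm ρ (ENNReal.ofReal p) (F i)) := by
  obtain ⟨C, hC⟩ := exists_cs_low_product_le Φ hp m
  refine ⟨C, fun ρ hρ j F G D E hF hG => ?_⟩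
  set a : ℝ := Module.finrank ℝ (Bdry n) / p with ha
  have hmF : ∀ i, Measurable fun t => eLpNorm (fun x => F i (t, x)) (ENNReal.ofReal p) volume :=
    fun i => measurable_eLpNorm_fibre (hF.measurable i)
  have hGb : ∀ᵐ t, (bN p fun i x => G i (t, x)) ≤ lN ⊤ p G := by
    have h := ae_le_eLpNormEssSup (f := fun t => bN p fun i x => G i (t, x))
      (μ := (volume : Measure ℝ))
    have h2 := eLpNorm_bN_le (p := p) le_top hG.measurable
    rw [eLpNorm_exponent_top] at h2
    filter_upwards [h] with t ht
    exact ht.trans h2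
  have hmin : ∀ i : ℤ, min ((2 : ℝ≥0∞) ^ (a * (j : ℝ))) (2 ^ (a * (i : ℝ))) < ⊤ := fun i =>
    (min_le_left _ _).trans_lt (two_rpow_lt_top _)
  calc nrm ρ ⊤ (cvx (kern m j) fun z => D z * E z)
      ≤ eLpNorm (fun t => C * (lN ⊤ p G * ∑' i : ℤ,
          min (2 ^ (a * (j : ℝ))) (2 ^ (a * (i : ℝ))) *
            eLpNorm (fun x => F i (t, x)) (ENNReal.ofReal p) volume)) ρ volume := by
        rw [nrm, mixN]
        refine eLpNorm_mono_enorm_ae ?_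
        filter_upwards [hGb] with t ht
        rw [enorm_eq_self, enorm_eq_self, eLpNorm_enorm]
        have h1 := hC j _ _ _ _ (hF.fibre t) (hG.fibre t)
        have h2 : (fun x => cvx (kern m j) (fun z => D z * E z) (t, x)) =
            cs (kern m j) fun x => D (t, x) * E (t, x) := by
          funext x
          rw [cvx_apply]
        rw [h2]
        refine h1.trans ?_
        gcongr
    _ ≤ C * eLpNorm (fun t => lN ⊤ p G * ∑' i : ℤ,
          min (2 ^ (a * (j : ℝ))) (2 ^ (a * (i : ℝ))) *
            eLpNorm (fun x => F i (t, x)) (ENNReal.ofReal p) volume) ρ volume :=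
        eLpNorm_const_mul_le ENNReal.coe_lt_top _
    _ ≤ C * (lN ⊤ p G * eLpNorm (fun t => ∑' i : ℤ,
          min (2 ^ (a * (j : ℝ))) (2 ^ (a * (i : ℝ))) *
            eLpNorm (fun x => F i (t, x)) (ENNReal.ofReal p) volume) ρ volume) := by
        refine mul_le_mul' le_rfl (eLpNorm_const_mul_le hG.lN_lt_top _)
    _ ≤ _ := by
        refine mul_le_mul' le_rfl (mul_le_mul' le_rfl ?_)
        refine (eLpNorm_tsum_le hρ (a := fun (i : ℤ) t =>
          min (2 ^ (a * (j : ℝ))) (2 ^ (a * (i : ℝ))) *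
            eLpNorm (fun x => F i (t, x)) (ENNReal.ofReal p) volume)
          fun i => (hmF i).const_mul _).trans (ENNReal.tsum_le_tsum fun i => ?_)
        refine (eLpNorm_const_mul_le (hmin i) _).trans (le_of_eq ?_)
        rw [nrm, mixN]
        simp only [eLpNorm_enorm]

/-- Dominated convergence for series. -/
theorem tendsto_tsum_zero_of_dominated {ι : Type*} [Countable ι] {f : ℕ → ι → ℝ≥0∞}
    {b : ι → ℝ≥0∞} (hb : ∑' i, b i < ⊤) (hfb : ∀ N i, f N i ≤ b i)
    (hf : ∀ i, Tendsto (fun N => f N i) atTop (𝓝 0)) :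
    Tendsto (fun N => ∑' i, f N i) atTop (𝓝 0) := by
  let _ : MeasurableSpace ι := ⊤
  have h := tendsto_lintegral_of_dominated_convergence (μ := Measure.count) (F := f)
    (f := fun _ => 0) b (fun N => measurable_from_top) (fun N => ae_of_all _ (hfb N))
    (by rw [lintegral_count]; exact hb.ne) (ae_of_all _ hf)
  simpa only [lintegral_count, lintegral_zero] using h

theorem tendsto_two_rpow_neg {a : ℝ} (ha : 0 < a) :
    Tendsto (fun N : ℕ => (2 : ℝ≥0∞) ^ (a * ((-(N : ℤ) : ℤ) : ℝ))) atTop (𝓝 0) := by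
  have h1 : ∀ N : ℕ, (2 : ℝ≥0∞) ^ (a * ((-(N : ℤ) : ℤ) : ℝ)) = ((2 : ℝ≥0∞) ^ (-a)) ^ N := by
    intro N
    rw [← ENNReal.rpow_natCast, ← ENNReal.rpow_mul]
    congr 1
    push_cast
    ring
  simp only [h1]
  refine ENNReal.tendsto_pow_atTop_nhds_zero_of_lt_one ?_
  exact ENNReal.rpow_lt_one_of_one_lt_of_neg (by norm_num) (by linarith)

/-- A product of sums of blocks is the sum of its blocks. -/
theorem isRealized_product {Φ : LittlewoodPaley (Bdry n)} (hn : 0 < Module.finrank ℝ (Bdry n))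
    (hρ : 1 ≤ ρ) (hp : 1 ≤ p) {F G : ℤ → ℝ × Bdry n → ℂ} {D E : ℝ × Bdry n → ℂ}
    (hF : IsBlockFamily Φ ρ p F D) (hG : IsBlockFamily Φ ⊤ p G E)
    (hDE : TemperedFun fun z => D z * E z) : IsRealized Φ hDE.toDistribution := by
  refine isRealized_of_tendsto_low Φ _ fun η => ?_
  obtain ⟨C, hC⟩ := exists_nrm_low_product_le Φ hp (lowSymbol Φ)
  obtain ⟨C', hC'⟩ := exists_lintegral_mul_le_nrm (n := n) hρ le_top η
  set a : ℝ := Module.finrank ℝ (Bdry n) / p with ha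
  have ha0 : 0 < a := by
    have : (0 : ℝ) < Module.finrank ℝ (Bdry n) := by exact_mod_cast hn
    positivity
  have hval : ∀ N : ℕ, hDE.toDistribution (𝓕 (SchwartzMap.smulLeftCLM ℂ
      (fun z => dilate (lowSymbol Φ) (-(N : ℤ)) (sndST n z)) (𝓕⁻ η))) =
      ∫ z, η (WithLp.toLp 2 z) * cvx (kern (lowSymbol Φ) (-(N : ℤ))) (fun z => D z * E z) z := by
    intro N
    have h1 : RestrictsTo univ (TemperedDistribution.fourierMultiplierCLM ℂ
        (fun z => dilate (lowSymbol Φ) (-(N : ℤ)) (sndST n z)) hDE.toDistribution) _ :=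
      (hDE.restrictsTo univ).multiplier_space hDE (m := lowSymbol Φ) (j := -(N : ℤ))
        (fun ζ => rfl)
    exact h1.apply_eq hDE.cv η (fun z _ => mem_univ _)
  have hmin : ∀ (N : ℕ) (i : ℤ), min ((2 : ℝ≥0∞) ^ (a * ((-(N : ℤ) : ℤ) : ℝ))) (2 ^ (a * (i : ℝ))) *
      nrm ρ (ENNReal.ofReal p) (F i) ≤ 2 ^ (a * (i : ℝ)) * nrm ρ (ENNReal.ofReal p) (F i) :=
    fun N i => mul_le_mul' (min_le_right _ _) le_rfl
  have hlim : Tendsto (fun N : ℕ => ∑' i : ℤ, min ((2 : ℝ≥0∞) ^ (a * ((-(N : ℤ) : ℤ) : ℝ)))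
      (2 ^ (a * (i : ℝ))) * nrm ρ (ENNReal.ofReal p) (F i)) atTop (𝓝 0) := by
    refine tendsto_tsum_zero_of_dominated hF.lN_lt_top hmin fun i => ?_
    have h1 : Tendsto (fun N : ℕ => (2 : ℝ≥0∞) ^ (a * ((-(N : ℤ) : ℤ) : ℝ)) *
        nrm ρ (ENNReal.ofReal p) (F i)) atTop (𝓝 0) := by
      have h2 := ENNReal.Tendsto.mul_const (tendsto_two_rpow_neg ha0)
        (Or.inr (nrm_lt_top_of_lN hF.lN_lt_top i).ne)
      simpa using h2
    exact tendsto_of_tendsto_of_tendsto_of_le_of_le tendsto_const_nhds h1 (fun _ => zero_le)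
      fun N => mul_le_mul' (min_le_left _ _) le_rfl
  have hlim2 : Tendsto (fun N : ℕ => (C' : ℝ≥0∞) * (C * (lN ⊤ p G * ∑' i : ℤ,
      min ((2 : ℝ≥0∞) ^ (a * ((-(N : ℤ) : ℤ) : ℝ)))
      (2 ^ (a * (i : ℝ))) * nrm ρ (ENNReal.ofReal p) (F i)))) atTop (𝓝 0) := by
    have h1 := ENNReal.Tendsto.const_mul (a := (C' : ℝ≥0∞)) (ENNReal.Tendsto.const_mul
      (a := (C : ℝ≥0∞)) (ENNReal.Tendsto.const_mul hlim (Or.inr hG.lN_lt_top.ne))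
      (Or.inr ENNReal.coe_ne_top)) (Or.inr ENNReal.coe_ne_top)
    simpa using h1
  simp only [hval]
  rw [tendsto_zero_iff_enorm_tendsto_zero]
  refine tendsto_of_tendsto_of_tendsto_of_le_of_le tendsto_const_nhds hlim2 (fun _ => zero_le)
    fun N => ?_
  refine (enorm_integral_le_lintegral_enorm _).trans
    ((hC' _ (measurable_cv hDE.measurable)).trans ?_)
  gcongr
  exact hC ρ hρ _ F G D E hF hG

end Realisation

end CheminLerner

/-! ### Even reflection in time -/

namespace CheminLerner

open FourierTransform

section Reflection

variable {n : ℕ} {ρ p : ℝ≥0∞}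

/-- The even extension in time of the restriction of `f` to positive times. -/
def ev (f : ℝ × Bdry n → ℂ) : ℝ × Bdry n → ℂ := fun z => f (|z.1|, z.2)

theorem measurable_ev {f : ℝ × Bdry n → ℂ} (hf : Measurable f) : Measurable (ev f) :=
  hf.comp (measurable_fst.abs.prodMk measurable_snd)

theorem cvx_ev (κ : 𝓢(Bdry n, ℂ)) (f : ℝ × Bdry n → ℂ) : cvx κ (ev f) = ev (cvx κ f) := by
  funext z
  obtain ⟨t, x⟩ := z
  rw [cvx_apply, ev, cvx_apply]
  rfl

theorem mixN_comp_affine {σ : ℝ → ℝ} (hσ : MeasurePreserving σ volume volume)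
    {a : ℝ × Bdry n → ℝ≥0∞} (ha : Measurable a) :
    mixN ρ p volume volume (fun z => a (σ z.1, z.2)) = mixN ρ p volume volume a :=
  mixN_comp_map (ρ := ρ) (p := p) (τ := id) hσ (MeasurePreserving.id _) (a := a) ha

theorem nrm_ev_le (hρ : 1 ≤ ρ) (hp : 1 ≤ p) {f : ℝ × Bdry n → ℂ} (hf : Measurable f) :
    nrm ρ p (ev f) ≤ 2 * nrm ρ p f := by
  have h0 := mixN_comp_affine (ρ := ρ) (p := p) (Measure.measurePreserving_neg (volume : Measure ℝ))
    (a := fun z => ‖f z‖ₑ) hf.enorm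
  have hm : Measurable fun z : ℝ × Bdry n => ‖f (-z.1, z.2)‖ₑ :=
    (hf.comp (measurable_fst.neg.prodMk measurable_snd)).enorm
  have h1 : nrm ρ p (ev f) ≤ mixN ρ p volume volume
      fun z => (fun z => ‖f z‖ₑ) z + (fun z : ℝ × Bdry n => ‖f (-z.1, z.2)‖ₑ) z := by
    refine mixN_mono fun z => ?_
    rcases abs_choice z.1 with h | h
    · rw [ev, h]
      exact le_self_add
    · rw [ev, h]
      exact le_add_self
  refine h1.trans ((mixN_add_le hρ hp hf.enorm hm).trans (le_of_eq ?_))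
  rw [h0, two_mul]
  rfl

theorem IsBlockFamily.ev {Φ : LittlewoodPaley (Bdry n)} {p : ℝ} (hρ : 1 ≤ ρ) (hp : 1 ≤ p)
    {F : ℤ → ℝ × Bdry n → ℂ} {D : ℝ × Bdry n → ℂ} (h : IsBlockFamily Φ ρ p F D) :
    IsBlockFamily Φ ρ p (fun i => ev (F i)) (ev D) where
  measurable i := measurable_ev (h.measurable i)
  measurable_sum := measurable_ev h.measurable_sum
  fibre t := h.fibre |t|
  lN_lt_top := by
    refine lt_of_le_of_lt (ENNReal.tsum_le_tsum fun i => mul_le_mul' le_rfl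
      (nrm_ev_le hρ (by simpa using hp) (h.measurable i))) ?_
    simp only [mul_left_comm _ (2 : ℝ≥0∞), ENNReal.tsum_mul_left]
    exact ENNReal.mul_lt_top (by norm_num) h.lN_lt_top
  hasSum := by
    have h1 : MeasurePreserving (fun z : ℝ × Bdry n => (-z.1, z.2)) volume volume :=
      (Measure.measurePreserving_neg (volume : Measure ℝ)).prod (MeasurePreserving.id _)
    filter_upwards [h.hasSum, h1.quasiMeasurePreserving.ae h.hasSum] with z hz hz'
    rcases abs_choice z.1 with h | h
    · simp only [CheminLerner.ev, h]
      exact hz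
    · simp only [CheminLerner.ev, h]
      exact hz'

/-- The restriction to positive times of a time difference. -/
noncomputable def pdt (h : ℝ) (f : ℝ × Bdry n → ℂ) : ℝ × Bdry n → ℂ :=
  (Ioi 0 ×ˢ univ).indicator (dt h f)

theorem nrm_pdt (h : ℝ) (f : ℝ × Bdry n → ℂ) : nrm ρ p (pdt h f) = dN ρ p h f := by
  rw [pdt, nrm_indicator _ measurableSet_Ioi, dN, mixN]
  simp only [eLpNorm_enorm]

theorem pdt_of_pos {h t : ℝ} (ht : 0 < t) (f : ℝ × Bdry n → ℂ) (x : Bdry n) :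
    pdt h f (t, x) = f (t + h, x) - f (t, x) :=
  indicator_of_mem (show (t, x) ∈ Ioi (0 : ℝ) ×ˢ univ from ⟨ht, mem_univ _⟩) _

theorem measurable_pdt_uncurry {f : ℝ × Bdry n → ℂ} (hf : Measurable f) :
    Measurable fun q : ℝ × (ℝ × Bdry n) => pdt q.1 f q.2 := by
  have h1 : (fun q : ℝ × (ℝ × Bdry n) => pdt q.1 f q.2) =
      (univ ×ˢ (Ioi 0 ×ˢ univ)).indicator fun q => dt q.1 f q.2 := by
    funext q
    by_cases hq : q.2 ∈ Ioi (0 : ℝ) ×ˢ (univ : Set (Bdry n))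
    · have h2 : q ∈ (univ : Set ℝ) ×ˢ (Ioi (0 : ℝ) ×ˢ (univ : Set (Bdry n))) := ⟨mem_univ _, hq⟩
      rw [pdt, indicator_of_mem hq, indicator_of_mem h2]
    · rw [pdt, indicator_of_notMem hq, indicator_of_notMem fun h => hq h.2]
  rw [h1]
  refine Measurable.indicator ?_
    (MeasurableSet.univ.prod (measurableSet_Ioi.prod MeasurableSet.univ))
  exact (hf.comp ((measurable_snd.fst.add measurable_fst).prodMk measurable_snd.snd)).sub
    (hf.comp measurable_snd)

/-- The mean over the steps in `(0, 2 s)` of the differences of `f`. -/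
noncomputable def meanDiff (s : ℝ) (f : ℝ × Bdry n → ℂ) (z : ℝ × Bdry n) : ℝ≥0∞ :=
  (ENNReal.ofReal s)⁻¹ * ∫⁻ h, (Ioo 0 (2 * s)).indicator (fun h => ‖pdt h f z‖ₑ) h

theorem measurable_meanDiff_integrand (s : ℝ) {f : ℝ × Bdry n → ℂ} (hf : Measurable f) :
    Measurable fun q : ℝ × (ℝ × Bdry n) =>
      (Ioo 0 (2 * s)).indicator (fun h => ‖pdt h f q.2‖ₑ) q.1 := by
  have h1 : (fun q : ℝ × (ℝ × Bdry n) => (Ioo 0 (2 * s)).indicator (fun h => ‖pdt h f q.2‖ₑ) q.1) =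
      (Ioo 0 (2 * s) ×ˢ univ).indicator fun q => ‖pdt q.1 f q.2‖ₑ := by
    funext q
    by_cases hq : q.1 ∈ Ioo 0 (2 * s)
    · have h2 : q ∈ Ioo 0 (2 * s) ×ˢ (univ : Set (ℝ × Bdry n)) := ⟨hq, mem_univ _⟩
      rw [indicator_of_mem hq, indicator_of_mem h2]
    · rw [indicator_of_notMem hq, indicator_of_notMem fun h => hq h.1]
  rw [h1]
  exact (measurable_pdt_uncurry hf).enorm.indicator (measurableSet_Ioo.prod MeasurableSet.univ)

theorem measurable_meanDiff (s : ℝ) {f : ℝ × Bdry n → ℂ} (hf : Measurable f) :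
    Measurable (meanDiff s f) :=
  ((measurable_meanDiff_integrand s hf).lintegral_prod_left' (μ := volume)).const_mul _

/-- The modulus of continuity in time on the half-line. -/
noncomputable def modN (ρ p : ℝ≥0∞) (f : ℝ × Bdry n → ℂ) (b : ℝ) : ℝ≥0∞ :=
  ⨆ (h : ℝ) (_ : 0 < h ∧ h ≤ b), dN ρ p h f

theorem modN_mono (ρ p : ℝ≥0∞) (f : ℝ × Bdry n → ℂ) : Monotone (modN ρ p f) :=
  fun _ _ hab => iSup₂_le fun h hh =>
    le_iSup₂ (f := fun (h : ℝ) (_ : 0 < h ∧ h ≤ _) => dN ρ p h f) h ⟨hh.1, hh.2.trans hab⟩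

theorem dN_le_modN {h b : ℝ} (hh : 0 < h) (hb : h ≤ b) (f : ℝ × Bdry n → ℂ) :
    dN ρ p h f ≤ modN ρ p f b :=
  le_iSup₂ (f := fun (h : ℝ) (_ : 0 < h ∧ h ≤ b) => dN ρ p h f) h ⟨hh, hb⟩

theorem mixN_meanDiff_le (hρ : 1 ≤ ρ) (hp : 1 ≤ p) {s : ℝ} (hs : 0 < s)
    {f : ℝ × Bdry n → ℂ} (hf : Measurable f) :
    mixN ρ p volume volume (meanDiff s f) ≤ 2 * modN ρ p f (2 * s) := by
  have hs0 : ENNReal.ofReal s ≠ 0 := by simpa using hs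
  have h1 : mixN ρ p volume volume (fun z => ∫⁻ h, (Ioo 0 (2 * s)).indicator
      (fun h => ‖pdt h f z‖ₑ) h) ≤
      ∫⁻ h, (Ioo 0 (2 * s)).indicator (fun _ => modN ρ p f (2 * s)) h := by
    refine mixN_lintegral_le (ρ := ρ) (p := p) (κ := (volume : Measure ℝ)) hρ hp
      (a := fun h z => (Ioo 0 (2 * s)).indicator (fun h => ‖pdt h f z‖ₑ) h)
      (measurable_meanDiff_integrand s hf) (measurable_const.indicator measurableSet_Ioo)
      fun h => ?_
    by_cases hh : h ∈ Ioo 0 (2 * s)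
    · simp only [indicator_of_mem hh]
      exact (le_of_eq (nrm_pdt h f)).trans (dN_le_modN hh.1 hh.2.le f)
    · simp only [indicator_of_notMem hh]
      rw [mixN]
      simp
  rw [lintegral_indicator measurableSet_Ioo, setLIntegral_const, Real.volume_Ioo, sub_zero,
    ENNReal.ofReal_mul zero_le_two, ENNReal.ofReal_ofNat] at h1
  have hinv : (ENNReal.ofReal s)⁻¹ = ((ENNReal.ofReal s)⁻¹.toNNReal : ℝ≥0∞) :=
    (ENNReal.coe_toNNReal (ENNReal.inv_ne_top.2 hs0)).symm
  have h2 := mixN_const_mul_le (ρ := ρ) (p := p) (μ := (volume : Measure ℝ))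
    (ν := (volume : Measure (Bdry n))) (ENNReal.ofReal s)⁻¹.toNNReal
    (fun z => ∫⁻ h, (Ioo 0 (2 * s)).indicator (fun h => ‖pdt h f z‖ₑ) h)
  rw [← hinv] at h2
  refine h2.trans ((mul_le_mul' le_rfl h1).trans (le_of_eq ?_))
  calc (ENNReal.ofReal s)⁻¹ * (modN ρ p f (2 * s) * (2 * ENNReal.ofReal s))
      = ((ENNReal.ofReal s)⁻¹ * ENNReal.ofReal s) * (2 * modN ρ p f (2 * s)) := by ring
    _ = _ := by rw [ENNReal.inv_mul_cancel hs0 ENNReal.ofReal_ne_top, one_mul]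

/-- The values at two positive times with sum `s` are both compared with the values at the times in
`(s, 2 s)`. -/
theorem enorm_sub_le_meanDiff {f : ℝ × Bdry n → ℂ} (hf : Measurable f) {u v : ℝ} (hu : 0 < u)
    (hv : 0 < v) (x : Bdry n) :
    ‖f (u, x) - f (v, x)‖ₑ ≤ meanDiff (u + v) f (u, x) + meanDiff (u + v) f (v, x) := by
  set s := u + v with hs
  have hs0 : 0 < s := by positivity
  have hs0' : ENNReal.ofReal s ≠ 0 := by simpa using hs0
  set ψ : ℝ → ℝ → ℝ≥0∞ := fun w h => (Ioo 0 (2 * s)).indicator (fun h => ‖pdt h f (w, x)‖ₑ) h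
  have hψm : ∀ w, Measurable (ψ w) := fun w =>
    (measurable_meanDiff_integrand s hf).comp (measurable_id.prodMk measurable_const)
  have hψ : ∀ w, 0 < w → w < s → ∀ c ∈ Ioo s (2 * s), ‖f (c, x) - f (w, x)‖ₑ = ψ w (c - w) := by
    intro w hw hws c hc
    have h1 : c - w ∈ Ioo 0 (2 * s) := ⟨by linarith [hc.1], by linarith [hc.2]⟩
    simp only [ψ, indicator_of_mem h1]
    rw [pdt_of_pos hw, add_sub_cancel]
  have h1 : ENNReal.ofReal s * ‖f (u, x) - f (v, x)‖ₑ ≤ (∫⁻ h, ψ u h) + ∫⁻ h, ψ v h := by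
    calc ENNReal.ofReal s * ‖f (u, x) - f (v, x)‖ₑ
        = ∫⁻ _ in Ioo s (2 * s), ‖f (u, x) - f (v, x)‖ₑ := by
          rw [setLIntegral_const, Real.volume_Ioo, two_mul, add_sub_cancel_right, mul_comm]
      _ ≤ ∫⁻ c in Ioo s (2 * s), (ψ u (c - u) + ψ v (c - v)) := by
          refine setLIntegral_mono_ae (by
            exact (((hψm u).comp (measurable_id.sub_const u)).add
              ((hψm v).comp (measurable_id.sub_const v))).aemeasurable)
            (ae_of_all _ fun c hc => ?_)
          rw [← hψ u hu (by linarith) c hc, ← hψ v hv (by linarith) c hc]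
          have h2 : f (u, x) - f (v, x) =
              -(f (c, x) - f (u, x)) + (f (c, x) - f (v, x)) := by ring
          rw [h2]
          exact (enorm_add_le _ _).trans (by rw [enorm_neg])
      _ ≤ ∫⁻ c, (ψ u (c - u) + ψ v (c - v)) := setLIntegral_le_lintegral _ _
      _ = _ := by
          rw [lintegral_add_left (f := fun c => ψ u (c - u))
            ((hψm u).comp (measurable_id.sub_const u)),
            lintegral_sub_right_eq_self (ψ u) u, lintegral_sub_right_eq_self (ψ v) v]
  calc ‖f (u, x) - f (v, x)‖ₑ
      = (ENNReal.ofReal s)⁻¹ * (ENNReal.ofReal s * ‖f (u, x) - f (v, x)‖ₑ) := by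
        rw [← mul_assoc, ENNReal.inv_mul_cancel hs0' ENNReal.ofReal_ne_top, one_mul]
    _ ≤ (ENNReal.ofReal s)⁻¹ * ((∫⁻ h, ψ u h) + ∫⁻ h, ψ v h) := by gcongr
    _ = _ := by rw [mul_add]; rfl

theorem mixN_add_add_le (hρ : 1 ≤ ρ) (hp : 1 ≤ p) {a b c d : ℝ × Bdry n → ℝ≥0∞}
    (ha : Measurable a) (hb : Measurable b) (hc : Measurable c) (hd : Measurable d) {M : ℝ≥0∞}
    (haM : mixN ρ p volume volume a ≤ M) (hbM : mixN ρ p volume volume b ≤ M)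
    (hcM : mixN ρ p volume volume c ≤ M) (hdM : mixN ρ p volume volume d ≤ M) :
    mixN ρ p volume volume (fun z => (a z + b z) + (c z + d z)) ≤ 4 * M := by
  have h1 := mixN_add_le (μ := (volume : Measure ℝ)) (ν := (volume : Measure (Bdry n))) hρ hp
    (a := fun z => a z + b z) (b := fun z => c z + d z) (ha.add hb) (hc.add hd)
  have h2 := mixN_add_le (μ := (volume : Measure ℝ)) (ν := (volume : Measure (Bdry n))) hρ hp ha hb
  have h3 := mixN_add_le (μ := (volume : Measure ℝ)) (ν := (volume : Measure (Bdry n))) hρ hp hc hd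
  refine h1.trans ((add_le_add (h2.trans (add_le_add haM hbM))
    (h3.trans (add_le_add hcM hdM))).trans (le_of_eq ?_))
  ring

/-- The function controlling the differences of step `s` of the even reflection of `f`. -/
noncomputable def evBound (s : ℝ) (f : ℝ × Bdry n → ℂ) (z : ℝ × Bdry n) : ℝ≥0∞ :=
  ‖pdt s f z‖ₑ + meanDiff s f z

theorem measurable_evBound (s : ℝ) {f : ℝ × Bdry n → ℂ} (hf : Measurable f) :
    Measurable (evBound s f) := by
  have hpm : Measurable fun z => ‖pdt s f z‖ₑ :=
    ((measurable_pdt_uncurry hf).comp (measurable_const.prodMk measurable_id)).enorm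
  exact hpm.add (measurable_meanDiff s hf)

theorem mixN_evBound_le (hρ : 1 ≤ ρ) (hp : 1 ≤ p) {s : ℝ} (hs : 0 < s)
    {f : ℝ × Bdry n → ℂ} (hf : Measurable f) :
    mixN ρ p volume volume (evBound s f) ≤ 3 * modN ρ p f (2 * s) := by
  have hpm : Measurable fun z => ‖pdt s f z‖ₑ :=
    ((measurable_pdt_uncurry hf).comp (measurable_const.prodMk measurable_id)).enorm
  have h1 : mixN ρ p volume volume (fun z => ‖pdt s f z‖ₑ) ≤ modN ρ p f (2 * s) :=
    (le_of_eq (nrm_pdt s f)).trans (dN_le_modN hs (by linarith) f)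
  have h2 := mixN_add_le (μ := (volume : Measure ℝ)) (ν := (volume : Measure (Bdry n))) hρ hp
    hpm (measurable_meanDiff s hf)
  refine h2.trans ((add_le_add h1 (mixN_meanDiff_le hρ hp hs hf)).trans (le_of_eq ?_))
  ring

theorem enorm_dt_ev_le {s : ℝ} (hs : 0 < s) {f : ℝ × Bdry n → ℂ} (hf : Measurable f) {t : ℝ}
    (h0 : t ≠ 0) (h0' : t ≠ -s) (x : Bdry n) : ‖dt s (ev f) (t, x)‖ₑ ≤
      (evBound s f (t, x) + evBound s f (-(t + s), x)) +
        (evBound s f (t + s, x) + evBound s f (-t, x)) := by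
  simp only [dt, ev]
  rcases lt_or_gt_of_ne h0 with h1 | h1
  · rcases lt_or_gt_of_ne h0' with h2 | h2
    · -- both times are negative
      have h3 : 0 < -(t + s) := by linarith
      rw [abs_of_neg (by linarith : t + s < 0), abs_of_neg h1, enorm_sub_rev]
      have h4 := pdt_of_pos (h := s) h3 f x
      rw [show -(t + s) + s = -t by ring] at h4
      rw [← h4]
      exact le_trans (le_self_add : _ ≤ evBound s f (-(t + s), x)) (le_add_right le_add_self)
    · -- the times are separated by zero
      have h3 : 0 < t + s := by linarith
      have h4 : 0 < -t := by linarith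
      rw [abs_of_pos h3, abs_of_neg h1]
      have h5 := enorm_sub_le_meanDiff hf h3 h4 x
      rw [show t + s + -t = s by ring] at h5
      exact h5.trans (le_trans (add_le_add (le_add_self : _ ≤ evBound s f (t + s, x))
        (le_add_self : _ ≤ evBound s f (-t, x))) le_add_self)
  · -- both times are positive
    rw [abs_of_pos (by linarith : 0 < t + s), abs_of_pos h1, ← pdt_of_pos h1 f x]
    exact le_trans (le_self_add : _ ≤ evBound s f (t, x)) (le_add_right le_self_add)

theorem nrm_dt_ev_le_of_pos (hρ : 1 ≤ ρ) (hp : 1 ≤ p) {s : ℝ} (hs : 0 < s)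
    {f : ℝ × Bdry n → ℂ} (hf : Measurable f) :
    nrm ρ p (dt s (ev f)) ≤ 12 * modN ρ p f (2 * s) := by
  have ham := measurable_evBound s hf
  have haN := mixN_evBound_le hρ hp hs hf
  have hneg := Measure.measurePreserving_neg (volume : Measure ℝ)
  have hadd := measurePreserving_add_right (volume : Measure ℝ) s
  have hna : MeasurePreserving (fun t : ℝ => -(t + s)) volume volume := hneg.comp hadd
  have h4 := mixN_add_add_le hρ hp (a := evBound s f) (b := fun z => evBound s f (-(z.1 + s), z.2))
    (c := fun z => evBound s f (z.1 + s, z.2)) (d := fun z => evBound s f (-z.1, z.2)) ham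
    (ham.comp ((hna.measurable.comp measurable_fst).prodMk measurable_snd))
    (ham.comp ((hadd.measurable.comp measurable_fst).prodMk measurable_snd))
    (ham.comp ((hneg.measurable.comp measurable_fst).prodMk measurable_snd))
    haN ((le_of_eq (mixN_comp_affine hna ham)).trans haN)
    ((le_of_eq (mixN_comp_affine hadd ham)).trans haN)
    ((le_of_eq (mixN_comp_affine hneg ham)).trans haN)
  have h0 : ∀ c : ℝ, ∀ᵐ z : ℝ × Bdry n, z.1 ≠ c := by
    intro c
    rw [Measure.volume_eq_prod]
    exact Measure.quasiMeasurePreserving_fst.ae (by simp [ae_iff] : ∀ᵐ t : ℝ, t ≠ c)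
  have h5 : nrm ρ p (dt s (ev f)) ≤ mixN ρ p volume volume fun z =>
      (evBound s f z + evBound s f (-(z.1 + s), z.2)) +
        (evBound s f (z.1 + s, z.2) + evBound s f (-z.1, z.2)) := by
    refine mixN_mono_ae ?_
    rw [← Measure.volume_eq_prod]
    filter_upwards [h0 0, h0 (-s)] with z hz1 hz2
    exact enorm_dt_ev_le hs hf hz1 hz2 z.2
  refine h5.trans (h4.trans (le_of_eq ?_))
  ring

/-- The time differences of the even reflection. -/
theorem nrm_dt_ev_le (hρ : 1 ≤ ρ) (hp : 1 ≤ p) (s : ℝ) {f : ℝ × Bdry n → ℂ} (hf : Measurable f) :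
    nrm ρ p (dt s (ev f)) ≤ 12 * modN ρ p f (2 * |s|) := by
  rcases lt_trichotomy s 0 with hs | hs | hs
  · have h1 : nrm ρ p (dt s (ev f)) = nrm ρ p (dt (-s) (ev f)) := by
      rw [← nrm_tr s (measurable_dt (measurable_ev hf) : Measurable (dt (-s) (ev f)))]
      rw [nrm, nrm]
      congr 1
      funext z
      simp only [tr, dt]
      rw [enorm_sub_rev, add_neg_cancel_right]
    rw [h1, abs_of_neg hs]
    exact nrm_dt_ev_le_of_pos hρ hp (neg_pos.2 hs) hf
  · have h1 : dt s (ev f) = fun _ => 0 := by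
      funext z
      simp [dt, hs]
    rw [h1, nrm, mixN]
    simp
  · rw [abs_of_pos hs]
    exact nrm_dt_ev_le_of_pos hρ hp hs hf

end Reflection

end CheminLerner

/-! ### The norm of the even reflection -/

namespace CheminLerner

open FourierTransform

section ReflectionNorm

variable {n : ℕ} {ρ p : ℝ≥0∞}

theorem integral_kern_block (Ψ : LittlewoodPaley ℝ) (k : ℤ) :
    ∫ y, kern (blockSymbol Ψ) k y = 0 := by
  have h1 : 𝓕 (kern (blockSymbol Ψ) k) (0 : ℝ) = ∫ y, kern (blockSymbol Ψ) k y := by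
    rw [SchwartzMap.fourier_coe, Real.fourier_eq']
    simp
  rw [← h1, fourier_kern, dilate_blockSymbol, LittlewoodPaley.dyadic, smul_zero, smul_zero]
  have h2 : Ψ.symbol 0 = 0 := by
    refine image_eq_zero_of_notMem_tsupport fun h => ?_
    have h3 := (Ψ.tsupport_symbol h).1
    rw [norm_zero] at h3
    norm_num at h3
  rw [h2, Complex.ofReal_zero]

/-- A time convolution with a kernel of mean zero, in terms of differences. -/
theorem nrm_cvt_ev_le (hρ : 1 ≤ ρ) (hp : 1 ≤ p) (κ : 𝓢(ℝ, ℂ)) (hκ : ∫ y, κ y = 0)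
    {f : ℝ × Bdry n → ℂ} (hf : Measurable f) (hE : TemperedFun (ev f)) :
    nrm ρ p (cvt κ (ev f)) ≤ ∫⁻ y, ‖κ y‖ₑ * (12 * modN ρ p f (2 * |y|)) := by
  have hpt : ∀ᵐ z, ‖cvt κ (ev f) z‖ₑ ≤ ∫⁻ y, ‖κ y‖ₑ * ‖dt (-y) (ev f) z‖ₑ := by
    filter_upwards [hE.ae_integrable_cv (ContinuousLinearMap.inl ℝ ℝ (Bdry n)) κ] with z hz
    have h1 : cvt κ (ev f) z = ∫ y, κ y * dt (-y) (ev f) z := by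
      have h2 : ∀ y : ℝ, κ y * dt (-y) (ev f) z =
          κ y * ev f (z - ContinuousLinearMap.inl ℝ ℝ (Bdry n) y) - κ y * ev f z := by
        intro y
        have h3 : z - ContinuousLinearMap.inl ℝ ℝ (Bdry n) y = (z.1 + -y, z.2) := by
          ext <;> simp [sub_eq_add_neg]
        rw [h3, dt, mul_sub]
      simp only [h2]
      rw [integral_sub hz (κ.integrable.mul_const _), integral_mul_const, hκ, zero_mul, sub_zero]
      rfl
    rw [h1]
    refine (enorm_integral_le_lintegral_enorm _).trans (le_of_eq ?_)
    simp only [enorm_mul]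
  have hm : Measurable fun q : ℝ × (ℝ × Bdry n) => ‖κ q.1‖ₑ * ‖dt (-q.1) (ev f) q.2‖ₑ := by
    refine (κ.continuous.measurable.comp measurable_fst).enorm.mul (Measurable.enorm ?_)
    exact ((measurable_ev hf).comp ((measurable_snd.fst.add measurable_fst.neg).prodMk
      measurable_snd.snd)).sub ((measurable_ev hf).comp measurable_snd)
  have hM : Measurable fun y : ℝ => ‖κ y‖ₑ * (12 * modN ρ p f (2 * |y|)) := by
    refine κ.continuous.measurable.enorm.mul (Measurable.const_mul ?_ _)
    exact (modN_mono ρ p f).measurable.comp (measurable_id.abs.const_mul 2)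
  have h1 := mixN_lintegral_le (ρ := ρ) (p := p) (μ := (volume : Measure ℝ))
    (ν := (volume : Measure (Bdry n))) (κ := (volume : Measure ℝ)) hρ hp
    (a := fun y z => ‖κ y‖ₑ * ‖dt (-y) (ev f) z‖ₑ) hm hM fun y => by
      have h2 := mixN_const_mul_le (ρ := ρ) (p := p) (μ := (volume : Measure ℝ))
        (ν := (volume : Measure (Bdry n))) ‖κ y‖₊ fun z => ‖dt (-y) (ev f) z‖ₑ
      have h3 := nrm_dt_ev_le hρ hp (-y) hf
      rw [abs_neg] at h3
      exact h2.trans (mul_le_mul' le_rfl h3)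
  refine le_trans (mixN_mono_ae ?_) h1
  rw [← Measure.volume_eq_prod]
  exact hpt

theorem lintegral_kern_mul (m : 𝓢(ℝ, ℂ)) (k : ℤ) {g : ℝ → ℝ≥0∞} (hg : Measurable g) :
    ∫⁻ y, ‖kern m k y‖ₑ * g y = ∫⁻ y, ‖kern m 0 y‖ₑ * g ((2 : ℝ) ^ (-k) * y) := by
  have hk : (0 : ℝ) < 2 ^ k := by positivity
  have hm : Measurable fun y : ℝ => ‖kern m 0 y‖ₑ * g ((2 : ℝ) ^ (-k) * y) :=
    (kern m 0).continuous.measurable.enorm.mul (hg.comp (measurable_const_mul _))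
  rw [← lintegral_comp_pos_mul hk hm, ← lintegral_const_mul' _ _ ENNReal.ofReal_ne_top]
  refine lintegral_congr fun y => ?_
  have h1 : (2 : ℝ) ^ (-k) * ((2 : ℝ) ^ k * y) = y := by
    rw [← mul_assoc, ← zpow_add₀ two_ne_zero, neg_add_cancel, zpow_zero, one_mul]
  rw [h1, kern_apply m k y, Module.finrank_self, pow_one, enorm_smul,
    Real.enorm_of_nonneg hk.le, smul_eq_mul, mul_assoc]

/-- Rescaling the dyadic scales costs a power of the scaling factor. -/
theorem tsum_om_le {r : ℝ} (hr : 0 < r) {W : ℝ → ℝ≥0∞} (hW : Monotone W) {x : ℝ} (hx : 0 < x) :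
    ∑' k : ℤ, (2 : ℝ≥0∞) ^ (r * (k : ℝ)) * W ((2 : ℝ) ^ (-k) * x) ≤
      ENNReal.ofReal ((2 * x) ^ r) *
        ∑' k : ℤ, (2 : ℝ≥0∞) ^ (r * (k : ℝ)) * W (2 ^ (-(k : ℝ))) := by
  obtain ⟨m, hm1, hm2⟩ := exists_mem_Ioc_zpow hx one_lt_two
  have h1 : ∑' k : ℤ, (2 : ℝ≥0∞) ^ (r * (k : ℝ)) * W ((2 : ℝ) ^ (-k) * x) ≤
      ∑' k : ℤ, (2 : ℝ≥0∞) ^ (r * ((m + 1 : ℤ) : ℝ)) *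
        (2 ^ (r * ((k - (m + 1) : ℤ) : ℝ)) * W (2 ^ (-((k - (m + 1) : ℤ) : ℝ)))) := by
    refine ENNReal.tsum_le_tsum fun k => ?_
    rw [← mul_assoc, two_rpow_mul]
    have h2 : r * ((m + 1 : ℤ) : ℝ) + r * ((k - (m + 1) : ℤ) : ℝ) = r * (k : ℝ) := by
      push_cast; ring
    rw [h2]
    refine mul_le_mul' le_rfl (hW ?_)
    have h3 : (2 : ℝ) ^ (-((k - (m + 1) : ℤ) : ℝ)) = (2 : ℝ) ^ (-k) * 2 ^ (m + 1) := by
      rw [← Int.cast_neg, Real.rpow_intCast, ← zpow_add₀ two_ne_zero]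
      congr 1
      ring
    rw [h3]
    gcongr
  refine h1.trans ?_
  have e : ∑' k : ℤ, (2 : ℝ≥0∞) ^ (r * ((k - (m + 1) : ℤ) : ℝ)) *
      W (2 ^ (-((k - (m + 1) : ℤ) : ℝ))) =
      ∑' k : ℤ, (2 : ℝ≥0∞) ^ (r * (k : ℝ)) * W (2 ^ (-(k : ℝ))) :=
    (Equiv.subRight (m + 1)).tsum_eq fun k : ℤ => (2 : ℝ≥0∞) ^ (r * (k : ℝ)) * W (2 ^ (-(k : ℝ)))
  rw [ENNReal.tsum_mul_left, e]
  refine mul_le_mul' ?_ le_rfl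
  have h4 : (2 : ℝ≥0∞) ^ (r * ((m + 1 : ℤ) : ℝ)) = ENNReal.ofReal (((2 : ℝ) ^ (m + 1)) ^ r) := by
    rw [mul_comm, ENNReal.rpow_mul, ← ofReal_two_zpow, ENNReal.ofReal_rpow_of_pos (by positivity)]
  rw [h4]
  refine ENNReal.ofReal_le_ofReal (Real.rpow_le_rpow (by positivity) ?_ hr.le)
  rw [zpow_add_one₀ two_ne_zero]
  linarith

theorem om_eq_tsum_modN (ρ p : ℝ≥0∞) (s : ℝ) (F : ℤ → ℝ × Bdry n → ℂ) (b : ℝ) :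
    om ρ p s F b = ∑' i : ℤ, (2 : ℝ≥0∞) ^ (s * (i : ℝ)) * modN ρ p (F i) b := rfl

theorem lintegral_kern_rpow_lt_top (m : 𝓢(ℝ, ℂ)) {r : ℝ} (hr : 0 < r) (hr1 : r ≤ 1) :
    ∫⁻ y, ‖kern m 0 y‖ₑ * ENNReal.ofReal ((2 * (2 * |y|)) ^ r) < ⊤ := by
  have h1 : Integrable fun y : ℝ => ‖y‖ ^ 1 * ‖kern m 0 y‖ := (kern m 0).integrable_pow_mul volume 1
  have h2 : Integrable fun y : ℝ => ‖kern m 0 y‖ + 4 * (‖y‖ ^ 1 * ‖kern m 0 y‖) :=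
    (kern m 0).integrable.norm.add (h1.const_mul 4)
  refine lt_of_le_of_lt (lintegral_mono fun y => ?_) h2.2
  rw [← ofReal_norm, ← ENNReal.ofReal_mul (norm_nonneg _),
    Real.enorm_of_nonneg (by positivity)]
  refine ENNReal.ofReal_le_ofReal ?_
  have h3 : (2 * (2 * |y|)) ^ r ≤ 1 + 2 * (2 * |y|) := by
    rcases le_total (2 * (2 * |y|)) 1 with h | h
    · have := Real.rpow_le_one (by positivity) h hr.le
      linarith [abs_nonneg y]
    · have := Real.rpow_le_rpow_of_exponent_le h hr1
      rw [Real.rpow_one] at this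
      linarith
  calc ‖kern m 0 y‖ * (2 * (2 * |y|)) ^ r ≤ ‖kern m 0 y‖ * (1 + 2 * (2 * |y|)) := by gcongr
    _ = _ := by
      beta_reduce
      rw [Real.norm_eq_abs y, pow_one]
      ring

/-- The norm of the even reflection of a function is controlled by the norm defined by
differences. -/
theorem exists_besovBesovNormLine_ev_le (Ψ : LittlewoodPaley ℝ) {r : ℝ} (hr : 0 < r)
    (hr1 : r < 1) : ∃ C : ℝ≥0, ∀ (n : ℕ) (Φ : LittlewoodPaley (Bdry n)) (ρ p : ℝ≥0∞), 1 ≤ ρ →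
      1 ≤ p → ∀ (s : ℝ) (f : ℝ × Bdry n → ℂ), Measurable f → ∀ hE : TemperedFun (ev f),
      besovBesovNormLine Ψ Φ r s ρ p hE.toDistribution ≤
        C * besovDiff ρ p r s fun j => cvx (kern (blockSymbol Φ) j) f := by
  have hK := lintegral_kern_rpow_lt_top (blockSymbol Ψ) hr hr1.le
  set K := ∫⁻ y, ‖kern (blockSymbol Ψ) 0 y‖ₑ * ENNReal.ofReal ((2 * (2 * |y|)) ^ r) with hKdef
  refine ⟨12 * K.toNNReal, fun n Φ ρ p hρ hp s f hf hE => ?_⟩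
  rw [ENNReal.coe_mul, ENNReal.coe_toNNReal hK.ne, ENNReal.coe_ofNat]
  set F : ℤ → ℝ × Bdry n → ℂ := fun j => cvx (kern (blockSymbol Φ) j) f with hF
  have hFm : ∀ j, Measurable (F j) := fun j => measurable_cv hf
  have hW := om_mono ρ p s F
  set W := om ρ p s F with hWdef
  have hblock : ∀ k j, mixedNorm univ ρ p (timeBlock Ψ k (spaceBlock Φ j hE.toDistribution)) ≤
      ∫⁻ y, ‖kern (blockSymbol Ψ) k y‖ₑ * (12 * modN ρ p (F j) (2 * |y|)) := by
    intro k j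
    have h1 := (hE.restrictsTo univ).spaceBlock Φ j hE
    have h2 : TemperedFun (cvx (kern (blockSymbol Φ) j) (ev f)) := hE.cv
    have h3 := h1.timeBlock Ψ k h2
    refine (mixedNorm_le MeasurableSet.univ h3).trans ?_
    rw [cvx_ev] at h2 ⊢
    exact nrm_cvt_ev_le hρ hp _ (integral_kern_block Ψ k) (hFm j) h2
  have hmm : ∀ j, Measurable fun y : ℝ => modN ρ p (F j) (2 * |y|) := fun j =>
    (modN_mono ρ p (F j)).measurable.comp (measurable_id.abs.const_mul 2)
  have hWm : ∀ c : ℝ, Measurable fun y : ℝ => W (c * (2 * |y|)) := fun c =>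
    hW.measurable.comp ((measurable_id.abs.const_mul 2).const_mul c)
  have hk : ∀ k : ℤ, ∑' j : ℤ, (2 : ℝ≥0∞) ^ (s * (j : ℝ)) *
      mixedNorm univ ρ p (timeBlock Ψ k (spaceBlock Φ j hE.toDistribution)) ≤
      12 * ∫⁻ y, ‖kern (blockSymbol Ψ) 0 y‖ₑ * W ((2 : ℝ) ^ (-k) * (2 * |y|)) := by
    intro k
    calc ∑' j : ℤ, (2 : ℝ≥0∞) ^ (s * (j : ℝ)) *
        mixedNorm univ ρ p (timeBlock Ψ k (spaceBlock Φ j hE.toDistribution))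
        ≤ ∑' j : ℤ, ∫⁻ y, 12 * (‖kern (blockSymbol Ψ) k y‖ₑ *
            (2 ^ (s * (j : ℝ)) * modN ρ p (F j) (2 * |y|))) := by
          refine ENNReal.tsum_le_tsum fun j => (mul_le_mul' le_rfl (hblock k j)).trans
            (le_of_eq ?_)
          rw [← lintegral_const_mul' _ _ (two_rpow_lt_top _).ne]
          refine lintegral_congr fun y => ?_
          ring
      _ = ∫⁻ y, ∑' j : ℤ, 12 * (‖kern (blockSymbol Ψ) k y‖ₑ *
            (2 ^ (s * (j : ℝ)) * modN ρ p (F j) (2 * |y|))) := by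
          rw [lintegral_tsum fun j => ?_]
          exact (((kern (blockSymbol Ψ) k).continuous.measurable.enorm.mul
            ((hmm j).const_mul _)).const_mul _).aemeasurable
      _ = ∫⁻ y, 12 * (‖kern (blockSymbol Ψ) k y‖ₑ * W (1 * (2 * |y|))) := by
          refine lintegral_congr fun y => ?_
          rw [ENNReal.tsum_mul_left, ENNReal.tsum_mul_left, one_mul, hWdef, om_eq_tsum_modN]
      _ = 12 * ∫⁻ y, ‖kern (blockSymbol Ψ) k y‖ₑ * W (1 * (2 * |y|)) :=
          lintegral_const_mul' _ _ (by norm_num)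
      _ = _ := by
          rw [lintegral_kern_mul _ _ (hWm 1)]
          congr 1
          refine lintegral_congr fun y => ?_
          rw [abs_mul, abs_of_pos (by positivity : (0 : ℝ) < 2 ^ (-k)), one_mul]
          congr 2
          ring
  calc besovBesovNormLine Ψ Φ r s ρ p hE.toDistribution
      ≤ ∑' k : ℤ, ∫⁻ y, 12 * (‖kern (blockSymbol Ψ) 0 y‖ₑ *
          (2 ^ (r * (k : ℝ)) * W ((2 : ℝ) ^ (-k) * (2 * |y|)))) := by
        refine ENNReal.tsum_le_tsum fun k => (mul_le_mul' le_rfl (hk k)).trans (le_of_eq ?_)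
        rw [← lintegral_const_mul' _ _ (by norm_num), ← lintegral_const_mul' _ _
          (two_rpow_lt_top _).ne]
        refine lintegral_congr fun y => ?_
        ring
    _ = ∫⁻ y, ∑' k : ℤ, 12 * (‖kern (blockSymbol Ψ) 0 y‖ₑ *
          (2 ^ (r * (k : ℝ)) * W ((2 : ℝ) ^ (-k) * (2 * |y|)))) := by
        rw [lintegral_tsum fun k => ?_]
        exact (((kern (blockSymbol Ψ) 0).continuous.measurable.enorm.mul
          ((hWm _).const_mul _)).const_mul _).aemeasurable
    _ ≤ ∫⁻ y, (12 * besovDiff ρ p r s F) * (‖kern (blockSymbol Ψ) 0 y‖ₑ *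
          ENNReal.ofReal ((2 * (2 * |y|)) ^ r)) := by
        refine lintegral_mono_ae ?_
        have h0 : ∀ᵐ y : ℝ, y ≠ 0 := by simp [ae_iff]
        filter_upwards [h0] with y hy
        rw [ENNReal.tsum_mul_left, ENNReal.tsum_mul_left]
        have h1 := tsum_om_le hr hW (x := 2 * |y|) (by positivity)
        calc _ ≤ 12 * (‖kern (blockSymbol Ψ) 0 y‖ₑ * (ENNReal.ofReal ((2 * (2 * |y|)) ^ r) *
              besovDiff ρ p r s F)) := mul_le_mul' le_rfl (mul_le_mul' le_rfl h1)
          _ = _ := by ring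
    _ = (12 * besovDiff ρ p r s F) * K := by
        refine lintegral_const_mul _ ?_
        refine (kern (blockSymbol Ψ) 0).continuous.measurable.enorm.mul ?_
        exact (((measurable_id.abs.const_mul 2).const_mul 2).pow_const r).ennreal_ofReal
    _ = _ := by ring

end ReflectionNorm

end CheminLerner

/-! ### The product estimate -/

namespace CheminLerner

section ProductEstimate

variable {n : ℕ} {ρ : ℝ≥0∞} {p : ℝ}

theorem tempered_product {Φ : LittlewoodPaley (Bdry n)} (hρ : 1 ≤ ρ) (hp : 1 ≤ p)
    {F G : ℤ → ℝ × Bdry n → ℂ} {D E : ℝ × Bdry n → ℂ} (hF : IsBlockFamily Φ ρ p F D)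
    (hG : IsBlockFamily Φ ⊤ p G E) : TemperedFun fun z => D z * E z := by
  obtain ⟨C, hC⟩ := exists_nrm_sum_le Φ hp
  have hD : nrm ρ ⊤ D < ⊤ :=
    (hC ρ hρ F D hF).trans_lt (ENNReal.mul_lt_top ENNReal.coe_lt_top hF.lN_lt_top)
  have hE : nrm ⊤ ⊤ E < ⊤ :=
    (hC ⊤ le_top G E hG).trans_lt (ENNReal.mul_lt_top ENNReal.coe_lt_top hG.lN_lt_top)
  refine tempered_of_nrm hρ le_top (hF.measurable_sum.mul hG.measurable_sum) ?_
  have h1 : nrm ρ ⊤ (fun z => D z * E z) ≤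
      eLpNorm (fun t => nrm ⊤ ⊤ E * eLpNorm (fun x => D (t, x)) ⊤ volume) ρ volume := by
    rw [nrm, mixN]
    refine eLpNorm_mono_enorm_ae ?_
    filter_upwards [ae_eLpNorm_le_nrm_top (P := ⊤) E] with t ht
    rw [enorm_eq_self, enorm_eq_self, eLpNorm_enorm]
    have h2 : ∀ᵐ x, ‖E (t, x)‖ₑ ≤ nrm ⊤ ⊤ E := by
      rw [eLpNorm_exponent_top] at ht
      filter_upwards [ae_le_eLpNormEssSup (f := fun x => E (t, x))] with x hx
      exact hx.trans ht
    have h3 := eLpNorm_mul_le_of_bound (p := ⊤) (f := fun x => E (t, x)) (g := fun x => D (t, x))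
      hE h2
    simpa only [mul_comm (E _)] using h3
  refine h1.trans_lt ((eLpNorm_const_mul_le hE _).trans_lt (ENNReal.mul_lt_top hE ?_))
  rw [nrm, mixN] at hD
  simpa only [eLpNorm_enorm] using hD

/-- The norm defined by differences is controlled by the quotient norm. -/
theorem exists_besovDiff_le_besovBesovNorm (Ψ : LittlewoodPaley ℝ) {r : ℝ} (hr : 0 < r)
    (hr1 : r < 1) : ∃ C : ℝ≥0, ∀ (n : ℕ) (Φ : LittlewoodPaley (Bdry n)) (ρ p : ℝ≥0∞), 1 ≤ ρ →
      1 ≤ p → ∀ (s : ℝ) (f : ℝ × Bdry n → ℂ) (F : ℤ → ℝ × Bdry n → ℂ), (∀ i, Measurable (F i)) →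
      (∀ i, nrm ρ p (F i) < ⊤) →
      (∀ u, IsExtension Φ u f → ∀ i, RestrictsTo (Ioi 0) (spaceBlock Φ i u) (F i)) →
      besovDiff ρ p r s F ≤ C * besovBesovNorm Ψ Φ r s ρ p f := by
  obtain ⟨C, hC⟩ := exists_besovDiff_le Ψ hr hr1
  refine ⟨C + 1, fun n Φ ρ p hρ hp s f F hF hFn hFr => ?_⟩
  have hc0 : ((C + 1 : ℝ≥0) : ℝ≥0∞) ≠ 0 := by
    rw [Ne, ENNReal.coe_eq_zero]
    positivity
  rw [← ENNReal.div_le_iff' hc0 ENNReal.coe_ne_top]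
  refine le_iInf₂ fun u hu => ?_
  rw [ENNReal.div_le_iff' hc0 ENNReal.coe_ne_top]
  refine (hC n Φ ρ p hρ hp s u F hF hFn (hFr u hu)).trans (mul_le_mul' ?_ le_rfl)
  rw [ENNReal.coe_add]
  exact le_self_add

/-- The product estimate for general exponents of regularity. -/
theorem exists_besovBesovNorm_mul_le (Ψ : LittlewoodPaley ℝ) (Φ : LittlewoodPaley (Bdry n))
    (hn : 0 < Module.finrank ℝ (Bdry n)) (hp : 1 ≤ p) {r s : ℝ} (hr : 0 < r) (hr1 : r < 1)
    (hsa : s ≤ Module.finrank ℝ (Bdry n) / p)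
    (hs : 0 < s ∨ 2 ≤ p ∧ 0 < s + Module.finrank ℝ (Bdry n) / p) :
    ∃ C : ℝ≥0, ∀ ρ : ℝ≥0∞, 1 ≤ ρ → ∀ f g : ℝ × Bdry n → ℂ,
      lebesgueBesovNorm Φ (Module.finrank ℝ (Bdry n) / p) ρ (ENNReal.ofReal p) f < ⊤ →
      lebesgueBesovNorm Φ (Module.finrank ℝ (Bdry n) / p) ⊤ (ENNReal.ofReal p) g < ⊤ →
      besovBesovNorm Ψ Φ r s ρ (ENNReal.ofReal p) (fun z => f z * g z) ≤
        C * (besovBesovNorm Ψ Φ r s ρ (ENNReal.ofReal p) f *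
          lebesgueBesovNorm Φ (Module.finrank ℝ (Bdry n) / p) ⊤ (ENNReal.ofReal p) g +
          besovBesovNorm Ψ Φ r s ⊤ (ENNReal.ofReal p) g *
          lebesgueBesovNorm Φ (Module.finrank ℝ (Bdry n) / p) ρ (ENNReal.ofReal p) f) := by
  obtain ⟨C₁, hC₁⟩ := exists_besovDiff_le_besovBesovNorm Ψ hr hr1
  obtain ⟨C₂, hC₂⟩ := exists_besovDiff_product_le Φ hp hsa hs
  obtain ⟨C₃, hC₃⟩ := exists_besovBesovNormLine_ev_le Ψ hr hr1
  have hp' : 1 ≤ ENNReal.ofReal p := by simpa using hp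
  refine ⟨C₃ * C₂ * C₁, fun ρ hρ f g hf hg => ?_⟩
  obtain ⟨F, D, hFD, -, hfD, hFr, hFl⟩ := exists_blocks_of_lebesgueBesovNorm hρ hp hf
  obtain ⟨G, E, hGE, -, hgE, hGr, hGl⟩ := exists_blocks_of_lebesgueBesovNorm le_top hp hg
  have hU : MeasurableSet (Ioi (0 : ℝ) ×ˢ (univ : Set (Bdry n))) :=
    measurableSet_Ioi.prod MeasurableSet.univ
  have hT : TemperedFun (ev fun z => D z * E z) :=
    tempered_product hρ hp (hFD.ev hρ hp) (hGE.ev le_top hp)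
  have hreal : IsRealized Φ hT.toDistribution :=
    isRealized_product hn hρ hp (hFD.ev hρ hp) (hGE.ev le_top hp) hT
  have hrestr : RestrictsTo (Ioi 0) hT.toDistribution fun z => f z * g z := by
    refine (hT.restrictsTo _).congr measurableSet_Ioi ?_
    filter_upwards [hfD, hgE, ae_restrict_mem hU] with z h1 h2 h3
    rw [ev, abs_of_pos h3.1, h1, h2]
  have hB := hC₁ n Φ ρ _ hρ hp' s f F hFD.measurable (nrm_lt_top_of_lN hFD.lN_lt_top) hFr
  have hB' := hC₁ n Φ ⊤ _ le_top hp' s g G hGE.measurable (nrm_lt_top_of_lN hGE.lN_lt_top) hGr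
  calc besovBesovNorm Ψ Φ r s ρ (ENNReal.ofReal p) (fun z => f z * g z)
      ≤ besovBesovNormLine Ψ Φ r s ρ (ENNReal.ofReal p) hT.toDistribution :=
        iInf₂_le _ ⟨hreal, hrestr⟩
    _ ≤ C₃ * (C₂ * (besovDiff ρ (ENNReal.ofReal p) r s F * lN ⊤ p G +
          besovDiff ⊤ (ENNReal.ofReal p) r s G * lN ρ p F)) :=
        (hC₃ n Φ ρ _ hρ hp' s _ (hFD.measurable_sum.mul hGE.measurable_sum) hT).trans
          (mul_le_mul' le_rfl (hC₂ ρ hρ r F G D E hFD hGE))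
    _ ≤ C₃ * (C₂ * ((C₁ * besovBesovNorm Ψ Φ r s ρ (ENNReal.ofReal p) f) *
          lebesgueBesovNorm Φ (Module.finrank ℝ (Bdry n) / p) ⊤ (ENNReal.ofReal p) g +
          (C₁ * besovBesovNorm Ψ Φ r s ⊤ (ENNReal.ofReal p) g) *
          lebesgueBesovNorm Φ (Module.finrank ℝ (Bdry n) / p) ρ (ENNReal.ofReal p) f)) := by
        gcongr
    _ = _ := by
        rw [ENNReal.coe_mul, ENNReal.coe_mul]
        ring

end ProductEstimate

end CheminLerner

theorem proposition7p5 (n : ℕ) (p : ℝ) (hp : 1 < p) (hpn : p < 2 * (n : ℝ) - 1)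
    (ρ : ℝ≥0∞) (hρ : 1 ≤ ρ)
    (Ψ : LittlewoodPaley ℝ) (Φ : LittlewoodPaley (CheminLerner.Bdry n)) :
    ∃ C : ℝ≥0, ∀ F G : ℝ × CheminLerner.Bdry n → ℂ,
      CheminLerner.normB Ψ Φ p ρ F < ⊤ → CheminLerner.normL Φ p ρ F < ⊤ →
      CheminLerner.normB Ψ Φ p ⊤ G < ⊤ → CheminLerner.normL Φ p ⊤ G < ⊤ →
        CheminLerner.normB Ψ Φ p ρ (fun z => F z * G z) < ⊤ ∧
        CheminLerner.normB Ψ Φ p ρ (fun z => F z * G z) ≤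
          C * (CheminLerner.normL Φ p ρ F * CheminLerner.normB Ψ Φ p ⊤ G) +
            C * ((CheminLerner.normB Ψ Φ p ρ F + CheminLerner.normL Φ p ρ F) *
              CheminLerner.normL Φ p ⊤ G) ∧
        C * (CheminLerner.normL Φ p ρ F * CheminLerner.normB Ψ Φ p ⊤ G) +
            C * ((CheminLerner.normB Ψ Φ p ρ F + CheminLerner.normL Φ p ρ F) *
              CheminLerner.normL Φ p ⊤ G) ≤
          C * ((CheminLerner.normB Ψ Φ p ρ F + CheminLerner.normL Φ p ρ F) *
            (CheminLerner.normB Ψ Φ p ⊤ G + CheminLerner.normL Φ p ⊤ G)) := by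
  have hp0 : 0 < p := by linarith
  have hn1 : (1 : ℝ) < n := by linarith
  have hn2 : 1 < n := by exact_mod_cast hn1
  have hn2' : (2 : ℝ) ≤ n := by exact_mod_cast hn2
  have hd : (Module.finrank ℝ (CheminLerner.Bdry n) : ℝ) = n - 1 := by
    rw [finrank_euclideanSpace_fin, Nat.cast_sub hn2.le, Nat.cast_one]
  have hd0 : 0 < Module.finrank ℝ (CheminLerner.Bdry n) := by
    rw [finrank_euclideanSpace_fin]
    omega
  have hr : 0 < 1 / 2 - 1 / (2 * p) := by
    rw [sub_pos, div_lt_div_iff₀ (by linarith) two_pos]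
    linarith
  have hr1 : 1 / 2 - 1 / (2 * p) < 1 := by
    have : 0 < 1 / (2 * p) := by positivity
    linarith
  have hsa : -1 + (n : ℝ) / p ≤ Module.finrank ℝ (CheminLerner.Bdry n) / p := by
    rw [hd, sub_div]
    have : 1 / p ≤ 1 := by
      rw [div_le_one hp0]
      exact hp.le
    linarith
  have hs : 0 < -1 + (n : ℝ) / p ∨
      2 ≤ p ∧ 0 < -1 + (n : ℝ) / p + Module.finrank ℝ (CheminLerner.Bdry n) / p := by
    rcases lt_or_ge p 2 with h | h
    · left
      have : 1 < (n : ℝ) / p := by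
        rw [lt_div_iff₀ hp0]
        linarith
      linarith
    · right
      refine ⟨h, ?_⟩
      have : 1 < (2 * (n : ℝ) - 1) / p := by
        rw [lt_div_iff₀ hp0]
        linarith
      have h2 : -1 + (n : ℝ) / p + ((n : ℝ) - 1) / p = -1 + (2 * (n : ℝ) - 1) / p := by ring
      rw [hd, h2]
      linarith
  obtain ⟨C, hC⟩ := CheminLerner.exists_besovBesovNorm_mul_le Ψ Φ hd0 hp.le hr hr1 hsa hs
  rw [hd] at hC
  refine ⟨C, fun F G hFB hFL hGB hGL => ?_⟩
  have h := hC ρ hρ F G hFL hGL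
  have h1 : CheminLerner.normB Ψ Φ p ρ (fun z => F z * G z) ≤
      C * (CheminLerner.normL Φ p ρ F * CheminLerner.normB Ψ Φ p ⊤ G) +
        C * ((CheminLerner.normB Ψ Φ p ρ F + CheminLerner.normL Φ p ρ F) *
          CheminLerner.normL Φ p ⊤ G) := by
    refine h.trans ?_
    rw [mul_add, add_comm]
    refine add_le_add (le_of_eq ?_) (mul_le_mul' le_rfl (mul_le_mul' le_self_add le_rfl))
    rw [mul_comm (CheminLerner.besovBesovNorm _ _ _ _ _ _ _)]
    rfl
  have hfin : ∀ {a b : ℝ≥0∞}, a < ⊤ → b < ⊤ → (C : ℝ≥0∞) * (a * b) < ⊤ := fun ha hb =>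
    ENNReal.mul_lt_top ENNReal.coe_lt_top (ENNReal.mul_lt_top ha hb)
  refine ⟨h1.trans_lt (ENNReal.add_lt_top.2 ⟨hfin hFL hGB,
    hfin (ENNReal.add_lt_top.2 ⟨hFB, hFL⟩) hGL⟩), h1, ?_⟩
  rw [← mul_add, mul_add (_ + _)]
  gcongr
  exact le_add_self
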